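/- **Setting.** Let $\mathbb K$ be a field, $M$ a smooth surface and $\Lambda\subset J^1M=T^*M\times\mathbb R$ a closed (compact, embedded) Legendrian surface for $dz-y\,dx$, with projections $\pi_{xz}:\Lambda\to M\times\mathbb R$ and $\pi_x:\Lambda\to M$. Assume: * *mild front singularities:* at every point of the set $\Lambda_{cusp}$ where $\pi_{xz}$ is not an immersion, $\pi_{xz}$ is $(t_1,t_2)\mapsto(t_1^3,t_1^2,t_2)$ in suitable smooth coordinates; * *self-transversality of the front:* for every $w\in M\times\mathbb R$ the spaces $\operatorname{im}(d\pi_{xz})_p$, $p\in\pi_{xz}^{-1}(w)$, are in general position (codimensions add under intersection); * *self-transversality of the base projection:* for every $x\in M$ the projections to $T_xM$ of the intersections $\bigcap_{\pi_{xz}(p)=(x,z)}\operatorname{im}(d\pi_{xz})_p$, $z\in\mathbb R$, are in general position. Let $\Lambda^F_k\subset M\times\mathbb R$ ($-1\le k\le 2$) be the set of points with $a$ preimages in $\Lambda\setminus\Lambda_{cusp}$ and $b$ in $\Lambda_{cusp}$, $a+2b-1=k$, and $\Lambda^B_k$ the set of $x\in\pi_x(\Lambda)$ such that the indices of the front points above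 $x$ add up to $k$. Let $\mu$ be a $\mathbb Z$-valued Maslov potential: a locally constant function on $\Lambda\setminus\Lambda_{cusp}$ which increases by $1$ from the lower to the upper sheet of every cusp edge. Let $\mathcal E=\{e_I\}$ be a locally finite simplicial decomposition of $M$ with linearly ordered vertices, compatible with $\Lambda$: $\Lambda^B_k$ lies in the $(2-k)$-skeleton for $0\le k\le2$. Here $e_I$ is the open simplex with vertex set $I$. **Stratification.** For $I\subset J$ let $h(e_I,e_J)\subset M$ be given in barycentric coordinates by $x_v>\frac14$ for $v\in I$, $x_v=\frac14$ for $v\in J\setminus I$, $x_v<\frac14$ for $v\notin J$; these are the cells of the polygonal decomposition dual to the pair subdivision of $\mathcal E$. Let $\mathcal S$ be the set of connected components of the sets $\Lambda^F_k\cap(h(e_I,e_J)\times\mathbb R)$, and $P(\mathcal S)$ the category of $\mathcal S$ ordered by $s\le s'\Leftrightarrow s\subset\overline{s'}$. Let $\mathbf{Fun}^\bullet_\Lambda(\mathcal S,\mathbb K)$ consist of the functors $F$ from $P(\mathcal S)$ to cochain complexes of $\mathbb K$-modules such that: 1. $F(s\to s')$ is a quasi-isomorphism if $s\to s'$ is downward,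 i.e. for some $x_0$ the set $s\cap(\{x_0\}\times\mathbb R)$ is one point bordered below by an interval of $s'\cap(\{x_0\}\times\mathbb R)$; 2. $F(s\to s')$ is a quasi-isomorphism if $s,s'$ lie in the same $\Lambda^F_k$; 3. for every $1$-stratum $O\subset\Lambda^F_1$ along which two non-cusp sheets cross, with $NW,NE\subset\Lambda^F_0$ the strata that locally form the parts of the two sheets lying above the other one, and $N\subset\Lambda^F_{-1}$ the stratum locally above both, the total complex of the square $F(O)\to F(NW)\oplus F(NE)\to F(N)$ is acyclic. **Simplex diagrams.** A simplex diagram $(\Delta,W,\{a_F\})$ is a simplex $\Delta$ with ordered vertices, a graded $\mathbb K$-module $W$, and for every face $F=[i_0,\dots,i_m]\le\Delta$ a linear map $a_F=a_{i_0\ldots i_m}:W\to W$ of degree $1-m$ with $$\sum_{0<k<m}(-1)^{k+1}a_{i_0\ldots\widehat{i_k}\ldots i_m}+\sum_{0\le k\le m}(-1)^k a_{i_k\ldots i_m}\circ a_{i_0\ldots i_k}=0 .$$ A morphism $(\Delta,W,\{a_F\})\to(\Delta',W',\{b_F\})$, defined when $\Delta$ is a face of $\Delta'$, is a degree $0$ map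 $\varphi:W\to W'$ with $\varphi a_F=b_F\varphi$ for $F\le\Delta$. The mapping cylinder is $\mathit{Map}(\Delta,W,\{a_F\})=\bigoplus_{F\le\Delta}W_F$, $W_F=W[\dim F]$, whose differential on $W_{i_0\ldots i_m}$ is $$\sum_{k=0}^m(-1)^{m+1}a_{i_0\ldots i_k}\colon W_{i_0\ldots i_m}\to W_{i_k\ldots i_m},\quad\text{plus}\quad\sum_{k=1}^m(-1)^{m+k+1}\mathrm{id}\colon W_{i_0\ldots i_m}\to W_{i_0\ldots\widehat{i_k}\ldots i_m}.$$ It is a functor to cochain complexes, morphisms acting componentwise followed by inclusion. **Chain homotopy diagrams.** For $A\subset M$, the sheets of $\Lambda$ above $A$ are the components of $\pi_x^{-1}(A)$ disjoint from $\Lambda_{cusp}$; the components meeting $\Lambda_{cusp}$ are the cusp components above $A$. Let $V(e_I)$ be spanned by the sheets above $e_I$, with $|S|=-\mu(S)$. If $e_I\le e_J$, then $V(e_J)=V(e_I)\oplus V_{cusp}$, where a sheet above $e_I$ is identified with the sheet above $e_J$ whose closure contains it, and $V_{cusp}$ is spanned by the remaining sheets, which meet in pairs at cusps above $e_I$. The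 boundary extension $c_J(e_I)$ to $V(e_J)$ of an endomorphism $c(e_I)$ of $V(e_I)$ is $c(e_I)$ on $V(e_I)$; on $V_{cusp}$ it is $d_0$ if $\dim e_I=0$, where $d_0$ maps the upper sheet of a pair to the lower one and the lower one to $0$; it is $\mathrm{id}$ if $\dim e_I=1$, and $0$ if $\dim e_I\ge2$. A chain homotopy diagram $\mathcal C$ for $(\Lambda,\mu,\mathcal E)$ assigns to each $e_I$ an endomorphism $c(e_I)$ of $V(e_I)$ of degree $1-\dim e_I$ such that $c(e_I)$ (respectively $c(e_I)-\mathrm{id}$ if $\dim e_I=1$) maps each sheet into the span of the sheets strictly below it, and such that $(\overline{e_I},V(e_I),\{c_I(e_F)\}_{F\subset I})$ is a simplex diagram for every $I$. **The functor.** Let $s\in\mathcal S$ lie above $h(e_I,e_J)$. Let $Y(s)$ be spanned by the sheets above $h(e_I,e_J)$ that are strictly below $s$. Each sheet above $h(e_I,e_J)$ meets exactly one sheet above $e_J$, and this identifies $Y(s)$ with a subspace of $V(e_J)$. A cusp component $C$ above $h(e_I,e_J)$ has an upper and a lower branch $C_u,C_l$; $s$ is exceptional for $C$ if at every $x\in\pi_x(s)$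 both branches are present and $s$ lies strictly above $C_l$ and weakly below $C_u$. Let $Z(s)$ have a basis of elements $v_C$, $|v_C|=-\mu(C_l)$, one for each $C$ for which $s$ is exceptional, and $X(s)=Y(s)\oplus Z(s)$. For $F\subset I$ let $a_F=c_J(e_F)|_{Y(s)}\oplus\beta_F$, with $\beta_F=\mathrm{id}$ if $\dim e_F=1$ and $\beta_F=0$ otherwise, and put $G(\mathcal C)(s)=(\overline{e_I},X(s),\{a_F\})$. For $s\le s'$ let $G(\mathcal C)(s\to s')$ be given by $X(s\to s')=(p,k+\ell):Y(s)\oplus Z(s)\to Y(s')\oplus Z(s')$, where * $p(T)=T'$ if $T\subset\overline{T'}$ for a sheet $T'$ spanning part of $Y(s')$, and $p(T)=0$ if there is none; * $k(T)=v_C$ if $T\subset\overline{C_l}$ for a $C$ for which $s'$ is exceptional, and $k(T)=0$ otherwise; * $\ell(v_C)=v_{C'}$ if $C\subset\overline{C'}$ for a $C'$ for which $s'$ is exceptional, and $\ell(v_C)=0$ otherwise. **Proposition.** For every chain homotopy diagram $\mathcal C$ for $(\Lambda,\mu,\mathcal E)$, $G(\mathcal C)$ is a well-defined functor from $P(\mathcal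 S)$ to simplex diagrams, and $F(\mathcal C)=\mathit{Map}\circ G(\mathcal C)$ lies in $\mathbf{Fun}^\bullet_\Lambda(\mathcal S,\mathbb K)$. -/

import Mathlib

open scoped Manifold ContDiff Topology
open CategoryTheory Bundle

namespace LegendrianSheaf

noncomputable section

/-! ### Graded modules, simplex diagrams and mapping cylinders -/

/-- The free module on `ι`, graded by a degree function on the generators: its degree `n` part. -/
def freeGrading (K : Type*) [Field K] {ι : Type*} (deg : ι → ℤ) (n : ℤ) : Submodule K (ι →₀ K) :=
  Finsupp.supported K K {i | deg i = n}

/-- The grading of a direct sum of two graded modules. -/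
def prodGrading {K : Type*} [Field K] {Y Z : Type*} [AddCommGroup Y] [Module K Y]
    [AddCommGroup Z] [Module K Z] (gY : ℤ → Submodule K Y) (gZ : ℤ → Submodule K Z) (n : ℤ) :
    Submodule K (Y × Z) :=
  (gY n).prod (gZ n)

theorem freeGrading_isInternal (K : Type*) [Field K] {ι : Type*} (deg : ι → ℤ) :
    DirectSum.IsInternal (freeGrading K deg) := by
  rw [DirectSum.isInternal_submodule_iff_iSupIndep_and_iSup_eq_top]
  constructor
  · intro n
    have h : (⨆ (j) (_ : j ≠ n), freeGrading K deg j)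
        ≤ Finsupp.supported K K {i | deg i ≠ n} := by
      refine iSup₂_le fun j hj => Finsupp.supported_mono ?_
      rintro i rfl
      exact hj
    refine Disjoint.mono_right h ?_
    rw [freeGrading, Finsupp.disjoint_supported_supported_iff]
    exact Set.disjoint_left.mpr fun i hi hi' => hi' hi
  · rw [eq_top_iff]
    rintro f -
    rw [← Finsupp.sum_single f]
    refine Submodule.sum_mem _ fun i _ => ?_
    exact (le_iSup (freeGrading K deg) (deg i)) (Finsupp.single_mem_supported K _ rfl)

theorem prodGrading_isInternal {K : Type*} [Field K] {Y Z : Type*} [AddCommGroup Y] [Module K Y]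
    [AddCommGroup Z] [Module K Z] {gY : ℤ → Submodule K Y} {gZ : ℤ → Submodule K Z}
    (hY : DirectSum.IsInternal gY) (hZ : DirectSum.IsInternal gZ) :
    DirectSum.IsInternal (prodGrading gY gZ) := by
  rw [DirectSum.isInternal_submodule_iff_iSupIndep_and_iSup_eq_top] at *
  constructor
  · intro n
    have h : (⨆ (j) (_ : j ≠ n), prodGrading gY gZ j)
        ≤ (⨆ (j) (_ : j ≠ n), gY j).prod (⨆ (j) (_ : j ≠ n), gZ j) :=
      iSup₂_le fun j hj => Submodule.prod_mono (le_iSup₂_of_le j hj le_rfl)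
        (le_iSup₂_of_le j hj le_rfl)
    refine Disjoint.mono_right h ?_
    rw [Submodule.disjoint_def]
    rintro ⟨y, z⟩ ⟨hy, hz⟩ ⟨hy', hz'⟩
    have h1 := (Submodule.disjoint_def.mp (hY.1 n)) y hy hy'
    have h2 := (Submodule.disjoint_def.mp (hZ.1 n)) z hz hz'
    simp [h1, h2]
  · have e1 : Submodule.map (LinearMap.inl K Y Z) ⊤ ≤ ⨆ n, prodGrading gY gZ n := by
      rw [← hY.2, Submodule.map_iSup]
      refine iSup_mono fun n => ?_
      rintro _ ⟨y, hy, rfl⟩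
      exact ⟨hy, (gZ n).zero_mem⟩
    have e2 : Submodule.map (LinearMap.inr K Y Z) ⊤ ≤ ⨆ n, prodGrading gY gZ n := by
      rw [← hZ.2, Submodule.map_iSup]
      refine iSup_mono fun n => ?_
      rintro _ ⟨y, hy, rfl⟩
      exact ⟨(gY n).zero_mem, hy⟩
    rw [eq_top_iff]
    rintro ⟨y, z⟩ -
    have : (y, z) = LinearMap.inl K Y Z y + LinearMap.inr K Y Z z := by simp
    rw [this]
    exact add_mem (e1 ⟨y, trivial, rfl⟩) (e2 ⟨z, trivial, rfl⟩)

section Simplex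

variable {V : Type*} [LinearOrder V]

/-- The dimension of the simplex spanned by a nonempty finite set of vertices. -/
def sdim (F : Finset V) : ℤ := (F.card : ℤ) - 1

/-- For `F = [i₀, …, iₘ]` and `v = iₖ`, the index `k`. -/
def pos (F : Finset V) (v : V) : ℕ := (F.filter (· < v)).card

/-- For `F = [i₀, …, iₘ]` and `v = iₖ`, the front face `[i₀, …, iₖ]`. -/
def frontFace (F : Finset V) (v : V) : Finset V := F.filter (· ≤ v)

/-- For `F = [i₀, …, iₘ]` and `v = iₖ`, the back face `[iₖ, …, iₘ]`. -/
def backFace (F : Finset V) (v : V) : Finset V := F.filter (v ≤ ·)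

/-- The vertices of `F` other than the first one. -/
def nonFirst (F : Finset V) : Finset V := F.filter fun v => ∃ u ∈ F, u < v

/-- The vertices of `F` other than the first and the last one. -/
def inner (F : Finset V) : Finset V := F.filter fun v => (∃ u ∈ F, u < v) ∧ ∃ u ∈ F, v < u

/-- The condition that `(Δ, W, {a_F})` is a simplex diagram, where `W` is graded by `gr`
and the simplex `Δ` and its faces are given by their vertex sets. -/
structure IsSimplexDiagram {K : Type*} [Field K] {W : Type*} [AddCommGroup W] [Module K W]
    (Δ : Finset V) (gr : ℤ → Submodule K W) (a : Finset V → W →ₗ[K] W) : Prop where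
  degree : ∀ F : Finset V, F.Nonempty → F ⊆ Δ → ∀ n, ∀ w ∈ gr n, a F w ∈ gr (n + 1 - sdim F)
  identity : ∀ F : Finset V, F.Nonempty → F ⊆ Δ →
    ∑ v ∈ inner F, (-1 : K) ^ (pos F v + 1) • a (F.erase v)
      + ∑ v ∈ F, (-1 : K) ^ pos F v • (a (backFace F v) ∘ₗ a (frontFace F v)) = 0

end Simplex

universe uV uK uW

/-- A simplex diagram; only the maps `map F` for the faces `F` of `simplex` are relevant. -/
structure SimplexDiagram (K : Type uK) [Field K] (V : Type uV) [LinearOrder V] where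
  simplex : Finset V
  nonempty : simplex.Nonempty
  carrier : Type uW
  [addCommGroup : AddCommGroup carrier]
  [module : Module K carrier]
  gr : ℤ → Submodule K carrier
  internal : DirectSum.IsInternal gr
  map : Finset V → carrier →ₗ[K] carrier
  isDiagram : IsSimplexDiagram simplex gr map

namespace SimplexDiagram

attribute [instance] SimplexDiagram.addCommGroup SimplexDiagram.module

variable {K : Type uK} [Field K] {V : Type uV} [LinearOrder V]

/-- A morphism of simplex diagrams: the first simplex is a face of the second one, and the
degree zero linear map commutes with the maps of all faces of the first simplex. -/
@[ext]
structure Hom (A B : SimplexDiagram.{uV, uK, uW} K V) where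
  face : A.simplex ⊆ B.simplex
  lin : A.carrier →ₗ[K] B.carrier
  degree : ∀ n, ∀ w ∈ A.gr n, lin w ∈ B.gr n
  comm : ∀ F : Finset V, F.Nonempty → F ⊆ A.simplex → lin ∘ₗ A.map F = B.map F ∘ₗ lin

instance : Category (SimplexDiagram.{uV, uK, uW} K V) where
  Hom := Hom
  id A := ⟨subset_rfl, LinearMap.id, fun _ _ h => h, fun _ _ _ => rfl⟩
  comp f g := ⟨f.face.trans g.face, g.lin ∘ₗ f.lin, fun n w h => g.degree n _ (f.degree n w h),
    fun F h h' => by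
      rw [LinearMap.comp_assoc, f.comm F h h', ← LinearMap.comp_assoc,
        g.comm F h (h'.trans f.face), LinearMap.comp_assoc]⟩

end SimplexDiagram

section Cylinder

variable {K : Type*} [Field K] {V : Type*} [LinearOrder V]
  {W : Type*} [AddCommGroup W] [Module K W]

/-- The degree `n` part of `⨁_{F ≤ Δ} W[dim F]`: finitely supported functions `F ↦ w_F` on faces
of `Δ` with `w_F` of degree `n + dim F`. -/
def cylPart (Δ : Finset V) (gr : ℤ → Submodule K W) (n : ℤ) : Submodule K (Finset V →₀ W) where
  carrier := {f | ∀ F, (F.Nonempty ∧ F ⊆ Δ → f F ∈ gr (n + sdim F)) ∧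
    (¬ (F.Nonempty ∧ F ⊆ Δ) → f F = 0)}
  zero_mem' := fun F => ⟨fun _ => (gr _).zero_mem, fun _ => rfl⟩
  add_mem' := fun {f g} hf hg F => ⟨fun h => (gr _).add_mem ((hf F).1 h) ((hg F).1 h),
    fun h => by simp [(hf F).2 h, (hg F).2 h]⟩
  smul_mem' := fun c f hf F => ⟨fun h => (gr _).smul_mem c ((hf F).1 h),
    fun h => by simp [(hf F).2 h]⟩

/-- The restriction of the mapping cylinder differential to the summand of the face `E`. -/
def cylDiffOn (a : Finset V → W →ₗ[K] W) (E : Finset V) : W →ₗ[K] (Finset V →₀ W) :=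
  ∑ v ∈ E, (-1 : K) ^ E.card • (Finsupp.lsingle (backFace E v) ∘ₗ a (frontFace E v))
    + ∑ v ∈ nonFirst E, (-1 : K) ^ (E.card + pos E v) • Finsupp.lsingle (E.erase v)

/-- The mapping cylinder differential. -/
def cylDiff (a : Finset V → W →ₗ[K] W) : (Finset V →₀ W) →ₗ[K] (Finset V →₀ W) :=
  Finsupp.lsum K (cylDiffOn a)

theorem cylDiff_single (a : Finset V → W →ₗ[K] W) (E : Finset V) (w : W) :
    cylDiff a (Finsupp.single E w) =
      ∑ v ∈ E, (-1 : K) ^ E.card • Finsupp.single (backFace E v) (a (frontFace E v) w)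
      + ∑ v ∈ nonFirst E, (-1 : K) ^ (E.card + pos E v) • Finsupp.single (E.erase v) w := by
  simp [cylDiff, cylDiffOn, LinearMap.sum_apply]

theorem single_mem_cylPart {Δ : Finset V} {gr : ℤ → Submodule K W} {n : ℤ} {F : Finset V}
    {w : W} (h : F.Nonempty) (h' : F ⊆ Δ) (hw : w ∈ gr (n + sdim F)) :
    Finsupp.single F w ∈ cylPart Δ gr n := by
  intro G
  by_cases hG : F = G
  · subst hG
    simp [h, h', hw]
  · simp [Finsupp.single_eq_of_ne (Ne.symm hG)]

theorem mem_cylPart_induction {Δ : Finset V} {gr : ℤ → Submodule K W} {n : ℤ}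
    {p : Submodule K (Finset V →₀ W)}
    (hp : ∀ F : Finset V, F.Nonempty → F ⊆ Δ → ∀ w ∈ gr (n + sdim F), Finsupp.single F w ∈ p)
    {f : Finset V →₀ W} (hf : f ∈ cylPart Δ gr n) : f ∈ p := by
  rw [← Finsupp.sum_single f]
  refine Submodule.sum_mem _ fun F hF => ?_
  by_cases h : F.Nonempty ∧ F ⊆ Δ
  · exact hp F h.1 h.2 _ ((hf F).1 h)
  · exact absurd ((hf F).2 h) (Finsupp.mem_support_iff.mp hF)

theorem mem_nonFirst {F : Finset V} {v : V} : v ∈ nonFirst F ↔ v ∈ F ∧ ∃ u ∈ F, u < v :=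
  Finset.mem_filter

theorem mem_inner {F : Finset V} {v : V} :
    v ∈ inner F ↔ v ∈ F ∧ (∃ u ∈ F, u < v) ∧ ∃ u ∈ F, v < u :=
  Finset.mem_filter

theorem card_backFace {E : Finset V} {v : V} : (backFace E v).card + pos E v = E.card := by
  rw [backFace, pos, add_comm]
  simpa [not_lt] using Finset.card_filter_add_card_filter_not (s := E) (fun u => u < v)

theorem card_frontFace {E : Finset V} {v : V} (hv : v ∈ E) :
    (frontFace E v).card = pos E v + 1 := by
  have : frontFace E v = insert v (E.filter (· < v)) := by
    ext u
    simp only [frontFace, Finset.mem_filter, Finset.mem_insert, le_iff_lt_or_eq]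
    grind
  rw [this, Finset.card_insert_of_notMem (by simp), pos]

theorem cylDiff_mem {Δ : Finset V} {gr : ℤ → Submodule K W} {a : Finset V → W →ₗ[K] W}
    (h : IsSimplexDiagram Δ gr a) {n : ℤ} {f : Finset V →₀ W} (hf : f ∈ cylPart Δ gr n) :
    cylDiff a f ∈ cylPart Δ gr (n + 1) := by
  refine mem_cylPart_induction (p := (cylPart Δ gr (n + 1)).comap (cylDiff a)) ?_ hf
  intro E hE hΔ w hw
  rw [Submodule.mem_comap, cylDiff_single]
  refine add_mem (Submodule.sum_mem _ fun v hv => Submodule.smul_mem _ _ ?_)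
    (Submodule.sum_mem _ fun v hv => Submodule.smul_mem _ _ ?_)
  · refine single_mem_cylPart ⟨v, by simp [backFace, hv]⟩
      ((Finset.filter_subset _ _).trans hΔ) ?_
    have := h.degree (frontFace E v) ⟨v, by simp [frontFace, hv]⟩
      ((Finset.filter_subset _ _).trans hΔ) _ w hw
    convert this using 2
    have h1 := card_backFace (E := E) (v := v)
    have h2 := card_frontFace hv
    simp only [sdim]
    lia
  · obtain ⟨hvE, u, hu, huv⟩ := Finset.mem_filter.mp hv
    refine single_mem_cylPart ⟨u, by simp [hu, huv.ne]⟩ ((Finset.erase_subset _ _).trans hΔ) ?_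
    convert hw using 2
    have := Finset.card_erase_add_one hvE
    simp only [sdim]
    lia


theorem cylDiff_comp_single {Δ : Finset V} {gr : ℤ → Submodule K W} {a : Finset V → W →ₗ[K] W}
    (h : IsSimplexDiagram Δ gr a) {E : Finset V} (hΔ : E ⊆ Δ) (w : W) :
    cylDiff a (cylDiff a (Finsupp.single E w)) = 0 := by
  have sq : ∀ m : ℕ, (-1 : K) ^ (2 * m) = 1 := fun m => by simp [pow_mul]
  -- terms of type `a ∘ a`
  have T11 : ∀ v ∈ E, (-1 : K) ^ E.card • ∑ u ∈ backFace E v, (-1 : K) ^ (backFace E v).card •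
        Finsupp.single (backFace (backFace E v) u)
          (a (frontFace (backFace E v) u) (a (frontFace E v) w))
      = ∑ u ∈ backFace E v, (-1 : K) ^ pos E v •
        Finsupp.single (backFace E u) (a (backFace (frontFace E u) v)
          (a (frontFace (frontFace E u) v) w)) := by
    intro v hv
    rw [Finset.smul_sum]
    refine Finset.sum_congr rfl fun u hu => ?_
    have hvu : v ≤ u := (Finset.mem_filter.mp hu).2
    have e1 : backFace (backFace E v) u = backFace E u := by
      ext t; simp only [backFace, Finset.mem_filter]; grind
    have e2 : frontFace (backFace E v) u = backFace (frontFace E u) v := by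
      ext t; simp only [backFace, frontFace, Finset.mem_filter]; grind
    have e3 : frontFace E v = frontFace (frontFace E u) v := by
      ext t; simp only [frontFace, Finset.mem_filter]; grind
    rw [smul_smul, ← pow_add, e1, e2, ← e3]
    congr 1
    have := card_backFace (E := E) (v := v)
    rw [show E.card + (backFace E v).card = pos E v + 2 * (backFace E v).card by lia, pow_add, sq,
      mul_one]
  -- terms of type `id ∘ a`
  have T12 : ∀ v ∈ E, (-1 : K) ^ E.card • ∑ u ∈ nonFirst (backFace E v),
        (-1 : K) ^ ((backFace E v).card + pos (backFace E v) u) •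
        Finsupp.single ((backFace E v).erase u) (a (frontFace E v) w)
      = ∑ u ∈ E.filter (v < ·), (-1 : K) ^ pos E u •
        Finsupp.single ((backFace E v).erase u) (a (frontFace E v) w) := by
    intro v hv
    rw [Finset.smul_sum]
    have e0 : nonFirst (backFace E v) = E.filter (v < ·) := by
      ext t
      simp only [mem_nonFirst, backFace, Finset.mem_filter]
      constructor
      · rintro ⟨⟨h1, h2⟩, u, ⟨h3, h4⟩, h5⟩
        exact ⟨h1, lt_of_le_of_lt h4 h5⟩
      · rintro ⟨h1, h2⟩
        exact ⟨⟨h1, h2.le⟩, v, ⟨hv, le_rfl⟩, h2⟩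
    rw [e0]
    refine Finset.sum_congr rfl fun u hu => ?_
    have hvu : v < u := (Finset.mem_filter.mp hu).2
    rw [smul_smul, ← pow_add]
    congr 1
    have h1 := card_backFace (E := E) (v := v)
    have h2 : pos E u = pos E v + pos (backFace E v) u := by
      have : E.filter (· < u) = E.filter (· < v) ∪ (backFace E v).filter (· < u) := by
        ext t; simp only [backFace, Finset.mem_filter, Finset.mem_union]; grind
      rw [pos, this, Finset.card_union_of_disjoint, pos, pos]
      rw [Finset.disjoint_left]
      intro t ht ht'
      simp only [backFace, Finset.mem_filter] at ht ht'
      exact absurd ht'.1.2 (not_le.mpr ht.2)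
    rw [show E.card + ((backFace E v).card + pos (backFace E v) u)
      = pos E u + 2 * (backFace E v).card by lia, pow_add, sq, mul_one]
  -- terms of type `a ∘ id`
  have T21 : ∀ v ∈ nonFirst E, (-1 : K) ^ (E.card + pos E v) •
        ∑ u ∈ E.erase v, (-1 : K) ^ (E.erase v).card •
        Finsupp.single (backFace (E.erase v) u) (a (frontFace (E.erase v) u) w)
      = - ∑ u ∈ E.filter (· < v), (-1 : K) ^ pos E v •
          Finsupp.single ((backFace E u).erase v) (a (frontFace E u) w)
        + ∑ u ∈ E.filter (v < ·), (-1 : K) ^ (pos E v + 1) •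
          Finsupp.single (backFace E u) (a ((frontFace E u).erase v) w) := by
    intro v hv
    have hvE : v ∈ E := (Finset.mem_filter.mp hv).1
    have e0 : E.erase v = E.filter (· < v) ∪ E.filter (v < ·) := by
      ext t
      simp only [Finset.mem_erase, Finset.mem_filter, Finset.mem_union]
      grind
    have hd : Disjoint (E.filter (· < v)) (E.filter (v < ·)) := by
      rw [Finset.disjoint_left]
      intro t ht ht'
      exact absurd (Finset.mem_filter.mp ht).2 (not_lt.mpr (Finset.mem_filter.mp ht').2.le)
    have hc := Finset.card_erase_add_one hvE
    have hs : (-1 : K) ^ (E.card + pos E v) * (-1 : K) ^ (E.erase v).card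
        = (-1 : K) ^ (pos E v + 1) := by
      rw [← pow_add, show E.card + pos E v + (E.erase v).card
        = pos E v + 1 + 2 * (E.erase v).card by lia, pow_add _ (pos E v + 1), sq, mul_one]
    rw [Finset.smul_sum]
    simp only [smul_smul, hs]
    conv_lhs => rw [Finset.sum_congr e0 fun _ _ => rfl, Finset.sum_union hd]
    congr 1
    · rw [← Finset.sum_neg_distrib]
      refine Finset.sum_congr rfl fun u hu => ?_
      have huv : u < v := (Finset.mem_filter.mp hu).2
      have e1 : backFace (E.erase v) u = (backFace E u).erase v := by
        ext t; simp only [backFace, Finset.mem_filter, Finset.mem_erase]; grind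
      have e2 : frontFace (E.erase v) u = frontFace E u := by
        ext t; simp only [frontFace, Finset.mem_filter, Finset.mem_erase]; grind
      rw [e1, e2, pow_succ, mul_neg_one, neg_smul]
    · refine Finset.sum_congr rfl fun u hu => ?_
      have huv : v < u := (Finset.mem_filter.mp hu).2
      have e1 : backFace (E.erase v) u = backFace E u := by
        ext t; simp only [backFace, Finset.mem_filter, Finset.mem_erase]; grind
      have e2 : frontFace (E.erase v) u = (frontFace E u).erase v := by
        ext t; simp only [frontFace, Finset.mem_filter, Finset.mem_erase]; grind
      rw [e1, e2]
  -- terms of type `id ∘ id`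
  have T22 : ∑ v ∈ nonFirst E, (-1 : K) ^ (E.card + pos E v) •
        ∑ u ∈ nonFirst (E.erase v), (-1 : K) ^ ((E.erase v).card + pos (E.erase v) u) •
        Finsupp.single ((E.erase v).erase u) w = 0 := by
    have e : ∀ v ∈ nonFirst E, (-1 : K) ^ (E.card + pos E v) •
        ∑ u ∈ nonFirst (E.erase v), (-1 : K) ^ ((E.erase v).card + pos (E.erase v) u) •
        Finsupp.single ((E.erase v).erase u) w
        = - ∑ u ∈ (nonFirst E).filter (· < v), (-1 : K) ^ (pos E v + pos E u) •
            Finsupp.single ((E.erase v).erase u) w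
          + ∑ u ∈ (nonFirst E).filter (v < ·), (-1 : K) ^ (pos E v + pos E u) •
            Finsupp.single ((E.erase v).erase u) w := by
      intro v hv
      obtain ⟨hvE, m, hm, hmv⟩ := Finset.mem_filter.mp hv
      have e0 : nonFirst (E.erase v)
          = (nonFirst E).filter (· < v) ∪ (nonFirst E).filter (v < ·) := by
        ext t
        simp only [mem_nonFirst, Finset.mem_erase, Finset.mem_filter, Finset.mem_union]
        constructor
        · rintro ⟨⟨h1, h2⟩, u, ⟨h3, h4⟩, h5⟩
          rcases lt_or_gt_of_ne h1 with h6 | h6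
          · exact Or.inl ⟨⟨h2, u, h4, h5⟩, h6⟩
          · exact Or.inr ⟨⟨h2, u, h4, h5⟩, h6⟩
        · rintro (⟨⟨h2, u, h4, h5⟩, h6⟩ | ⟨⟨h2, u, h4, h5⟩, h6⟩)
          · exact ⟨⟨h6.ne, h2⟩, u, ⟨(h5.trans h6).ne, h4⟩, h5⟩
          · exact ⟨⟨h6.ne', h2⟩, m, ⟨hmv.ne, hm⟩, hmv.trans h6⟩
      have hd : Disjoint ((nonFirst E).filter (· < v)) ((nonFirst E).filter (v < ·)) := by
        rw [Finset.disjoint_left]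
        intro t ht ht'
        exact absurd (Finset.mem_filter.mp ht).2 (not_lt.mpr (Finset.mem_filter.mp ht').2.le)
      have hc := Finset.card_erase_add_one hvE
      rw [Finset.smul_sum, e0, Finset.sum_union hd]
      congr 1
      · rw [← Finset.sum_neg_distrib]
        refine Finset.sum_congr rfl fun u hu => ?_
        have huv : u < v := (Finset.mem_filter.mp hu).2
        have hp : pos (E.erase v) u = pos E u := by
          rw [pos, pos]; congr 1
          ext t; simp only [Finset.mem_filter, Finset.mem_erase]; grind
        rw [smul_smul, ← pow_add, hp, ← neg_smul]
        congr 1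
        rw [show E.card + pos E v + ((E.erase v).card + pos E u)
          = pos E v + pos E u + 1 + 2 * (E.erase v).card by lia, pow_add _ (_ + 1), sq, pow_succ]
        ring
      · refine Finset.sum_congr rfl fun u hu => ?_
        have huv : v < u := (Finset.mem_filter.mp hu).2
        have hp : pos (E.erase v) u + 1 = pos E u := by
          rw [pos, pos, ← Finset.card_erase_add_one (s := E.filter (· < u)) (a := v)
            (by simp [hvE, huv])]
          congr 2
          ext t; simp only [Finset.mem_filter, Finset.mem_erase]; grind
        rw [smul_smul, ← pow_add]
        congr 1
        rw [show E.card + pos E v + ((E.erase v).card + pos (E.erase v) u)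
          = pos E v + pos E u + 2 * (E.erase v).card by lia, pow_add _ (_ + _), sq, mul_one]
    rw [Finset.sum_congr rfl e, Finset.sum_add_distrib, Finset.sum_neg_distrib, neg_add_eq_zero]
    rw [Finset.sum_comm' (t' := nonFirst E) (s' := fun u => (nonFirst E).filter (u < ·))
      (by intro x y; simp only [Finset.mem_filter]; tauto)]
    refine Finset.sum_congr rfl fun v hv => Finset.sum_congr rfl fun u hu => ?_
    rw [Finset.erase_right_comm, add_comm (pos E u)]
  rw [cylDiff_single, map_add, map_sum, map_sum]
  simp only [map_smul, cylDiff_single, smul_add, Finset.sum_add_distrib]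
  rw [T22, add_zero, Finset.sum_congr rfl T11, Finset.sum_congr rfl T12, Finset.sum_congr rfl T21,
    Finset.sum_add_distrib, Finset.sum_neg_distrib]
  have c1 : ∑ v ∈ E, ∑ u ∈ E.filter (v < ·), (-1 : K) ^ pos E u •
        Finsupp.single ((backFace E v).erase u) (a (frontFace E v) w)
      = ∑ v ∈ nonFirst E, ∑ u ∈ E.filter (· < v), (-1 : K) ^ pos E v •
          Finsupp.single ((backFace E u).erase v) (a (frontFace E u) w) := by
    refine Finset.sum_comm' ?_
    intro x y
    simp only [mem_nonFirst, Finset.mem_filter]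
    grind
  have c2 : ∑ v ∈ E, ∑ u ∈ backFace E v, (-1 : K) ^ pos E v •
        Finsupp.single (backFace E u) (a (backFace (frontFace E u) v)
          (a (frontFace (frontFace E u) v) w))
      + ∑ v ∈ nonFirst E, ∑ u ∈ E.filter (v < ·), (-1 : K) ^ (pos E v + 1) •
          Finsupp.single (backFace E u) (a ((frontFace E u).erase v) w) = 0 := by
    rw [Finset.sum_comm' (t' := E) (s' := fun u => frontFace E u)
      (by intro x y; simp only [frontFace, backFace, Finset.mem_filter]; tauto)]
    rw [Finset.sum_comm' (s := nonFirst E) (t' := E) (s' := fun u => inner (frontFace E u))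
      (by
        intro x y
        simp only [mem_nonFirst, mem_inner, frontFace, Finset.mem_filter]
        constructor
        · rintro ⟨⟨h1, u, h2, h3⟩, h4, h5⟩
          exact ⟨⟨⟨h1, h5.le⟩, ⟨u, ⟨h2, (h3.trans h5).le⟩, h3⟩, y, ⟨h4, le_rfl⟩, h5⟩, h4⟩
        · rintro ⟨⟨⟨h1, h5⟩, ⟨u, ⟨h2, _⟩, h3⟩, z, ⟨h6, h7⟩, h8⟩, h4⟩
          exact ⟨⟨h1, u, h2, h3⟩, h4, lt_of_lt_of_le h8 h7⟩)]
    rw [← Finset.sum_add_distrib]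
    refine Finset.sum_eq_zero fun u hu => ?_
    have hid := h.identity (frontFace E u) ⟨u, by simp [frontFace, hu]⟩
      ((Finset.filter_subset _ _).trans hΔ)
    have hp : ∀ v ∈ frontFace E u, pos (frontFace E u) v = pos E v := by
      intro v hv
      have : v ≤ u := (Finset.mem_filter.mp hv).2
      rw [pos, pos]; congr 1
      ext t; simp only [frontFace, Finset.mem_filter]; grind
    have hid' := congrArg (fun f => Finsupp.lsingle (R := K) (backFace E u) (f w)) hid
    simp only [LinearMap.add_apply, LinearMap.sum_apply, LinearMap.smul_apply, map_add, map_sum,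
      map_smul, LinearMap.comp_apply, LinearMap.zero_apply, map_zero, Finsupp.lsingle_apply] at hid'
    rw [add_comm, ← hid']
    congr 1
    · refine Finset.sum_congr rfl fun v hv => ?_
      rw [hp v (Finset.mem_filter.mp hv).1]
    · refine Finset.sum_congr rfl fun v hv => ?_
      rw [hp v hv]
  rw [c1, add_comm (-_), ← add_assoc, ← sub_eq_add_neg, sub_eq_zero, add_right_comm, c2, zero_add]

theorem cylDiff_comp {Δ : Finset V} {gr : ℤ → Submodule K W} {a : Finset V → W →ₗ[K] W}
    (h : IsSimplexDiagram Δ gr a) {n : ℤ} {f : Finset V →₀ W} (hf : f ∈ cylPart Δ gr n) :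
    cylDiff a (cylDiff a f) = 0 :=
  mem_cylPart_induction (p := LinearMap.ker (cylDiff a ∘ₗ cylDiff a))
    (fun _ _ hΔ w _ => cylDiff_comp_single h hΔ w) hf

end Cylinder

namespace SimplexDiagram

variable {K : Type uK} [Field K] {V : Type uV} [LinearOrder V]

/-- The mapping cylinder of a simplex diagram, a cochain complex. -/
def cylinder (A : SimplexDiagram.{uV, uK, uW} K V) :
    CochainComplex (ModuleCat.{max uV uW} K) ℤ where
  X n := ModuleCat.of K (cylPart A.simplex A.gr n)
  d i j := if h : i + 1 = j then
      ModuleCat.ofHom ((cylDiff A.map).restrict fun _ hf => h ▸ cylDiff_mem A.isDiagram hf)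
    else 0
  shape i j h := dif_neg h
  d_comp_d' i j k hij hjk := by
    obtain rfl : i + 1 = j := hij
    obtain rfl : i + 1 + 1 = k := hjk
    rw [dif_pos rfl, dif_pos rfl]
    refine ModuleCat.hom_ext (LinearMap.ext fun f => Subtype.ext ?_)
    exact cylDiff_comp A.isDiagram f.2

theorem Hom.map_mem {A B : SimplexDiagram.{uV, uK, uW} K V} (f : A ⟶ B) {n : ℤ}
    {x : Finset V →₀ A.carrier} (hx : x ∈ cylPart A.simplex A.gr n) :
    Finsupp.mapRange.linearMap f.lin x ∈ cylPart B.simplex B.gr n := by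
  refine mem_cylPart_induction
    (p := (cylPart B.simplex B.gr n).comap (Finsupp.mapRange.linearMap f.lin)) ?_ hx
  intro F hF hΔ w hw
  rw [Submodule.mem_comap, Finsupp.mapRange.linearMap_apply, Finsupp.mapRange_single]
  exact single_mem_cylPart hF (hΔ.trans f.face) (f.degree _ _ hw)

theorem Hom.map_comm {A B : SimplexDiagram.{uV, uK, uW} K V} (f : A ⟶ B) {n : ℤ}
    {x : Finset V →₀ A.carrier} (hx : x ∈ cylPart A.simplex A.gr n) :
    cylDiff B.map (Finsupp.mapRange.linearMap f.lin x)
      = Finsupp.mapRange.linearMap f.lin (cylDiff A.map x) := by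
  rw [← sub_eq_zero]
  refine mem_cylPart_induction (p := LinearMap.ker (cylDiff B.map ∘ₗ
    Finsupp.mapRange.linearMap f.lin - Finsupp.mapRange.linearMap f.lin ∘ₗ cylDiff A.map)) ?_ hx
  intro F hF hΔ w hw
  have key : ∀ v ∈ F, f.lin (A.map (frontFace F v) w) = B.map (frontFace F v) (f.lin w) :=
    fun v hv => LinearMap.congr_fun (f.comm (frontFace F v) ⟨v, by simp [frontFace, hv]⟩
      ((Finset.filter_subset _ _).trans hΔ)) w
  rw [LinearMap.mem_ker, LinearMap.sub_apply, sub_eq_zero, LinearMap.comp_apply,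
    LinearMap.comp_apply, Finsupp.mapRange.linearMap_apply, Finsupp.mapRange_single,
    cylDiff_single, cylDiff_single, map_add, map_sum, map_sum]
  simp only [map_smul, Finsupp.mapRange.linearMap_apply, Finsupp.mapRange_single]
  congr 1
  exact Finset.sum_congr rfl fun v hv => by rw [key v hv]

/-- The mapping cylinder functor from simplex diagrams to cochain complexes. -/
def Map : SimplexDiagram.{uV, uK, uW} K V ⥤ CochainComplex (ModuleCat.{max uV uW} K) ℤ where
  obj A := A.cylinder
  map {A B} f :=
    { f := fun n => ModuleCat.ofHom
        ((Finsupp.mapRange.linearMap f.lin).restrict fun _ hx => Hom.map_mem f hx)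
      comm' := fun i j hij => by
        obtain rfl : i + 1 = j := hij
        simp only [cylinder, dif_pos]
        refine ModuleCat.hom_ext (LinearMap.ext fun x => Subtype.ext ?_)
        exact Hom.map_comm f x.2 }
  map_id A := by
    refine HomologicalComplex.hom_ext _ _ fun n =>
      ModuleCat.hom_ext (LinearMap.ext fun x => Subtype.ext ?_)
    exact Finsupp.mapRange_id x.1
  map_comp f g := by
    refine HomologicalComplex.hom_ext _ _ fun n =>
      ModuleCat.hom_ext (LinearMap.ext fun x => Subtype.ext ?_)
    exact LinearMap.congr_fun (Finsupp.mapRange.linearMap_comp g.lin f.lin) x.1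

end SimplexDiagram

/-! ### Legendrian surfaces in one-jet spaces -/

/-- The model plane for surfaces. -/
abbrev Plane := EuclideanSpace ℝ (Fin 2)

/-- The cotangent bundle `T*M` of a surface. -/
abbrev CotangentBundle (M : Type*) [TopologicalSpace M] [ChartedSpace Plane M]
    [IsManifold (𝓡 2) ∞ M] : Type _ :=
  TotalSpace (Plane →L[ℝ] ℝ) fun x : M => TangentSpace (𝓡 2) x →L[ℝ] Bundle.Trivial M ℝ x

/-- The one-jet space `J¹M = T*M × ℝ`. -/
abbrev OneJet (M : Type*) [TopologicalSpace M] [ChartedSpace Plane M]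
    [IsManifold (𝓡 2) ∞ M] : Type _ :=
  CotangentBundle M × ℝ

/-- The model with corners of `J¹M`. -/
abbrev oneJetModel := ((𝓡 2).prod 𝓘(ℝ, Plane →L[ℝ] ℝ)).prod 𝓘(ℝ, ℝ)

/-- The model with corners of `J⁰M = M × ℝ`. -/
abbrev zeroJetModel := (𝓡 2).prod 𝓘(ℝ, ℝ)

/-- A Legendrian surface in `J¹M`: an embedded surface, given by a smooth embedding
`p ↦ (x, y, z)` of a surface `L`, along which the contact form `dz - y dx` vanishes. -/
structure LegendrianSurface (L M : Type*) [TopologicalSpace L] [ChartedSpace Plane L]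
    [TopologicalSpace M] [ChartedSpace Plane M] [IsManifold (𝓡 2) ∞ M] where
  toJet : L → OneJet M
  embedding : Manifold.IsSmoothEmbedding (𝓡 2) oneJetModel ∞ toJet
  legendrian : ∀ (p : L) (v : TangentSpace (𝓡 2) p),
    mfderiv (𝓡 2) 𝓘(ℝ, ℝ) (fun q => (toJet q).2) p v
      = (toJet p).1.2 (mfderiv (𝓡 2) (𝓡 2) (fun q => (toJet q).1.proj) p v)

/-- A finite family of subspaces is in general position (transverse) if the codimension of its
intersection is the sum of the codimensions. -/
def GeneralPosition {W ι : Type*} [AddCommGroup W] [Module ℝ W] (s : Finset ι)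
    (A : ι → Submodule ℝ W) : Prop :=
  Module.finrank ℝ (W ⧸ ⨅ i ∈ s, A i) = ∑ i ∈ s, Module.finrank ℝ (W ⧸ A i)

/-- The set of connected components of a subset of a topological space. -/
def components {X : Type*} [TopologicalSpace X] (A : Set X) : Set (Set X) :=
  {S | ∃ p ∈ A, S = connectedComponentIn A p}

/-- The value of a function on a set on which it is constant. -/
def valueOn {X : Type*} (μ : X → ℤ) (S : Set X) : ℤ :=
  open Classical in if h : S.Nonempty then μ h.some else 0

namespace LegendrianSurface

variable {L M : Type*} [TopologicalSpace L] [ChartedSpace Plane L]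
  [TopologicalSpace M] [ChartedSpace Plane M] [IsManifold (𝓡 2) ∞ M]
  (Λ : LegendrianSurface L M)

/-- The base projection `Λ → M`. -/
def base (p : L) : M := (Λ.toJet p).1.proj

/-- The `z`-coordinate. -/
def height (p : L) : ℝ := (Λ.toJet p).2

/-- The front projection `Λ → J⁰M = M × ℝ`. -/
def front (p : L) : M × ℝ := (Λ.base p, Λ.height p)

/-- The differential of the front projection. -/
def frontDiff (p : L) : Plane →ₗ[ℝ] Plane × ℝ :=
  (mfderiv (𝓡 2) zeroJetModel Λ.front p : Plane →L[ℝ] Plane × ℝ).toLinearMap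

/-- The set `Λ_cusp` of points where the front projection is not an immersion. -/
def cusp : Set L := {p | ¬ Function.Injective (Λ.frontDiff p)}

/-- The front projection has a standard cusp singularity at `p`: it is
`(t₁, t₂) ↦ (t₁³, t₁², t₂)` in suitable smooth coordinates. -/
def IsStandardCusp (p : L) : Prop :=
  ∃ φ ∈ IsManifold.maximalAtlas (𝓡 2) ∞ L, ∃ ψ ∈ IsManifold.maximalAtlas zeroJetModel ∞ (M × ℝ),
    p ∈ φ.source ∧ φ p 0 = 0 ∧ ∀ q ∈ φ.source, Λ.front q ∈ ψ.source ∧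
      ψ (Λ.front q) = (!₂[(φ q 0) ^ 3, (φ q 0) ^ 2], φ q 1)

/-- Mild front singularities: the only singularities of the front projection are standard cusps. -/
def HasMildFront : Prop := ∀ p ∈ Λ.cusp, Λ.IsStandardCusp p

/-- The image of the differential of the front projection: the tangent plane of the front at a
point which is not a cusp point, the tangent line of the cusp edge at a cusp point. -/
def frontTangent (p : L) : Submodule ℝ (Plane × ℝ) := LinearMap.range (Λ.frontDiff p)

/-- The intersection of the spaces `frontTangent p` over all preimages `p` of a front point: the
tangent space of the singular stratum of the front through this point. -/
def stratumTangent (w : M × ℝ) : Submodule ℝ (Plane × ℝ) :=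
  ⨅ p ∈ {p | Λ.front p = w}, Λ.frontTangent p

/-- Self-transversality of the front projection: sheets and cusp edges passing through the same
point of the front are in general position. -/
def FrontTransverse : Prop :=
  ∀ (w : M × ℝ) (P : Finset L), (∀ p ∈ P, Λ.front p = w) → GeneralPosition P Λ.frontTangent

/-- Self-transversality of the base projection: above any point of `M`, the base projections of
the singular strata of the front are in general position. -/
def BaseTransverse : Prop :=
  ∀ (x : M) (Z : Finset ℝ),
    GeneralPosition Z fun z => (Λ.stratumTangent (x, z)).map (LinearMap.fst ℝ Plane ℝ)

/-- `p + 2 q` for a point of `M × ℝ` with `p` preimages in `Λ ∖ Λ_cusp` and `q` in `Λ_cusp`. -/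
def frontDepth (w : M × ℝ) : ℕ :=
  {p | Λ.front p = w ∧ p ∉ Λ.cusp}.ncard + 2 * {p | Λ.front p = w ∧ p ∈ Λ.cusp}.ncard

/-- The strata `Λ^F_k` of `M × ℝ`: the complement of the front for `k = -1`; smooth points of the
front for `k = 0`; crossings and cusp edges for `k = 1`; triple points and cusp-sheet
intersections for `k = 2`. -/
def frontStratum (k : ℤ) : Set (M × ℝ) := {w | (Λ.frontDepth w : ℤ) - 1 = k}

/-- The strata `Λ^B_k` of the base projection: points above which the codimensions of the points
of the front add up to `k`. -/
def baseStratum (k : ℕ) : Set M :=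
  {x | x ∈ Set.range Λ.base ∧ ∑ᶠ z : ℝ, (Λ.frontDepth (x, z) - 1) = k}

/-- The sheets of `Λ` above a subset of `M`. -/
def sheets (A : Set M) : Set (Set L) := {S | S ∈ components (Λ.base ⁻¹' A) ∧ Disjoint S Λ.cusp}

/-- The cusp components of `Λ` above a subset of `M`. -/
def cuspComponents (A : Set M) : Set (Set L) :=
  {C | C ∈ components (Λ.base ⁻¹' A) ∧ (C ∩ Λ.cusp).Nonempty}

/-- The upper branch `C_u` of a cusp component. -/
def upper (C : Set L) : Set L := {p ∈ C | ∃ q ∈ C, Λ.base q = Λ.base p ∧ Λ.height q < Λ.height p}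

/-- The lower branch `C_l` of a cusp component. -/
def lower (C : Set L) : Set L := {p ∈ C | ∃ q ∈ C, Λ.base q = Λ.base p ∧ Λ.height p < Λ.height q}

/-- The order of sheets by descending `z`-coordinate: `S ≺ T` iff `z(S) > z(T)`. -/
def Above (S T : Set L) : Prop :=
  ∀ p ∈ S, ∀ q ∈ T, Λ.base p = Λ.base q → Λ.height q < Λ.height p

/-- A `ℤ`-valued Maslov potential: a locally constant function on `Λ ∖ Λ_cusp` (its values at cusp
points play no role) that increases by `1` when passing from the lower to the upper sheet of a
cusp edge. -/
structure MaslovPotential where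
  toFun : L → ℤ
  locallyConstant : ∀ p ∉ Λ.cusp, ∀ᶠ q in 𝓝 p, toFun q = toFun p
  jump : ∀ p ∈ Λ.cusp, ∀ᶠ ab in 𝓝 p ×ˢ 𝓝 p, Λ.base ab.1 = Λ.base ab.2 →
    Λ.height ab.2 < Λ.height ab.1 → toFun ab.1 = toFun ab.2 + 1

end LegendrianSurface

/-! ### Simplicial decompositions and the associated stratification -/

/-- The geometric realization of a simplicial complex in barycentric coordinates. For locally
finite complexes the topology of pointwise convergence is the usual one. -/
def realization {V : Type*} (𝒦 : AbstractSimplicialComplex V) : Set (V → ℝ) :=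
  {b | (∀ v, 0 ≤ b v) ∧ ∃ F ∈ 𝒦.faces, (∀ v ∉ F, b v = 0) ∧ ∑ v ∈ F, b v = 1}

/-- A simplicial decomposition of a surface `M`. -/
structure Triangulation (V M : Type*) [TopologicalSpace M] where
  complex : AbstractSimplicialComplex V
  locallyFinite : ∀ v, {F | F ∈ complex.faces ∧ v ∈ F}.Finite
  card_le : ∀ F ∈ complex.faces, F.card ≤ 3
  homeo : M ≃ₜ realization complex

namespace Triangulation

variable {V M : Type*} [TopologicalSpace M] (ℰ : Triangulation V M)

/-- The vertex sets of the simplices. -/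
def faces : Set (Finset V) := ℰ.complex.faces

/-- The barycentric coordinates of a point of `M`. -/
def coord (x : M) (v : V) : ℝ := (ℰ.homeo x).1 v

/-- The cell `e_I`: the interior of the simplex with vertex set `I`. -/
def cell (I : Finset V) : Set M := {x | ∀ v, 0 < ℰ.coord x v ↔ v ∈ I}

/-- The `j`-skeleton. -/
def skeleton (j : ℕ) : Set M := {x | ∃ I ∈ ℰ.faces, I.card ≤ j + 1 ∧ x ∈ ℰ.cell I}

/-- The cell `h(e_I, e_J)` of the handle decomposition, for `I ⊆ J`. The lines on which a
barycentric coordinate equals `1/4` divide every triangle into a central region, a strip along each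
edge and a corner at each vertex, which form the handles. This is the polygonal decomposition dual
to the pair subdivision; changing the parametrization `homeo` without changing the cells `e_I`
gives the other choices of it. -/
def handleCell (I J : Finset V) : Set M :=
  {x | (∀ v ∈ I, 1 / 4 < ℰ.coord x v) ∧ (∀ v ∈ J, v ∉ I → ℰ.coord x v = 1 / 4) ∧
    ∀ v ∉ J, ℰ.coord x v < 1 / 4}

end Triangulation

universe uL uM

section Setting

variable {L : Type uL} {M : Type uM} [TopologicalSpace L] [ChartedSpace Plane L]
  [TopologicalSpace M] [ChartedSpace Plane M] [IsManifold (𝓡 2) ∞ M]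
  {V : Type uV} [LinearOrder V]

/-- The simplicial decomposition is compatible with the Legendrian surface. -/
def Compatible (Λ : LegendrianSurface L M) (ℰ : Triangulation V M) : Prop :=
  ∀ k ≤ 2, Λ.baseStratum k ⊆ ℰ.skeleton (2 - k)

/-- The strata of the associated front stratification `𝒮` of `M × ℝ`: the connected components of
the sets `Λ^F_k ∩ (h(e_I, e_J) × ℝ)`. -/
structure Stratum (Λ : LegendrianSurface L M) (ℰ : Triangulation V M) where
  carrier : Set (M × ℝ)
  I : Finset V
  J : Finset V
  I_mem : I ∈ ℰ.faces
  J_mem : J ∈ ℰ.faces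
  I_subset : I ⊆ J
  k : ℤ
  k_mem : k ∈ Set.Icc (-1) 2
  isComponent : carrier ∈ components (Λ.frontStratum k ∩ ℰ.handleCell I J ×ˢ Set.univ)

/-- The closure order on strata; the resulting category is `P(𝒮)`. -/
instance (Λ : LegendrianSurface L M) (ℰ : Triangulation V M) : Preorder (Stratum Λ ℰ) where
  le s s' := s.carrier ⊆ closure s'.carrier
  le_refl _ := subset_closure
  le_trans _ _ _ h h' := h.trans (closure_minimal h' isClosed_closure)

/-- Downward generization maps. -/
def IsDownward {Λ : LegendrianSurface L M} {ℰ : Triangulation V M} (s s' : Stratum Λ ℰ) : Prop :=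
  s ≤ s' ∧ ∃ (x₀ : M) (z₀ : ℝ), {z | (x₀, z) ∈ s.carrier} = {z₀} ∧
    ∃ δ > 0, ∀ z ∈ Set.Ioo (z₀ - δ) z₀, (x₀, z) ∈ s'.carrier

/-- The strata `O`, `NW`, `NE`, `N` in the closure of the upper region at a crossing arc: `O` is a
`1`-stratum where two smooth sheets cross, `NW` and `NE` are the parts of the two sheets that lie
above the other sheet, and `N` is the region above both sheets. -/
structure IsCrossingSquare {Λ : LegendrianSurface L M} {ℰ : Triangulation V M}
    (O NW NE N : Stratum Λ ℰ) : Prop where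
  O_k : O.k = 1
  O_dim : O.I = O.J
  NW_k : NW.k = 0
  NE_k : NE.k = 0
  N_k : N.k = -1
  O_le_NW : O ≤ NW
  O_le_NE : O ≤ NE
  NW_le_N : NW ≤ N
  NE_le_N : NE ≤ N
  local_form : ∃ p q : L, p ∉ Λ.cusp ∧ q ∉ Λ.cusp ∧ p ≠ q ∧ Λ.front p = Λ.front q ∧
    Λ.front p ∈ O.carrier ∧
    (∀ᶠ ab in 𝓝 p ×ˢ 𝓝 q, Λ.base ab.1 = Λ.base ab.2 →
      (Λ.height ab.2 < Λ.height ab.1 → Λ.front ab.1 ∈ NW.carrier) ∧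
      (Λ.height ab.1 < Λ.height ab.2 → Λ.front ab.2 ∈ NE.carrier)) ∧
    (∀ᶠ abz in (𝓝 p ×ˢ 𝓝 q) ×ˢ 𝓝 (Λ.height p), Λ.base abz.1.1 = Λ.base abz.1.2 →
      max (Λ.height abz.1.1) (Λ.height abz.1.2) < abz.2 →
        (Λ.base abz.1.1, abz.2) ∈ N.carrier)

/-- The total complex of the image of a commutative square under a functor from a preorder,
written as an iterated mapping cone. -/
def totalComplex {K : Type uK} [Field K] {P : Type*} [Preorder P]
    (F : P ⥤ CochainComplex (ModuleCat.{uW} K) ℤ) {a b c d : P} (hab : a ≤ b) (hac : a ≤ c)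
    (hbd : b ≤ d) (hcd : c ≤ d) : CochainComplex (ModuleCat.{uW} K) ℤ :=
  CochainComplex.mappingCone (CochainComplex.mappingCone.map (F.map (homOfLE hab))
    (F.map (homOfLE hcd)) (F.map (homOfLE hac)) (F.map (homOfLE hbd))
    (by rw [← F.map_comp, ← F.map_comp]; rfl))

/-- The conditions which define `Fun_Λ(𝒮, K)` as a full subcategory of the category of functors
from `P(𝒮)` to cochain complexes. -/
structure MemFun {Λ : LegendrianSurface L M} {ℰ : Triangulation V M} {K : Type uK} [Field K]
    (F : Stratum Λ ℰ ⥤ CochainComplex (ModuleCat.{uW} K) ℤ) : Prop where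
  downward : ∀ (s s' : Stratum Λ ℰ) (h : s ≤ s'), IsDownward s s' → QuasiIso (F.map (homOfLE h))
  sameStratum : ∀ (s s' : Stratum Λ ℰ) (h : s ≤ s'), s.k = s'.k → QuasiIso (F.map (homOfLE h))
  crossing : ∀ (O NW NE N : Stratum Λ ℰ) (h : IsCrossingSquare O NW NE N),
    (totalComplex F h.O_le_NW h.O_le_NE h.NW_le_N h.NE_le_N).Acyclic

/-! ### Chain homotopy diagrams -/

/-- The linear map between free modules induced by a relation on the generators: a generator is
sent to the generator related to it, and to `0` if there is none. -/
def relMap (K : Type*) [Field K] {α β : Type*} (R : α → β → Prop) : (α →₀ K) →ₗ[K] (β →₀ K) :=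
  Finsupp.linearCombination K fun a =>
    open Classical in if h : ∃ b, R a b then Finsupp.single h.choose 1 else 0

variable (K : Type uK) [Field K]
variable (Λ : LegendrianSurface L M) (μ : Λ.MaslovPotential) (ℰ : Triangulation V M)

/-- The vector space spanned by the sheets above a subset of `M`. -/
abbrev SheetModule (A : Set M) := Λ.sheets A →₀ K

/-- The grading by `|S| = -μ(S)`. -/
def sheetGrading (A : Set M) : ℤ → Submodule K (SheetModule K Λ A) :=
  freeGrading K fun S => -valueOn μ.toFun S.1

/-- A linear map of `V(A)` is strictly lower triangular if it maps every sheet to a combination of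
sheets that lie below it. -/
def StrictlyLower {A : Set M} (c : SheetModule K Λ A →ₗ[K] SheetModule K Λ A) : Prop :=
  ∀ S : Λ.sheets A, c (Finsupp.single S 1) ∈ Finsupp.supported K K {T | Λ.Above S.1 T.1}

/-- The inclusion `ι : V(e_I) → V(e_J)` for a face `e_I` of `e_J`. -/
def incl (I J : Finset V) :
    SheetModule K Λ (ℰ.cell I) →ₗ[K] SheetModule K Λ (ℰ.cell J) :=
  relMap K fun S T => S.1 ⊆ closure T.1

/-- The projection `p : V(e_J) → V(e_I)` for a face `e_I` of `e_J`, which vanishes on `V_cusp`. -/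
def proj (J I : Finset V) :
    SheetModule K Λ (ℰ.cell J) →ₗ[K] SheetModule K Λ (ℰ.cell I) :=
  relMap K fun T S => S.1 ⊆ closure T.1

/-- The projection of `V(e_J)` to the span `V_cusp` of those sheets above `e_J` that meet in pairs
at cusps above `e_I`, i.e. do not contain a sheet above `e_I` in their closure. -/
def cuspProj (I J : Finset V) :
    SheetModule K Λ (ℰ.cell J) →ₗ[K] SheetModule K Λ (ℰ.cell J) :=
  relMap K fun T T' => T = T' ∧ ¬ ∃ S ∈ Λ.sheets (ℰ.cell I), S ⊆ closure T.1

/-- The map `d₀`, which sends the upper sheet of two sheets above `e_J` that meet at a cusp above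
`e_I` to the lower one. -/
def cuspDiff (I J : Finset V) :
    SheetModule K Λ (ℰ.cell J) →ₗ[K] SheetModule K Λ (ℰ.cell J) :=
  relMap K fun S T => S ≠ T ∧ Λ.Above S.1 T.1 ∧
    (closure S.1 ∩ closure T.1 ∩ Λ.cusp ∩ Λ.base ⁻¹' ℰ.cell I).Nonempty

/-- The boundary extension `c_J(e_I)` of `c = c(e_I)` to `V(e_J)`. -/
def boundaryExtension (I J : Finset V)
    (c : SheetModule K Λ (ℰ.cell I) →ₗ[K] SheetModule K Λ (ℰ.cell I)) :
    SheetModule K Λ (ℰ.cell J) →ₗ[K] SheetModule K Λ (ℰ.cell J) :=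
  incl K Λ ℰ I J ∘ₗ c ∘ₗ proj K Λ ℰ J I +
    if I.card = 1 then cuspDiff K Λ ℰ I J ∘ₗ cuspProj K Λ ℰ I J
    else if I.card = 2 then cuspProj K Λ ℰ I J
    else 0

/-- A chain homotopy diagram for `(Λ, μ, ℰ)`. -/
structure ChainHomotopyDiagram where
  c : ∀ I : Finset V, SheetModule K Λ (ℰ.cell I) →ₗ[K] SheetModule K Λ (ℰ.cell I)
  degree : ∀ I ∈ ℰ.faces, ∀ n, ∀ w ∈ sheetGrading K Λ μ (ℰ.cell I) n,
    c I w ∈ sheetGrading K Λ μ (ℰ.cell I) (n + 1 - sdim I)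
  lower : ∀ I ∈ ℰ.faces, I.card ≠ 2 → StrictlyLower K Λ (c I)
  lower_edge : ∀ I ∈ ℰ.faces, I.card = 2 → StrictlyLower K Λ (c I - LinearMap.id)
  diagram : ∀ I ∈ ℰ.faces, IsSimplexDiagram I (sheetGrading K Λ μ (ℰ.cell I))
    fun F => boundaryExtension K Λ ℰ F I (c F)

/-! ### The combinatorial sheaf of a chain homotopy diagram -/

variable {Λ ℰ}

namespace Stratum

variable (s s' : Stratum Λ ℰ)

/-- The cell of the handle decomposition below a stratum. -/
def handle : Set M := ℰ.handleCell s.I s.J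

/-- The non-cusp sheets strictly below the stratum; they span `Y(s)`. -/
def below : Set (Set L) :=
  {T ∈ Λ.sheets s.handle | ∀ p ∈ T, ∀ z, (Λ.base p, z) ∈ s.carrier → Λ.height p < z}

/-- The stratum is exceptional for a cusp component: at every point below the stratum, it lies
strictly above the lower branch and weakly below the upper branch. -/
def IsExceptional (C : Set L) : Prop :=
  ∀ w ∈ s.carrier, ∃ p ∈ Λ.lower C, ∃ q ∈ Λ.upper C, Λ.base p = w.1 ∧ Λ.base q = w.1 ∧
    Λ.height p < w.2 ∧ w.2 ≤ Λ.height q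

/-- The cusp components for which the stratum is exceptional; they index the basis `v_C`
of `Z(s)`. -/
def exceptional : Set (Set L) := {C ∈ Λ.cuspComponents s.handle | s.IsExceptional C}

/-- The module `Y(s)`. -/
abbrev Y := s.below →₀ K

/-- The module `Z(s)`. -/
abbrev Z := s.exceptional →₀ K

/-- The preliminary module `X(s) = Y(s) ⊕ Z(s)`. -/
abbrev X := s.Y K × s.Z K

/-- The grading of `Y(s)`, with `|T| = -μ(T)`. -/
def gradingY : ℤ → Submodule K (s.Y K) := freeGrading K fun T => -valueOn μ.toFun T.1

/-- The grading of `Z(s)`, with `|v_C| = -μ(C_l)`. -/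
def gradingZ : ℤ → Submodule K (s.Z K) := freeGrading K fun C => -valueOn μ.toFun (Λ.lower C.1)

/-- The grading of `X(s)`. -/
def gradingX : ℤ → Submodule K (s.X K) := prodGrading (s.gradingY K μ) (s.gradingZ K μ)

/-- The component `p : Y(s) → Y(s')` of the preliminary generization map. -/
def mapP : s.Y K →ₗ[K] s'.Y K := relMap K fun T T' => T.1 ⊆ closure T'.1

/-- The component `k : Y(s) → Z(s')` of the preliminary generization map. -/
def mapK : s.Y K →ₗ[K] s'.Z K := relMap K fun T C => T.1 ⊆ closure (Λ.lower C.1)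

/-- The component `ℓ : Z(s) → Z(s')` of the preliminary generization map. -/
def mapL : s.Z K →ₗ[K] s'.Z K := relMap K fun C C' => C.1 ⊆ closure C'.1

/-- The preliminary generization map `X(s → s') = (p, k + ℓ)`. -/
def mapX : s.X K →ₗ[K] s'.X K :=
  (s.mapP K s' ∘ₗ LinearMap.fst K _ _).prod
    (s.mapK K s' ∘ₗ LinearMap.fst K _ _ + s.mapL K s' ∘ₗ LinearMap.snd K _ _)

/-- The inclusion of `Y(s)` into `V(e_J)`: a sheet above `h(e_I, e_J)` is identified with the sheet
above `e_J` that it meets. -/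
def inclY : s.Y K →ₗ[K] SheetModule K Λ (ℰ.cell s.J) :=
  relMap K fun T S => (T.1 ∩ S.1).Nonempty

/-- The projection of `V(e_J)` to `Y(s)` which is zero on the sheets that are not in `Y(s)`. -/
def projY : SheetModule K Λ (ℰ.cell s.J) →ₗ[K] s.Y K :=
  relMap K fun S T => (T.1 ∩ S.1).Nonempty

variable {K μ}

/-- The map `α_F = c_J(e_F)|_{Y(s)}`. -/
def faceY (𝒞 : ChainHomotopyDiagram K Λ μ ℰ) (F : Finset V) : s.Y K →ₗ[K] s.Y K :=
  s.projY K ∘ₗ boundaryExtension K Λ ℰ F s.J (𝒞.c F) ∘ₗ s.inclY K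

/-- The map `a_F = α_F ⊕ β_F` of `X(s)`, with `β_F` the identity if `F` is an edge and `0`
otherwise. -/
def faceX (𝒞 : ChainHomotopyDiagram K Λ μ ℰ) (F : Finset V) : s.X K →ₗ[K] s.X K :=
  LinearMap.prodMap (s.faceY 𝒞 F) (if F.card = 2 then LinearMap.id else 0)

end Stratum

variable {K μ}

/-- The construction of `G(𝒞)` makes sense and gives a functor from `P(𝒮)` to simplex diagrams:
the sheets above `h(e_I, e_J)` are identified with those above `e_J`, the maps `c_J(e_F)` restrict
to `Y(s)`, the projections map `Y(s)` to `Y(s')`, the maps `a_F` form simplex diagrams, and the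
maps `X(s → s')` are morphisms of simplex diagrams which respect identities and composition. -/
structure IsWellDefined (𝒞 : ChainHomotopyDiagram K Λ μ ℰ) : Prop where
  sheet_bijection : ∀ (s : Stratum Λ ℰ),
    (∀ T ∈ Λ.sheets s.handle, ∃! S, S ∈ Λ.sheets (ℰ.cell s.J) ∧ (T ∩ S).Nonempty) ∧
    ∀ S ∈ Λ.sheets (ℰ.cell s.J), ∃! T, T ∈ Λ.sheets s.handle ∧ (T ∩ S).Nonempty
  invariant : ∀ (s : Stratum Λ ℰ) (F : Finset V), F.Nonempty → F ⊆ s.I →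
    (LinearMap.range (s.inclY K)).map (boundaryExtension K Λ ℰ F s.J (𝒞.c F))
      ≤ LinearMap.range (s.inclY K)
  below_of_le : ∀ s s' : Stratum Λ ℰ, s ≤ s' → ∀ T ∈ s.below, ∀ T' ∈ Λ.sheets s'.handle,
    T ⊆ closure T' → T' ∈ s'.below
  diagram : ∀ s : Stratum Λ ℰ, IsSimplexDiagram s.I (s.gradingX K μ) (s.faceX 𝒞)
  face : ∀ s s' : Stratum Λ ℰ, s ≤ s' → s.I ⊆ s'.I
  degree : ∀ s s' : Stratum Λ ℰ, s ≤ s' → ∀ n, ∀ w ∈ s.gradingX K μ n,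
    s.mapX K s' w ∈ s'.gradingX K μ n
  comm : ∀ s s' : Stratum Λ ℰ, s ≤ s' → ∀ F : Finset V, F.Nonempty → F ⊆ s.I →
    s.mapX K s' ∘ₗ s.faceX 𝒞 F = s'.faceX 𝒞 F ∘ₗ s.mapX K s'
  map_id : ∀ s : Stratum Λ ℰ, s.mapX K s = LinearMap.id
  map_comp : ∀ s s' s'' : Stratum Λ ℰ, s ≤ s' → s' ≤ s'' →
    s.mapX K s'' = s'.mapX K s'' ∘ₗ s.mapX K s'

/-- The functor `G(𝒞)` from `P(𝒮)` to simplex diagrams. -/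
def functorG (𝒞 : ChainHomotopyDiagram K Λ μ ℰ) (h : IsWellDefined 𝒞) :
    Stratum Λ ℰ ⥤ SimplexDiagram.{uV, uK, max uK uL} K V where
  obj s :=
    { simplex := s.I
      nonempty := ℰ.complex.isRelLowerSet_faces.prop_of_mem s.I_mem
      carrier := s.X K
      gr := s.gradingX K μ
      internal := prodGrading_isInternal (freeGrading_isInternal K _) (freeGrading_isInternal K _)
      map := s.faceX 𝒞
      isDiagram := h.diagram s }
  map {s s'} f :=
    { face := h.face s s' (leOfHom f)
      lin := s.mapX K s'
      degree := h.degree s s' (leOfHom f)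
      comm := h.comm s s' (leOfHom f) }
  map_id s := SimplexDiagram.Hom.ext (h.map_id s)
  map_comp {s s' s''} f g := SimplexDiagram.Hom.ext (h.map_comp s s' s'' (leOfHom f) (leOfHom g))

/-- The combinatorial sheaf `F(𝒞) = Map ∘ G(𝒞)`. -/
def functorF (𝒞 : ChainHomotopyDiagram K Λ μ ℰ) (h : IsWellDefined 𝒞) :
    Stratum Λ ℰ ⥤ CochainComplex (ModuleCat.{max uV uK uL} K) ℤ :=
  functorG 𝒞 h ⋙ SimplexDiagram.Map

end Setting

end

end LegendrianSheaf

open LegendrianSheaf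

namespace LegendrianSheaf

open Set Filter

/-- Two local diffeomorphisms of the plane with the same differential which agree on the line
`u = 0` differ by a local homeomorphism preserving the two sides of this line. -/
theorem exists_side_preserving_transition {E : Type*} [NormedAddCommGroup E] [NormedSpace ℝ E]
    {Bp Bm : ℝ × ℝ → E} {A : (ℝ × ℝ) ≃L[ℝ] E} {v₀ : ℝ}
    (hp : HasStrictFDerivAt Bp (A : (ℝ × ℝ) →L[ℝ] E) (0, v₀))
    (hm : HasStrictFDerivAt Bm (A : (ℝ × ℝ) →L[ℝ] E) (0, v₀))
    (h0 : ∀ v, Bp (0, v) = Bm (0, v)) {W : Set (ℝ × ℝ)} (hW : W ∈ 𝓝 (0, v₀)) :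
    ∃ (D : Set (ℝ × ℝ)) (θ : ℝ × ℝ → ℝ × ℝ), D ∈ 𝓝 (0, v₀) ∧ θ '' D ∈ 𝓝 (0, v₀) ∧
      D ⊆ W ∧ θ '' D ⊆ W ∧ Convex ℝ D ∧ ContinuousOn θ D ∧ InjOn Bp D ∧ InjOn Bm (θ '' D) ∧
      (∀ a ∈ D, Bm (θ a) = Bp a) ∧ (∀ a ∈ D, a.1 = 0 → θ a = a) ∧
      (∀ a ∈ D, 0 < a.1 → 0 < (θ a).1) ∧ (∀ a ∈ D, a.1 < 0 → (θ a).1 < 0) := by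
  set a₀ : ℝ × ℝ := (0, v₀) with ha₀
  let B1 := hp.toOpenPartialHomeomorph Bp
  let B2 := hm.toOpenPartialHomeomorph Bm
  have h1s : a₀ ∈ B1.source := hp.mem_toOpenPartialHomeomorph_source
  have h2s : a₀ ∈ B2.source := hm.mem_toOpenPartialHomeomorph_source
  have e1 : ∀ a, B1 a = Bp a := fun a => rfl
  have e2 : ∀ a, B2 a = Bm a := fun a => rfl
  have e0 : Bp a₀ = Bm a₀ := h0 v₀
  let θ : ℝ × ℝ → ℝ × ℝ := fun a => B2.symm (Bp a)
  have hinv : HasStrictFDerivAt B2.symm (A.symm : E →L[ℝ] ℝ × ℝ) (Bm a₀) :=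
    hm.to_localInverse
  have hθ' : HasStrictFDerivAt θ ((A.symm : E →L[ℝ] ℝ × ℝ).comp (A : (ℝ × ℝ) →L[ℝ] E)) a₀ := by
    refine HasStrictFDerivAt.comp a₀ ?_ hp
    rw [e0]; exact hinv
  have hθ : HasStrictFDerivAt θ ((ContinuousLinearEquiv.refl ℝ (ℝ × ℝ) :
      (ℝ × ℝ) ≃L[ℝ] (ℝ × ℝ)) : (ℝ × ℝ) →L[ℝ] (ℝ × ℝ)) a₀ := by
    convert hθ' using 1
    ext <;> simp
  have hθ0 : θ a₀ = a₀ := by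
    show B2.symm (Bp a₀) = a₀
    rw [e0, ← e2]; exact B2.left_inv h2s
  have hθc : ContinuousAt θ a₀ := hθ.continuousAt
  have hN : B1.source ∩ B2.source ∩ W ∈ 𝓝 a₀ :=
    inter_mem (inter_mem (B1.open_source.mem_nhds h1s) (B2.open_source.mem_nhds h2s)) hW
  have hN' : θ ⁻¹' (B1.source ∩ B2.source ∩ W) ∈ 𝓝 a₀ := hθc (by rw [hθ0]; exact hN)
  have hT : Bp ⁻¹' B2.target ∈ 𝓝 a₀ := by
    refine hp.continuousAt (B2.open_target.mem_nhds ?_)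
    rw [e0, ← e2]; exact B2.map_source h2s
  obtain ⟨r, hr, hD⟩ := Metric.mem_nhds_iff.mp (inter_mem (inter_mem hN hN') hT)
  set D := Metric.ball a₀ r with hDdef
  have hDc : Convex ℝ D := convex_ball _ _
  have cθ : ContinuousOn θ D := by
    refine B2.continuousOn_symm.comp (B1.continuousOn.mono fun a ha => (hD ha).1.1.1.1) ?_
    exact fun a ha => (hD ha).2
  have key : ∀ a ∈ D, Bm (θ a) = Bp a := fun a ha => B2.right_inv (hD ha).2
  have fix : ∀ a ∈ D, a.1 = 0 → θ a = a := by
    rintro ⟨u, v⟩ ha (rfl : u = 0)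
    show B2.symm (Bp (0, v)) = (0, v)
    rw [h0, ← e2]; exact B2.left_inv (hD ha).1.1.1.2
  have ne : ∀ a ∈ D, a.1 ≠ 0 → (θ a).1 ≠ 0 := by
    intro a ha hne h
    have h3 : Bp (θ a) = Bp a := by
      rw [← key a ha]
      have : θ a = (0, (θ a).2) := Prod.ext h rfl
      rw [this, h0]
    have := B1.injOn (hD ha).1.2.1.1 (hD ha).1.1.1.1 h3
    rw [this] at h
    exact hne h
  have hlim : Tendsto (fun u : ℝ => u⁻¹ * (θ (u, v₀)).1) (𝓝[≠] 0) (𝓝 1) := by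
    have hc : HasDerivAt (fun u : ℝ => ((u, v₀) : ℝ × ℝ)) (1, 0) 0 :=
      (hasDerivAt_id 0).prodMk (hasDerivAt_const 0 v₀)
    have hd : HasDerivAt (fun u : ℝ => θ (u, v₀)) (1, 0) 0 := by
      have := hθ.hasFDerivAt.comp_hasDerivAt (0 : ℝ) hc
      simpa [Function.comp_def] using this
    have hd1 : HasDerivAt (fun u : ℝ => (θ (u, v₀)).1) 1 0 := hd.fst
    have := hd1.tendsto_slope_zero
    simpa [hθ0, ha₀, show θ (0, v₀) = (0, v₀) from hθ0] using this
  have hev : ∀ᶠ u : ℝ in 𝓝[≠] 0, 0 < u⁻¹ * (θ (u, v₀)).1 := hlim (Ioi_mem_nhds one_pos)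
  have hcv : ContinuousAt (fun u : ℝ => ((u, v₀) : ℝ × ℝ)) 0 := by fun_prop
  have hDn : D ∈ 𝓝 a₀ := Metric.ball_mem_nhds _ hr
  have hev2 : ∀ᶠ u : ℝ in 𝓝 (0 : ℝ), (u, v₀) ∈ D := hcv hDn
  have c1 : ContinuousOn (fun a => (θ a).1) D := continuous_fst.comp_continuousOn cθ
  refine ⟨D, θ, hDn, ?_, fun a ha => (hD ha).1.1.2, ?_, hDc, cθ, ?_, ?_, key, fix, ?_, ?_⟩
  · have := hθ.map_nhds_eq_of_equiv
    rw [hθ0] at this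
    rw [← this]
    exact image_mem_map hDn
  · rintro _ ⟨a, ha, rfl⟩
    exact (hD ha).1.2.2
  · exact fun a ha b hb h => B1.injOn (hD ha).1.1.1.1 (hD hb).1.1.1.1 h
  · rintro _ ⟨a, ha, rfl⟩ _ ⟨b, hb, rfl⟩ h
    exact B2.injOn (hD ha).1.2.1.2 (hD hb).1.2.1.2 h
  · intro a ha hpos
    by_contra hneg
    obtain ⟨u, hu, hu1⟩ := ((hev.filter_mono (nhdsWithin_mono 0 (fun x (hx : x ∈ Ioi (0 : ℝ)) => ne_of_gt hx))
      |>.and (hev2.filter_mono nhdsWithin_le_nhds)).and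
      (self_mem_nhdsWithin : ∀ᶠ u in 𝓝[>] (0 : ℝ), u ∈ Ioi (0 : ℝ))).exists
    · have hconv : Convex ℝ (D ∩ {a | 0 < a.1}) :=
        hDc.inter (convex_halfSpace_gt (f := Prod.fst) ⟨fun _ _ => rfl, fun _ _ => rfl⟩ 0)
      have := hconv.isPreconnected.intermediate_value (a := a) (b := (u, v₀)) ⟨ha, hpos⟩
        ⟨hu.2, hu1⟩ (c1.mono inter_subset_left)
      obtain ⟨d, hd, hd0⟩ := this (show (0 : ℝ) ∈ Icc _ _ from
        ⟨not_lt.mp hneg, (pos_of_mul_pos_right hu.1 (inv_nonneg.mpr (le_of_lt hu1))).le⟩)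
      exact ne d hd.1 hd.2.ne' hd0
  · intro a ha hpos
    by_contra hneg
    obtain ⟨u, hu, hu1⟩ := ((hev.filter_mono (nhdsWithin_mono 0 (fun x (hx : x ∈ Iio (0 : ℝ)) => ne_of_lt hx))
      |>.and (hev2.filter_mono nhdsWithin_le_nhds)).and
      (self_mem_nhdsWithin : ∀ᶠ u in 𝓝[<] (0 : ℝ), u ∈ Iio (0 : ℝ))).exists
    have hconv : Convex ℝ (D ∩ {a | a.1 < 0}) :=
        hDc.inter (convex_halfSpace_lt (f := Prod.fst) ⟨fun _ _ => rfl, fun _ _ => rfl⟩ 0)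
    have := hconv.isPreconnected.intermediate_value (a := (u, v₀)) (b := a) ⟨hu.2, hu1⟩
        ⟨ha, hpos⟩ (c1.mono inter_subset_left)
    have hneg' : (θ (u, v₀)).1 ≤ 0 := by
      have h1 := hu.1
      have h2 : u < 0 := hu1
      by_contra h3
      push Not at h3
      have := mul_neg_of_neg_of_pos (inv_lt_zero.mpr h2) h3
      linarith
    obtain ⟨d, hd, hd0⟩ := this (show (0 : ℝ) ∈ Icc _ _ from ⟨hneg', not_lt.mp hneg⟩)
    exact ne d hd.1 hd.2.ne hd0

theorem hasStrictDerivAt_rpow_three_halves :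
    HasStrictDerivAt (fun u : ℝ => u ^ (3 / 2 : ℝ)) 0 0 := by
  have h : ContDiff ℝ 1 (fun u : ℝ => u ^ (3 / 2 : ℝ)) :=
    Real.contDiff_rpow_const_of_le (by norm_num)
  have h2 := (h.contDiffAt (x := 0)).hasStrictDerivAt (by norm_num)
  have h3 : (0 : ℝ) ^ ((3 : ℝ) / 2 - 1) = 0 := Real.zero_rpow (by norm_num)
  simpa [Real.deriv_rpow_const, h3] using h2

end LegendrianSheaf

namespace LegendrianSheaf

open Set Filter

namespace LegendrianSurface

section Calculus

variable {L M : Type*} [TopologicalSpace L] [ChartedSpace Plane L]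
  [TopologicalSpace M] [ChartedSpace Plane M] [IsManifold (𝓡 2) ∞ M] (Λ : LegendrianSurface L M)

theorem contMDiff_base : ContMDiff (𝓡 2) (𝓡 2) ∞ Λ.base := by
  have h := Λ.embedding.contMDiff
  exact (contMDiff_proj _).comp (contMDiff_fst.comp h)

theorem contMDiff_height : ContMDiff (𝓡 2) 𝓘(ℝ, ℝ) ∞ Λ.height :=
  contMDiff_snd.comp Λ.embedding.contMDiff

theorem contMDiff_front : ContMDiff (𝓡 2) zeroJetModel ∞ Λ.front :=
  Λ.contMDiff_base.prodMk Λ.contMDiff_height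

/-- The covector `y` of a point of the Legendrian surface, in the coordinates on `T*M` induced by
the preferred chart at `x₀`. -/
noncomputable def slope (x₀ : M) (q : L) : Plane →L[ℝ] ℝ :=
  (trivializationAt (Plane →L[ℝ] ℝ)
    (fun x : M => TangentSpace (𝓡 2) x →L[ℝ] Bundle.Trivial M ℝ x) x₀ (Λ.toJet q).1).2

theorem continuousAt_slope {x₀ : M} {q : L} (h : Λ.base q ∈ (chartAt Plane x₀).source) :
    ContinuousAt (Λ.slope x₀) q := by
  have h1 : ContinuousAt (fun q => (Λ.toJet q).1) q :=
    (continuous_fst.comp Λ.embedding.contMDiff.continuous).continuousAt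
  refine continuousAt_snd.comp (ContinuousAt.comp (f := fun q => (Λ.toJet q).1) ?_ h1)
  refine (trivializationAt (Plane →L[ℝ] ℝ)
    (fun x : M => TangentSpace (𝓡 2) x →L[ℝ] Bundle.Trivial M ℝ x) x₀).continuousAt ?_
  rw [Trivialization.mem_source]
  exact ⟨h, trivial⟩

theorem eq_of_slope_eq {x₀ : M} {p q : L} (h : Λ.base p ∈ (chartAt Plane x₀).source)
    (hf : Λ.front p = Λ.front q) (hs : Λ.slope x₀ p = Λ.slope x₀ q) : p = q := by
  apply Λ.embedding.isEmbedding.injective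
  have hb : Λ.base p = Λ.base q := congrArg Prod.fst hf
  have hh : Λ.height p = Λ.height q := congrArg (Prod.snd : M × ℝ → ℝ) hf
  refine Prod.ext ?_ hh
  set e := trivializationAt (Plane →L[ℝ] ℝ)
    (fun x : M => TangentSpace (𝓡 2) x →L[ℝ] Bundle.Trivial M ℝ x) x₀
  have h1 : (Λ.toJet p).1 ∈ e.source := by
    rw [Trivialization.mem_source]; exact ⟨h, trivial⟩
  have h2 : (Λ.toJet q).1 ∈ e.source := by
    rw [Trivialization.mem_source]; exact ⟨show Λ.base q ∈ _ from hb ▸ h, trivial⟩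
  refine e.injOn h1 h2 (Prod.ext ?_ hs)
  exact (e.coe_fst h1).trans (hb.trans (e.coe_fst h2).symm)

/-- The base projection in coordinates. -/
noncomputable def baseIn (φ : OpenPartialHomeomorph L Plane) (x₀ : M) (t : Plane) : Plane :=
  chartAt Plane x₀ (Λ.base (φ.symm t))

/-- The height function in coordinates. -/
noncomputable def heightIn (φ : OpenPartialHomeomorph L Plane) (t : Plane) : ℝ :=
  Λ.height (φ.symm t)

variable {φ : OpenPartialHomeomorph L Plane} (hφ : φ ∈ IsManifold.maximalAtlas (𝓡 2) ∞ L)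
  {t : Plane} (ht : t ∈ φ.target)
include hφ ht

theorem contMDiffAt_symm_of_mem : ContMDiffAt (𝓡 2) (𝓡 2) ∞ φ.symm t :=
  (contMDiffOn_symm_of_mem_maximalAtlas hφ).contMDiffAt (φ.open_target.mem_nhds ht)

theorem mfderiv_symm_bijective_of_mem : Function.Bijective (mfderiv (𝓡 2) (𝓡 2) φ.symm t) := by
  have h : φ.MDifferentiable (𝓡 2) (𝓡 2) :=
    ⟨(contMDiffOn_of_mem_maximalAtlas hφ).mdifferentiableOn (by simp),
      (contMDiffOn_symm_of_mem_maximalAtlas hφ).mdifferentiableOn (by simp)⟩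
  exact h.symm.mfderiv_bijective ht

theorem contDiffAt_heightIn : ContDiffAt ℝ ∞ (Λ.heightIn φ) t := by
  rw [← contMDiffAt_iff_contDiffAt]
  exact (Λ.contMDiff_height _).comp t (contMDiffAt_symm_of_mem hφ ht)

theorem contDiffAt_baseIn {x₀ : M} (hx : Λ.base (φ.symm t) ∈ (chartAt Plane x₀).source) :
    ContDiffAt ℝ ∞ (Λ.baseIn φ x₀) t := by
  rw [← contMDiffAt_iff_contDiffAt]
  have h1 : ContMDiffAt (𝓡 2) (𝓡 2) ∞ (chartAt Plane x₀) (Λ.base (φ.symm t)) :=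
    (contMDiffOn_chart (I := 𝓡 2) (n := ∞)).contMDiffAt
      ((chartAt Plane x₀).open_source.mem_nhds hx)
  exact h1.comp t ((Λ.contMDiff_base _).comp t (contMDiffAt_symm_of_mem hφ ht))

theorem fderiv_heightIn_apply (v : Plane) : fderiv ℝ (Λ.heightIn φ) t v =
    mfderiv (𝓡 2) 𝓘(ℝ, ℝ) Λ.height (φ.symm t) (mfderiv (𝓡 2) (𝓡 2) φ.symm t v) := by
  have h1 := (contMDiffAt_symm_of_mem hφ ht).mdifferentiableAt (by simp)
  have h2 := (Λ.contMDiff_height (φ.symm t)).mdifferentiableAt (by simp)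
  have := mfderiv_comp t h2 h1
  rw [← mfderiv_eq_fderiv]
  exact congrArg (fun f => f v) this

theorem fderiv_baseIn_apply {x₀ : M} (hx : Λ.base (φ.symm t) ∈ (chartAt Plane x₀).source)
    (v : Plane) : fderiv ℝ (Λ.baseIn φ x₀) t v =
    mfderiv (𝓡 2) (𝓡 2) (chartAt Plane x₀) (Λ.base (φ.symm t))
      (mfderiv (𝓡 2) (𝓡 2) Λ.base (φ.symm t) (mfderiv (𝓡 2) (𝓡 2) φ.symm t v)) := by
  have h0 : MDifferentiableAt (𝓡 2) (𝓡 2) (chartAt Plane x₀) (Λ.base (φ.symm t)) :=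
    mdifferentiableAt_atlas (chart_mem_atlas _ _) hx
  have h1 := (contMDiffAt_symm_of_mem hφ ht).mdifferentiableAt (by simp)
  have h2 := (Λ.contMDiff_base (φ.symm t)).mdifferentiableAt (by simp)
  have h3 := mfderiv_comp t h2 h1
  have := mfderiv_comp t (h0 : MDifferentiableAt (𝓡 2) (𝓡 2) (chartAt Plane x₀)
    ((Λ.base ∘ φ.symm) t)) (h2.comp t h1)
  rw [← mfderiv_eq_fderiv]
  refine (congrArg (fun f => f v) this).trans ?_
  exact congrArg (fun f => mfderiv (𝓡 2) (𝓡 2) (chartAt Plane x₀) (Λ.base (φ.symm t)) (f v)) h3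

/-- The Legendrian condition `dz = y dx` in coordinates. -/
theorem fderiv_heightIn {x₀ : M} (hx : Λ.base (φ.symm t) ∈ (chartAt Plane x₀).source) :
    fderiv ℝ (Λ.heightIn φ) t
      = (Λ.slope x₀ (φ.symm t)).comp (fderiv ℝ (Λ.baseIn φ x₀) t) := by
  ext1 v
  rw [ContinuousLinearMap.comp_apply, Λ.fderiv_heightIn_apply hφ ht,
    Λ.fderiv_baseIn_apply hφ ht hx]
  refine (Λ.legendrian (φ.symm t) _).trans ?_
  generalize mfderiv (𝓡 2) (𝓡 2) φ.symm t v = w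
  generalize φ.symm t = q at hx w
  have e2 : (trivializationAt Plane (TangentSpace (𝓡 2)) x₀).continuousLinearMapAt ℝ (Λ.base q)
      = mfderiv (𝓡 2) (𝓡 2) (chartAt Plane x₀) (Λ.base q) :=
    TangentBundle.continuousLinearMapAt_trivializationAt hx
  have e3 := (trivializationAt Plane (TangentSpace (𝓡 2)) x₀).symmL_continuousLinearMapAt
    (R := ℝ) (b := Λ.base q) hx (mfderiv (𝓡 2) (𝓡 2) Λ.base q w)
  rw [e2] at e3
  have e4 : ∀ r : ℝ, (trivializationAt ℝ (Bundle.Trivial M ℝ) x₀).continuousLinearMapAt ℝ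
      (Λ.base q) r = r := fun r => congrArg (fun f => f r)
        (Bundle.Trivial.continuousLinearMapAt_trivialization ℝ M ℝ (Λ.base q))
  refine Eq.trans ?_ (e4 ((Λ.toJet q).1.2 _)).symm
  exact (congrArg (Λ.toJet q).1.2 e3).symm

theorem injective_fderiv_baseIn (hc : φ.symm t ∉ Λ.cusp) {x₀ : M}
    (hx : Λ.base (φ.symm t) ∈ (chartAt Plane x₀).source) :
    Function.Injective (fderiv ℝ (Λ.baseIn φ x₀) t) := by
  rw [injective_iff_map_eq_zero]
  intro v hv
  have hh : fderiv ℝ (Λ.heightIn φ) t v = 0 := by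
    rw [Λ.fderiv_heightIn hφ ht hx, ContinuousLinearMap.comp_apply, hv, map_zero]
  rw [Λ.fderiv_heightIn_apply hφ ht] at hh
  rw [Λ.fderiv_baseIn_apply hφ ht hx] at hv
  have hb := (mdifferentiable_chart (I := 𝓡 2) x₀).mfderiv_injective hx
    (hv.trans (map_zero _).symm)
  have hinj := not_not.mp hc
  have h1 : Λ.frontDiff (φ.symm t) (mfderiv (𝓡 2) (𝓡 2) φ.symm t v) = 0 := by
    have h2 := (Λ.contMDiff_base (φ.symm t)).mdifferentiableAt (by simp)
    have h3 := (Λ.contMDiff_height (φ.symm t)).mdifferentiableAt (by simp)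
    have := mfderiv_prodMk h2 h3
    have h4 : Λ.frontDiff (φ.symm t) (mfderiv (𝓡 2) (𝓡 2) φ.symm t v) =
      (mfderiv (𝓡 2) (𝓡 2) Λ.base (φ.symm t) (mfderiv (𝓡 2) (𝓡 2) φ.symm t v),
        mfderiv (𝓡 2) 𝓘(ℝ, ℝ) Λ.height (φ.symm t) (mfderiv (𝓡 2) (𝓡 2) φ.symm t v)) :=
      congrArg (fun f => f (mfderiv (𝓡 2) (𝓡 2) φ.symm t v)) this
    rw [h4]
    exact Prod.ext hb hh
  have h5 := hinj (h1.trans (map_zero _).symm)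
  exact (mfderiv_symm_bijective_of_mem hφ ht).1 (h5.trans (map_zero _).symm)

end Calculus
end LegendrianSurface
end LegendrianSheaf

namespace LegendrianSheaf

open Set Filter

/-- An invertible endomorphism of a finite-dimensional space as a continuous equivalence. -/
theorem exists_continuousLinearEquiv_of_injective {E F : Type*} [NormedAddCommGroup E]
    [NormedSpace ℝ E] [NormedAddCommGroup F] [NormedSpace ℝ F] [FiniteDimensional ℝ E]
    [FiniteDimensional ℝ F] (h : Module.finrank ℝ E = Module.finrank ℝ F) (f : E →L[ℝ] F)
    (hf : Function.Injective f) : ∃ A : E ≃L[ℝ] F, (A : E →L[ℝ] F) = f :=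
  ⟨(LinearEquiv.ofInjectiveOfFinrankEq (f : E →ₗ[ℝ] F) hf h).toContinuousLinearEquiv, by
    ext x; rfl⟩

/-- The zero set of a function whose derivative does not vanish is a curve, and the function
takes both signs. -/
theorem exists_arc_of_hasStrictFDerivAt {E : Type*} [NormedAddCommGroup E] [NormedSpace ℝ E]
    [FiniteDimensional ℝ E] (hE : Module.finrank ℝ E = 2) {f : E → ℝ} {f' : E →L[ℝ] ℝ} {u₀ : E}
    (hf : HasStrictFDerivAt f f' u₀) (hne : f' ≠ 0) (h0 : f u₀ = 0) :
    (∃ ε > 0, ∃ γ : ℝ → E, ContinuousOn γ (Ioo (-ε) ε) ∧ InjOn γ (Ioo (-ε) ε) ∧ γ 0 = u₀ ∧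
      ∀ t ∈ Ioo (-ε) ε, f (γ t) = 0) ∧ (∃ᶠ u in 𝓝 u₀, 0 < f u) ∧ ∃ᶠ u in 𝓝 u₀, f u < 0 := by
  have hsurj : f'.range = ⊤ := by
    refine LinearMap.range_eq_top.mpr (LinearMap.surjective ?_)
    intro h; exact hne (ContinuousLinearMap.coe_injective h)
  let Θ := hf.implicitToOpenPartialHomeomorph f f' hsurj
  have hs : u₀ ∈ Θ.source := hf.mem_implicitToOpenPartialHomeomorph_source hsurj
  have hfst : ∀ u, (Θ u).1 = f u := fun u => hf.implicitToOpenPartialHomeomorph_fst hsurj u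
  have h00 : Θ u₀ = (0, 0) := by
    have := hf.implicitToOpenPartialHomeomorph_self hsurj
    rw [h0] at this; exact this
  have hker : ∃ k : f'.ker, k ≠ 0 := by
    have h1 := f'.toLinearMap.finrank_range_add_finrank_ker
    have h2 : Module.finrank ℝ f'.toLinearMap.range ≤ 1 := by
      simpa using Submodule.finrank_le f'.toLinearMap.range
    have h3 : 0 < Module.finrank ℝ f'.ker := by
      have : Module.finrank ℝ f'.ker = Module.finrank ℝ f'.toLinearMap.ker := rfl
      omega
    have := Module.finrank_pos_iff.mp h3
    exact exists_ne 0
  obtain ⟨k, hk⟩ := hker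
  have ht0 : (0, 0) ∈ Θ.target := h00 ▸ Θ.map_source hs
  have hsymm0 : Θ.symm (0, 0) = u₀ := by rw [← h00]; exact Θ.left_inv hs
  have hT : Θ.target ∈ 𝓝 ((0 : ℝ), (0 : f'.ker)) := Θ.open_target.mem_nhds ht0
  have hval : ∀ w ∈ Θ.target, f (Θ.symm w) = w.1 := fun w hw => by
    rw [← hfst, Θ.right_inv hw]
  have hcs : ContinuousAt Θ.symm ((0 : ℝ), (0 : f'.ker)) :=
    Θ.continuousOn_symm.continuousAt hT
  rw [ContinuousAt, hsymm0] at hcs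
  have hc1 : Tendsto (fun s : ℝ => (s, (0 : f'.ker))) (𝓝 0) (𝓝 (0, 0)) :=
    Continuous.tendsto' (by fun_prop) _ _ rfl
  refine ⟨?_, ?_, ?_⟩
  · have hcont : Continuous (fun t : ℝ => ((0 : ℝ), t • k)) := by fun_prop
    have hmem : (fun t : ℝ => ((0 : ℝ), t • k)) ⁻¹' Θ.target ∈ 𝓝 (0 : ℝ) :=
      hcont.continuousAt.preimage_mem_nhds (by simpa using hT)
    obtain ⟨ε, hε, hsub⟩ := Metric.mem_nhds_iff.mp hmem
    rw [Real.ball_eq_Ioo, zero_sub, zero_add] at hsub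
    refine ⟨ε, hε, fun t => Θ.symm (0, t • k), ?_, ?_, ?_, ?_⟩
    · exact Θ.continuousOn_symm.comp hcont.continuousOn hsub
    · intro a ha b hb hab
      have := Θ.symm.injOn (hsub ha) (hsub hb) hab
      have h2 : a • k = b • k := congrArg Prod.snd this
      exact smul_left_injective ℝ hk h2
    · simp [hsymm0]
    · intro t ht
      exact hval _ (hsub ht)
  · have h1 : ∃ᶠ s : ℝ in 𝓝 0, 0 < s :=
      (Eventually.frequently (f := 𝓝[>] (0 : ℝ)) self_mem_nhdsWithin).filter_mono
        nhdsWithin_le_nhds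
    refine (hcs.comp hc1).frequently ?_
    refine (h1.and_eventually (hc1 hT)).mono fun s hs => ?_
    simpa [hval _ hs.2] using hs.1
  · have h1 : ∃ᶠ s : ℝ in 𝓝 0, s < 0 :=
      (Eventually.frequently (f := 𝓝[<] (0 : ℝ)) self_mem_nhdsWithin).filter_mono
        nhdsWithin_le_nhds
    refine (hcs.comp hc1).frequently ?_
    refine (h1.and_eventually (hc1 hT)).mono fun s hs => ?_
    simpa [hval _ hs.2] using hs.1

namespace LegendrianSurface

variable {L M : Type*} [TopologicalSpace L] [ChartedSpace Plane L] [IsManifold (𝓡 2) ∞ L]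
  [TopologicalSpace M] [ChartedSpace Plane M] [IsManifold (𝓡 2) ∞ M] (Λ : LegendrianSurface L M)

theorem exists_localHomeomorph_hasStrictFDerivAt {p : L} (hp : p ∉ Λ.cusp) :
    ∃ Φ : OpenPartialHomeomorph L M, p ∈ Φ.source ∧ EqOn Φ Λ.base Φ.source ∧
      HasStrictFDerivAt
        (fun u => Λ.height (Φ.symm ((chartAt Plane (Λ.base p)).symm u)))
        (Λ.slope (Λ.base p) p) (chartAt Plane (Λ.base p) (Λ.base p)) := by
  set x₀ := Λ.base p
  set φ := chartAt Plane p
  set e := chartAt Plane x₀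
  have hφ : φ ∈ IsManifold.maximalAtlas (𝓡 2) ∞ L := IsManifold.chart_mem_maximalAtlas p
  have hps : p ∈ φ.source := mem_chart_source _ p
  have ht : φ p ∈ φ.target := φ.map_source hps
  have hpt : φ.symm (φ p) = p := φ.left_inv hps
  have hx0 : x₀ ∈ e.source := mem_chart_source _ x₀
  have hx : Λ.base (φ.symm (φ p)) ∈ e.source := by rw [hpt]; exact hx0
  have hbt : Λ.baseIn φ x₀ (φ p) = e x₀ := by simp only [baseIn, hpt]; rfl
  obtain ⟨A, hA⟩ := exists_continuousLinearEquiv_of_injective rfl _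
    (Λ.injective_fderiv_baseIn hφ ht (by rwa [hpt]) hx)
  have hb : HasStrictFDerivAt (Λ.baseIn φ x₀) (A : Plane →L[ℝ] Plane) (φ p) := by
    rw [hA]; exact (Λ.contDiffAt_baseIn hφ ht hx).hasStrictFDerivAt (by simp)
  let Bh := hb.toOpenPartialHomeomorph (Λ.baseIn φ x₀)
  have hBs : φ p ∈ Bh.source := hb.mem_toOpenPartialHomeomorph_source
  have hO : IsOpen (Λ.base ⁻¹' e.source) := e.open_source.preimage Λ.contMDiff_base.continuous
  let Φ := (φ.trans (Bh.trans e.symm)).restrOpen _ hO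
  have hΦ : EqOn Φ Λ.base Φ.source := by
    intro q hq
    have hq2 : q ∈ φ.source ∧ Λ.base q ∈ e.source := ⟨hq.1.1, hq.2⟩
    show e.symm (Λ.baseIn φ x₀ (φ q)) = Λ.base q
    rw [baseIn, φ.left_inv hq2.1]
    exact e.left_inv hq2.2
  refine ⟨Φ, ?_, hΦ, ?_⟩
  · refine ⟨⟨hps, hBs, ?_⟩, hx0⟩
    show Λ.baseIn φ x₀ (φ p) ∈ e.symm.source
    rw [hbt]; exact e.map_source hx0
  · have hh : HasStrictFDerivAt (Λ.heightIn φ) (fderiv ℝ (Λ.heightIn φ) (φ p)) (φ p) :=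
      (Λ.contDiffAt_heightIn hφ ht).hasStrictFDerivAt (by simp)
    have hinv : HasStrictFDerivAt Bh.symm (A.symm : Plane →L[ℝ] Plane)
        (Λ.baseIn φ x₀ (φ p)) := hb.to_localInverse
    have hBp : Bh.symm (Λ.baseIn φ x₀ (φ p)) = φ p := Bh.left_inv hBs
    have hcomp : HasStrictFDerivAt (fun u => Λ.heightIn φ (Bh.symm u))
        ((fderiv ℝ (Λ.heightIn φ) (φ p)).comp (A.symm : Plane →L[ℝ] Plane))
        (Λ.baseIn φ x₀ (φ p)) := by
      refine HasStrictFDerivAt.comp _ ?_ hinv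
      rw [hBp]; exact hh
    have hd : (fderiv ℝ (Λ.heightIn φ) (φ p)).comp (A.symm : Plane →L[ℝ] Plane)
        = Λ.slope x₀ p := by
      rw [Λ.fderiv_heightIn hφ ht hx, ← hA, hpt]
      ext v; simp
    rw [hd, hbt] at hcomp
    refine hcomp.congr_of_eventuallyEq ?_
    filter_upwards [e.open_target.mem_nhds (e.map_source hx0)] with u hu
    show Λ.height (φ.symm (Bh.symm u)) = Λ.height (φ.symm (Bh.symm (e (e.symm u))))
    rw [e.right_inv hu]

theorem exists_localHomeomorph {p : L} (hp : p ∉ Λ.cusp) :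
    ∃ Φ : OpenPartialHomeomorph L M, p ∈ Φ.source ∧ EqOn Φ Λ.base Φ.source :=
  let ⟨Φ, h, h', _⟩ := Λ.exists_localHomeomorph_hasStrictFDerivAt hp
  ⟨Φ, h, h'⟩

/-- Two smooth sheets of the front that meet at a point cross along a curve. -/
theorem exists_crossing_arc {p q : L} (hp : p ∉ Λ.cusp) (hq : q ∉ Λ.cusp) (hne : p ≠ q)
    (hf : Λ.front p = Λ.front q) :
    ∃ Φ Ψ : OpenPartialHomeomorph L M, p ∈ Φ.source ∧ EqOn Φ Λ.base Φ.source ∧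
      q ∈ Ψ.source ∧ EqOn Ψ Λ.base Ψ.source ∧
      (∃ ε > 0, ∃ γ : ℝ → M, ContinuousOn γ (Ioo (-ε) ε) ∧ InjOn γ (Ioo (-ε) ε) ∧
        γ 0 = Λ.base p ∧
        ∀ t ∈ Ioo (-ε) ε, Λ.height (Φ.symm (γ t)) = Λ.height (Ψ.symm (γ t))) ∧
      (∃ᶠ x in 𝓝 (Λ.base p), Λ.height (Ψ.symm x) < Λ.height (Φ.symm x)) ∧
      ∃ᶠ x in 𝓝 (Λ.base p), Λ.height (Φ.symm x) < Λ.height (Ψ.symm x) := by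
  obtain ⟨Φ, hΦ, hΦb, hΦd⟩ := Λ.exists_localHomeomorph_hasStrictFDerivAt hp
  obtain ⟨Ψ, hΨ, hΨb, hΨd⟩ := Λ.exists_localHomeomorph_hasStrictFDerivAt hq
  have hb : Λ.base q = Λ.base p := congrArg (Prod.fst : M × ℝ → M) hf.symm
  have hh : Λ.height p = Λ.height q := congrArg (Prod.snd : M × ℝ → ℝ) hf
  rw [hb] at hΨd
  set x₀ := Λ.base p
  set e := chartAt Plane x₀
  have hx0 : x₀ ∈ e.source := mem_chart_source _ x₀
  have he0 : e.symm (e x₀) = x₀ := e.left_inv hx0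
  have hsl : Λ.slope x₀ p - Λ.slope x₀ q ≠ 0 := fun h =>
    hne (Λ.eq_of_slope_eq (x₀ := x₀) hx0 hf (sub_eq_zero.mp h))
  have hp' : Φ.symm x₀ = p := by
    have : Φ p = x₀ := hΦb hΦ
    rw [← this]; exact Φ.left_inv hΦ
  have hq' : Ψ.symm x₀ = q := by
    have : Ψ q = x₀ := (hΨb hΨ).trans hb
    rw [← this]; exact Ψ.left_inv hΨ
  obtain ⟨⟨ε, hε, γ, hγc, hγi, hγ0, hγ⟩, h1, h2⟩ := exists_arc_of_hasStrictFDerivAt (by simp)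
    (hΦd.sub hΨd) hsl (by simp [he0, hp', hq', hh])
  have hce : Tendsto e.symm (𝓝 (e x₀)) (𝓝 x₀) := by
    have := e.symm.continuousAt (e.map_source hx0)
    rwa [ContinuousAt, he0] at this
  refine ⟨Φ, Ψ, hΦ, hΦb, hΨ, hΨb, ?_, ?_, ?_⟩
  · have h0 : (0 : ℝ) ∈ Ioo (-ε) ε := ⟨by linarith, hε⟩
    have hN : γ ⁻¹' e.target ∈ 𝓝 (0 : ℝ) :=
      (hγc.continuousAt (Ioo_mem_nhds h0.1 h0.2)).preimage_mem_nhds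
        (by rw [hγ0]; exact e.open_target.mem_nhds (e.map_source hx0))
    obtain ⟨δ, hδ, hsub⟩ := Metric.mem_nhds_iff.mp (inter_mem hN (Ioo_mem_nhds h0.1 h0.2))
    rw [Real.ball_eq_Ioo, zero_sub, zero_add] at hsub
    refine ⟨δ, hδ, fun t => e.symm (γ t), ?_, ?_, ?_, ?_⟩
    · exact e.continuousOn_symm.comp (hγc.mono fun t ht => (hsub ht).2) fun t ht => (hsub ht).1
    · intro a ha b hb hab
      exact hγi (hsub ha).2 (hsub hb).2 (e.symm.injOn (hsub ha).1 (hsub hb).1 hab)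
    · show e.symm (γ 0) = x₀
      rw [hγ0, he0]
    · intro t ht
      exact sub_eq_zero.mp (hγ t (hsub ht).2)
  · exact hce.frequently (h1.mono fun u hu => sub_pos.mp hu)
  · exact hce.frequently (h2.mono fun u hu => sub_neg.mp hu)

end LegendrianSurface
end LegendrianSheaf

namespace LegendrianSheaf

open Set Filter

/-- The standard cusp `(t₁, t₂) ↦ (t₁³, t₁², t₂)`. -/
noncomputable def cuspMap (t : Plane) : Plane × ℝ := (!₂[t 0 ^ 3, t 0 ^ 2], t 1)

/-- The differential of the standard cusp. -/
noncomputable def cuspMapDeriv (t : Plane) : Plane →L[ℝ] Plane × ℝ :=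
  (((3 * t 0 ^ 2) • (EuclideanSpace.proj 0 : Plane →L[ℝ] ℝ)).smulRight (!₂[1, 0] : Plane)
    + ((2 * t 0) • (EuclideanSpace.proj 0 : Plane →L[ℝ] ℝ)).smulRight (!₂[0, 1] : Plane)).prod
    (EuclideanSpace.proj 1 : Plane →L[ℝ] ℝ)

theorem plane_mk_eq (a u : ℝ) : (!₂[a, u] : Plane) = a • !₂[1, 0] + u • !₂[0, 1] := by
  ext i; fin_cases i <;> simp

theorem cuspMapDeriv_apply (t v : Plane) :
    cuspMapDeriv t v = (!₂[3 * t 0 ^ 2 * v 0, 2 * t 0 * v 0], v 1) := by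
  refine Prod.ext ?_ rfl
  rw [plane_mk_eq]
  rfl

theorem hasFDerivAt_cuspMap (t : Plane) : HasFDerivAt cuspMap (cuspMapDeriv t) t := by
  have h0 : HasFDerivAt (fun t : Plane => t 0) (EuclideanSpace.proj 0 : Plane →L[ℝ] ℝ) t :=
    (EuclideanSpace.proj 0 : Plane →L[ℝ] ℝ).hasFDerivAt
  have h1 : HasFDerivAt (fun t : Plane => t 1) (EuclideanSpace.proj 1 : Plane →L[ℝ] ℝ) t :=
    (EuclideanSpace.proj 1 : Plane →L[ℝ] ℝ).hasFDerivAt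
  have e : cuspMap = fun t : Plane =>
      (t 0 ^ 3 • (!₂[1, 0] : Plane) + t 0 ^ 2 • (!₂[0, 1] : Plane), t 1) := by
    funext t; rw [cuspMap, plane_mk_eq]
  rw [e]
  refine HasFDerivAt.prodMk (HasFDerivAt.add ?_ ?_) h1
  · convert! (h0.pow 3).smul_const (!₂[1, 0] : Plane) using 2
    simp
  · convert! (h0.pow 2).smul_const (!₂[0, 1] : Plane) using 2
    simp

theorem injective_cuspMapDeriv_iff (t : Plane) :
    Function.Injective (cuspMapDeriv t) ↔ t 0 ≠ 0 := by
  rw [injective_iff_map_eq_zero]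
  constructor
  · intro h h0
    have := h !₂[1, 0] (by rw [cuspMapDeriv_apply]; ext i <;> simp [h0]; fin_cases i <;> simp)
    have := congrArg (fun v : Plane => v 0) this
    simp at this
  · intro h0 v hv
    rw [cuspMapDeriv_apply] at hv
    have h1 := congrArg (fun w : Plane × ℝ => w.1 1) hv
    have h2 := congrArg (fun w : Plane × ℝ => w.2) hv
    simp [h0] at h1 h2
    ext i; fin_cases i <;> simp [h1, h2]

namespace LegendrianSurface

variable {L M : Type*} [TopologicalSpace L] [ChartedSpace Plane L]
  [TopologicalSpace M] [ChartedSpace Plane M] [IsManifold (𝓡 2) ∞ M] (Λ : LegendrianSurface L M)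

/-- Charts in which the front projection is the standard cusp. -/
structure CuspChart (φ : OpenPartialHomeomorph L Plane)
    (ψ : OpenPartialHomeomorph (M × ℝ) (ModelProd Plane ℝ)) : Prop where
  left_mem : φ ∈ IsManifold.maximalAtlas (𝓡 2) ∞ L
  right_mem : ψ ∈ IsManifold.maximalAtlas zeroJetModel ∞ (M × ℝ)
  front_mem : ∀ q ∈ φ.source, Λ.front q ∈ ψ.source
  front_eq : ∀ q ∈ φ.source, ψ (Λ.front q) = cuspMap (φ q)

namespace CuspChart

variable {Λ} {φ : OpenPartialHomeomorph L Plane}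
  {ψ : OpenPartialHomeomorph (M × ℝ) (ModelProd Plane ℝ)} (h : Λ.CuspChart φ ψ)
include h

theorem mdifferentiable_right : ψ.MDifferentiable zeroJetModel zeroJetModel :=
  ⟨(contMDiffOn_of_mem_maximalAtlas h.right_mem).mdifferentiableOn (by simp),
    (contMDiffOn_symm_of_mem_maximalAtlas h.right_mem).mdifferentiableOn (by simp)⟩

theorem mem_cusp_iff {q : L} (hq : q ∈ φ.source) : q ∈ Λ.cusp ↔ φ q 0 = 0 := by
  have ht : φ q ∈ φ.target := φ.map_source hq
  have hqt : φ.symm (φ q) = q := φ.left_inv hq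
  have d1 : MDifferentiableAt (𝓡 2) (𝓡 2) φ.symm (φ q) :=
    (contMDiffAt_symm_of_mem h.left_mem ht).mdifferentiableAt (by simp)
  have d2 : MDifferentiableAt (𝓡 2) zeroJetModel Λ.front (φ.symm (φ q)) :=
    (Λ.contMDiff_front _).mdifferentiableAt (by simp)
  have d3 : MDifferentiableAt zeroJetModel zeroJetModel ψ (Λ.front (φ.symm (φ q))) :=
    h.mdifferentiable_right.mdifferentiableAt (h.front_mem _ (by rwa [hqt]))
  have hc : HasMFDerivAt (𝓡 2) zeroJetModel (ψ ∘ Λ.front ∘ φ.symm) (φ q)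
      ((mfderiv zeroJetModel zeroJetModel ψ (Λ.front (φ.symm (φ q)))).comp
        ((mfderiv (𝓡 2) zeroJetModel Λ.front (φ.symm (φ q))).comp
          (mfderiv (𝓡 2) (𝓡 2) φ.symm (φ q)))) :=
    d3.hasMFDerivAt.comp (φ q) (d2.hasMFDerivAt.comp (φ q) d1.hasMFDerivAt)
  have hc2 : HasMFDerivAt (𝓡 2) zeroJetModel (M' := ModelProd Plane ℝ) cuspMap (φ q)
      (cuspMapDeriv (φ q)) := by
    have := (hasFDerivAt_cuspMap (φ q)).hasMFDerivAt
    rw [modelWithCornersSelf_prod] at this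
    exact this
  have hev : (ψ ∘ Λ.front ∘ φ.symm) =ᶠ[𝓝 (φ q)] cuspMap := by
    filter_upwards [φ.open_target.mem_nhds ht] with t ht
    show ψ (Λ.front (φ.symm t)) = _
    rw [h.front_eq _ (φ.map_target ht), φ.right_inv ht]
  have heq := hasMFDerivAt_unique hc (hc2.congr_of_eventuallyEq hev)
  have hL := mfderiv_symm_bijective_of_mem h.left_mem ht
  have hR := h.mdifferentiable_right.mfderiv_bijective (h.front_mem _ (φ.map_target ht))
  have key : Function.Injective (cuspMapDeriv (φ q)) ↔
      Function.Injective (mfderiv (𝓡 2) zeroJetModel Λ.front (φ.symm (φ q))) := by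
    have e : (cuspMapDeriv (φ q) : Plane → Plane × ℝ) =
        (mfderiv zeroJetModel zeroJetModel ψ (Λ.front (φ.symm (φ q)))) ∘
        (mfderiv (𝓡 2) zeroJetModel Λ.front (φ.symm (φ q))) ∘
          (mfderiv (𝓡 2) (𝓡 2) φ.symm (φ q)) := by
      funext v
      exact (congrArg (fun f => f v) heq).symm
    rw [e]
    constructor
    · intro hinj
      have h2 := Function.Injective.of_comp hinj
      exact fun a b hab => by
        obtain ⟨a, rfl⟩ := hL.2 a
        obtain ⟨b, rfl⟩ := hL.2 b
        exact congrArg _ (h2 hab)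
    · intro hinj
      exact hR.1.comp (hinj.comp hL.1)
  rw [hqt, injective_cuspMapDeriv_iff] at key
  show ¬ Function.Injective (Λ.frontDiff q) ↔ _
  rw [show Function.Injective (Λ.frontDiff q) ↔
    Function.Injective (mfderiv (𝓡 2) zeroJetModel Λ.front q) from Iff.rfl, ← key, not_not]

end CuspChart

theorem exists_cuspChart (hmild : Λ.HasMildFront) {p : L} (hp : p ∈ Λ.cusp) :
    ∃ φ ψ, Λ.CuspChart φ ψ ∧ p ∈ φ.source ∧ φ p 0 = 0 := by
  obtain ⟨φ, hφ, ψ, hψ, h1, h2, h3⟩ := hmild p hp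
  exact ⟨φ, ψ, ⟨hφ, hψ, fun q hq => (h3 q hq).1, fun q hq => (h3 q hq).2⟩, h1, h2⟩

end LegendrianSurface
end LegendrianSheaf

namespace LegendrianSheaf

open Set Filter

namespace LegendrianSurface

variable {L M : Type*} [TopologicalSpace L] [ChartedSpace Plane L]
  [TopologicalSpace M] [ChartedSpace Plane M] [IsManifold (𝓡 2) ∞ M] {Λ : LegendrianSurface L M}

namespace CuspChart

variable {φ : OpenPartialHomeomorph L Plane}
  {ψ : OpenPartialHomeomorph (M × ℝ) (ModelProd Plane ℝ)} (h : Λ.CuspChart φ ψ)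
include h

theorem contMDiffAt_symm {w : ModelProd Plane ℝ} (hw : w ∈ ψ.target) :
    ContMDiffAt 𝓘(ℝ, Plane × ℝ) zeroJetModel ∞ (fun w : Plane × ℝ => ψ.symm w) w := by
  have := (contMDiffOn_symm_of_mem_maximalAtlas h.right_mem).contMDiffAt
    (ψ.open_target.mem_nhds hw)
  rw [modelWithCornersSelf_prod]
  exact this

theorem mfderiv_symm_injective {w : ModelProd Plane ℝ} (hw : w ∈ ψ.target) :
    Function.Injective (mfderiv 𝓘(ℝ, Plane × ℝ) zeroJetModel (fun w : Plane × ℝ => ψ.symm w) w) := by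
  have := h.mdifferentiable_right.symm.mfderiv_injective hw
  rw [modelWithCornersSelf_prod]
  exact this

theorem contDiffAt_snd {w : Plane × ℝ} (hw : w ∈ ψ.target) :
    ContDiffAt ℝ ∞ (fun w : Plane × ℝ => (ψ.symm w).2) w := by
  rw [← contMDiffAt_iff_contDiffAt]
  exact contMDiffAt_snd.comp w (h.contMDiffAt_symm hw)

theorem contDiffAt_fst {w : Plane × ℝ} (hw : w ∈ ψ.target) {x₀ : M}
    (hx : (ψ.symm w).1 ∈ (chartAt Plane x₀).source) :
    ContDiffAt ℝ ∞ (fun w : Plane × ℝ => chartAt Plane x₀ (ψ.symm w).1) w := by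
  rw [← contMDiffAt_iff_contDiffAt]
  have h1 : ContMDiffAt (𝓡 2) (𝓡 2) ∞ (chartAt Plane x₀) (ψ.symm w).1 :=
    (contMDiffOn_chart (I := 𝓡 2) (n := ∞)).contMDiffAt
      ((chartAt Plane x₀).open_source.mem_nhds hx)
  exact h1.comp w (contMDiffAt_fst.comp w (h.contMDiffAt_symm hw))

theorem eq_zero_of_fderiv_eq_zero {w : Plane × ℝ} (hw : w ∈ ψ.target) {x₀ : M}
    (hx : (ψ.symm w).1 ∈ (chartAt Plane x₀).source) {v : Plane × ℝ}
    (h1 : fderiv ℝ (fun w : Plane × ℝ => chartAt Plane x₀ (ψ.symm w).1) w v = 0)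
    (h2 : fderiv ℝ (fun w : Plane × ℝ => (ψ.symm w).2) w v = 0) : v = 0 := by
  have d0 := (h.contMDiffAt_symm hw).mdifferentiableAt (by simp)
  have d1 : MDifferentiableAt zeroJetModel (𝓡 2) (Prod.fst : M × ℝ → M) (ψ.symm w) :=
    mdifferentiableAt_fst
  have d2 : MDifferentiableAt zeroJetModel 𝓘(ℝ, ℝ) (Prod.snd : M × ℝ → ℝ) (ψ.symm w) :=
    mdifferentiableAt_snd
  have d3 : MDifferentiableAt (𝓡 2) (𝓡 2) (chartAt Plane x₀) (ψ.symm w).1 :=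
    mdifferentiableAt_atlas (chart_mem_atlas _ _) hx
  have c1 := d3.hasMFDerivAt.comp w (d1.hasMFDerivAt.comp w d0.hasMFDerivAt)
  have c2 := d2.hasMFDerivAt.comp w d0.hasMFDerivAt
  rw [← mfderiv_eq_fderiv] at h1 h2
  have g1 := (congrArg (fun f => f v) c1.mfderiv).symm.trans h1
  have g2 := (congrArg (fun f => f v) c2.mfderiv).symm.trans h2
  have g3 := (mdifferentiable_chart (I := 𝓡 2) x₀).mfderiv_injective hx
    (g1.trans (map_zero _).symm)
  set u := mfderiv 𝓘(ℝ, Plane × ℝ) zeroJetModel (fun w : Plane × ℝ => ψ.symm w) w v with hu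
  have g4 : u.1 = 0 := by
    have : mfderiv zeroJetModel (𝓡 2) (Prod.fst : M × ℝ → M) (ψ.symm w) u = u.1 :=
      congrArg (fun f => f u) (mfderiv_fst (I := 𝓡 2) (I' := 𝓘(ℝ, ℝ)) (x := ψ.symm w))
    exact this.symm.trans g3
  have g5 : u.2 = 0 := by
    have : mfderiv zeroJetModel 𝓘(ℝ, ℝ) (Prod.snd : M × ℝ → ℝ) (ψ.symm w) u = u.2 :=
      congrArg (fun f => f u) (mfderiv_snd (I := 𝓡 2) (I' := 𝓘(ℝ, ℝ)) (x := ψ.symm w))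
    exact this.symm.trans g2
  have g6 : u = 0 := Prod.ext g4 g5
  exact h.mfderiv_symm_injective hw (g6.trans (map_zero _).symm)

end CuspChart

end LegendrianSurface
end LegendrianSheaf

namespace LegendrianSheaf

open Set Filter

/-- The plane with coordinates `(u, v)`, embedded into the target of the standard cusp. -/
noncomputable def sideDeriv : ℝ × ℝ →L[ℝ] Plane × ℝ :=
  ((ContinuousLinearMap.fst ℝ ℝ ℝ).smulRight (!₂[0, 1] : Plane)).prod
    (ContinuousLinearMap.snd ℝ ℝ ℝ)

/-- The two halves of the standard cusp, parametrized by `(t₁², t₂)`. -/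
noncomputable def sideMap (σ : ℝ) (a : ℝ × ℝ) : Plane × ℝ :=
  ((σ * a.1 ^ (3 / 2 : ℝ)) • (!₂[1, 0] : Plane) + a.1 • (!₂[0, 1] : Plane), a.2)

theorem hasStrictFDerivAt_sideMap (σ v₀ : ℝ) :
    HasStrictFDerivAt (sideMap σ) sideDeriv (0, v₀) := by
  have h1 : HasStrictFDerivAt (fun a : ℝ × ℝ => a.1) (ContinuousLinearMap.fst ℝ ℝ ℝ) (0, v₀) :=
    (ContinuousLinearMap.fst ℝ ℝ ℝ).hasStrictFDerivAt
  have h2 : HasStrictFDerivAt (fun a : ℝ × ℝ => a.2) (ContinuousLinearMap.snd ℝ ℝ ℝ) (0, v₀) :=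
    (ContinuousLinearMap.snd ℝ ℝ ℝ).hasStrictFDerivAt
  have h3 : HasStrictFDerivAt (fun a : ℝ × ℝ => a.1 ^ (3 / 2 : ℝ))
      ((0 : ℝ) • ContinuousLinearMap.fst ℝ ℝ ℝ) (0, v₀) :=
    HasStrictDerivAt.comp_hasStrictFDerivAt (h₂ := fun u : ℝ => u ^ (3 / 2 : ℝ))
      ((0, v₀) : ℝ × ℝ) hasStrictDerivAt_rpow_three_halves h1
  have h4 := (((h3.const_mul σ).smul_const (!₂[1, 0] : Plane)).add
    (h1.smul_const (!₂[0, 1] : Plane))).prodMk h2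
  convert! h4 using 1
  ext <;> simp [sideDeriv]

/-- The two inverses of `t ↦ (t₁², t₂)`. -/
noncomputable def sideLift (σ : ℝ) (a : ℝ × ℝ) : Plane := !₂[σ * √a.1, a.2]

theorem continuous_sideLift (σ : ℝ) : Continuous (sideLift σ) := by
  have : sideLift σ = fun a : ℝ × ℝ =>
      (σ * √a.1) • (!₂[1, 0] : Plane) + a.2 • (!₂[0, 1] : Plane) := by
    funext a; rw [sideLift, plane_mk_eq]
  rw [this]
  fun_prop

theorem cuspMap_sideLift {σ : ℝ} (hσ : σ = 1 ∨ σ = -1) {a : ℝ × ℝ} (ha : 0 ≤ a.1) :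
    cuspMap (sideLift σ a) = sideMap σ a := by
  rw [sideMap, ← plane_mk_eq, cuspMap, sideLift]
  have h1 : √a.1 ^ 3 = a.1 ^ (3 / 2 : ℝ) := by
    rw [Real.sqrt_eq_rpow, ← Real.rpow_natCast, ← Real.rpow_mul ha]; norm_num
  have h2 : √a.1 ^ 2 = a.1 := Real.sq_sqrt ha
  rcases hσ with rfl | rfl <;> simp [h1, h2, Odd.neg_pow (by decide : Odd 3)]

namespace LegendrianSurface

variable {L M : Type*} [TopologicalSpace L] [ChartedSpace Plane L]
  [TopologicalSpace M] [ChartedSpace Plane M] [IsManifold (𝓡 2) ∞ M] {Λ : LegendrianSurface L M}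

namespace CuspChart

variable {φ : OpenPartialHomeomorph L Plane}
  {ψ : OpenPartialHomeomorph (M × ℝ) (ModelProd Plane ℝ)} (h : Λ.CuspChart φ ψ)
include h

/-- The base projection restricted to the limiting tangent plane of the front at a cusp is an
isomorphism, because the covector `y` is finite there. -/
theorem injective_fderiv_comp_sideDeriv {p : L} (hp : p ∈ φ.source) (h0 : φ p 0 = 0) :
    Function.Injective ((fderiv ℝ (fun w : Plane × ℝ => chartAt Plane (Λ.base p) (ψ.symm w).1)
      (cuspMap (φ p))).comp sideDeriv) := by
  set x₀ := Λ.base p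
  set P : Plane × ℝ → Plane := fun w => chartAt Plane x₀ (ψ.symm w).1
  set ζ : Plane × ℝ → ℝ := fun w => (ψ.symm w).2
  have hx0 : x₀ ∈ (chartAt Plane x₀).source := mem_chart_source _ _
  have good : ∀ᶠ t in 𝓝 (φ p), t ∈ φ.target ∧ Λ.base (φ.symm t) ∈ (chartAt Plane x₀).source := by
    have hc : ContinuousAt (fun t => Λ.base (φ.symm t)) (φ p) :=
      Λ.contMDiff_base.continuous.continuousAt.comp
        (φ.symm.continuousAt (φ.map_source hp))
    refine Filter.Eventually.and (φ.open_target.mem_nhds (φ.map_source hp))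
      (hc.preimage_mem_nhds ?_)
    rw [φ.left_inv hp]
    exact (chartAt Plane x₀).open_source.mem_nhds hx0
  have hsymm : ∀ t ∈ φ.target, ψ.symm (cuspMap t) = Λ.front (φ.symm t) := by
    intro t ht
    have := h.front_eq _ (φ.map_target ht)
    rw [φ.right_inv ht] at this
    rw [← this]; exact ψ.left_inv (h.front_mem _ (φ.map_target ht))
  have hmem : ∀ t ∈ φ.target, cuspMap t ∈ ψ.target := by
    intro t ht
    have := h.front_eq _ (φ.map_target ht)
    rw [φ.right_inv ht] at this
    rw [← this]; exact ψ.map_source (h.front_mem _ (φ.map_target ht))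
  have dP : ∀ t, t ∈ φ.target ∧ Λ.base (φ.symm t) ∈ (chartAt Plane x₀).source →
      ContDiffAt ℝ ∞ P (cuspMap t) := fun t ht =>
    h.contDiffAt_fst (hmem t ht.1) (by rw [hsymm t ht.1]; exact ht.2)
  have dζ : ∀ t, t ∈ φ.target → ContDiffAt ℝ ∞ ζ (cuspMap t) := fun t ht =>
    h.contDiffAt_snd (hmem t ht)
  have hleg : ∀ᶠ t in 𝓝 (φ p), ∀ v, fderiv ℝ ζ (cuspMap t) (cuspMapDeriv t v)
      = Λ.slope x₀ (φ.symm t) (fderiv ℝ P (cuspMap t) (cuspMapDeriv t v)) := by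
    filter_upwards [good.eventually_nhds] with t ht v
    have ht' := ht.self_of_nhds
    have e1 : Λ.heightIn φ =ᶠ[𝓝 t] ζ ∘ cuspMap := by
      filter_upwards [ht] with s hs
      simp only [heightIn, ζ, Function.comp, hsymm s hs.1]; rfl
    have e2 : Λ.baseIn φ x₀ =ᶠ[𝓝 t] P ∘ cuspMap := by
      filter_upwards [ht] with s hs
      simp only [baseIn, P, Function.comp, hsymm s hs.1]; rfl
    have f1 : fderiv ℝ (Λ.heightIn φ) t = (fderiv ℝ ζ (cuspMap t)).comp (cuspMapDeriv t) := by
      rw [e1.fderiv_eq]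
      exact (((dζ t ht'.1).differentiableAt (by simp)).hasFDerivAt.comp t
        (hasFDerivAt_cuspMap t)).fderiv
    have f2 : fderiv ℝ (Λ.baseIn φ x₀) t = (fderiv ℝ P (cuspMap t)).comp (cuspMapDeriv t) := by
      rw [e2.fderiv_eq]
      exact (((dP t ht').differentiableAt (by simp)).hasFDerivAt.comp t
        (hasFDerivAt_cuspMap t)).fderiv
    have f3 := Λ.fderiv_heightIn h.left_mem ht'.1 ht'.2
    rw [f1, f2] at f3
    exact DFunLike.congr_fun f3 v
  set t₀ := φ p with ht0
  set Y := Λ.slope x₀ p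
  have gp := good.self_of_nhds
  have hcusp : Continuous cuspMap := continuous_iff_continuousAt.mpr fun t =>
    (hasFDerivAt_cuspMap t).continuousAt
  have cY : ContinuousAt (fun t => Λ.slope x₀ (φ.symm t)) t₀ := by
    refine ContinuousAt.comp (g := Λ.slope x₀) ?_ (φ.symm.continuousAt gp.1)
    exact Λ.continuousAt_slope gp.2
  have cDP : ContinuousAt (fun t => fderiv ℝ P (cuspMap t)) t₀ :=
    ContinuousAt.comp (g := fderiv ℝ P) ((dP t₀ gp).continuousAt_fderiv (by simp))
      hcusp.continuousAt
  have cDζ : ContinuousAt (fun t => fderiv ℝ ζ (cuspMap t)) t₀ :=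
    ContinuousAt.comp (g := fderiv ℝ ζ) ((dζ t₀ gp.1).continuousAt_fderiv (by simp))
      hcusp.continuousAt
  have hpY : φ.symm t₀ = p := φ.left_inv hp
  -- the direction of the cusp edge
  have k1 : fderiv ℝ ζ (cuspMap t₀) (0, 1) = Y (fderiv ℝ P (cuspMap t₀) (0, 1)) := by
    have := hleg.self_of_nhds !₂[0, 1]
    rw [cuspMapDeriv_apply, hpY] at this
    have e : ((!₂[3 * t₀ 0 ^ 2 * (!₂[0, 1] : Plane) 0, 2 * t₀ 0 * (!₂[0, 1] : Plane) 0],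
        (!₂[0, 1] : Plane) 1) : Plane × ℝ) = (0, 1) := by
      refine Prod.ext ?_ (by simp)
      ext i; fin_cases i <;> simp
    rwa [e] at this
  -- the transverse direction in the limiting tangent plane
  have k2 : fderiv ℝ ζ (cuspMap t₀) (!₂[0, 1], 0) = Y (fderiv ℝ P (cuspMap t₀) (!₂[0, 1], 0)) := by
    have cW : Continuous (fun t : Plane =>
        (((3 / 2 * t 0) • (!₂[1, 0] : Plane) + (!₂[0, 1] : Plane), 0) : Plane × ℝ)) := by fun_prop
    have c1 : ContinuousAt (fun t : Plane => fderiv ℝ ζ (cuspMap t)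
        ((3 / 2 * t 0) • (!₂[1, 0] : Plane) + (!₂[0, 1] : Plane), 0)
        - Λ.slope x₀ (φ.symm t) (fderiv ℝ P (cuspMap t)
        ((3 / 2 * t 0) • (!₂[1, 0] : Plane) + (!₂[0, 1] : Plane), 0))) t₀ :=
      (cDζ.clm_apply cW.continuousAt).sub (cY.clm_apply (cDP.clm_apply cW.continuousAt))
    have c2 : Tendsto (fun s : ℝ => t₀ + s • (!₂[1, 0] : Plane)) (𝓝[≠] 0) (𝓝 t₀) :=
      (Continuous.tendsto' (by fun_prop) _ _ (by simp)).mono_left nhdsWithin_le_nhds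
    have c3 := c1.tendsto.comp c2
    have c4 : Tendsto (fun _ : ℝ => (0 : ℝ)) (𝓝[≠] (0 : ℝ)) (𝓝 0) := tendsto_const_nhds
    have ev := (c2.eventually hleg).and (eventually_mem_nhdsWithin (s := ({0}ᶜ : Set ℝ)))
    have := tendsto_nhds_unique (c3.congr' (f₂ := fun _ => (0 : ℝ)) ?_) c4
    · simp only [h0, mul_zero, zero_smul, zero_add, hpY] at this
      exact sub_eq_zero.mp this
    · filter_upwards [ev] with s ⟨hs, hs0⟩
      have hs0 : s ≠ 0 := hs0
      have hs1 := hs ((2 * s)⁻¹ • !₂[1, 0])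
      rw [cuspMapDeriv_apply] at hs1
      have e : ((!₂[3 * (t₀ + s • (!₂[1, 0] : Plane)) 0 ^ 2 * ((2 * s)⁻¹ • (!₂[1, 0] : Plane)) 0,
          2 * (t₀ + s • (!₂[1, 0] : Plane)) 0 * ((2 * s)⁻¹ • (!₂[1, 0] : Plane)) 0],
          ((2 * s)⁻¹ • (!₂[1, 0] : Plane)) 1) : Plane × ℝ)
          = ((3 / 2 * (t₀ + s • (!₂[1, 0] : Plane)) 0) • (!₂[1, 0] : Plane)
            + (!₂[0, 1] : Plane), 0) := by
        refine Prod.ext ?_ (by simp)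
        ext i; fin_cases i <;> simp [h0] <;> field_simp
      rw [e] at hs1
      simp only [Function.comp]
      rw [hs1, sub_self]
  rw [injective_iff_map_eq_zero]
  rintro ⟨u, v⟩ huv
  have hs : sideDeriv (u, v) = u • (!₂[0, 1], 0) + v • ((0, 1) : Plane × ℝ) := by
    simp [sideDeriv]
  have huv' : fderiv ℝ P (cuspMap t₀) (sideDeriv (u, v)) = 0 := huv
  have hz : fderiv ℝ ζ (cuspMap t₀) (sideDeriv (u, v)) = 0 := by
    have : fderiv ℝ ζ (cuspMap t₀) (sideDeriv (u, v))
        = Y (fderiv ℝ P (cuspMap t₀) (sideDeriv (u, v))) := by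
      rw [hs]; simp only [map_add, map_smul, k1, k2]
    rw [this, huv', map_zero]
  have := h.eq_zero_of_fderiv_eq_zero (hmem _ gp.1)
    (by rw [hsymm _ gp.1]; exact gp.2) huv' hz
  rw [hs] at this
  have a1 := congrArg (fun w : Plane × ℝ => w.1 1) this
  have a2 := congrArg (fun w : Plane × ℝ => w.2) this
  simp at a1 a2
  rw [a1, a2]; rfl

end CuspChart

end LegendrianSurface
end LegendrianSheaf

namespace LegendrianSheaf

open Set Filter

namespace LegendrianSurface

variable {L M : Type*} [TopologicalSpace L] [ChartedSpace Plane L]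
  [TopologicalSpace M] [ChartedSpace Plane M] [IsManifold (𝓡 2) ∞ M] {Λ : LegendrianSurface L M}

/-- A neighbourhood of a cusp point, decomposed into its upper half `A`, its lower half `B` and
the cusp edge `Z`. -/
structure IsFold (Λ : LegendrianSurface L M) (p : L) (A B Z : Set L) : Prop where
  mem_nhds : A ∪ B ∪ Z ∈ 𝓝 p
  preconnected_left : _root_.IsPreconnected A
  preconnected_right : _root_.IsPreconnected B
  nonempty_left : A.Nonempty
  left_notMem : ∀ q ∈ A, q ∉ Λ.cusp
  right_notMem : ∀ q ∈ B, q ∉ Λ.cusp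
  edge_mem : Z ⊆ Λ.cusp
  injOn_left : InjOn Λ.base (A ∪ Z)
  injOn_right : InjOn Λ.base (B ∪ Z)
  image_eq : Λ.base '' A = Λ.base '' B
  above : ∀ a ∈ A, ∀ b ∈ B, Λ.base a = Λ.base b → Λ.height b < Λ.height a

theorem CuspChart.exists_arc {φ : OpenPartialHomeomorph L Plane}
    {ψ : OpenPartialHomeomorph (M × ℝ) (ModelProd Plane ℝ)} (h : Λ.CuspChart φ ψ)
    {p : L} (hp : p ∈ φ.source) (h0 : φ p 0 = 0) :
    ∃ ε > 0, ∃ γ : ℝ → L, ContinuousOn γ (Ioo (-ε) ε) ∧ InjOn γ (Ioo (-ε) ε) ∧ γ 0 = p ∧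
      ∀ t ∈ Ioo (-ε) ε, γ t ∈ Λ.cusp := by
  let τ : ℝ → Plane := fun s => φ p + s • !₂[0, 1]
  have hτ : Continuous τ := by fun_prop
  have hτ0 : τ 0 = φ p := by simp [τ]
  have hN : τ ⁻¹' φ.target ∈ 𝓝 (0 : ℝ) := hτ.continuousAt.preimage_mem_nhds
    (by rw [hτ0]; exact φ.open_target.mem_nhds (φ.map_source hp))
  obtain ⟨ε, hε, hsub⟩ := Metric.mem_nhds_iff.mp hN
  rw [Real.ball_eq_Ioo, zero_sub, zero_add] at hsub
  refine ⟨ε, hε, fun s => φ.symm (τ s), φ.continuousOn_symm.comp hτ.continuousOn hsub, ?_, ?_, ?_⟩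
  · intro a ha b hb hab
    have := congrArg (fun t : Plane => t 1) (φ.symm.injOn (hsub ha) (hsub hb) hab)
    simpa [τ] using this
  · show φ.symm (τ 0) = p
    rw [hτ0, φ.left_inv hp]
  · intro s hs
    refine (h.mem_cusp_iff (φ.map_target (hsub hs))).mpr ?_
    rw [φ.right_inv (hsub hs)]
    simp [τ, h0]

theorem CuspChart.exists_isFold {φ : OpenPartialHomeomorph L Plane}
    {ψ : OpenPartialHomeomorph (M × ℝ) (ModelProd Plane ℝ)} (h : Λ.CuspChart φ ψ)
    {p : L} (hp : p ∈ φ.source) (h0 : φ p 0 = 0) {N : Set L} (hN : N ∈ 𝓝 p) :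
    ∃ A B Z, Λ.IsFold p A B Z ∧ A ∪ B ∪ Z ⊆ N := by
  set x₀ := Λ.base p
  set e := chartAt Plane x₀
  set P : Plane × ℝ → Plane := fun w => e (ψ.symm w).1
  have hx0 : x₀ ∈ e.source := mem_chart_source _ _
  set t₀ := φ p with ht0
  set v₀ := t₀ 1
  have htt : t₀ ∈ φ.target := φ.map_source hp
  have hpt : φ.symm t₀ = p := φ.left_inv hp
  have hl0 : ∀ σ, sideLift σ (0, v₀) = t₀ := by
    intro σ; ext i; fin_cases i <;> simp [sideLift, h0, v₀]
  have hm0 : ∀ σ, sideMap σ (0, v₀) = cuspMap t₀ := by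
    intro σ
    rw [sideMap, ← plane_mk_eq, cuspMap, h0, Real.zero_rpow (by norm_num)]; simp; rfl
  have hsymm : ∀ t ∈ φ.target, ψ.symm (cuspMap t) = Λ.front (φ.symm t) := by
    intro t ht
    have := h.front_eq _ (φ.map_target ht)
    rw [φ.right_inv ht] at this
    rw [← this]; exact ψ.left_inv (h.front_mem _ (φ.map_target ht))
  have hmem : ∀ t ∈ φ.target, cuspMap t ∈ ψ.target := by
    intro t ht
    have := h.front_eq _ (φ.map_target ht)
    rw [φ.right_inv ht] at this
    rw [← this]; exact ψ.map_source (h.front_mem _ (φ.map_target ht))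
  have hP : HasStrictFDerivAt P (fderiv ℝ P (cuspMap t₀)) (cuspMap t₀) := by
    refine ContDiffAt.hasStrictFDerivAt (n := ∞) (h.contDiffAt_fst (hmem _ htt) ?_) (by simp)
    rw [hsymm _ htt, hpt]; exact hx0
  obtain ⟨A, hA⟩ := exists_continuousLinearEquiv_of_injective (by simp) _
    (h.injective_fderiv_comp_sideDeriv hp h0)
  have hB : ∀ σ, HasStrictFDerivAt (fun a => P (sideMap σ a)) (A : ℝ × ℝ →L[ℝ] Plane)
      (0, v₀) := by
    intro σ
    rw [hA]
    refine HasStrictFDerivAt.comp _ ?_ (hasStrictFDerivAt_sideMap σ v₀)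
    rw [hm0]; exact hP
  have hW : ∀ σ, (sideLift σ) ⁻¹' (φ.target ∩ φ.symm ⁻¹' (N ∩ Λ.base ⁻¹' e.source))
      ∈ 𝓝 ((0, v₀) : ℝ × ℝ) := by
    intro σ
    refine (continuous_sideLift σ).continuousAt.preimage_mem_nhds ?_
    rw [hl0]
    refine inter_mem (φ.open_target.mem_nhds htt)
      ((φ.symm.continuousAt htt).preimage_mem_nhds ?_)
    rw [hpt]
    exact inter_mem hN (Λ.contMDiff_base.continuous.continuousAt.preimage_mem_nhds
      (e.open_source.mem_nhds hx0))
  obtain ⟨D, θ, hDn, hθDn, hDW, hθDW, hDc, hθc, hBp, hBm, hθB, hθ0, hθpos, hθneg⟩ :=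
    exists_side_preserving_transition (hB 1) (hB (-1))
      (fun v => by simp [sideMap, Real.zero_rpow]) (inter_mem (hW 1) (hW (-1)))
  -- the two parametrizations of the two halves
  set s₁ : ℝ × ℝ → L := fun a => φ.symm (sideLift 1 a)
  set s₂ : ℝ × ℝ → L := fun a => φ.symm (sideLift (-1) a)
  have good₁ : ∀ a ∈ D, sideLift 1 a ∈ φ.target ∧ s₁ a ∈ N ∧ Λ.base (s₁ a) ∈ e.source :=
    fun a ha => ⟨(hDW ha).1.1, (hDW ha).1.2.1, (hDW ha).1.2.2⟩
  have good₂ : ∀ a ∈ θ '' D, sideLift (-1) a ∈ φ.target ∧ s₂ a ∈ N ∧ Λ.base (s₂ a) ∈ e.source :=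
    fun a ha => ⟨(hθDW ha).2.1, (hθDW ha).2.2.1, (hθDW ha).2.2.2⟩
  have hb₁ : ∀ a ∈ D, 0 ≤ a.1 → e (Λ.base (s₁ a)) = P (sideMap 1 a) := by
    intro a ha ha0
    rw [← cuspMap_sideLift (Or.inl rfl) ha0]
    simp only [P, hsymm _ (good₁ a ha).1]; rfl
  have hb₂ : ∀ a ∈ θ '' D, 0 ≤ a.1 → e (Λ.base (s₂ a)) = P (sideMap (-1) a) := by
    intro a ha ha0
    rw [← cuspMap_sideLift (Or.inr rfl) ha0]
    simp only [P, hsymm _ (good₂ a ha).1]; rfl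
  have hbase : ∀ a ∈ D, 0 ≤ a.1 → 0 ≤ (θ a).1 → Λ.base (s₂ (θ a)) = Λ.base (s₁ a) := by
    intro a ha h1 h2
    refine e.injOn (good₂ _ ⟨a, ha, rfl⟩).2.2 (good₁ a ha).2.2 ?_
    rw [hb₁ a ha h1, hb₂ _ ⟨a, ha, rfl⟩ h2]
    exact hθB a ha
  have c₁ : ContinuousOn s₁ D :=
    φ.continuousOn_symm.comp (continuous_sideLift _).continuousOn fun a ha => (good₁ a ha).1
  have c₂ : ContinuousOn s₂ (θ '' D) :=
    φ.continuousOn_symm.comp (continuous_sideLift _).continuousOn fun a ha => (good₂ a ha).1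
  set Dp : Set (ℝ × ℝ) := D ∩ {a | 0 < a.1}
  have hDp : _root_.IsPreconnected Dp :=
    (hDc.inter (convex_halfSpace_gt (f := Prod.fst) ⟨fun _ _ => rfl, fun _ _ => rfl⟩ 0)).isPreconnected
  have hne : Dp.Nonempty := by
    have c : ContinuousAt (fun u : ℝ => ((u, v₀) : ℝ × ℝ)) 0 := by fun_prop
    have hev : ∀ᶠ u in 𝓝 (0 : ℝ), (u, v₀) ∈ D := c.preimage_mem_nhds hDn
    obtain ⟨u, hu, hu'⟩ := ((hev.filter_mono
      (nhdsWithin_le_nhds (s := Ioi 0))).and eventually_mem_nhdsWithin).exists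
    exact ⟨(u, v₀), hu, hu'⟩
  have hc₂ : ContinuousOn (fun a => s₂ (θ a)) D := c₂.comp hθc (mapsTo_image _ _)
  have cusp₁ : ∀ a ∈ D, 0 ≤ a.1 → (s₁ a ∈ Λ.cusp ↔ a.1 = 0) := by
    intro a ha h1
    rw [h.mem_cusp_iff (φ.map_target (good₁ a ha).1), φ.right_inv (good₁ a ha).1]
    simp [sideLift, Real.sqrt_eq_zero h1]
  have cusp₂ : ∀ a ∈ θ '' D, 0 ≤ a.1 → (s₂ a ∈ Λ.cusp ↔ a.1 = 0) := by
    intro a ha h1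
    rw [h.mem_cusp_iff (φ.map_target (good₂ a ha).1), φ.right_inv (good₂ a ha).1]
    simp [sideLift, Real.sqrt_eq_zero h1]
  set A' : Set L := s₁ '' Dp
  set B' : Set L := (fun a => s₂ (θ a)) '' Dp
  set Z' : Set L := s₁ '' (D ∩ {a | a.1 = 0})
  have preA : _root_.IsPreconnected A' := hDp.image _ (c₁.mono inter_subset_left)
  have preB : _root_.IsPreconnected B' := hDp.image _ (hc₂.mono inter_subset_left)
  have nA : ∀ q ∈ A', q ∉ Λ.cusp := by
    rintro _ ⟨a, ha, rfl⟩ hc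
    exact ha.2.ne' ((cusp₁ a ha.1 ha.2.le).mp hc)
  have nB : ∀ q ∈ B', q ∉ Λ.cusp := by
    rintro _ ⟨a, ha, rfl⟩ hc
    have := hθpos a ha.1 ha.2
    exact this.ne' ((cusp₂ _ ⟨a, ha.1, rfl⟩ this.le).mp hc)
  have mZ : Z' ⊆ Λ.cusp := by
    rintro _ ⟨a, ha, rfl⟩
    exact (cusp₁ a ha.1 ha.2.ge).mpr ha.2
  have eA : A' ∪ Z' = s₁ '' (D ∩ {a | 0 ≤ a.1}) := by
    rw [← image_union]; congr 1; ext a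
    simp only [Dp, mem_union, mem_inter_iff, mem_ofPred_eq, le_iff_lt_or_eq, eq_comm (a := a.1)]
    tauto
  have eZ : ∀ a ∈ D, a.1 = 0 → s₁ a = s₂ (θ a) := by
    intro a ha h1
    rw [hθ0 a ha h1]
    simp only [s₁, s₂, sideLift, h1, Real.sqrt_zero, mul_zero]
  have eB : B' ∪ Z' = (fun a => s₂ (θ a)) '' (D ∩ {a | 0 ≤ a.1}) := by
    have : Z' = (fun a => s₂ (θ a)) '' (D ∩ {a | a.1 = 0}) :=
      image_congr fun a ha => eZ a ha.1 ha.2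
    rw [this, ← image_union]; congr 1; ext a
    simp only [Dp, mem_union, mem_inter_iff, mem_ofPred_eq, le_iff_lt_or_eq, eq_comm (a := a.1)]
    tauto
  have hθnn : ∀ a ∈ D, 0 ≤ a.1 → 0 ≤ (θ a).1 := by
    intro a ha h1
    rcases h1.lt_or_eq with h2 | h2
    · exact (hθpos a ha h2).le
    · rw [hθ0 a ha h2.symm]; exact h1
  have iA : InjOn Λ.base (A' ∪ Z') := by
    rw [eA]
    rintro _ ⟨a, ha, rfl⟩ _ ⟨b, hb, rfl⟩ hab
    have := congrArg e hab
    rw [hb₁ a ha.1 ha.2, hb₁ b hb.1 hb.2] at this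
    rw [hBp ha.1 hb.1 this]
  have iB : InjOn Λ.base (B' ∪ Z') := by
    rw [eB]
    rintro _ ⟨a, ha, rfl⟩ _ ⟨b, hb, rfl⟩ hab
    have := congrArg e hab
    dsimp only at this
    rw [hb₂ _ ⟨a, ha.1, rfl⟩ (hθnn a ha.1 ha.2), hb₂ _ ⟨b, hb.1, rfl⟩ (hθnn b hb.1 hb.2)] at this
    dsimp only
    rw [hBm ⟨a, ha.1, rfl⟩ ⟨b, hb.1, rfl⟩ this]
  have hAB : ∀ a ∈ Dp, Λ.base (s₂ (θ a)) = Λ.base (s₁ a) := fun a ha =>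
    hbase a ha.1 ha.2.le (hθpos a ha.1 ha.2).le
  have im : Λ.base '' A' = Λ.base '' B' := by
    rw [image_image, image_image]
    exact image_congr fun a ha => (hAB a ha).symm
  have nbhd : A' ∪ B' ∪ Z' ∈ 𝓝 p := by
    have cont : ContinuousAt (fun q => ((φ q 0 ^ 2, φ q 1) : ℝ × ℝ)) p := by
      have := φ.continuousAt hp
      fun_prop
    have hval : ((φ p 0 ^ 2, φ p 1) : ℝ × ℝ) = (0, v₀) := by rw [h0]; simp [v₀, t₀]
    have m1 := cont.preimage_mem_nhds (by rw [hval]; exact inter_mem hDn hθDn)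
    filter_upwards [m1, φ.open_source.mem_nhds hp] with q hq hqs
    set a : ℝ × ℝ := (φ q 0 ^ 2, φ q 1)
    rcases lt_trichotomy (φ q 0) 0 with hlt | heq | hgt
    · left; right
      obtain ⟨b, hb, hba⟩ := hq.2
      have ha1 : 0 < a.1 := sq_pos_iff.mpr (ne_of_lt hlt)
      have hbpos : 0 < b.1 := by
        by_contra hneg
        rcases (not_lt.mp hneg).lt_or_eq with h2 | h2
        · have := hθneg b hb h2
          rw [hba] at this
          exact lt_asymm ha1 this
        · have := hθ0 b hb h2
          rw [hba] at this
          rw [← this] at h2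
          exact ha1.ne' h2
      refine ⟨b, ⟨hb, hbpos⟩, ?_⟩
      show φ.symm (sideLift (-1) (θ b)) = q
      rw [hba]
      have : sideLift (-1) a = φ q := by
        ext i; fin_cases i
        · simp [sideLift, a, Real.sqrt_sq_eq_abs, abs_of_neg hlt]
        · simp [sideLift, a]
      rw [this, φ.left_inv hqs]
    · right
      refine ⟨a, ⟨hq.1, by simp [a, heq]⟩, ?_⟩
      show φ.symm (sideLift 1 a) = q
      have : sideLift 1 a = φ q := by
        ext i; fin_cases i <;> simp [sideLift, a, heq]
      rw [this, φ.left_inv hqs]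
    · left; left
      refine ⟨a, ⟨hq.1, sq_pos_iff.mpr (ne_of_gt hgt)⟩, ?_⟩
      show φ.symm (sideLift 1 a) = q
      have : sideLift 1 a = φ q := by
        ext i; fin_cases i
        · simp [sideLift, a, Real.sqrt_sq_eq_abs, abs_of_pos hgt]
        · simp [sideLift, a]
      rw [this, φ.left_inv hqs]
  have sub : A' ∪ B' ∪ Z' ⊆ N := by
    rintro q ((⟨a, ha, rfl⟩ | ⟨a, ha, rfl⟩) | ⟨a, ha, rfl⟩)
    · exact (good₁ a ha.1).2.1
    · exact (good₂ _ ⟨a, ha.1, rfl⟩).2.1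
    · exact (good₁ a ha.1).2.1
  -- the height difference of the two branches has constant sign
  set g : ℝ × ℝ → ℝ := fun a => Λ.height (s₁ a) - Λ.height (s₂ (θ a))
  have hgc : ContinuousOn g Dp :=
    (Λ.contMDiff_height.continuous.comp_continuousOn (c₁.mono inter_subset_left)).sub
      (Λ.contMDiff_height.continuous.comp_continuousOn (hc₂.mono inter_subset_left))
  have hg0 : ∀ a ∈ Dp, g a ≠ 0 := by
    intro a ha hga
    have hfr : Λ.front (s₁ a) = Λ.front (s₂ (θ a)) :=
      Prod.ext (hAB a ha).symm (sub_eq_zero.mp hga)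
    have g1 := (good₁ a ha.1).1
    have g2 := (good₂ _ ⟨a, ha.1, rfl⟩).1
    have := congrArg ψ hfr
    rw [h.front_eq _ (φ.map_target g1), h.front_eq _ (φ.map_target g2), φ.right_inv g1,
      φ.right_inv g2] at this
    have := congrArg (fun w : Plane × ℝ => w.1 0) this
    simp only [cuspMap, sideLift] at this
    simp [Odd.neg_pow (by decide : Odd 3)] at this
    have p1 : 0 < √a.1 ^ 3 := by have : 0 < a.1 := ha.2; positivity
    have p2 : 0 < √(θ a).1 ^ 3 := by have := hθpos a ha.1 ha.2; positivity
    linarith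
  have hpairs : ∀ x ∈ A', ∀ y ∈ B', Λ.base x = Λ.base y → ∃ a ∈ Dp, x = s₁ a ∧ y = s₂ (θ a) := by
    rintro _ ⟨a, ha, rfl⟩ y hy hxy
    refine ⟨a, ha, rfl, ?_⟩
    exact iB (Or.inl hy) (Or.inl ⟨a, ha, rfl⟩) (hxy.symm.trans (hAB a ha).symm)
  have hsign : (∀ a ∈ Dp, 0 < g a) ∨ ∀ a ∈ Dp, g a < 0 := by
    by_contra hcon
    push Not at hcon
    obtain ⟨⟨a, ha, ha'⟩, b, hb, hb'⟩ := hcon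
    obtain ⟨d, hd, hd0⟩ := hDp.intermediate_value ha hb hgc
      (show (0 : ℝ) ∈ Icc (g a) (g b) from ⟨ha', hb'⟩)
    exact hg0 d hd hd0
  rcases hsign with hs | hs
  · refine ⟨A', B', Z', ⟨nbhd, preA, preB, hne.image _, nA, nB, mZ, iA, iB, im, ?_⟩, sub⟩
    intro x hx y hy hxy
    obtain ⟨a, ha, rfl, rfl⟩ := hpairs x hx y hy hxy
    exact sub_pos.mp (hs a ha)
  · rw [union_comm A' B'] at nbhd sub
    refine ⟨B', A', Z', ⟨nbhd, preB, preA, hne.image _, nB, nA, mZ, iB, iA, im.symm, ?_⟩, sub⟩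
    intro y hy x hx hxy
    obtain ⟨a, ha, rfl, rfl⟩ := hpairs x hx y hy hxy.symm
    exact sub_neg.mp (hs a ha)

theorem exists_isFold (hmild : Λ.HasMildFront) {p : L} (hp : p ∈ Λ.cusp) {N : Set L}
    (hN : N ∈ 𝓝 p) : ∃ A B Z, Λ.IsFold p A B Z ∧ A ∪ B ∪ Z ⊆ N := by
  obtain ⟨φ, ψ, h, hps, h0⟩ := Λ.exists_cuspChart hmild hp
  exact h.exists_isFold hps h0 hN

theorem exists_cusp_arc (hmild : Λ.HasMildFront) {p : L} (hp : p ∈ Λ.cusp) :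
    ∃ ε > 0, ∃ γ : ℝ → L, ContinuousOn γ (Ioo (-ε) ε) ∧ InjOn γ (Ioo (-ε) ε) ∧ γ 0 = p ∧
      ∀ t ∈ Ioo (-ε) ε, γ t ∈ Λ.cusp := by
  obtain ⟨φ, ψ, h, hps, h0⟩ := Λ.exists_cuspChart hmild hp
  exact h.exists_arc hps h0

end LegendrianSurface
end LegendrianSheaf

namespace LegendrianSheaf

open Set Filter

namespace LegendrianSurface

variable {L M : Type*} [TopologicalSpace L] [ChartedSpace Plane L] 
  [TopologicalSpace M] [ChartedSpace Plane M] [IsManifold (𝓡 2) ∞ M] (Λ : LegendrianSurface L M)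

theorem continuous_base : Continuous Λ.base := Λ.contMDiff_base.continuous

theorem continuous_height : Continuous Λ.height := Λ.contMDiff_height.continuous

theorem continuous_front : Continuous Λ.front := Λ.continuous_base.prodMk Λ.continuous_height

variable {Λ}

theorem front_eq_iff {p q : L} :
    Λ.front p = Λ.front q ↔ Λ.base p = Λ.base q ∧ Λ.height p = Λ.height q := Prod.ext_iff

theorem IsFold.mem_edge {p : L} {A B Z : Set L} (h : Λ.IsFold p A B Z) {q : L}
    (hq : q ∈ A ∪ B ∪ Z) (hc : q ∈ Λ.cusp) : q ∈ Z := by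
  rcases hq with (hq | hq) | hq
  · exact absurd hc (h.left_notMem q hq)
  · exact absurd hc (h.right_notMem q hq)
  · exact hq

theorem IsFold.eq_of_base_eq {p : L} {A B Z : Set L} (h : Λ.IsFold p A B Z) {q r : L}
    (hq : q ∈ A ∪ B ∪ Z) (hc : q ∈ Λ.cusp) (hr : r ∈ A ∪ B ∪ Z) (hqr : Λ.base q = Λ.base r) :
    q = r := by
  have hZ := h.mem_edge hq hc
  rcases hr with (hr | hr) | hr
  · exact h.injOn_left (Or.inr hZ) (Or.inl hr) hqr
  · exact h.injOn_right (Or.inr hZ) (Or.inl hr) hqr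
  · exact h.injOn_left (Or.inr hZ) (Or.inr hr) hqr

theorem IsFold.injOn_front {p : L} {A B Z : Set L} (h : Λ.IsFold p A B Z) :
    InjOn Λ.front (A ∪ B ∪ Z) := by
  intro q hq r hr hqr
  rw [front_eq_iff] at hqr
  by_cases hc : q ∈ Λ.cusp
  · exact h.eq_of_base_eq hq hc hr hqr.1
  by_cases hc' : r ∈ Λ.cusp
  · exact (h.eq_of_base_eq hr hc' hq hqr.1.symm).symm
  rcases hq with (hq | hq) | hq
  · rcases hr with (hr | hr) | hr
    · exact h.injOn_left (Or.inl hq) (Or.inl hr) hqr.1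
    · exact absurd hqr.2 (h.above q hq r hr hqr.1).ne'
    · exact absurd (h.edge_mem hr) hc'
  · rcases hr with (hr | hr) | hr
    · exact absurd hqr.2 (h.above r hr q hq hqr.1.symm).ne
    · exact h.injOn_right (Or.inl hq) (Or.inl hr) hqr.1
    · exact absurd (h.edge_mem hr) hc'
  · exact absurd (h.edge_mem hq) hc

section

variable [IsManifold (𝓡 2) ∞ L]

theorem exists_injOn_base {p : L} (hp : p ∉ Λ.cusp) : ∃ U ∈ 𝓝 p, InjOn Λ.base U := by
  obtain ⟨Φ, hΦ, hb⟩ := Λ.exists_localHomeomorph hp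
  exact ⟨Φ.source, Φ.open_source.mem_nhds hΦ, hb.injOn_iff.mp Φ.injOn⟩

theorem map_base_nhds {p : L} (hp : p ∉ Λ.cusp) : map Λ.base (𝓝 p) = 𝓝 (Λ.base p) := by
  obtain ⟨Φ, hΦ, hb⟩ := Λ.exists_localHomeomorph hp
  rw [← hb hΦ, ← Φ.map_nhds_eq hΦ]
  exact Filter.map_congr (by
    filter_upwards [Φ.open_source.mem_nhds hΦ] with q hq using (hb hq).symm)

variable (hmild : Λ.HasMildFront)
include hmild

theorem isClosed_cusp : IsClosed Λ.cusp := by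
  rw [← isOpen_compl_iff, isOpen_iff_mem_nhds]
  intro p hp
  obtain ⟨Φ, hΦ, hb⟩ := Λ.exists_localHomeomorph hp
  filter_upwards [Φ.open_source.mem_nhds hΦ] with q hq hc
  obtain ⟨A, B, Z, h, hsub⟩ := exists_isFold hmild hc (Φ.open_source.mem_nhds hq)
  obtain ⟨a, ha⟩ := h.nonempty_left
  obtain ⟨b, hb', hab⟩ := (h.image_eq ▸ mem_image_of_mem Λ.base ha : Λ.base a ∈ Λ.base '' B)
  have := hb.injOn_iff.mp Φ.injOn (hsub (Or.inl (Or.inr hb'))) (hsub (Or.inl (Or.inl ha))) hab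
  have h2 := h.above a ha b hb' hab.symm
  rw [this] at h2
  exact lt_irrefl _ h2

theorem eventually_eq_of_base_eq (p : L) : ∀ᶠ q in 𝓝 p, Λ.base q = Λ.base p → q = p := by
  by_cases hp : p ∈ Λ.cusp
  · obtain ⟨A, B, Z, h, -⟩ := exists_isFold hmild hp univ_mem
    filter_upwards [h.mem_nhds] with q hq hqp
    exact (h.eq_of_base_eq (mem_of_mem_nhds h.mem_nhds) hp hq hqp.symm).symm
  · obtain ⟨U, hU, hi⟩ := exists_injOn_base hp
    filter_upwards [hU] with q hq hqp
    exact hi hq (mem_of_mem_nhds hU) hqp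

theorem exists_injOn_front (p : L) : ∃ U ∈ 𝓝 p, InjOn Λ.front U := by
  by_cases hp : p ∈ Λ.cusp
  · obtain ⟨A, B, Z, h, -⟩ := exists_isFold hmild hp univ_mem
    exact ⟨_, h.mem_nhds, h.injOn_front⟩
  · obtain ⟨U, hU, hi⟩ := exists_injOn_base hp
    exact ⟨U, hU, fun a ha b hb hab => hi ha hb (front_eq_iff.mp hab).1⟩

variable [CompactSpace L] [T2Space M]

theorem finite_fiber (x : M) : {q | Λ.base q = x}.Finite := by
  have hc : IsCompact {q | Λ.base q = x} :=
    (isClosed_singleton.preimage Λ.continuous_base).isCompact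
  obtain ⟨t', ht'⟩ := hc.elim_nhds_subcover' (fun p _ => {q | Λ.base q = Λ.base p → q = p})
    (fun p _ => eventually_eq_of_base_eq hmild p)
  classical
  refine (t'.image Subtype.val).finite_toSet.subset fun q hq => ?_
  obtain ⟨p, hp, hqp⟩ := mem_iUnion₂.mp (ht' hq)
  have : q = p := hqp (by rw [show Λ.base q = x from hq, show Λ.base p = x from p.2])
  rw [this]
  exact Finset.mem_coe.mpr (Finset.mem_image_of_mem _ hp)

end

end LegendrianSurface
end LegendrianSheaf

namespace LegendrianSheaf

open Set Filter

namespace LegendrianSurface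

variable {L M : Type*} [TopologicalSpace L] [ChartedSpace Plane L]
  [TopologicalSpace M] [ChartedSpace Plane M] [IsManifold (𝓡 2) ∞ M] (Λ : LegendrianSurface L M)

open Classical in
/-- The contribution of a point to the depth of its image in the front. -/
noncomputable def weight (p : L) : ℕ := if p ∈ Λ.cusp then 2 else 1

theorem weight_pos (p : L) : 0 < Λ.weight p := by
  rw [weight]; split_ifs <;> norm_num

theorem weight_le_two (p : L) : Λ.weight p ≤ 2 := by
  rw [weight]; split_ifs <;> norm_num

variable {Λ}

theorem weight_of_mem {p : L} (h : p ∈ Λ.cusp) : Λ.weight p = 2 := if_pos h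

theorem weight_of_notMem {p : L} (h : p ∉ Λ.cusp) : Λ.weight p = 1 := if_neg h

theorem weight_le_finrank (p : L) :
    Λ.weight p ≤ Module.finrank ℝ ((Plane × ℝ) ⧸ Λ.frontTangent p) := by
  have h1 := Submodule.finrank_quotient_add_finrank (Λ.frontTangent p)
  have h2 := LinearMap.finrank_range_add_finrank_ker (Λ.frontDiff p)
  have h3 : Module.finrank ℝ (Plane × ℝ) = 3 := by simp
  have h4 : Module.finrank ℝ Plane = 2 := by simp
  rw [h3] at h1
  rw [h4] at h2
  rw [frontTangent] at h1 ⊢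
  by_cases hp : p ∈ Λ.cusp
  · rw [weight_of_mem hp]
    have : LinearMap.ker (Λ.frontDiff p) ≠ ⊥ := fun h => hp (LinearMap.ker_eq_bot.mp h)
    have key : ∀ a b c : ℕ, a + b = 3 → b + c = 2 → 1 ≤ c → 2 ≤ a := by lia
    exact key _ _ _ h1 h2 (Submodule.one_le_finrank_iff.mpr this)
  · rw [weight_of_notMem hp]
    have key : ∀ a b c : ℕ, a + b = 3 → b + c = 2 → 1 ≤ a := by lia
    exact key _ _ _ h1 h2

section

variable [IsManifold (𝓡 2) ∞ L] [CompactSpace L] [T2Space M]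
  (hmild : Λ.HasMildFront)
include hmild

theorem finite_frontFiber (w : M × ℝ) : {p | Λ.front p = w}.Finite :=
  (finite_fiber hmild w.1).subset fun _ hp => congrArg Prod.fst hp

theorem frontDepth_eq (w : M × ℝ) :
    Λ.frontDepth w = ∑ p ∈ (finite_frontFiber hmild w).toFinset, Λ.weight p := by
  classical
  have h1 : {p | Λ.front p = w ∧ p ∉ Λ.cusp}
      = ((finite_frontFiber hmild w).toFinset.filter (· ∉ Λ.cusp) : Finset L) := by
    ext; simp
  have h2 : {p | Λ.front p = w ∧ p ∈ Λ.cusp}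
      = ((finite_frontFiber hmild w).toFinset.filter (· ∈ Λ.cusp) : Finset L) := by
    ext; simp
  rw [frontDepth, h1, h2, ncard_coe_finset, ncard_coe_finset,
    ← Finset.sum_filter_add_sum_filter_not _ (· ∈ Λ.cusp), add_comm, mul_comm,
    Finset.sum_congr rfl (g := fun _ => 2) fun p hp => weight_of_mem (Finset.mem_filter.mp hp).2,
    Finset.sum_congr rfl (g := fun _ => 1) fun p hp => weight_of_notMem (Finset.mem_filter.mp hp).2]
  simp

theorem sum_weight_le_frontDepth {w : M × ℝ} {P : Finset L} (hP : ∀ p ∈ P, Λ.front p = w) :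
    ∑ p ∈ P, Λ.weight p ≤ Λ.frontDepth w := by
  rw [frontDepth_eq hmild]
  exact Finset.sum_le_sum_of_subset fun p hp => by simpa using hP p hp

theorem frontDepth_le_finrank (hfront : Λ.FrontTransverse) (w : M × ℝ) :
    Λ.frontDepth w ≤ Module.finrank ℝ ((Plane × ℝ) ⧸ Λ.stratumTangent w) := by
  have h := hfront w (finite_frontFiber hmild w).toFinset fun p hp => by simpa using hp
  have e : Λ.stratumTangent w
      = ⨅ p ∈ (finite_frontFiber hmild w).toFinset, Λ.frontTangent p := by
    simp [stratumTangent]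
  rw [frontDepth_eq hmild, e, h]
  exact Finset.sum_le_sum fun p _ => weight_le_finrank p

theorem sum_frontDepth_le (hfront : Λ.FrontTransverse) (hbase : Λ.BaseTransverse) (x : M)
    (Z : Finset ℝ) : ∑ z ∈ Z, (Λ.frontDepth (x, z) - 1) ≤ 2 := by
  have h2 : Module.finrank ℝ Plane = 2 := by simp
  have h3 : Module.finrank ℝ (Plane × ℝ) = 3 := by simp
  have key : ∀ z, Λ.frontDepth (x, z) - 1 ≤ Module.finrank ℝ
      (Plane ⧸ (Λ.stratumTangent (x, z)).map (LinearMap.fst ℝ Plane ℝ)) := by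
    intro z
    have a := frontDepth_le_finrank hmild hfront (x, z)
    have b := Submodule.finrank_quotient_add_finrank (Λ.stratumTangent (x, z))
    have c := Submodule.finrank_quotient_add_finrank
      ((Λ.stratumTangent (x, z)).map (LinearMap.fst ℝ Plane ℝ))
    have d := Submodule.finrank_map_le (LinearMap.fst ℝ Plane ℝ) (Λ.stratumTangent (x, z))
    have key : ∀ a b c e f : ℕ, a ≤ b → b + c = 3 → e + f = 2 → f ≤ c → a - 1 ≤ e := by lia
    exact key _ _ _ _ _ a (b.trans h3) (c.trans h2) d
  refine (Finset.sum_le_sum fun z _ => key z).trans ?_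
  rw [← hbase x Z]
  exact (Submodule.finrank_quotient_le _).trans h2.le

theorem support_frontDepth_sub_one_subset (x : M) :
    (fun z : ℝ => Λ.frontDepth (x, z) - 1).support ⊆
      ((finite_fiber hmild x).image Λ.height).toFinset := by
  intro z hz
  rw [Function.mem_support] at hz
  have : 0 < Λ.frontDepth (x, z) := by lia
  rw [frontDepth_eq hmild] at this
  obtain ⟨p, hp, -⟩ := Finset.exists_ne_zero_of_sum_ne_zero this.ne'
  have hp' : Λ.front p = (x, z) := by simpa using hp
  simp only [Finite.coe_toFinset]
  exact ⟨p, congrArg Prod.fst hp', congrArg Prod.snd hp'⟩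

variable {V : Type*} {ℰ : Triangulation V M}

theorem sum_weight_add_card_le (hfront : Λ.FrontTransverse) (hbase : Λ.BaseTransverse)
    (hcompat : Compatible Λ ℰ) {w : M × ℝ} {P : Finset L} (hne : P.Nonempty)
    (hP : ∀ p ∈ P, Λ.front p = w) {I : Finset V} (hI : w.1 ∈ ℰ.cell I) :
    ∑ p ∈ P, Λ.weight p + I.card ≤ 4 := by
  obtain ⟨p, hp⟩ := hne
  have hs := support_frontDepth_sub_one_subset hmild w.1
  set Z := ((finite_fiber hmild w.1).image Λ.height).toFinset
  have hk : ∑ᶠ z : ℝ, (Λ.frontDepth (w.1, z) - 1) = ∑ z ∈ Z, (Λ.frontDepth (w.1, z) - 1) :=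
    finsum_eq_sum_of_support_subset _ hs
  have hle := sum_frontDepth_le hmild hfront hbase w.1 Z
  obtain ⟨I', -, hc, hI'⟩ := hcompat _ hle ⟨⟨p, congrArg Prod.fst (hP p hp)⟩, hk⟩
  obtain rfl : I' = I := Finset.ext fun v => (hI' v).symm.trans (hI v)
  have h1 := sum_weight_le_frontDepth hmild hP
  have hz : w.2 ∈ Z := by
    simp only [Z, Finite.mem_toFinset]
    exact ⟨p, congrArg Prod.fst (hP p hp), congrArg Prod.snd (hP p hp)⟩
  have h2 := Finset.single_le_sum (f := fun z => Λ.frontDepth (w.1, z) - 1)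
    (fun _ _ => Nat.zero_le _) hz
  simp only [Prod.mk.eta] at h2
  lia

theorem card_le_two_of_mem_cusp (hfront : Λ.FrontTransverse) (hbase : Λ.BaseTransverse)
    (hcompat : Compatible Λ ℰ) {p : L} (hp : p ∈ Λ.cusp) {I : Finset V}
    (hI : Λ.base p ∈ ℰ.cell I) : I.card ≤ 2 := by
  have := sum_weight_add_card_le hmild hfront hbase hcompat (w := Λ.front p)
    (Finset.singleton_nonempty p) (by simp) hI
  simp [weight_of_mem hp] at this
  lia

theorem card_le_of_front_eq (hfront : Λ.FrontTransverse) (hbase : Λ.BaseTransverse)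
    (hcompat : Compatible Λ ℰ) {p q : L} (hne : p ≠ q) (hpq : Λ.front p = Λ.front q)
    {I : Finset V} (hI : Λ.base p ∈ ℰ.cell I) : Λ.weight p + Λ.weight q + I.card ≤ 4 := by
  classical
  have := sum_weight_add_card_le hmild hfront hbase hcompat (w := Λ.front p) (P := {p, q})
    (by simp) (by simp [hpq]) hI
  rwa [Finset.sum_pair hne] at this

theorem exists_front_eq_of_frontDepth_eq [T2Space L] {q₀ : L} {U : Set L} (hU : U ∈ 𝓝 q₀) :
    ∀ᶠ w in 𝓝 (Λ.front q₀), Λ.frontDepth w = Λ.frontDepth (Λ.front q₀) →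
      ∃ q ∈ U, Λ.front q = w ∧ (q₀ ∈ Λ.cusp → q ∈ Λ.cusp) := by
  classical
  set w₀ := Λ.front q₀
  have hfin := finite_frontFiber hmild w₀
  obtain ⟨D, hD, hdisj⟩ := hfin.t2_separation
  have hcov : ∀ p : L, ∃ N ∈ 𝓝 p, InjOn Λ.front N ∧ N ⊆ D p ∧ (p ∉ Λ.cusp → Disjoint N Λ.cusp) ∧
      (p = q₀ → N ⊆ U) := by
    intro p
    obtain ⟨N, hN, hi⟩ := exists_injOn_front hmild p
    have h1 : (if p ∈ Λ.cusp then univ else Λ.cuspᶜ) ∈ 𝓝 p := by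
      split_ifs with h
      · exact univ_mem
      · exact (isClosed_cusp hmild).isOpen_compl.mem_nhds h
    have h2 : (if p = q₀ then U else univ) ∈ 𝓝 p := by
      split_ifs with h
      · exact h ▸ hU
      · exact univ_mem
    refine ⟨_, inter_mem (inter_mem hN ((hD p).2.mem_nhds (hD p).1)) (inter_mem h1 h2),
      hi.mono fun a ha => ha.1.1, fun a ha => ha.1.2, fun h => ?_, fun h a ha => ?_⟩
    · rw [disjoint_left]
      intro a ha
      have := ha.2.1
      rwa [if_neg h] at this
    · have := ha.2.2
      rwa [if_pos h] at this
  choose N hN hinj hND hNc hNU using hcov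
  have hcm : IsClosedMap Λ.front := Λ.continuous_front.isClosedMap
  have hev : ∀ᶠ w in 𝓝 w₀, ∀ q, Λ.front q = w → ∃ p, Λ.front p = w₀ ∧ q ∈ N p := by
    have := hcm.eventually_nhds_fiber (y₀ := w₀)
      (p := fun q => ∃ p, Λ.front p = w₀ ∧ q ∈ N p) (fun p hp => by
        filter_upwards [hN p] with q hq using ⟨p, hp, hq⟩)
    simpa using this
  filter_upwards [hev] with w hw hdepth
  choose f hf hfN using hw
  let g : L → L := fun q => if h : Λ.front q = w then f q h else q
  have hg : ∀ q, Λ.front q = w → Λ.front (g q) = w₀ ∧ q ∈ N (g q) := by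
    intro q hq
    simp only [g, dif_pos hq]
    exact ⟨hf q hq, hfN q hq⟩
  have hwt : ∀ q, Λ.front q = w → Λ.weight q ≤ Λ.weight (g q) := by
    intro q hq
    by_cases hc : g q ∈ Λ.cusp
    · rw [weight_of_mem hc]; exact Λ.weight_le_two q
    · rw [weight_of_notMem hc, weight_of_notMem]
      exact fun h => disjoint_left.mp (hNc _ hc) (hg q hq).2 h
  set P := (finite_frontFiber hmild w).toFinset
  have hP : ∀ q ∈ P, Λ.front q = w := fun q hq => by simpa [P] using hq
  have hgi : InjOn g P := by
    intro a ha b hb hab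
    have h1 := hg a (hP a ha)
    have h2 := hg b (hP b hb)
    rw [← hab] at h2
    exact hinj _ h1.2 h2.2 ((hP a ha).trans (hP b hb).symm)
  have hsub : P.image g ⊆ hfin.toFinset := by
    intro p hp
    obtain ⟨q, hq, rfl⟩ := Finset.mem_image.mp hp
    simpa using (hg q (hP q hq)).1
  rw [frontDepth_eq hmild, frontDepth_eq hmild] at hdepth
  have s1 : ∑ q ∈ P, Λ.weight q ≤ ∑ q ∈ P, Λ.weight (g q) :=
    Finset.sum_le_sum fun q hq => hwt q (hP q hq)
  have s2 : ∑ q ∈ P, Λ.weight (g q) = ∑ p ∈ P.image g, Λ.weight p :=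
    (Finset.sum_image hgi).symm
  have s3 := Finset.sum_le_sum_of_subset (f := Λ.weight) hsub
  have hq₀ : q₀ ∈ P.image g := by
    by_contra hn
    have : ∑ p ∈ P.image g, Λ.weight p < ∑ p ∈ hfin.toFinset, Λ.weight p :=
      Finset.sum_lt_sum_of_subset hsub (by simp [w₀]) hn (Λ.weight_pos q₀) fun _ _ _ => Nat.zero_le _
    lia
  obtain ⟨q, hq, hqq⟩ := Finset.mem_image.mp hq₀
  refine ⟨q, hNU q₀ rfl (hqq ▸ (hg q (hP q hq)).2), hP q hq, fun hc => ?_⟩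
  have hall := (Finset.sum_eq_sum_iff_of_le fun q hq => hwt q (hP q hq)).mp
    (le_antisymm s1 (by lia)) q hq
  by_contra hnc
  rw [hqq, weight_of_mem hc, weight_of_notMem hnc] at hall
  lia

end

end LegendrianSurface
end LegendrianSheaf

namespace LegendrianSheaf

open Set Filter

namespace Triangulation

variable {V M : Type*} [TopologicalSpace M] (ℰ : Triangulation V M)

theorem coord_nonneg (x : M) (v : V) : 0 ≤ ℰ.coord x v := (ℰ.homeo x).2.1 v

theorem isInducing_coord : Topology.IsInducing ℰ.coord :=
  Topology.IsInducing.subtypeVal.comp ℰ.homeo.isInducing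

theorem coord_injective : Function.Injective ℰ.coord :=
  Subtype.val_injective.comp ℰ.homeo.injective

theorem continuous_coord (v : V) : Continuous fun x => ℰ.coord x v :=
  (continuous_apply v).comp ℰ.isInducing_coord.continuous

theorem continuousOn_iff {X : Type*} [TopologicalSpace X] {f : X → M} {s : Set X} :
    ContinuousOn f s ↔ ∀ v, ContinuousOn (fun a => ℰ.coord (f a) v) s := by
  rw [ℰ.isInducing_coord.continuousOn_iff, continuousOn_pi]
  rfl

variable {ℰ}

theorem nonempty_of_mem_faces {F : Finset V} (hF : F ∈ ℰ.faces) : F.Nonempty :=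
  ℰ.complex.isRelLowerSet_faces.prop_of_mem hF

theorem mem_faces_of_subset {F J : Finset V} (hF : F ∈ ℰ.faces) (hJ : J.Nonempty) (h : J ⊆ F) :
    J ∈ ℰ.faces :=
  ℰ.complex.isRelLowerSet_faces.mem_of_le hF h hJ

theorem exists_coord_eq {F : Finset V} (hF : F ∈ ℰ.faces) {b : V → ℝ} (h0 : ∀ v, 0 ≤ b v)
    (hb : ∀ v ∉ F, b v = 0) (h1 : ∑ v ∈ F, b v = 1) : ∃ x, ℰ.coord x = b :=
  ⟨ℰ.homeo.symm ⟨b, h0, F, hF, hb, h1⟩, by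
    funext v
    simp [coord]⟩

theorem exists_face (ℰ : Triangulation V M) (x : M) :
    ∃ F ∈ ℰ.faces, (∀ v ∉ F, ℰ.coord x v = 0) ∧ ∑ v ∈ F, ℰ.coord x v = 1 :=
  (ℰ.homeo x).2.2

theorem finite_support (ℰ : Triangulation V M) (x : M) : {v | 0 < ℰ.coord x v}.Finite := by
  obtain ⟨F, -, h, -⟩ := ℰ.exists_face x
  refine F.finite_toSet.subset fun v hv => ?_
  by_contra hn
  exact (ne_of_gt (show 0 < ℰ.coord x v from hv)) (h v hn)

/-- The vertices of the simplex whose interior contains a point. -/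
noncomputable def supp (ℰ : Triangulation V M) (x : M) : Finset V := (ℰ.finite_support x).toFinset

@[simp]
theorem mem_supp {x : M} {v : V} : v ∈ ℰ.supp x ↔ 0 < ℰ.coord x v := by simp [supp]

theorem coord_eq_zero {x : M} {v : V} (h : v ∉ ℰ.supp x) : ℰ.coord x v = 0 :=
  le_antisymm (not_lt.mp fun h' => h (mem_supp.mpr h')) (ℰ.coord_nonneg x v)

theorem mem_cell_iff {x : M} {K : Finset V} : x ∈ ℰ.cell K ↔ ℰ.supp x = K := by
  rw [Finset.ext_iff]
  simp only [mem_supp]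
  rfl

theorem mem_cell_supp (x : M) : x ∈ ℰ.cell (ℰ.supp x) := mem_cell_iff.mpr rfl

theorem sum_coord {x : M} {F : Finset V} (h : ℰ.supp x ⊆ F) : ∑ v ∈ F, ℰ.coord x v = 1 := by
  classical
  obtain ⟨G, -, hG, h1⟩ := ℰ.exists_face x
  rw [← h1]
  have hs : ℰ.supp x ⊆ G := fun v hv => by
    by_contra hn
    exact (mem_supp.mp hv).ne' (hG v hn)
  rw [← Finset.sum_subset h fun v _ hv => coord_eq_zero hv,
    ← Finset.sum_subset hs fun v _ hv => coord_eq_zero hv]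

theorem supp_mem_faces (x : M) : ℰ.supp x ∈ ℰ.faces := by
  obtain ⟨G, hG, hG', h1⟩ := ℰ.exists_face x
  refine mem_faces_of_subset hG ?_ fun v hv => ?_
  · rw [Finset.nonempty_iff_ne_empty]
    intro h
    have := sum_coord (ℰ := ℰ) (x := x) subset_rfl
    simp [h] at this
  · by_contra hn
    exact (mem_supp.mp hv).ne' (hG' v hn)

theorem mem_faces_of_mem_cell {x : M} {K : Finset V} (h : x ∈ ℰ.cell K) : K ∈ ℰ.faces :=
  mem_cell_iff.mp h ▸ supp_mem_faces x

/-- The closed simplex with vertex set `K`. -/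
def closedCell (ℰ : Triangulation V M) (K : Finset V) : Set M := {x | ∀ v ∉ K, ℰ.coord x v = 0}

theorem mem_closedCell_iff {x : M} {K : Finset V} : x ∈ ℰ.closedCell K ↔ ℰ.supp x ⊆ K := by
  constructor
  · intro h v hv
    by_contra hn
    exact (mem_supp.mp hv).ne' (h v hn)
  · exact fun h v hv => coord_eq_zero fun h' => hv (h h')

theorem isClosed_closedCell (K : Finset V) : IsClosed (ℰ.closedCell K) := by
  simp only [closedCell, ofPred_forall]
  exact isClosed_iInter fun v => isClosed_iInter fun _ =>
    isClosed_eq (ℰ.continuous_coord v) continuous_const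

theorem cell_subset_closedCell (K : Finset V) : ℰ.cell K ⊆ ℰ.closedCell K := fun _ hx =>
  mem_closedCell_iff.mpr (mem_cell_iff.mp hx).subset

theorem closedCell_mono {J K : Finset V} (h : J ⊆ K) : ℰ.closedCell J ⊆ ℰ.closedCell K :=
  fun _ hx v hv => hx v fun h' => hv (h h')

/-- The open star of the open simplex with vertex set `J`. -/
def star (ℰ : Triangulation V M) (J : Finset V) : Set M := {x | J ⊆ ℰ.supp x}

theorem isOpen_star (J : Finset V) : IsOpen (ℰ.star J) := by
  have : ℰ.star J = ⋂ v ∈ J, {x | 0 < ℰ.coord x v} := by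
    ext x
    simp [star, Finset.subset_iff]
  rw [this]
  exact isOpen_biInter_finset fun v _ => isOpen_lt continuous_const (ℰ.continuous_coord v)

theorem eventually_supp_subset (x : M) : ∀ᶠ y in 𝓝 x, ℰ.supp x ⊆ ℰ.supp y :=
  (isOpen_star (ℰ.supp x)).mem_nhds (show ℰ.supp x ⊆ ℰ.supp x from subset_rfl)

theorem finite_faces_superset (ℰ : Triangulation V M) {J : Finset V} (hJ : J.Nonempty) :
    {F | F ∈ ℰ.faces ∧ J ⊆ F}.Finite := by
  obtain ⟨v, hv⟩ := hJ
  exact (ℰ.locallyFinite v).subset fun F hF => ⟨hF.1, hF.2 hv⟩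

theorem sum_coord_of_mem {x : M} {K : Finset V} (h : x ∈ ℰ.closedCell K) :
    ∑ v ∈ K, ℰ.coord x v = 1 := sum_coord (mem_closedCell_iff.mp h)

/-- The points of a closed simplex whose coordinates lie in a convex set form a connected set. -/
theorem isPreconnected_closedCell_inter {K : Finset V} (hK : K ∈ ℰ.faces) {C : Set (V → ℝ)}
    (hC : Convex ℝ C) : _root_.IsPreconnected (ℰ.closedCell K ∩ ℰ.coord ⁻¹' C) := by
  rw [← ℰ.isInducing_coord.isPreconnected_image]
  have : ℰ.coord '' (ℰ.closedCell K ∩ ℰ.coord ⁻¹' C)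
      = {b | (∀ v, 0 ≤ b v) ∧ (∀ v ∉ K, b v = 0) ∧ ∑ v ∈ K, b v = 1} ∩ C := by
    ext b
    constructor
    · rintro ⟨x, ⟨hx, hxC⟩, rfl⟩
      exact ⟨⟨ℰ.coord_nonneg x, hx, sum_coord_of_mem hx⟩, hxC⟩
    · rintro ⟨⟨h0, h1, h2⟩, hb⟩
      obtain ⟨x, rfl⟩ := exists_coord_eq hK h0 h1 h2
      exact ⟨x, ⟨h1, hb⟩, rfl⟩
  rw [this]
  refine (Convex.inter ?_ hC).isPreconnected
  rintro a ⟨ha0, ha1, ha2⟩ b ⟨hb0, hb1, hb2⟩ s t hs ht hst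
  refine ⟨fun v => ?_, fun v hv => ?_, ?_⟩
  · simp only [Pi.add_apply, Pi.smul_apply, smul_eq_mul]
    exact add_nonneg (mul_nonneg hs (ha0 v)) (mul_nonneg ht (hb0 v))
  · simp [ha1 v hv, hb1 v hv]
  · simp only [Pi.add_apply, Pi.smul_apply, smul_eq_mul, Finset.sum_add_distrib, ← Finset.mul_sum,
      ha2, hb2]
    simpa using hst

theorem cell_eq_inter (K : Finset V) :
    ℰ.cell K = ℰ.closedCell K ∩ ℰ.coord ⁻¹' {b | ∀ v ∈ K, 0 < b v} := by
  ext x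
  constructor
  · exact fun h => ⟨cell_subset_closedCell K h, fun v hv => (h v).mpr hv⟩
  · rintro ⟨h1, h2⟩ v
    refine ⟨fun h => ?_, h2 v⟩
    by_contra hn
    exact h.ne' (h1 v hn)

theorem convex_setOf_pos (K : Finset V) : Convex ℝ {b : V → ℝ | ∀ v ∈ K, 0 < b v} := by
  simp only [ofPred_forall]
  exact convex_iInter₂ fun v _ => convex_halfSpace_gt
    ⟨fun _ _ => rfl, fun _ _ => rfl⟩ 0

theorem isPreconnected_cell {K : Finset V} (hK : K ∈ ℰ.faces) :
    _root_.IsPreconnected (ℰ.cell K) := by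
  rw [cell_eq_inter]
  exact isPreconnected_closedCell_inter hK (convex_setOf_pos K)

/-- A neighbourhood basis which meets an open simplex in connected sets. -/
theorem exists_nhds_isPreconnected_inter_cell {K : Finset V} (hK : K ∈ ℰ.faces) {x : M} {U : Set M}
    (hU : U ∈ 𝓝 x) : ∃ N ∈ 𝓝 x, N ⊆ U ∧ _root_.IsPreconnected (N ∩ ℰ.cell K) := by
  rw [ℰ.isInducing_coord.nhds_eq_comap] at hU
  obtain ⟨W, hW, hWU⟩ := hU
  obtain ⟨C, ⟨hC, hconv⟩, hCW⟩ := (LocallyConvexSpace.convex_basis (𝕜 := ℝ)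
    (ℰ.coord x)).mem_iff.mp hW
  refine ⟨ℰ.coord ⁻¹' C, ℰ.isInducing_coord.continuous.continuousAt.preimage_mem_nhds hC,
    (preimage_mono hCW).trans hWU, ?_⟩
  rw [cell_eq_inter, inter_left_comm, ← preimage_inter]
  exact isPreconnected_closedCell_inter hK (hconv.inter (convex_setOf_pos K))

open Classical in
/-- The straight segment between two points of a closed simplex. -/
noncomputable def seg (ℰ : Triangulation V M) (x y : M) (t : ℝ) : M :=
  if h : ∃ z, ℰ.coord z = fun v => (1 - t) * ℰ.coord x v + t * ℰ.coord y v then h.choose else x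

theorem coord_seg {K : Finset V} (hK : K ∈ ℰ.faces) {x y : M} (hx : x ∈ ℰ.closedCell K)
    (hy : y ∈ ℰ.closedCell K) {t : ℝ} (ht : t ∈ Icc (0 : ℝ) 1) (v : V) :
    ℰ.coord (ℰ.seg x y t) v = (1 - t) * ℰ.coord x v + t * ℰ.coord y v := by
  have h : ∃ z, ℰ.coord z = fun v => (1 - t) * ℰ.coord x v + t * ℰ.coord y v := by
    refine exists_coord_eq hK (fun v => ?_) (fun v hv => ?_) ?_
    · exact add_nonneg (mul_nonneg (sub_nonneg.mpr ht.2) (ℰ.coord_nonneg x v))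
        (mul_nonneg ht.1 (ℰ.coord_nonneg y v))
    · simp [hx v hv, hy v hv]
    · simp [Finset.sum_add_distrib, ← Finset.mul_sum, sum_coord_of_mem hx, sum_coord_of_mem hy]
  rw [seg, dif_pos h, h.choose_spec]

theorem seg_zero (ℰ : Triangulation V M) (x y : M) : ℰ.seg x y 0 = x := by
  have h : ∃ z, ℰ.coord z = fun v => (1 - 0) * ℰ.coord x v + 0 * ℰ.coord y v := ⟨x, by simp⟩
  rw [seg, dif_pos h]
  exact ℰ.coord_injective (h.choose_spec.trans (by simp))

theorem seg_one (ℰ : Triangulation V M) (x y : M) : ℰ.seg x y 1 = y := by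
  have h : ∃ z, ℰ.coord z = fun v => (1 - 1) * ℰ.coord x v + 1 * ℰ.coord y v := ⟨y, by simp⟩
  rw [seg, dif_pos h]
  exact ℰ.coord_injective (h.choose_spec.trans (by simp))

theorem seg_mem_closedCell {K : Finset V} (hK : K ∈ ℰ.faces) {x y : M} (hx : x ∈ ℰ.closedCell K)
    (hy : y ∈ ℰ.closedCell K) {t : ℝ} (ht : t ∈ Icc (0 : ℝ) 1) :
    ℰ.seg x y t ∈ ℰ.closedCell K := by
  intro v hv
  rw [coord_seg hK hx hy ht, hx v hv, hy v hv]
  simp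

theorem seg_mem_cell {K : Finset V} {x y : M} (hx : x ∈ ℰ.closedCell K)
    (hy : y ∈ ℰ.cell K) {t : ℝ} (ht : t ∈ Ioc (0 : ℝ) 1) : ℰ.seg x y t ∈ ℰ.cell K := by
  have hK := mem_faces_of_mem_cell hy
  have hy' := cell_subset_closedCell K hy
  have ht' : t ∈ Icc (0 : ℝ) 1 := ⟨ht.1.le, ht.2⟩
  rw [cell_eq_inter]
  refine ⟨seg_mem_closedCell hK hx hy' ht', fun v hv => ?_⟩
  rw [coord_seg hK hx hy' ht']
  have := (hy v).mpr hv
  exact add_pos_of_nonneg_of_pos (mul_nonneg (sub_nonneg.mpr ht.2) (ℰ.coord_nonneg x v))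
    (mul_pos ht.1 this)

theorem continuousOn_seg {K : Finset V} (hK : K ∈ ℰ.faces) :
    ContinuousOn (fun a : M × M × ℝ => ℰ.seg a.1 a.2.1 a.2.2)
      (ℰ.closedCell K ×ˢ ℰ.closedCell K ×ˢ Icc (0 : ℝ) 1) := by
  rw [ℰ.continuousOn_iff]
  intro v
  have c := ℰ.continuous_coord v
  refine ContinuousOn.congr (f := fun a : M × M × ℝ =>
    (1 - a.2.2) * ℰ.coord a.1 v + a.2.2 * ℰ.coord a.2.1 v) ?_
    fun a ha => coord_seg hK ha.1 ha.2.1 ha.2.2 v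
  have c1 := c.comp (continuous_fst (X := M) (Y := M × ℝ))
  have c2 := c.comp (continuous_fst.comp (continuous_snd (X := M) (Y := M × ℝ)))
  have c3 : Continuous fun a : M × M × ℝ => a.2.2 := by fun_prop
  exact (((continuous_const.sub c3).mul c1).add (c3.mul c2)).continuousOn

theorem tendsto_seg {K : Finset V} (hK : K ∈ ℰ.faces) {x y : M} (hx : x ∈ ℰ.closedCell K)
    (hy : y ∈ ℰ.closedCell K) : Tendsto (ℰ.seg x y) (𝓝[>] 0) (𝓝 x) := by
  have h := (continuousOn_seg hK).comp (s := Icc (0 : ℝ) 1) (f := fun t => (x, y, t))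
    (by fun_prop) (fun t ht => ⟨hx, hy, ht⟩)
  have h0 := (h 0 (left_mem_Icc.mpr zero_le_one)).tendsto
  simp only [Function.comp_def, seg_zero] at h0
  refine h0.mono_left ?_
  rw [← nhdsWithin_Ioo_eq_nhdsGT (zero_lt_one' ℝ)]
  exact nhdsWithin_mono _ Ioo_subset_Icc_self

theorem eventually_mem_Ioc : ∀ᶠ t : ℝ in 𝓝[>] 0, t ∈ Ioc (0 : ℝ) 1 := Ioc_mem_nhdsGT zero_lt_one

/-- The barycentre of a simplex. -/
def IsCenter (ℰ : Triangulation V M) (J : Finset V) (x : M) : Prop :=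
  x ∈ ℰ.cell J ∧ ∀ v ∈ J, ℰ.coord x v = (J.card : ℝ)⁻¹

theorem IsCenter.eq {J : Finset V} {x y : M} (hx : ℰ.IsCenter J x) (hy : ℰ.IsCenter J y) :
    x = y := by
  refine ℰ.coord_injective (funext fun v => ?_)
  by_cases hv : v ∈ J
  · rw [hx.2 v hv, hy.2 v hv]
  · rw [cell_subset_closedCell J hx.1 v hv, cell_subset_closedCell J hy.1 v hv]

theorem exists_mem_cell_coord_eq {J : Finset V} (hJ : J ∈ ℰ.faces) {b : V → ℝ}
    (h0 : ∀ v ∈ J, 0 < b v) (h1 : ∑ v ∈ J, b v = 1) :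
    ∃ x ∈ ℰ.cell J, ∀ v ∈ J, ℰ.coord x v = b v := by
  classical
  obtain ⟨x, hx⟩ := exists_coord_eq hJ (b := fun v => if v ∈ J then b v else 0)
    (fun v => by split_ifs with h; exacts [(h0 v h).le, le_rfl]) (fun v hv => if_neg hv)
    (by rw [← h1]; exact Finset.sum_congr rfl fun v hv => if_pos hv)
  refine ⟨x, fun v => ?_, fun v hv => by rw [hx]; exact if_pos hv⟩
  rw [hx]
  by_cases hv : v ∈ J
  · simp [hv, h0 v hv]
  · simp [hv]

theorem exists_isCenter {J : Finset V} (hJ : J ∈ ℰ.faces) : ∃ x, ℰ.IsCenter J x := by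
  have hc : (J.card : ℝ) ≠ 0 := by
    exact_mod_cast (Finset.card_pos.mpr (nonempty_of_mem_faces hJ)).ne'
  obtain ⟨x, hx, h⟩ := exists_mem_cell_coord_eq hJ (b := fun _ => (J.card : ℝ)⁻¹)
    (fun v hv => by
      have : (0 : ℝ) < J.card := by exact_mod_cast Finset.card_pos.mpr ⟨v, hv⟩
      positivity) (by simp [hc])
  exact ⟨x, hx, h⟩

theorem closedCell_subset_closure_cell {K : Finset V} (hK : K ∈ ℰ.faces) :
    ℰ.closedCell K ⊆ closure (ℰ.cell K) := by
  intro x hx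
  obtain ⟨y, hy, -⟩ := exists_isCenter hK
  exact mem_closure_of_tendsto (tendsto_seg hK hx (cell_subset_closedCell K hy))
    (eventually_mem_Ioc.mono fun t ht => seg_mem_cell hx hy ht)

end Triangulation
end LegendrianSheaf

namespace LegendrianSheaf

open Set Filter

namespace Triangulation

variable {V M : Type*} [TopologicalSpace M] {ℰ : Triangulation V M}

theorem eq_of_mem_cell_of_card_eq_one {K : Finset V} (hK : K.card = 1) {x y : M}
    (hx : x ∈ ℰ.cell K) (hy : y ∈ ℰ.cell K) : x = y := by
  obtain ⟨v, rfl⟩ := Finset.card_eq_one.mp hK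
  have h1 := sum_coord_of_mem (cell_subset_closedCell _ hx)
  have h2 := sum_coord_of_mem (cell_subset_closedCell _ hy)
  rw [Finset.sum_singleton] at h1 h2
  refine ℰ.coord_injective (funext fun u => ?_)
  by_cases hu : u = v
  · rw [hu, h1, h2]
  · rw [cell_subset_closedCell _ hx u (by simpa using hu),
      cell_subset_closedCell _ hy u (by simpa using hu)]

/-- An injective curve in an open edge covers a neighbourhood of each of its points. -/
theorem image_Ioo_mem_nhdsWithin_cell {K : Finset V} (hK : K.card = 2) {ε : ℝ} (hε : 0 < ε)
    {γ : ℝ → M} (hc : ContinuousOn γ (Ioo (-ε) ε)) (hi : InjOn γ (Ioo (-ε) ε))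
    (hm : ∀ t ∈ Ioo (-ε) ε, γ t ∈ ℰ.cell K) : γ '' Ioo (-ε) ε ∈ 𝓝[ℰ.cell K] (γ 0) := by
  classical
  obtain ⟨u, v, huv, rfl⟩ := Finset.card_eq_two.mp hK
  have hdet : ∀ x ∈ ℰ.cell {u, v}, ∀ y ∈ ℰ.cell {u, v}, ℰ.coord x u = ℰ.coord y u → x = y := by
    intro x hx y hy h
    have h1 := sum_coord_of_mem (cell_subset_closedCell _ hx)
    have h2 := sum_coord_of_mem (cell_subset_closedCell _ hy)
    rw [Finset.sum_pair huv] at h1 h2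
    refine ℰ.coord_injective (funext fun w => ?_)
    by_cases hw : w ∈ ({u, v} : Finset V)
    · rcases Finset.mem_insert.mp hw with rfl | hw
      · exact h
      · obtain rfl := Finset.mem_singleton.mp hw
        linarith
    · rw [cell_subset_closedCell _ hx w hw, cell_subset_closedCell _ hy w hw]
  set f : ℝ → ℝ := fun t => ℰ.coord (γ t) u
  set d := ε / 2 with hd
  have hd0 : 0 < d := by positivity
  have hsub : Icc (-d) d ⊆ Ioo (-ε) ε := fun t ht => ⟨by linarith [ht.1], by linarith [ht.2]⟩
  have fc : ContinuousOn f (Icc (-d) d) :=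
    (ℰ.continuous_coord u).comp_continuousOn (hc.mono hsub)
  have fi : InjOn f (Icc (-d) d) := fun a ha b hb hab =>
    hi (hsub ha) (hsub hb) (hdet _ (hm a (hsub ha)) _ (hm b (hsub hb)) hab)
  have m0 : (0 : ℝ) ∈ Icc (-d) d := ⟨by linarith, hd0.le⟩
  have m1 : -d ∈ Icc (-d) d := ⟨le_rfl, by linarith⟩
  have m2 : d ∈ Icc (-d) d := ⟨by linarith, le_rfl⟩
  have hmem : f 0 ∈ Ioo (min (f (-d)) (f d)) (max (f (-d)) (f d)) := by
    rcases fc.strictMonoOn_of_injOn_Icc' (by linarith) fi with h | h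
    · have a := h m1 m0 (by linarith)
      have b := h m0 m2 hd0
      exact ⟨min_lt_of_left_lt a, lt_max_of_lt_right b⟩
    · have a := h m1 m0 (by linarith)
      have b := h m0 m2 hd0
      exact ⟨min_lt_of_right_lt b, lt_max_of_lt_left a⟩
  have hiv := intermediate_value_uIcc (f := f) (a := -d) (b := d)
    (by rwa [uIcc_of_le (by linarith)])
  rw [uIcc_of_le (show -d ≤ d by linarith)] at hiv
  have hnear : ∀ᶠ x in 𝓝[ℰ.cell {u, v}] (γ 0),
      ℰ.coord x u ∈ Ioo (min (f (-d)) (f d)) (max (f (-d)) (f d)) :=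
    ((ℰ.continuous_coord u).continuousAt.preimage_mem_nhds (Ioo_mem_nhds hmem.1 hmem.2)
      |> nhdsWithin_le_nhds)
  filter_upwards [hnear, self_mem_nhdsWithin] with x hx hxK
  obtain ⟨t, ht, hft⟩ := hiv (show ℰ.coord x u ∈ uIcc (f (-d)) (f d) from ⟨hx.1.le, hx.2.le⟩)
  exact ⟨t, hsub ht, hdet _ (hm t (hsub ht)) _ hxK hft⟩

theorem forall_nhdsWithin_cell_of_arc {K : Finset V} (hK : K.card = 2) {ε : ℝ} (hε : 0 < ε)
    {γ : ℝ → M} (hc : ContinuousOn γ (Ioo (-ε) ε)) (hi : InjOn γ (Ioo (-ε) ε))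
    (hm : ∀ᶠ t in 𝓝 (0 : ℝ), γ t ∈ ℰ.cell K) {P : ℝ → Prop} (hP : ∀ᶠ t in 𝓝 (0 : ℝ), P t) :
    ∀ᶠ x in 𝓝[ℰ.cell K] (γ 0), ∃ t, P t ∧ γ t = x := by
  obtain ⟨δ, hδ, h⟩ := Metric.eventually_nhds_iff.mp (hm.and hP)
  have hsub : Ioo (-min δ ε) (min δ ε) ⊆ Ioo (-ε) ε :=
    Ioo_subset_Ioo (neg_le_neg (min_le_right _ _)) (min_le_right _ _)
  have hb : ∀ t ∈ Ioo (-min δ ε) (min δ ε), γ t ∈ ℰ.cell K ∧ P t := fun t ht => h (by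
    rw [Real.dist_eq, sub_zero, abs_lt]
    exact ⟨by linarith [ht.1, min_le_left δ ε], by linarith [ht.2, min_le_left δ ε]⟩)
  filter_upwards [image_Ioo_mem_nhdsWithin_cell hK (lt_min hδ hε) (hc.mono hsub) (hi.mono hsub)
    fun t ht => (hb t ht).1] with x ⟨t, ht, hx⟩
  exact ⟨t, (hb t ht).2, hx⟩

end Triangulation

section

variable {L M : Type*} [TopologicalSpace L] [ChartedSpace Plane L]
  [TopologicalSpace M] [ChartedSpace Plane M] [IsManifold (𝓡 2) ∞ M]
  {V : Type*}

/-- The standing assumptions on the Legendrian surface and the simplicial decomposition. -/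
structure Admissible (Λ : LegendrianSurface L M) (ℰ : Triangulation V M) : Prop where
  mild : Λ.HasMildFront
  front : Λ.FrontTransverse
  base : Λ.BaseTransverse
  compatible : Compatible Λ ℰ

namespace Admissible

open Triangulation LegendrianSurface

variable [IsManifold (𝓡 2) ∞ L] [CompactSpace L] [T2Space M]
  {Λ : LegendrianSurface L M} {ℰ : Triangulation V M} (h : Admissible Λ ℰ)
include h

theorem card_le_two {p : L} (hp : p ∈ Λ.cusp) {K : Finset V} (hK : Λ.base p ∈ ℰ.cell K) :
    K.card ≤ 2 :=
  card_le_two_of_mem_cusp h.mild h.front h.base h.compatible hp hK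

theorem card_le {p q : L} (hne : p ≠ q) (hpq : Λ.front p = Λ.front q) {K : Finset V}
    (hK : Λ.base p ∈ ℰ.cell K) : Λ.weight p + Λ.weight q + K.card ≤ 4 :=
  card_le_of_front_eq h.mild h.front h.base h.compatible hne hpq hK

/-- Near a point of an open edge, the points above which the front is singular lie on the edge. -/
theorem mem_cell_of_supp_subset {K : Finset V} (hK : K.card = 2) {x : M} (hx : K ⊆ ℰ.supp x)
    (hs : (∃ p ∈ Λ.cusp, Λ.base p = x) ∨ ∃ p q, p ≠ q ∧ Λ.front p = Λ.front q ∧ Λ.base p = x) :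
    x ∈ ℰ.cell K := by
  refine mem_cell_iff.mpr (Finset.eq_of_subset_of_card_le hx ?_).symm
  rw [hK]
  rcases hs with ⟨p, hp, rfl⟩ | ⟨p, q, hne, hpq, rfl⟩
  · exact h.card_le_two hp (mem_cell_supp _)
  · have := h.card_le hne hpq (mem_cell_supp _)
    have := Λ.weight_pos p
    have := Λ.weight_pos q
    lia

theorem exists_base_eq_of_nhdsWithin_cell {q₀ : L} {K : Finset V} (hq : Λ.base q₀ ∈ ℰ.cell K)
    {U : Set L} (hU : U ∈ 𝓝 q₀) :
    ∀ᶠ x in 𝓝[ℰ.cell K] (Λ.base q₀), ∃ q ∈ U, Λ.base q = x ∧ (q₀ ∈ Λ.cusp → q ∈ Λ.cusp) := by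
  by_cases hc : q₀ ∈ Λ.cusp
  · have hle := h.card_le_two hc hq
    have hpos := Finset.card_pos.mpr (nonempty_of_mem_faces (mem_faces_of_mem_cell hq))
    rcases (show K.card = 1 ∨ K.card = 2 by lia) with h1 | h2
    · filter_upwards [self_mem_nhdsWithin] with x hx
      exact ⟨q₀, mem_of_mem_nhds hU, eq_of_mem_cell_of_card_eq_one h1 hq hx, fun h => h⟩
    · obtain ⟨A, B, Z, hf, -⟩ := exists_isFold h.mild hc univ_mem
      obtain ⟨ε, hε, γ, hγc, hγi, rfl, hγ⟩ := exists_cusp_arc h.mild hc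
      have hγ0 : ContinuousAt γ 0 := hγc.continuousAt (Ioo_mem_nhds (by linarith) hε)
      have hb0 : ContinuousAt (fun t => Λ.base (γ t)) 0 := Λ.continuous_base.continuousAt.comp hγ0
      obtain ⟨δ, hδ, hδ'⟩ := Metric.eventually_nhds_iff.mp
        (Filter.Eventually.and (hγ0.preimage_mem_nhds hf.mem_nhds)
          (Ioo_mem_nhds (show -ε < 0 by linarith) hε))
      have hb : ∀ t ∈ Ioo (-δ) δ, γ t ∈ A ∪ B ∪ Z ∧ t ∈ Ioo (-ε) ε := fun t ht => hδ' (by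
        rw [Real.dist_eq, sub_zero, abs_lt]
        exact ⟨ht.1, ht.2⟩)
      have hcell : ∀ᶠ t in 𝓝 (0 : ℝ), Λ.base (γ t) ∈ ℰ.cell K := by
        have := hb0.eventually (eventually_supp_subset (ℰ := ℰ) (Λ.base (γ 0)))
        rw [mem_cell_iff.mp hq] at this
        filter_upwards [this, Ioo_mem_nhds (show -ε < 0 by linarith) hε] with t ht ht'
        exact h.mem_cell_of_supp_subset h2 ht (Or.inl ⟨_, hγ t ht', rfl⟩)
      have := forall_nhdsWithin_cell_of_arc h2 hδ (γ := fun t => Λ.base (γ t))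
        (Λ.continuous_base.comp_continuousOn (hγc.mono fun t ht => (hb t ht).2))
        (fun a ha b hb' hab => hγi (hb a ha).2 (hb b hb').2
          (hf.eq_of_base_eq (hb a ha).1 (hγ a (hb a ha).2) (hb b hb').1 hab))
        hcell (P := fun t => γ t ∈ U ∧ γ t ∈ Λ.cusp)
        (by
          filter_upwards [hγ0.preimage_mem_nhds hU, Ioo_mem_nhds (show -ε < 0 by linarith) hε]
            with t ht ht' using ⟨ht, hγ t ht'⟩)
      filter_upwards [this] with x ⟨t, ⟨ht1, ht2⟩, hx⟩
      exact ⟨γ t, ht1, hx, fun _ => ht2⟩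
  · have hev : ∀ᶠ x in map Λ.base (𝓝 q₀),
        ∃ q ∈ U, Λ.base q = x ∧ (q₀ ∈ Λ.cusp → q ∈ Λ.cusp) := by
      rw [eventually_map]
      filter_upwards [hU] with q hqU using ⟨q, hqU, rfl, fun h => absurd h hc⟩
    rw [map_base_nhds hc] at hev
    exact hev.filter_mono nhdsWithin_le_nhds

theorem exists_injOn_base_cell {q₀ : L} {K : Finset V} (hq : Λ.base q₀ ∈ ℰ.cell K) :
    ∃ U ∈ 𝓝 q₀, InjOn Λ.base (U ∩ Λ.base ⁻¹' ℰ.cell K) := by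
  by_cases hc : q₀ ∈ Λ.cusp
  · obtain ⟨A, B, Z, hf, -⟩ := exists_isFold h.mild hc univ_mem
    have hev := eventually_nhdsWithin_iff.mp
      (h.exists_base_eq_of_nhdsWithin_cell hq hf.mem_nhds)
    have hcusp : ∀ q ∈ A ∪ B ∪ Z, (∃ r ∈ A ∪ B ∪ Z, Λ.base r = Λ.base q ∧ (q₀ ∈ Λ.cusp → r ∈ Λ.cusp)) →
        q ∈ Λ.cusp := by
      rintro q hq ⟨r, hr, hrq, hrc⟩
      exact hf.eq_of_base_eq hr (hrc hc) hq hrq ▸ hrc hc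
    refine ⟨_, inter_mem hf.mem_nhds (Λ.continuous_base.continuousAt.eventually hev), ?_⟩
    rintro a ⟨⟨ha, ha'⟩, haK⟩ b ⟨⟨hb, -⟩, -⟩ hab
    exact hf.eq_of_base_eq ha (hcusp a ha (ha' haK)) hb hab
  · obtain ⟨U, hU, hi⟩ := exists_injOn_base hc
    exact ⟨U, hU, hi.mono inter_subset_left⟩

variable [T2Space L]

theorem exists_front_eq_of_nhdsWithin_cell {p q : L} (hne : p ≠ q) (hpq : Λ.front p = Λ.front q)
    {K : Finset V} (hK : Λ.base p ∈ ℰ.cell K) {U U' : Set L} (hU : U ∈ 𝓝 p) (hU' : U' ∈ 𝓝 q) :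
    ∀ᶠ x in 𝓝[ℰ.cell K] (Λ.base p), ∃ a ∈ U, ∃ b ∈ U', Λ.base a = x ∧ Λ.front a = Λ.front b := by
  have hle := h.card_le hne hpq hK
  have hpos := Finset.card_pos.mpr (nonempty_of_mem_faces (mem_faces_of_mem_cell hK))
  have hp1 := Λ.weight_pos p
  have hq1 := Λ.weight_pos q
  rcases (show K.card = 1 ∨ K.card = 2 by lia) with h1 | h2
  · filter_upwards [self_mem_nhdsWithin] with x hx
    exact ⟨p, mem_of_mem_nhds hU, q, mem_of_mem_nhds hU', eq_of_mem_cell_of_card_eq_one h1 hK hx, hpq⟩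
  · have hpc : p ∉ Λ.cusp := fun hc => by rw [weight_of_mem hc] at hle; lia
    have hqc : q ∉ Λ.cusp := fun hc => by rw [weight_of_mem hc] at hle; lia
    obtain ⟨Φ, Ψ, hΦ, hΦb, hΨ, hΨb, ⟨ε, hε, γ, hγc, hγi, hγ0, hγ⟩, -⟩ :=
      Λ.exists_crossing_arc hpc hqc hne hpq
    have c0 : ContinuousAt γ 0 := hγc.continuousAt (Ioo_mem_nhds (by linarith) hε)
    have cΦ : ContinuousAt (fun t => Φ.symm (γ t)) 0 := by
      refine ContinuousAt.comp (g := Φ.symm) ?_ c0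
      rw [hγ0, ← hΦb hΦ]
      exact Φ.continuousAt_symm (Φ.map_source hΦ)
    have cΨ : ContinuousAt (fun t => Ψ.symm (γ t)) 0 := by
      refine ContinuousAt.comp (g := Ψ.symm) ?_ c0
      rw [hγ0, (front_eq_iff.mp hpq).1, ← hΨb hΨ]
      exact Ψ.continuousAt_symm (Ψ.map_source hΨ)
    have eΦ : Φ.symm (γ 0) = p := by rw [hγ0, ← hΦb hΦ]; exact Φ.left_inv hΦ
    have eΨ : Ψ.symm (γ 0) = q := by
      rw [hγ0, (front_eq_iff.mp hpq).1, ← hΨb hΨ]; exact Ψ.left_inv hΨ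
    obtain ⟨D, D', hD, hD', hpD, hqD', hdisj⟩ := t2_separation hne
    have tΦ : ∀ᶠ t in 𝓝 (0 : ℝ), γ t ∈ Φ.target := c0.preimage_mem_nhds (by
      rw [hγ0, ← hΦb hΦ]; exact Φ.open_target.mem_nhds (Φ.map_source hΦ))
    have tΨ : ∀ᶠ t in 𝓝 (0 : ℝ), γ t ∈ Ψ.target := c0.preimage_mem_nhds (by
      rw [hγ0, (front_eq_iff.mp hpq).1, ← hΨb hΨ]; exact Ψ.open_target.mem_nhds (Ψ.map_source hΨ))
    have uΦ : ∀ᶠ t in 𝓝 (0 : ℝ), Φ.symm (γ t) ∈ U ∩ D := cΦ.preimage_mem_nhds (by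
      rw [eΦ]; exact inter_mem hU (hD.mem_nhds hpD))
    have uΨ : ∀ᶠ t in 𝓝 (0 : ℝ), Ψ.symm (γ t) ∈ U' ∩ D' := cΨ.preimage_mem_nhds (by
      rw [eΨ]; exact inter_mem hU' (hD'.mem_nhds hqD'))
    have hall : ∀ᶠ t in 𝓝 (0 : ℝ), (Φ.symm (γ t) ∈ U ∩ D ∧ Ψ.symm (γ t) ∈ U' ∩ D') ∧
        Λ.base (Φ.symm (γ t)) = γ t ∧ Λ.front (Φ.symm (γ t)) = Λ.front (Ψ.symm (γ t)) := by
      filter_upwards [tΦ, tΨ, uΦ, uΨ, Ioo_mem_nhds (show -ε < 0 by linarith) hε]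
        with t h1 h2 h3 h4 h5
      have e1 : Λ.base (Φ.symm (γ t)) = γ t := by
        rw [← hΦb (Φ.map_target h1), Φ.right_inv h1]
      have e2 : Λ.base (Ψ.symm (γ t)) = γ t := by
        rw [← hΨb (Ψ.map_target h2), Ψ.right_inv h2]
      exact ⟨⟨h3, h4⟩, e1, front_eq_iff.mpr ⟨e1.trans e2.symm, hγ t h5⟩⟩
    have hcell : ∀ᶠ t in 𝓝 (0 : ℝ), γ t ∈ ℰ.cell K := by
      have := c0.eventually (eventually_supp_subset (ℰ := ℰ) (γ 0))
      rw [hγ0, mem_cell_iff.mp hK] at this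
      filter_upwards [this, hall] with t ht ⟨⟨h3, h4⟩, e1, e2⟩
      refine h.mem_cell_of_supp_subset h2 ht (Or.inr ⟨_, _, fun heq => ?_, e2, e1⟩)
      exact disjoint_left.mp hdisj h3.2 (heq ▸ h4.2)
    have := forall_nhdsWithin_cell_of_arc h2 hε hγc hγi hcell hall
    rw [hγ0] at this
    filter_upwards [this] with x ⟨t, ⟨⟨h3, h4⟩, e1, e2⟩, hx⟩
    exact ⟨_, h3.1, _, h4.1, e1.trans hx, e2⟩

/-- The base projection is a covering over every open simplex. -/
theorem isCoveringMap_restrictPreimage (K : Finset V) :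
    IsCoveringMap ((ℰ.cell K).restrictPreimage Λ.base) := by
  set p := (ℰ.cell K).restrictPreimage Λ.base
  have hpc : Continuous p := Λ.continuous_base.restrictPreimage
  have hopen : IsOpenMap p := by
    rw [isOpenMap_iff_nhds_le]
    rintro ⟨q, hq⟩ S hS
    rw [mem_map, nhds_subtype_eq_comap, mem_comap] at hS
    obtain ⟨U, hU, hUS⟩ := hS
    have := h.exists_base_eq_of_nhdsWithin_cell hq hU
    rw [show p ⟨q, hq⟩ = ⟨Λ.base q, hq⟩ from rfl, mem_nhds_subtype_iff_nhdsWithin]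
    filter_upwards [this, self_mem_nhdsWithin] with x ⟨r, hr, hrx, _⟩ hx
    subst hrx
    exact ⟨⟨Λ.base r, hx⟩, hUS (show (⟨r, hx⟩ : Λ.base ⁻¹' ℰ.cell K) ∈ _ from hr), rfl⟩
  have hloc : IsLocalHomeomorph p := by
    rw [isLocalHomeomorph_iff_isOpenEmbedding_restrict]
    rintro ⟨q, hq⟩
    obtain ⟨U, hU, hi⟩ := h.exists_injOn_base_cell hq
    obtain ⟨W, hWU, hW, hqW⟩ := mem_nhds_iff.mp hU
    have hW' : IsOpen (Subtype.val ⁻¹' W : Set (Λ.base ⁻¹' ℰ.cell K)) :=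
      hW.preimage continuous_subtype_val
    refine ⟨_, hW'.mem_nhds hqW, ?_⟩
    refine Topology.IsOpenEmbedding.of_continuous_injective_isOpenMap
      (hpc.comp continuous_subtype_val) ?_ (hopen.domRestrict hW')
    rintro ⟨⟨a, ha⟩, haW⟩ ⟨⟨b, hb⟩, hbW⟩ hab
    have : a = b := hi ⟨hWU haW, ha⟩ ⟨hWU hbW, hb⟩ (congrArg Subtype.val hab)
    subst this
    rfl
  rw [isCoveringMap_iff_isCoveringMapOn_univ]
  refine IsClosedMap.isCoveringMapOn_of_isLocalHomeomorphOn
    (Λ.continuous_base.isClosedMap.restrictPreimage _) (fun x _ => ?_)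
    (hloc.isLocalHomeomorphOn.mono (subset_univ _))
  refine Finite.of_finite_image ((finite_fiber h.mild x.1).subset ?_)
    (Subtype.val_injective.injOn)
  rintro _ ⟨q, hq, rfl⟩
  exact congrArg Subtype.val (show p q = x from hq)

end Admissible

end

end LegendrianSheaf

namespace LegendrianSheaf

open Set Filter

set_option linter.unusedSectionVars false

variable {L M : Type*} [TopologicalSpace L] [ChartedSpace Plane L]
  [TopologicalSpace M] [ChartedSpace Plane M] [IsManifold (𝓡 2) ∞ M]
  {V : Type*}

/-- A continuous section of the base projection over a closed simplex. -/
structure IsSection (Λ : LegendrianSurface L M) (ℰ : Triangulation V M) (K : Finset V) (s : M → L) :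
    Prop where
  continuousOn : ContinuousOn s (ℰ.closedCell K)
  base_eq : ∀ x ∈ ℰ.closedCell K, Λ.base (s x) = x

open Classical in
/-- The section of the base projection through a given point, over the closed simplex whose
interior contains the projection of this point. -/
noncomputable def sec (Λ : LegendrianSurface L M) (ℰ : Triangulation V M) (q : L) : M → L :=
  if h : ∃ s, IsSection Λ ℰ (ℰ.supp (Λ.base q)) s ∧ s (Λ.base q) = q then h.choose else fun _ => q

open Classical in
/-- The transport of a point to the fibre over the barycentre of a face of its simplex. -/
noncomputable def transport (Λ : LegendrianSurface L M) (ℰ : Triangulation V M) (J : Finset V)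
    (q : L) : L :=
  if h : ∃ x, ℰ.IsCenter J x then sec Λ ℰ q h.choose else q

theorem transport_eq {Λ : LegendrianSurface L M} {ℰ : Triangulation V M} {J : Finset V} {x : M}
    (hx : ℰ.IsCenter J x) (q : L) : transport Λ ℰ J q = sec Λ ℰ q x := by
  have h : ∃ x, ℰ.IsCenter J x := ⟨x, hx⟩
  rw [transport, dif_pos h, h.choose_spec.eq hx]

namespace Admissible

open Triangulation LegendrianSurface

variable [IsManifold (𝓡 2) ∞ L] [CompactSpace L] [T2Space L] [T2Space M]
  {Λ : LegendrianSurface L M} {ℰ : Triangulation V M}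

theorem eventually_fiber {x : M} {P : L → Prop} (hP : ∀ p, Λ.base p = x → ∀ᶠ q in 𝓝 p, P q) :
    ∀ᶠ y in 𝓝 x, ∀ q, Λ.base q = y → P q := by
  have := Λ.continuous_base.isClosedMap.eventually_nhds_fiber (y₀ := x) (p := P) hP
  simpa using this

variable (h : Admissible Λ ℰ)
include h

/-- A section over an open simplex has a limit at each point of the closed simplex. -/
theorem exists_tendsto_of_continuousOn {K : Finset V} (hK : K ∈ ℰ.faces) {s : M → L}
    (hs : ContinuousOn s (ℰ.cell K)) (hb : ∀ x ∈ ℰ.cell K, Λ.base (s x) = x) {x : M}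
    (hx : x ∈ ℰ.closedCell K) : ∃ p, Tendsto s (𝓝[ℰ.cell K] x) (𝓝 p) := by
  classical
  have hfin := finite_fiber h.mild (Λ := Λ) x
  obtain ⟨D, hD, hdisj⟩ := hfin.t2_separation
  have h1 : ∀ᶠ y in 𝓝 x, ∀ q, Λ.base q = y → ∃ p, Λ.base p = x ∧ q ∈ D p :=
    eventually_fiber fun p hp => by
      filter_upwards [(hD p).2.mem_nhds (hD p).1] with q hq using ⟨p, hp, hq⟩
  obtain ⟨N, hN, hNsub, hNc⟩ := exists_nhds_isPreconnected_inter_cell hK h1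
  have : (𝓝[ℰ.cell K] x).NeBot :=
    mem_closure_iff_nhdsWithin_neBot.mp (closedCell_subset_closure_cell hK hx)
  have hmem : ∀ᶠ y in 𝓝[ℰ.cell K] x, y ∈ N ∩ ℰ.cell K :=
    inter_mem (nhdsWithin_le_nhds hN) self_mem_nhdsWithin
  obtain ⟨y, hy⟩ := hmem.exists
  obtain ⟨p, hp, hyp⟩ := hNsub hy.1 (s y) (hb y hy.2)
  have hsub : s '' (N ∩ ℰ.cell K) ⊆ D p := by
    refine (hNc.image s (hs.mono inter_subset_right)).subset_left_of_subset_union (hD p).2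
      (isOpen_biUnion fun p' (_ : p' ∈ {p' | Λ.base p' = x ∧ p' ≠ p}) => (hD p').2) ?_ ?_
      ⟨s y, mem_image_of_mem s hy, hyp⟩
    · rw [disjoint_iUnion₂_right]
      exact fun p' hp' => hdisj hp hp'.1 hp'.2.symm
    · rintro _ ⟨z, hz, rfl⟩
      obtain ⟨p', hp', hzp⟩ := hNsub hz.1 (s z) (hb z hz.2)
      by_cases hpp : p' = p
      · exact Or.inl (hpp ▸ hzp)
      · exact Or.inr (mem_biUnion (show p' ∈ {p' | Λ.base p' = x ∧ p' ≠ p} from ⟨hp', hpp⟩) hzp)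
  refine ⟨p, fun W hW => ?_⟩
  have h2 : ∀ᶠ y in 𝓝 x, ∀ q, Λ.base q = y → q ∈ D p → q ∈ W := by
    refine eventually_fiber fun p' hp' => ?_
    by_cases hpp : p' = p
    · subst hpp
      filter_upwards [hW] with q hq _ using hq
    · filter_upwards [(hD p').2.mem_nhds (hD p').1] with q hq hq'
      exact absurd hq' (disjoint_left.mp (hdisj hp' hp hpp) hq)
  rw [mem_map]
  filter_upwards [hmem, h2.filter_mono nhdsWithin_le_nhds] with z hz hz2
  exact hz2 (s z) (hb z hz.2) (hsub (mem_image_of_mem s hz))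

theorem exists_section_cell {K : Finset V} {q : L} (hq : Λ.base q ∈ ℰ.cell K) :
    ∃ s : M → L, ContinuousOn s (ℰ.cell K) ∧ (∀ x ∈ ℰ.cell K, Λ.base (s x) = x) ∧
      s (Λ.base q) = q := by
  classical
  have cov := h.isCoveringMap_restrictPreimage K
  set x₀ := Λ.base q
  have hx₀ := cell_subset_closedCell K hq
  have hK := mem_faces_of_mem_cell hq
  have hseg : ∀ (t : unitInterval) (x : ℰ.cell K), ℰ.seg x₀ x t ∈ ℰ.cell K := by
    intro t x
    rcases eq_or_lt_of_le t.2.1 with h0 | h0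
    · rw [← h0, seg_zero]; exact hq
    · exact seg_mem_cell hx₀ x.2 ⟨h0, t.2.2⟩
  let H : C(unitInterval × ℰ.cell K, ℰ.cell K) :=
    { toFun := fun a => ⟨ℰ.seg x₀ a.2 a.1, hseg a.1 a.2⟩
      continuous_toFun := by
        refine Continuous.subtype_mk ?_ _
        exact (continuousOn_seg hK).comp_continuous
          (f := fun a : unitInterval × ℰ.cell K => (x₀, (a.2 : M), (a.1 : ℝ))) (by fun_prop)
          fun a => ⟨hx₀, cell_subset_closedCell K a.2.2, a.1.2⟩ }
  let f : C(ℰ.cell K, Λ.base ⁻¹' ℰ.cell K) := ContinuousMap.const _ ⟨q, hq⟩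
  have H0 : ∀ a, H (0, a) = (ℰ.cell K).restrictPreimage Λ.base (f a) := fun a =>
    Subtype.ext (ℰ.seg_zero x₀ a)
  let G := cov.liftHomotopy H f H0
  have hG : ∀ x, (ℰ.cell K).restrictPreimage Λ.base (G (1, x)) = x := by
    intro x
    refine (congrFun (cov.liftHomotopy_lifts H f H0) (1, x)).trans ?_
    exact Subtype.ext (ℰ.seg_one x₀ x)
  have hGq : G (1, ⟨x₀, hq⟩) = ⟨q, hq⟩ := by
    have := (cov.eq_liftPath_iff (γ := H.comp ((ContinuousMap.id unitInterval).prodMk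
      (.const unitInterval ⟨x₀, hq⟩))) (e := f ⟨x₀, hq⟩) (γ_0 := H0 ⟨x₀, hq⟩)
      (Γ := fun _ => ⟨q, hq⟩)).mpr ⟨continuous_const, ?_, rfl⟩
    · exact (congrFun this 1).symm
    · funext t
      refine Subtype.ext (ℰ.coord_injective (funext fun v => ?_))
      have := coord_seg hK hx₀ hx₀ t.2 v
      refine Eq.trans ?_ this.symm
      change ℰ.coord x₀ v = _
      ring
  refine ⟨fun x => if hx : x ∈ ℰ.cell K then (G (1, ⟨x, hx⟩)).1 else q, ?_, ?_, ?_⟩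
  · rw [continuousOn_iff_continuous_domRestrict]
    have : Continuous fun x : ℰ.cell K => ((G (1, x)).1 : L) :=
      continuous_subtype_val.comp (G.continuous.comp (by fun_prop))
    refine this.congr fun x => ?_
    simp [Set.domRestrict, x.2]
  · intro x hx
    simp only [dif_pos hx]
    exact congrArg Subtype.val (hG ⟨x, hx⟩)
  · simp only [dif_pos hq]
    rw [hGq]

theorem exists_isSection {K : Finset V} {q : L} (hq : Λ.base q ∈ ℰ.cell K) :
    ∃ s, IsSection Λ ℰ K s ∧ s (Λ.base q) = q := by
  obtain ⟨s, hs, hb, hsq⟩ := h.exists_section_cell hq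
  have hK := mem_faces_of_mem_cell hq
  have hlim := fun x hx => h.exists_tendsto_of_continuousOn hK hs hb (x := x) hx
  have hcl := closedCell_subset_closure_cell hK
  refine ⟨extendFrom (ℰ.cell K) s, ⟨continuousOn_extendFrom hcl hlim, fun x hx => ?_⟩, ?_⟩
  · have : (𝓝[ℰ.cell K] x).NeBot := mem_closure_iff_nhdsWithin_neBot.mp (hcl hx)
    have h1 := tendsto_extendFrom (hlim x hx)
    have h2 : Tendsto (fun y => Λ.base (s y)) (𝓝[ℰ.cell K] x) (𝓝 x) :=
      (tendsto_id.mono_left nhdsWithin_le_nhds).congr' (by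
        filter_upwards [self_mem_nhdsWithin] with y hy using (hb y hy).symm)
    exact tendsto_nhds_unique ((Λ.continuous_base.tendsto _).comp h1) h2
  · rw [extendFrom_eq (hcl (cell_subset_closedCell K hq)) (hs _ hq), hsq]

theorem eqOn_of_isSection {K : Finset V} {s s' : M → L} (hs : IsSection Λ ℰ K s)
    (hs' : IsSection Λ ℰ K s') {x : M} (hx : x ∈ ℰ.cell K) (hxx : s x = s' x) :
    EqOn s s' (ℰ.closedCell K) := by
  have hK := mem_faces_of_mem_cell hx
  have hsub := cell_subset_closedCell (ℰ := ℰ) K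
  have hcell : EqOn s s' (ℰ.cell K) := by
    intro y hy
    refine (isPreconnected_cell hK).induction₂ (fun a b => s a = s' a ↔ s b = s' b) ?_
      (fun a b c _ _ _ hab hbc => hab.trans hbc) (fun a b _ _ hab => hab.symm) hx hy |>.mp hxx
    intro a ha
    have ca := (hs.continuousOn.mono hsub) a ha
    have ca' := (hs'.continuousOn.mono hsub) a ha
    by_cases haa : s a = s' a
    · obtain ⟨U, hU, hi⟩ := h.exists_injOn_base_cell
        (show Λ.base (s a) ∈ ℰ.cell K by rwa [hs.base_eq a (hsub ha)])
      filter_upwards [ca hU, ca' (haa ▸ hU), self_mem_nhdsWithin] with b hb hb' hbK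
      refine iff_of_true haa (hi ⟨hb, ?_⟩ ⟨hb', ?_⟩ ?_)
      · rwa [mem_preimage, hs.base_eq b (hsub hbK)]
      · rwa [mem_preimage, hs'.base_eq b (hsub hbK)]
      · rw [hs.base_eq b (hsub hbK), hs'.base_eq b (hsub hbK)]
    · filter_upwards [(ca.tendsto.prodMk_nhds ca'.tendsto).eventually
        (isClosed_diagonal.isOpen_compl.mem_nhds (show (s a, s' a) ∈ (diagonal L)ᶜ from haa))]
        with b hb
      exact iff_of_false haa hb
  exact hcell.of_subset_closure hs.continuousOn hs'.continuousOn hsub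
    (closedCell_subset_closure_cell hK)

theorem isSection_sec (q : L) : IsSection Λ ℰ (ℰ.supp (Λ.base q)) (sec Λ ℰ q) := by
  have := h.exists_isSection (mem_cell_supp (Λ.base q))
  rw [sec, dif_pos this]
  exact this.choose_spec.1

theorem sec_base (q : L) : sec Λ ℰ q (Λ.base q) = q := by
  have := h.exists_isSection (mem_cell_supp (Λ.base q))
  rw [sec, dif_pos this]
  exact this.choose_spec.2

end Admissible

theorem IsSection.mono {Λ : LegendrianSurface L M} {ℰ : Triangulation V M} {J K : Finset V}
    {s : M → L} (hs : IsSection Λ ℰ K s) (hJ : J ⊆ K) : IsSection Λ ℰ J s :=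
  ⟨hs.continuousOn.mono (Triangulation.closedCell_mono hJ),
    fun x hx => hs.base_eq x (Triangulation.closedCell_mono hJ hx)⟩

namespace Admissible

open Triangulation LegendrianSurface

variable [IsManifold (𝓡 2) ∞ L] [CompactSpace L] [T2Space L] [T2Space M]
  {Λ : LegendrianSurface L M} {ℰ : Triangulation V M}
variable (h : Admissible Λ ℰ)
include h

theorem eqOn_sec {K : Finset V} {s : M → L} (hs : IsSection Λ ℰ K s) {x : M}
    (hx : x ∈ ℰ.closedCell K) : EqOn (sec Λ ℰ (s x)) s (ℰ.closedCell (ℰ.supp x)) := by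
  have h1 := h.isSection_sec (s x)
  have h2 := h.sec_base (s x)
  rw [hs.base_eq x hx] at h1 h2
  exact h.eqOn_of_isSection h1 (hs.mono (mem_closedCell_iff.mp hx)) (mem_cell_supp x) h2

theorem transport_section {K J : Finset V} {s : M → L} (hs : IsSection Λ ℰ K s) {x c : M}
    (hx : x ∈ ℰ.closedCell K) (hJ : J ⊆ ℰ.supp x) (hc : ℰ.IsCenter J c) :
    transport Λ ℰ J (s x) = s c := by
  rw [transport_eq hc]
  exact h.eqOn_sec hs hx (closedCell_mono hJ (cell_subset_closedCell J hc.1))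

theorem isCenter_transport {J : Finset V} (hJ : J ∈ ℰ.faces) {q : L}
    (hq : J ⊆ ℰ.supp (Λ.base q)) : ℰ.IsCenter J (Λ.base (transport Λ ℰ J q)) := by
  obtain ⟨c, hc⟩ := exists_isCenter hJ
  rw [transport_eq hc, (h.isSection_sec q).base_eq c
    (closedCell_mono hq (cell_subset_closedCell J hc.1))]
  exact hc

theorem transport_transport {J K : Finset V} (hJ : J ∈ ℰ.faces) (hJK : J ⊆ K) (hK : K ∈ ℰ.faces)
    {q : L} (hq : K ⊆ ℰ.supp (Λ.base q)) :
    transport Λ ℰ J (transport Λ ℰ K q) = transport Λ ℰ J q := by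
  obtain ⟨c, hc⟩ := exists_isCenter hJ
  obtain ⟨d, hd⟩ := exists_isCenter hK
  rw [transport_eq hd, transport_eq hc q]
  exact h.transport_section (h.isSection_sec q)
    (closedCell_mono hq (cell_subset_closedCell K hd.1)) ((mem_cell_iff.mp hd.1) ▸ hJK) hc

theorem transport_self {J : Finset V} {c : L} (hc : ℰ.IsCenter J (Λ.base c)) :
    transport Λ ℰ J c = c := by
  rw [transport_eq hc, h.sec_base]

theorem isClosed_image_section {K : Finset V} {s : M → L} (hs : IsSection Λ ℰ K s) :
    IsClosed {q | Λ.base q ∈ ℰ.closedCell K ∧ s (Λ.base q) = q} := by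
  have hc : IsClosed (Λ.base ⁻¹' ℰ.closedCell K) := (isClosed_closedCell K).preimage Λ.continuous_base
  have hf : ContinuousOn (fun q => (s (Λ.base q), q)) (Λ.base ⁻¹' ℰ.closedCell K) :=
    (hs.continuousOn.comp Λ.continuous_base.continuousOn fun _ hq => hq).prodMk continuousOn_id
  exact hf.preimage_isClosed_of_isClosed hc isClosed_diagonal

/-- The section through a point near `q₀` passes through `q₀`. -/
theorem eventually_sec_eq (q₀ : L) : ∀ᶠ q in 𝓝 q₀, sec Λ ℰ q (Λ.base q₀) = q₀ := by
  classical
  set F := ℰ.supp (Λ.base q₀)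
  have hF : F ∈ ℰ.faces := supp_mem_faces _
  have hfin := finite_faces_superset ℰ (nonempty_of_mem_faces hF)
  have hK : ∀ K ∈ {K | K ∈ ℰ.faces ∧ F ⊆ K}, ∀ᶠ q in 𝓝 q₀, ℰ.supp (Λ.base q) = K →
      sec Λ ℰ q (Λ.base q₀) = q₀ := by
    rintro K ⟨hK, hFK⟩
    obtain ⟨b, hb⟩ := exists_isCenter hK
    have hx₀ : Λ.base q₀ ∈ ℰ.closedCell K := mem_closedCell_iff.mpr hFK
    have hr : ∀ r ∈ {r | Λ.base r = b}, ∀ᶠ q in 𝓝 q₀, (ℰ.supp (Λ.base q) = K ∧ sec Λ ℰ q b = r) →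
        sec Λ ℰ q (Λ.base q₀) = q₀ := by
      intro r hr
      have hsr := h.isSection_sec r
      rw [show Λ.base r = b from hr, mem_cell_iff.mp hb.1] at hsr
      have key : ∀ q, (ℰ.supp (Λ.base q) = K ∧ sec Λ ℰ q b = r) →
          EqOn (sec Λ ℰ r) (sec Λ ℰ q) (ℰ.closedCell K) := by
        rintro q ⟨hqK, rfl⟩
        have := h.eqOn_sec (h.isSection_sec q) (x := b) (by
          rw [hqK]; exact cell_subset_closedCell K hb.1)
        rwa [mem_cell_iff.mp hb.1] at this
      by_cases hq : sec Λ ℰ r (Λ.base q₀) = q₀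
      · refine Eventually.of_forall fun q hqq => ?_
        rw [← key q hqq hx₀, hq]
      · have := (h.isClosed_image_section hsr).isOpen_compl.mem_nhds
          (show q₀ ∈ _ from fun hn => hq hn.2)
        filter_upwards [this] with q hqn hqq
        refine absurd ⟨?_, ?_⟩ hqn
        · exact mem_closedCell_iff.mpr hqq.1.subset
        · rw [key q hqq (mem_closedCell_iff.mpr hqq.1.subset), h.sec_base]
    have := ((finite_fiber h.mild (Λ := Λ) b).eventually_all).mpr hr
    filter_upwards [this] with q hq hqK
    refine hq (sec Λ ℰ q b) ?_ ⟨hqK, rfl⟩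
    exact (h.isSection_sec q).base_eq b (hqK ▸ cell_subset_closedCell K hb.1)
  filter_upwards [(hfin.eventually_all).mpr hK, Λ.continuous_base.continuousAt.eventually
    (eventually_supp_subset (ℰ := ℰ) (Λ.base q₀))] with q h1 h2
  exact h1 _ ⟨supp_mem_faces _, h2⟩ rfl

theorem eventually_transport_eq {q₀ : L} {J : Finset V} (hJ : J ∈ ℰ.faces)
    (hq₀ : J ⊆ ℰ.supp (Λ.base q₀)) :
    ∀ᶠ q in 𝓝 q₀, transport Λ ℰ J q = transport Λ ℰ J q₀ := by
  obtain ⟨c, hc⟩ := exists_isCenter hJ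
  filter_upwards [h.eventually_sec_eq q₀, Λ.continuous_base.continuousAt.eventually
    (eventually_supp_subset (ℰ := ℰ) (Λ.base q₀))] with q h1 h2
  have := h.transport_section (h.isSection_sec q) (mem_closedCell_iff.mpr h2) hq₀ hc
  rw [h1] at this
  rw [this, transport_eq hc]

end Admissible

end LegendrianSheaf

namespace LegendrianSheaf

open Set Filter

set_option linter.unusedSectionVars false

variable {L M : Type*} [TopologicalSpace L] [ChartedSpace Plane L]
  [TopologicalSpace M] [ChartedSpace Plane M] [IsManifold (𝓡 2) ∞ M]
  {V : Type*}

/-- The points over `x` that are transported to the point `c` over a barycentre. -/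
def fib (Λ : LegendrianSurface L M) (ℰ : Triangulation V M) (J : Finset V) (c : L) (x : M) : Set L :=
  {q | Λ.base q = x ∧ transport Λ ℰ J q = c}

namespace Admissible

open Triangulation LegendrianSurface

variable [IsManifold (𝓡 2) ∞ L] [CompactSpace L] [T2Space L] [T2Space M]
  {Λ : LegendrianSurface L M} {ℰ : Triangulation V M}
variable (h : Admissible Λ ℰ)
include h

theorem mem_cusp_of_isSection {K : Finset V} {s : M → L} (hs : IsSection Λ ℰ K s) {x y : M}
    (hx : x ∈ ℰ.cell K) (hy : y ∈ ℰ.closedCell K) (hc : s x ∈ Λ.cusp) : s y ∈ Λ.cusp := by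
  have hK := mem_faces_of_mem_cell hx
  have hsub := cell_subset_closedCell (ℰ := ℰ) K
  have hclosed := isClosed_cusp h.mild (Λ := Λ)
  have hcell : ∀ z ∈ ℰ.cell K, s z ∈ Λ.cusp := by
    intro z hz
    refine (isPreconnected_cell hK).induction₂ (fun a b => s a ∈ Λ.cusp ↔ s b ∈ Λ.cusp) ?_
      (fun a b c _ _ _ hab hbc => hab.trans hbc) (fun a b _ _ hab => hab.symm) hx hz |>.mp hc
    intro a ha
    have ca := (hs.continuousOn.mono hsub) a ha
    have haK : Λ.base (s a) ∈ ℰ.cell K := by rwa [hs.base_eq a (hsub ha)]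
    by_cases hac : s a ∈ Λ.cusp
    · obtain ⟨U, hU, hi⟩ := h.exists_injOn_base_cell haK
      have := h.exists_base_eq_of_nhdsWithin_cell haK hU
      rw [hs.base_eq a (hsub ha)] at this
      filter_upwards [ca hU, this, self_mem_nhdsWithin] with b hb ⟨q, hq, hqb, hqc⟩ hbK
      have : s b = q := hi ⟨hb, by rwa [mem_preimage, hs.base_eq b (hsub hbK)]⟩
        ⟨hq, by rwa [mem_preimage, hqb]⟩ (by rw [hqb, hs.base_eq b (hsub hbK)])
      exact iff_of_true hac (this ▸ hqc hac)
    · filter_upwards [ca (hclosed.isOpen_compl.mem_nhds hac)] with b hb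
      exact iff_of_false hac hb
  have : s y ∈ closure (s '' ℰ.cell K) :=
    (hs.continuousOn y hy).mono hsub |>.mem_closure_image (closedCell_subset_closure_cell hK hy)
  exact hclosed.closure_subset_iff.mpr (by rintro _ ⟨z, hz, rfl⟩; exact hcell z hz) this

theorem height_lt_of_isSection {K : Finset V} {s s' : M → L} (hs : IsSection Λ ℰ K s)
    (hs' : IsSection Λ ℰ K s') {x y : M} (hx : x ∈ ℰ.closedCell K) (hy : y ∈ ℰ.cell K)
    (hlt : Λ.height (s x) < Λ.height (s' x)) : Λ.height (s y) < Λ.height (s' y) := by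
  have hK := mem_faces_of_mem_cell hy
  have hsub := cell_subset_closedCell (ℰ := ℰ) K
  have hc : ∀ {t : M → L}, IsSection Λ ℰ K t → ∀ a ∈ ℰ.closedCell K,
      Tendsto (fun b => Λ.height (t b)) (𝓝[ℰ.cell K] a) (𝓝 (Λ.height (t a))) := fun ht a ha =>
    (Λ.continuous_height.tendsto _).comp ((ht.continuousOn a ha).mono hsub)
  have : (𝓝[ℰ.cell K] x).NeBot :=
    mem_closure_iff_nhdsWithin_neBot.mp (closedCell_subset_closure_cell hK hx)
  obtain ⟨z, hz, hzK⟩ :=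
    (((hc hs x hx).eventually_lt (hc hs' x hx) hlt).and eventually_mem_nhdsWithin).exists
  refine (isPreconnected_cell hK).induction₂
    (fun a b => Λ.height (s a) < Λ.height (s' a) ↔ Λ.height (s b) < Λ.height (s' b)) ?_
    (fun a b c _ _ _ hab hbc => hab.trans hbc) (fun a b _ _ hab => hab.symm) hzK hy |>.mp hz
  intro a ha
  rcases lt_trichotomy (Λ.height (s a)) (Λ.height (s' a)) with hl | he | hg
  · filter_upwards [(hc hs a (hsub ha)).eventually_lt (hc hs' a (hsub ha)) hl] with b hb
    exact iff_of_true hl hb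
  · by_cases heq : s a = s' a
    · have := h.eqOn_of_isSection hs hs' ha heq
      filter_upwards [self_mem_nhdsWithin] with b hb
      rw [heq, this (hsub hb)]
      simp
    · have hb1 := hs.base_eq a (hsub ha)
      have hb2 := hs'.base_eq a (hsub ha)
      obtain ⟨U, hU, hi⟩ := h.exists_injOn_base_cell (show Λ.base (s a) ∈ ℰ.cell K by rwa [hb1])
      obtain ⟨U', hU', hi'⟩ := h.exists_injOn_base_cell (show Λ.base (s' a) ∈ ℰ.cell K by rwa [hb2])
      have := h.exists_front_eq_of_nhdsWithin_cell heq
        (front_eq_iff.mpr ⟨hb1.trans hb2.symm, he⟩) (by rwa [hb1]) hU hU'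
      rw [hb1] at this
      filter_upwards [this, (hs.continuousOn.mono hsub) a ha hU, (hs'.continuousOn.mono hsub) a ha hU',
        self_mem_nhdsWithin] with b ⟨p, hp, q, hq, hpb, hpq⟩ hb hb' hbK
      rw [front_eq_iff] at hpq
      have e1 : s b = p := hi ⟨hb, by rwa [mem_preimage, hs.base_eq b (hsub hbK)]⟩
        ⟨hp, by rwa [mem_preimage, hpb]⟩ (by rw [hpb, hs.base_eq b (hsub hbK)])
      have e2 : s' b = q := hi' ⟨hb', by rwa [mem_preimage, hs'.base_eq b (hsub hbK)]⟩
        ⟨hq, by rwa [mem_preimage, ← hpq.1, hpb]⟩ (by rw [← hpq.1, hpb, hs'.base_eq b (hsub hbK)])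
      rw [e1, e2, hpq.2, he]
      simp
  · filter_upwards [(hc hs' a (hsub ha)).eventually_lt (hc hs a (hsub ha)) hg] with b hb
    exact iff_of_false hg.not_gt hb.not_gt

theorem notMem_cusp_of_transport {J : Finset V} (hJ : J ∈ ℰ.faces) {q : L}
    (hq : J ⊆ ℰ.supp (Λ.base q)) (hc : transport Λ ℰ J q ∉ Λ.cusp) : q ∉ Λ.cusp := by
  intro hqc
  obtain ⟨c, hcJ⟩ := exists_isCenter hJ
  rw [transport_eq hcJ] at hc
  refine hc (h.mem_cusp_of_isSection (h.isSection_sec q) (mem_cell_supp _)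
    (closedCell_mono hq (cell_subset_closedCell J hcJ.1)) ?_)
  rwa [h.sec_base]

theorem fib_eq_image {J K : Finset V} (hJ : J ∈ ℰ.faces) (hJK : J ⊆ K) (c : L) {x y : M}
    (hx : x ∈ ℰ.cell K) (hy : y ∈ ℰ.cell K) :
    fib Λ ℰ J c x = (fun r => sec Λ ℰ r x) '' fib Λ ℰ J c y := by
  obtain ⟨b, hb⟩ := exists_isCenter hJ
  have key : ∀ {x y : M}, x ∈ ℰ.cell K → y ∈ ℰ.cell K → ∀ r ∈ fib Λ ℰ J c y,
      sec Λ ℰ r x ∈ fib Λ ℰ J c x := by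
    rintro x y hx hy r ⟨hry, hrc⟩
    have hs := h.isSection_sec r
    rw [hry, mem_cell_iff.mp hy] at hs
    refine ⟨hs.base_eq x (cell_subset_closedCell K hx), ?_⟩
    rw [h.transport_section hs (cell_subset_closedCell K hx) (by rwa [mem_cell_iff.mp hx]) hb,
      ← hrc, transport_eq hb]
  refine Subset.antisymm (fun q hq => ⟨sec Λ ℰ q y, key hy hx q hq, ?_⟩) ?_
  · have hs := h.isSection_sec q
    rw [hq.1, mem_cell_iff.mp hx] at hs
    have := h.eqOn_sec hs (cell_subset_closedCell K hy)
    rw [mem_cell_iff.mp hy] at this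
    refine (this (cell_subset_closedCell K hx)).trans ?_
    rw [← hq.1, h.sec_base]
  · rintro _ ⟨r, hr, rfl⟩
    exact key hx hy r hr

theorem exists_fib_eq {J K : Finset V} {c : L} (hc : ℰ.IsCenter J (Λ.base c))
    (hK : K ∈ ℰ.faces) (hJK : J ⊆ K) {N : Set L} (hN : N ∈ 𝓝 c) (hNJ : ∀ r ∈ N, transport Λ ℰ J r = c)
    {P : M → Prop} (hP : ∀ᶠ y in 𝓝 (Λ.base c), P y) :
    ∃ y ∈ ℰ.cell K, fib Λ ℰ J c y = {r ∈ N | Λ.base r = y} ∧ P y := by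
  have hJ := mem_faces_of_mem_cell hc.1
  have hev : ∀ᶠ y in 𝓝 (Λ.base c), ∀ r, Λ.base r = y → transport Λ ℰ J r = c → r ∈ N := by
    refine eventually_fiber fun p hp => ?_
    by_cases hpc : p = c
    · subst hpc
      filter_upwards [hN] with r hr _ using hr
    · have hpJ : ℰ.IsCenter J (Λ.base p) := hp ▸ hc
      filter_upwards [h.eventually_transport_eq (q₀ := p) hJ (mem_cell_iff.mp hpJ.1).symm.subset]
        with r hr hrc
      exact absurd (by rw [← hrc, hr, h.transport_self hpJ]) hpc
  have hcl : Λ.base c ∈ closure (ℰ.cell K) :=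
    closedCell_subset_closure_cell hK (closedCell_mono hJK (cell_subset_closedCell J hc.1))
  have := mem_closure_iff_nhdsWithin_neBot.mp hcl
  obtain ⟨y, ⟨h1, h2⟩, hy⟩ := (((hev.and hP).filter_mono
    (nhdsWithin_le_nhds (s := ℰ.cell K))).and eventually_mem_nhdsWithin).exists
  refine ⟨y, hy, Subset.antisymm (fun r hr => ⟨h1 r hr.1 hr.2, hr.1⟩)
    (fun r hr => ⟨hr.2, hNJ r hr.1⟩), h2⟩

theorem exists_fib_eq_singleton {J : Finset V} {c : L} (hc : ℰ.IsCenter J (Λ.base c))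
    (hcc : c ∉ Λ.cusp) {x : M} (hx : J ⊆ ℰ.supp x) :
    ∃ q, q ∉ Λ.cusp ∧ fib Λ ℰ J c x = {q} := by
  have hJ := mem_faces_of_mem_cell hc.1
  obtain ⟨U, hU, hi⟩ := exists_injOn_base hcc
  have hev := h.eventually_transport_eq (q₀ := c) hJ (mem_cell_iff.mp hc.1).symm.subset
  rw [h.transport_self hc] at hev
  have hN : U ∩ {r | transport Λ ℰ J r = c} ∈ 𝓝 c := inter_mem hU hev
  obtain ⟨y, hy, hfy, r, hr, hry⟩ := h.exists_fib_eq hc (supp_mem_faces x) hx hN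
    (fun r hr => hr.2) (P := fun y => ∃ r ∈ U ∩ {r | transport Λ ℰ J r = c}, Λ.base r = y) (by
      rw [← map_base_nhds hcc, eventually_map]
      filter_upwards [hN] with r hr using ⟨r, hr, rfl⟩)
  have hs : fib Λ ℰ J c y = {r} := by
    rw [hfy]
    refine Subset.antisymm (fun r' hr' => hi hr'.1.1 hr.1 (hr'.2.trans hry.symm)) ?_
    rintro _ rfl
    exact ⟨hr, hry⟩
  have hfx := h.fib_eq_image hJ hx c (mem_cell_supp x) hy
  rw [hs, image_singleton] at hfx
  refine ⟨_, ?_, hfx⟩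
  have hm : sec Λ ℰ r x ∈ fib Λ ℰ J c x := by rw [hfx]; rfl
  exact h.notMem_cusp_of_transport hJ (by rwa [hm.1]) (hm.2.symm ▸ hcc)

theorem fib_cases {J : Finset V} {c : L} (hc : ℰ.IsCenter J (Λ.base c)) (hcc : c ∈ Λ.cusp) {x : M}
    (hx : J ⊆ ℰ.supp x) : fib Λ ℰ J c x = ∅ ∨ (∃ q ∈ Λ.cusp, fib Λ ℰ J c x = {q}) ∨
      ∃ u l, u ∉ Λ.cusp ∧ l ∉ Λ.cusp ∧ Λ.height l < Λ.height u ∧ fib Λ ℰ J c x = {u, l} := by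
  have hJ := mem_faces_of_mem_cell hc.1
  have hev := h.eventually_transport_eq (q₀ := c) hJ (mem_cell_iff.mp hc.1).symm.subset
  rw [h.transport_self hc] at hev
  obtain ⟨A, B, Z, hf, hsub⟩ := exists_isFold h.mild hcc hev
  obtain ⟨y, hy, hfy, -⟩ := h.exists_fib_eq hc (supp_mem_faces x) hx hf.mem_nhds
    (fun r hr => hsub hr) (P := fun _ => True) (Eventually.of_forall fun _ => trivial)
  have hfx := h.fib_eq_image hJ hx c (mem_cell_supp x) hy
  rw [hfy] at hfx
  have hsec : ∀ r, Λ.base r = y → IsSection Λ ℰ (ℰ.supp x) (sec Λ ℰ r) := fun r hr => by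
    have := h.isSection_sec r
    rwa [hr, mem_cell_iff.mp hy] at this
  have hcl := cell_subset_closedCell (ℰ := ℰ) (ℰ.supp x)
  have key : ∀ a ∈ A, ∀ b ∈ B, Λ.base a = y → Λ.base b = y → ∃ u l, u ∉ Λ.cusp ∧ l ∉ Λ.cusp ∧
      Λ.height l < Λ.height u ∧ fib Λ ℰ J c x = {u, l} := by
    intro a ha b hb hay hby
    have hsa := hsec a hay
    have hsb := hsec b hby
    have ea : sec Λ ℰ a y = a := hay ▸ h.sec_base a
    have eb : sec Λ ℰ b y = b := hby ▸ h.sec_base b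
    refine ⟨sec Λ ℰ a x, sec Λ ℰ b x, fun hm => ?_, fun hm => ?_, ?_, ?_⟩
    · have := h.mem_cusp_of_isSection hsa (mem_cell_supp x) (hcl hy) hm
      rw [ea] at this
      exact hf.left_notMem a ha this
    · have := h.mem_cusp_of_isSection hsb (mem_cell_supp x) (hcl hy) hm
      rw [eb] at this
      exact hf.right_notMem b hb this
    · refine h.height_lt_of_isSection hsb hsa (hcl hy) (mem_cell_supp x) ?_
      rw [ea, eb]
      exact hf.above a ha b hb (hay.trans hby.symm)
    · rw [hfx, ← image_pair (f := fun r => sec Λ ℰ r x)]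
      congr 1
      refine Subset.antisymm ?_ ?_
      · rintro r ⟨(hr | hr) | hr, hry⟩
        · exact Or.inl (hf.injOn_left (Or.inl hr) (Or.inl ha) (hry.trans hay.symm))
        · exact Or.inr (hf.injOn_right (Or.inl hr) (Or.inl hb) (hry.trans hby.symm))
        · have := hf.injOn_left (Or.inr hr) (Or.inl ha) (hry.trans hay.symm)
          exact absurd (this ▸ hf.edge_mem hr) (hf.left_notMem a ha)
      · rintro _ (rfl | rfl)
        · exact ⟨Or.inl (Or.inl ha), hay⟩
        · exact ⟨Or.inl (Or.inr hb), hby⟩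
  rcases eq_empty_or_nonempty {r ∈ A ∪ B ∪ Z | Λ.base r = y} with he | ⟨r, hr, hry⟩
  · left
    rw [hfx, he, image_empty]
  · right
    rcases hr with (hr | hr) | hr
    · right
      obtain ⟨b, hb, hbr⟩ := (hf.image_eq ▸ mem_image_of_mem Λ.base hr : Λ.base r ∈ Λ.base '' B)
      exact key r hr b hb hry (hbr.trans hry)
    · right
      obtain ⟨a, ha, har⟩ := (hf.image_eq.symm ▸ mem_image_of_mem Λ.base hr : Λ.base r ∈ Λ.base '' A)
      exact key a ha r hr (har.trans hry) hry
    · left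
      have er : sec Λ ℰ r y = r := hry ▸ h.sec_base r
      refine ⟨sec Λ ℰ r x, h.mem_cusp_of_isSection (hsec r hry) hy (hcl (mem_cell_supp x)) (by
        rw [er]; exact hf.edge_mem hr), ?_⟩
      rw [hfx, ← image_singleton (f := fun r => sec Λ ℰ r x)]
      congr 1
      refine Subset.antisymm ?_ (by rintro _ rfl; exact ⟨Or.inr hr, hry⟩)
      rintro r' ⟨hr', hry'⟩
      exact (hf.eq_of_base_eq (Or.inr hr) (hf.edge_mem hr) hr' (hry.trans hry'.symm)).symm

end Admissible

/-- The points over `A` that are transported to `c`. -/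
def branch (Λ : LegendrianSurface L M) (ℰ : Triangulation V M) (J : Finset V) (A : Set M) (c : L) :
    Set L :=
  {q | Λ.base q ∈ A ∧ transport Λ ℰ J q = c}

/-- A region in the open star of a simplex that meets the interior of this simplex and whose
intersections with the closed simplices are connected. -/
structure IsDualRegion (ℰ : Triangulation V M) (J : Finset V) (A : Set M) : Prop where
  subset_star : A ⊆ ℰ.star J
  preconnected : ∀ K ∈ ℰ.faces, _root_.IsPreconnected (A ∩ ℰ.closedCell K)
  nonempty : (A ∩ ℰ.cell J).Nonempty

theorem IsDualRegion.mem_faces {ℰ : Triangulation V M} {J : Finset V} {A : Set M}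
    (hA : IsDualRegion ℰ J A) : J ∈ ℰ.faces :=
  Triangulation.mem_faces_of_mem_cell hA.nonempty.some_mem.2

namespace Admissible

open Triangulation LegendrianSurface

variable [IsManifold (𝓡 2) ∞ L] [CompactSpace L] [T2Space L] [T2Space M]
  {Λ : LegendrianSurface L M} {ℰ : Triangulation V M}
variable (h : Admissible Λ ℰ) {J : Finset V} {A : Set M}
include h

theorem fib_of_mem_cell {c : L} (hc : ℰ.IsCenter J (Λ.base c)) {x : M} (hx : x ∈ ℰ.cell J) :
    fib Λ ℰ J c x = {sec Λ ℰ c x} := by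
  have hJ := mem_faces_of_mem_cell hx
  rw [h.fib_eq_image hJ subset_rfl c hx hc.1]
  have : fib Λ ℰ J c (Λ.base c) = {c} := by
    refine Subset.antisymm ?_ (by rintro _ rfl; exact ⟨rfl, h.transport_self hc⟩)
    rintro q ⟨hq, hqc⟩
    exact (h.transport_self (hq ▸ hc)).symm.trans hqc
  rw [this, image_singleton]

theorem sec_mem_cusp_iff {c : L} (hc : ℰ.IsCenter J (Λ.base c)) {x : M} (hx : x ∈ ℰ.cell J) :
    sec Λ ℰ c x ∈ Λ.cusp ↔ c ∈ Λ.cusp := by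
  have hs := h.isSection_sec c
  rw [mem_cell_iff.mp hc.1] at hs
  have hcl := cell_subset_closedCell (ℰ := ℰ) J
  constructor
  · intro hm
    have := h.mem_cusp_of_isSection hs hx (hcl hc.1) hm
    rwa [h.sec_base] at this
  · intro hm
    exact h.mem_cusp_of_isSection hs hc.1 (hcl hx) (by rwa [h.sec_base])

theorem isCenter_transport_of_mem (hA : IsDualRegion ℰ J A) {q : L} (hq : Λ.base q ∈ A) :
    ℰ.IsCenter J (Λ.base (transport Λ ℰ J q)) :=
  h.isCenter_transport hA.mem_faces (hA.subset_star hq)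

theorem sec_mem_branch {c : L} (hc : ℰ.IsCenter J (Λ.base c)) {x : M}
    (hx : x ∈ A ∩ ℰ.cell J) : sec Λ ℰ c x ∈ branch Λ ℰ J A c := by
  have : sec Λ ℰ c x ∈ fib Λ ℰ J c x := by rw [h.fib_of_mem_cell hc hx.2]; rfl
  exact ⟨this.1.symm ▸ hx.1, this.2⟩

theorem branch_nonempty (hA : IsDualRegion ℰ J A) {c : L} (hc : ℰ.IsCenter J (Λ.base c)) :
    (branch Λ ℰ J A c).Nonempty := by
  obtain ⟨x, hx⟩ := hA.nonempty
  exact ⟨_, h.sec_mem_branch hc hx⟩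

theorem branch_injective (hA : IsDualRegion ℰ J A) {c c' : L} (hc : ℰ.IsCenter J (Λ.base c))
    (hcc : branch Λ ℰ J A c = branch Λ ℰ J A c') : c = c' := by
  obtain ⟨q, hq⟩ := h.branch_nonempty hA hc
  have hq' := hq
  rw [hcc] at hq'
  exact hq.2.symm.trans hq'.2

theorem connectedComponentIn_eq (hA : IsDualRegion ℰ J A) {q : L} (hq : Λ.base q ∈ A) :
    connectedComponentIn (Λ.base ⁻¹' A) q = branch Λ ℰ J A (transport Λ ℰ J q) := by
  have hJ := hA.mem_faces
  set c := transport Λ ℰ J q with hcdef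
  have hc := h.isCenter_transport_of_mem hA hq
  refine Subset.antisymm (fun r hr => ?_) ?_
  · have hrA : Λ.base r ∈ A := connectedComponentIn_subset (Λ.base ⁻¹' A) q hr
    refine ⟨hrA, ?_⟩
    refine (isPreconnected_connectedComponentIn (F := Λ.base ⁻¹' A) (x := q)).induction₂
      (fun a b => transport Λ ℰ J a = transport Λ ℰ J b) ?_
      (fun a b c _ _ _ hab hbc => hab.trans hbc) (fun a b _ _ hab => hab.symm) hr
      (mem_connectedComponentIn hq)
    intro a ha
    have haA : Λ.base a ∈ A := connectedComponentIn_subset (Λ.base ⁻¹' A) q ha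
    exact ((h.eventually_transport_eq hJ (hA.subset_star haA)).mono
      fun b hb => hb.symm).filter_mono nhdsWithin_le_nhds
  · refine IsPreconnected.subset_connectedComponentIn ?_ ⟨hq, rfl⟩ fun r hr => hr.1
    obtain ⟨x₀, hx₀⟩ := hA.nonempty
    refine isPreconnected_of_forall (sec Λ ℰ c x₀) fun r hr => ?_
    set K := ℰ.supp (Λ.base r)
    have hJK : J ⊆ K := hA.subset_star hr.1
    have hs := h.isSection_sec r
    obtain ⟨b, hb⟩ := exists_isCenter hJ
    have hmem : ∀ z ∈ A ∩ ℰ.closedCell K, sec Λ ℰ r z ∈ branch Λ ℰ J A c := by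
      intro z hz
      refine ⟨by rw [hs.base_eq z hz.2]; exact hz.1, ?_⟩
      rw [h.transport_section hs hz.2 (hA.subset_star hz.1) hb, ← hr.2, transport_eq hb]
    have hxK : x₀ ∈ ℰ.closedCell K := closedCell_mono hJK (cell_subset_closedCell J hx₀.2)
    refine ⟨sec Λ ℰ r '' (A ∩ ℰ.closedCell K), ?_, ⟨x₀, ⟨hx₀.1, hxK⟩, ?_⟩,
      ⟨Λ.base r, ⟨hr.1, cell_subset_closedCell K (mem_cell_supp _)⟩, h.sec_base r⟩,
      (hA.preconnected K (supp_mem_faces _)).image _ (hs.continuousOn.mono inter_subset_right)⟩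
    · rintro _ ⟨z, hz, rfl⟩
      exact hmem z hz
    · have h1 : sec Λ ℰ r x₀ ∈ fib Λ ℰ J c x₀ :=
        ⟨hs.base_eq x₀ hxK, (hmem x₀ ⟨hx₀.1, hxK⟩).2⟩
      rw [h.fib_of_mem_cell hc hx₀.2] at h1
      exact h1

theorem mem_components_iff (hA : IsDualRegion ℰ J A) {S : Set L} :
    S ∈ components (Λ.base ⁻¹' A) ↔ ∃ c, ℰ.IsCenter J (Λ.base c) ∧ S = branch Λ ℰ J A c := by
  constructor
  · rintro ⟨q, hq, rfl⟩
    exact ⟨_, h.isCenter_transport_of_mem hA hq, h.connectedComponentIn_eq hA hq⟩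
  · rintro ⟨c, hc, rfl⟩
    obtain ⟨q, hq⟩ := h.branch_nonempty hA hc
    exact ⟨q, hq.1, by rw [h.connectedComponentIn_eq hA hq.1, hq.2]⟩

theorem mem_sheets_iff (hA : IsDualRegion ℰ J A) {S : Set L} :
    S ∈ Λ.sheets A ↔ ∃ c, ℰ.IsCenter J (Λ.base c) ∧ c ∉ Λ.cusp ∧ S = branch Λ ℰ J A c := by
  rw [sheets, mem_ofPred_eq, h.mem_components_iff hA]
  constructor
  · rintro ⟨⟨c, hc, rfl⟩, hd⟩
    refine ⟨c, hc, fun hcc => ?_, rfl⟩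
    obtain ⟨x, hx⟩ := hA.nonempty
    exact disjoint_left.mp hd (h.sec_mem_branch hc hx) ((h.sec_mem_cusp_iff hc hx.2).mpr hcc)
  · rintro ⟨c, hc, hcc, rfl⟩
    refine ⟨⟨c, hc, rfl⟩, disjoint_left.mpr fun q hq => ?_⟩
    exact h.notMem_cusp_of_transport hA.mem_faces (hA.subset_star hq.1) (hq.2.symm ▸ hcc)

theorem mem_cuspComponents_iff (hA : IsDualRegion ℰ J A) {S : Set L} :
    S ∈ Λ.cuspComponents A ↔ ∃ c, ℰ.IsCenter J (Λ.base c) ∧ c ∈ Λ.cusp ∧ S = branch Λ ℰ J A c := by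
  rw [cuspComponents, mem_ofPred_eq, h.mem_components_iff hA]
  constructor
  · rintro ⟨⟨c, hc, rfl⟩, q, hq, hqc⟩
    refine ⟨c, hc, ?_, rfl⟩
    by_contra hcc
    exact h.notMem_cusp_of_transport hA.mem_faces (hA.subset_star hq.1) (hq.2.symm ▸ hcc) hqc
  · rintro ⟨c, hc, hcc, rfl⟩
    obtain ⟨x, hx⟩ := hA.nonempty
    exact ⟨⟨c, hc, rfl⟩, _, h.sec_mem_branch hc hx, (h.sec_mem_cusp_iff hc hx.2).mpr hcc⟩

end Admissible

end LegendrianSheaf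

namespace LegendrianSheaf

open Set Filter

set_option linter.unusedSectionVars false

section

variable {V M : Type*} [TopologicalSpace M] {ℰ : Triangulation V M}

open Triangulation

theorem isDualRegion_cell {J : Finset V} (hJ : J ∈ ℰ.faces) : IsDualRegion ℰ J (ℰ.cell J) where
  subset_star _ hx := (mem_cell_iff.mp hx).symm.subset
  preconnected K hK := by
    have : ℰ.cell J ∩ ℰ.closedCell K = ℰ.closedCell K ∩
        ℰ.coord ⁻¹' ({b | ∀ v ∈ J, 0 < b v} ∩ {b | ∀ v ∉ J, b v = 0}) := by
      rw [cell_eq_inter, inter_comm, preimage_inter]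
      congr 1
      rw [inter_comm]
      rfl
    rw [this]
    refine isPreconnected_closedCell_inter hK ((convex_setOf_pos J).inter ?_)
    simp only [ofPred_forall]
    exact convex_iInter₂ fun v _ => convex_hyperplane ⟨fun _ _ => rfl, fun _ _ => rfl⟩ 0
  nonempty := by
    obtain ⟨x, hx⟩ := exists_isCenter hJ
    exact ⟨x, hx.1, hx.1⟩

theorem isDualRegion_star {J : Finset V} (hJ : J ∈ ℰ.faces) : IsDualRegion ℰ J (ℰ.star J) where
  subset_star _ hx := hx
  preconnected K hK := by
    have : ℰ.star J ∩ ℰ.closedCell K = ℰ.closedCell K ∩ ℰ.coord ⁻¹' {b | ∀ v ∈ J, 0 < b v} := by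
      rw [inter_comm]
      congr 1
      ext x
      simp [Triangulation.star, Finset.subset_iff]
    rw [this]
    exact isPreconnected_closedCell_inter hK (convex_setOf_pos J)
  nonempty := by
    obtain ⟨x, hx⟩ := exists_isCenter hJ
    exact ⟨x, (mem_cell_iff.mp hx.1).symm.subset, hx.1⟩

theorem isDualRegion_handle {I J : Finset V} (hI : I ∈ ℰ.faces) (hJ : J ∈ ℰ.faces) (hIJ : I ⊆ J) :
    IsDualRegion ℰ J (ℰ.handleCell I J) where
  subset_star x hx v hv := by
    rw [mem_supp]
    by_cases hvI : v ∈ I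
    · linarith [hx.1 v hvI]
    · rw [hx.2.1 v hv hvI]; norm_num
  preconnected K hK := by
    have : ℰ.handleCell I J ∩ ℰ.closedCell K = ℰ.closedCell K ∩ ℰ.coord ⁻¹'
        ({b | ∀ v ∈ I, 1 / 4 < b v} ∩ ({b | ∀ v ∈ J, v ∉ I → b v = 1 / 4} ∩
          {b | ∀ v ∉ J, b v < 1 / 4})) := inter_comm _ _
    rw [this]
    refine isPreconnected_closedCell_inter hK (Convex.inter ?_ (Convex.inter ?_ ?_))
    all_goals simp only [ofPred_forall]
    · exact convex_iInter₂ fun v _ => convex_halfSpace_gt ⟨fun _ _ => rfl, fun _ _ => rfl⟩ _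
    · exact convex_iInter₂ fun v _ => convex_iInter fun _ =>
        convex_hyperplane ⟨fun _ _ => rfl, fun _ _ => rfl⟩ _
    · exact convex_iInter₂ fun v _ => convex_halfSpace_lt ⟨fun _ _ => rfl, fun _ _ => rfl⟩ _
  nonempty := by
    classical
    have hi : 0 < I.card := Finset.card_pos.mpr (nonempty_of_mem_faces hI)
    have hj := ℰ.card_le J hJ
    have hij := Finset.card_sdiff_add_card_eq_card hIJ
    set m := (J \ I).card
    have hi' : (0 : ℝ) < I.card := by exact_mod_cast hi
    have hm : (m : ℝ) + I.card ≤ 3 := by exact_mod_cast (by lia : m + I.card ≤ 3)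
    set r : ℝ := (1 - m / 4) / I.card
    have hr : 1 / 4 < r := by
      rw [lt_div_iff₀ hi']
      linarith
    obtain ⟨x, hx, h⟩ := exists_mem_cell_coord_eq hJ (b := fun v => if v ∈ I then r else 1 / 4)
      (fun v hv => by split_ifs; exacts [by linarith, by norm_num])
      (by
        rw [← Finset.sum_sdiff hIJ, Finset.sum_congr rfl (g := fun _ => (1 / 4 : ℝ))
          fun v hv => if_neg (Finset.mem_sdiff.mp hv).2, Finset.sum_congr (s₁ := I) rfl
          (g := fun _ => r) fun v hv => if_pos hv]
        simp only [Finset.sum_const, nsmul_eq_mul]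
        change (m : ℝ) * (1 / 4) + I.card * r = 1
        simp only [r]
        field_simp
        ring)
    refine ⟨x, ⟨fun v hv => ?_, fun v hv hvI => ?_, fun v hv => ?_⟩, hx⟩
    · rw [h v (hIJ hv), if_pos hv]; exact hr
    · rw [h v hv, if_neg hvI]
    · rw [cell_subset_closedCell J hx v hv]; norm_num

theorem subset_of_mem_closure_handle {I J I' J' : Finset V} {x : M}
    (hx : x ∈ ℰ.handleCell I J) (hx' : x ∈ closure (ℰ.handleCell I' J')) : I ⊆ I' ∧ J' ⊆ J := by
  have c := fun v => (ℰ.continuous_coord v).continuousAt (x := x)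
  constructor
  · intro v hv
    have := (c v).eventually_const_lt (hx.1 v hv)
    obtain ⟨y, hy, hy'⟩ := mem_closure_iff_nhds.mp hx' _ this
    by_contra hn
    have hy : 1 / 4 < ℰ.coord y v := hy
    by_cases hvJ : v ∈ J'
    · exact hy.ne' (hy'.2.1 v hvJ hn)
    · exact hy.not_gt (hy'.2.2 v hvJ)
  · intro v hv
    by_contra hn
    have := (c v).eventually_lt_const (hx.2.2 v hn)
    obtain ⟨y, hy, hy'⟩ := mem_closure_iff_nhds.mp hx' _ this
    have hy : ℰ.coord y v < 1 / 4 := hy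
    by_cases hvI : v ∈ I'
    · exact hy.not_gt (hy'.1 v hvI)
    · exact hy.ne (hy'.2.1 v hv hvI)

theorem seg_mem_handle {I J I' J' K : Finset V} (hI : I ⊆ I') (hIJ : I' ⊆ J') (hJ : J' ⊆ J)
    (hJK : J ⊆ K) (hK : K ∈ ℰ.faces) {x y : M} (hx : x ∈ ℰ.handleCell I J)
    (hxK : x ∈ ℰ.closedCell K) (hy : y ∈ ℰ.handleCell I' J' ∩ ℰ.cell J') {t : ℝ}
    (ht : t ∈ Ioc (0 : ℝ) 1) : ℰ.seg x y t ∈ ℰ.handleCell I' J' := by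
  have hyK : y ∈ ℰ.closedCell K := closedCell_mono (hJ.trans hJK) (cell_subset_closedCell J' hy.2)
  have hc := fun v => coord_seg hK hxK hyK ⟨ht.1.le, ht.2⟩ v
  have h1 : 0 ≤ 1 - t := by linarith [ht.2]
  have hge : ∀ v ∈ J, 1 / 4 ≤ ℰ.coord x v := by
    intro v hv
    by_cases hvI : v ∈ I
    · exact (hx.1 v hvI).le
    · exact (hx.2.1 v hv hvI).ge
  have hle : ∀ v ∉ I, ℰ.coord x v ≤ 1 / 4 := by
    intro v hv
    by_cases hvJ : v ∈ J
    · exact (hx.2.1 v hvJ hv).le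
    · exact (hx.2.2 v hvJ).le
  refine ⟨fun v hv => ?_, fun v hv hvI => ?_, fun v hv => ?_⟩
  · rw [hc v]
    have a := mul_le_mul_of_nonneg_left (hge v (hJ (hIJ hv))) h1
    have b := mul_lt_mul_of_pos_left (hy.1.1 v hv) ht.1
    linarith
  · rw [hc v, hx.2.1 v (hJ hv) fun hn => hvI (hI hn), hy.1.2.1 v hv hvI]
    ring
  · rw [hc v]
    have a := mul_le_mul_of_nonneg_left (hle v fun hn => hv (hIJ (hI hn))) h1
    have b := mul_lt_mul_of_pos_left (hy.1.2.2 v hv) ht.1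
    linarith

end

variable {L M : Type*} [TopologicalSpace L] [ChartedSpace Plane L]
  [TopologicalSpace M] [ChartedSpace Plane M] [IsManifold (𝓡 2) ∞ M]
  {V : Type*}

namespace Admissible

open Triangulation LegendrianSurface

variable [IsManifold (𝓡 2) ∞ L] [CompactSpace L] [T2Space L] [T2Space M]
  {Λ : LegendrianSurface L M} {ℰ : Triangulation V M}
variable (h : Admissible Λ ℰ)
include h

/-- The section through `q` evaluated along a segment that leaves the projection of `q`. -/
theorem tendsto_sec_seg (q : L) {y : M} (hy : y ∈ ℰ.closedCell (ℰ.supp (Λ.base q))) :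
    Tendsto (fun t => sec Λ ℰ q (ℰ.seg (Λ.base q) y t)) (𝓝[>] 0) (𝓝 q) := by
  have hx := cell_subset_closedCell (ℰ := ℰ) _ (mem_cell_supp (ℰ := ℰ) (Λ.base q))
  have hK := supp_mem_faces (ℰ := ℰ) (Λ.base q)
  have h1 := (h.isSection_sec q).continuousOn _ hx
  rw [ContinuousWithinAt, h.sec_base] at h1
  refine h1.comp (tendsto_nhdsWithin_iff.mpr ⟨tendsto_seg hK hx hy, ?_⟩)
  exact eventually_mem_Ioc.mono fun t ht => seg_mem_closedCell hK hx hy ⟨ht.1.le, ht.2⟩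

theorem transport_eq_of_mem_closure {J : Finset V} {A : Set M} {c q : L} (hJ : J ∈ ℰ.faces)
    (hq : J ⊆ ℰ.supp (Λ.base q)) (hc : q ∈ closure (branch Λ ℰ J A c)) :
    transport Λ ℰ J q = c := by
  obtain ⟨r, hr, hr'⟩ := mem_closure_iff_nhds.mp hc _ (h.eventually_transport_eq hJ hq)
  exact hr.symm.trans hr'.2

theorem transport_sec {q : L} {x : M} {J : Finset V} (hJ : J ∈ ℰ.faces)
    (hx : x ∈ ℰ.closedCell (ℰ.supp (Λ.base q))) (hJx : J ⊆ ℰ.supp x) :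
    transport Λ ℰ J (sec Λ ℰ q x) = transport Λ ℰ J q := by
  obtain ⟨b, hb⟩ := exists_isCenter hJ
  rw [h.transport_section (h.isSection_sec q) hx hJx hb, transport_eq hb]

theorem mem_closure_branch_handle {I J I' J' : Finset V} (hI : I ⊆ I') (hIJ : I' ⊆ J')
    (hJ : J' ⊆ J) (hIf : I ∈ ℰ.faces) (hJf : J ∈ ℰ.faces) {q : L}
    (hq : Λ.base q ∈ ℰ.handleCell I J) :
    q ∈ closure (branch Λ ℰ J' (ℰ.handleCell I' J') (transport Λ ℰ J' q)) := by
  have hI'n := (nonempty_of_mem_faces hIf).mono hI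
  have hJ'f := mem_faces_of_subset hJf (hI'n.mono hIJ) hJ
  have hI'f := mem_faces_of_subset hJ'f hI'n hIJ
  have hJK := (isDualRegion_handle hIf hJf ((hI.trans hIJ).trans hJ)).subset_star hq
  obtain ⟨y, hy⟩ := (isDualRegion_handle hI'f hJ'f hIJ).nonempty
  have hK := supp_mem_faces (ℰ := ℰ) (Λ.base q)
  have hx := cell_subset_closedCell (ℰ := ℰ) _ (mem_cell_supp (ℰ := ℰ) (Λ.base q))
  have hyK := closedCell_mono (hJ.trans hJK) (cell_subset_closedCell J' hy.2)
  refine mem_closure_of_tendsto (h.tendsto_sec_seg q hyK) (eventually_mem_Ioc.mono fun t ht => ?_)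
  have hm := seg_mem_handle hI hIJ hJ hJK hK hq hx hy ht
  have hcl := seg_mem_closedCell hK hx hyK ⟨ht.1.le, ht.2⟩
  refine ⟨by rwa [(h.isSection_sec q).base_eq _ hcl], ?_⟩
  exact h.transport_sec hJ'f hcl ((isDualRegion_handle hI'f hJ'f hIJ).subset_star hm)

theorem branch_subset_closure_handle_iff {I J I' J' : Finset V} (hI : I ⊆ I') (hIJ : I' ⊆ J')
    (hJ : J' ⊆ J) (hIf : I ∈ ℰ.faces) (hJf : J ∈ ℰ.faces) {c c' : L}
    (hc : ℰ.IsCenter J (Λ.base c)) :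
    branch Λ ℰ J (ℰ.handleCell I J) c ⊆ closure (branch Λ ℰ J' (ℰ.handleCell I' J') c') ↔
      transport Λ ℰ J' c = c' := by
  have hR := isDualRegion_handle hIf hJf ((hI.trans hIJ).trans hJ)
  have hJ'f := mem_faces_of_subset hJf (((nonempty_of_mem_faces hIf).mono hI).mono hIJ) hJ
  have htr : ∀ q ∈ branch Λ ℰ J (ℰ.handleCell I J) c, transport Λ ℰ J' q = transport Λ ℰ J' c := by
    intro q hq
    rw [← h.transport_transport hJ'f hJ hJf (hR.subset_star hq.1), hq.2]
  constructor
  · intro hsub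
    obtain ⟨q, hq⟩ := h.branch_nonempty hR hc
    rw [← htr q hq]
    exact h.transport_eq_of_mem_closure hJ'f (hJ.trans (hR.subset_star hq.1)) (hsub hq)
  · rintro rfl q hq
    rw [← htr q hq]
    exact h.mem_closure_branch_handle hI hIJ hJ hIf hJf hq.1

theorem mem_closure_branch_cell {I J : Finset V} (hI : I ∈ ℰ.faces) (hIJ : I ⊆ J) {c q : L}
    (hc : ℰ.IsCenter J (Λ.base c)) (hq : Λ.base q ∈ ℰ.cell I) :
    q ∈ closure (branch Λ ℰ J (ℰ.cell J) c) ↔ transport Λ ℰ I c = transport Λ ℰ I q := by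
  have hJ := mem_faces_of_mem_cell hc.1
  have hs := h.isSection_sec c
  have hsc := mem_cell_iff.mp hc.1
  rw [hsc] at hs
  have hqJ := closedCell_mono hIJ (cell_subset_closedCell I hq)
  obtain ⟨b, hb⟩ := exists_isCenter hI
  constructor
  · intro hcl
    have hsub : branch Λ ℰ J (ℰ.cell J) c ⊆ {q | Λ.base q ∈ ℰ.closedCell J ∧ sec Λ ℰ c (Λ.base q) = q} := by
      intro r hr
      refine ⟨cell_subset_closedCell J hr.1, ?_⟩
      have : r ∈ fib Λ ℰ J c (Λ.base r) := ⟨rfl, hr.2⟩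
      rw [h.fib_of_mem_cell hc hr.1] at this
      exact this.symm
    have := closure_minimal hsub (h.isClosed_image_section hs) hcl
    rw [← this.2, h.transport_section hs hqJ (mem_cell_iff.mp hq).symm.subset hb, transport_eq hb]
  · intro heq
    have h1 : sec Λ ℰ c (Λ.base q) = q := by
      have e := h.eqOn_of_isSection (K := I) (hs.mono hIJ)
        (by have := h.isSection_sec q; rwa [mem_cell_iff.mp hq] at this) hb.1
        (by rw [← transport_eq hb, heq, transport_eq hb])
      rw [e (cell_subset_closedCell I hq), h.sec_base]
    have hlim := (hs.continuousOn _ hqJ).mono (cell_subset_closedCell J)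
    rw [ContinuousWithinAt, h1] at hlim
    have : (𝓝[ℰ.cell J] (Λ.base q)).NeBot :=
      mem_closure_iff_nhdsWithin_neBot.mp (closedCell_subset_closure_cell hJ hqJ)
    refine mem_closure_of_tendsto hlim ?_
    filter_upwards [self_mem_nhdsWithin] with x hx
    exact h.sec_mem_branch hc ⟨hx, hx⟩

theorem branch_subset_closure_cell_iff {I J : Finset V} (hIJ : I ⊆ J) {c d : L}
    (hc : ℰ.IsCenter J (Λ.base c)) (hd : ℰ.IsCenter I (Λ.base d)) :
    branch Λ ℰ I (ℰ.cell I) d ⊆ closure (branch Λ ℰ J (ℰ.cell J) c) ↔ transport Λ ℰ I c = d := by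
  have hI := mem_faces_of_mem_cell hd.1
  constructor
  · intro hsub
    have : d ∈ branch Λ ℰ I (ℰ.cell I) d := ⟨hd.1, h.transport_self hd⟩
    rw [(h.mem_closure_branch_cell hI hIJ hc hd.1).mp (hsub this), h.transport_self hd]
  · rintro rfl q hq
    exact (h.mem_closure_branch_cell hI hIJ hc hq.1).mpr hq.2.symm

theorem branch_inter_nonempty_iff {J : Finset V} {A : Set M} (hA : IsDualRegion ℰ J A) {c d : L}
    (hc : ℰ.IsCenter J (Λ.base c)) :
    (branch Λ ℰ J A c ∩ branch Λ ℰ J (ℰ.cell J) d).Nonempty ↔ c = d := by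
  constructor
  · rintro ⟨q, hq, hq'⟩
    exact hq.2.symm.trans hq'.2
  · rintro rfl
    obtain ⟨x, hx⟩ := hA.nonempty
    exact ⟨_, h.sec_mem_branch hc hx, h.sec_mem_branch hc ⟨hx.2, hx.2⟩⟩

theorem height_lt_of_transport {J : Finset V} (hJ : J ∈ ℰ.faces) {p q : L}
    (hpq : Λ.base p = Λ.base q) (hp : J ⊆ ℰ.supp (Λ.base p))
    (hlt : Λ.height (transport Λ ℰ J p) < Λ.height (transport Λ ℰ J q)) :
    Λ.height p < Λ.height q := by
  obtain ⟨b, hb⟩ := exists_isCenter hJ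
  rw [transport_eq hb, transport_eq hb] at hlt
  have h1 := h.isSection_sec p
  have h2 := h.isSection_sec q
  rw [← hpq] at h2
  have := h.height_lt_of_isSection h1 h2 (closedCell_mono hp (cell_subset_closedCell J hb.1))
    (mem_cell_supp _) hlt
  rwa [h.sec_base, hpq, h.sec_base] at this

theorem above_branch_iff {J : Finset V} {c d : L} (hc : ℰ.IsCenter J (Λ.base c))
    (hd : ℰ.IsCenter J (Λ.base d)) :
    Λ.Above (branch Λ ℰ J (ℰ.cell J) c) (branch Λ ℰ J (ℰ.cell J) d) ↔
      Λ.height d < Λ.height c := by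
  constructor
  · intro hab
    exact hab c ⟨hc.1, h.transport_self hc⟩ d ⟨hd.1, h.transport_self hd⟩ (hc.eq hd)
  · rintro hlt p hp q hq hpq
    refine h.height_lt_of_transport (mem_faces_of_mem_cell hc.1) hpq.symm
      (mem_cell_iff.mp hq.1).symm.subset ?_
    rwa [hp.2, hq.2]

theorem transport_mem_cusp {J : Finset V} (hJ : J ∈ ℰ.faces) {q : L}
    (hq : J ⊆ ℰ.supp (Λ.base q)) (hqc : q ∈ Λ.cusp) : transport Λ ℰ J q ∈ Λ.cusp := by
  by_contra hn
  exact h.notMem_cusp_of_transport hJ hq hn hqc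

theorem closure_inter_cusp_nonempty_iff {I J : Finset V} (hI : I ∈ ℰ.faces) (hIJ : I ⊆ J) {c d : L}
    (hc : ℰ.IsCenter J (Λ.base c)) (hd : ℰ.IsCenter J (Λ.base d)) :
    (closure (branch Λ ℰ J (ℰ.cell J) c) ∩ closure (branch Λ ℰ J (ℰ.cell J) d) ∩ Λ.cusp ∩
      Λ.base ⁻¹' ℰ.cell I).Nonempty ↔
      transport Λ ℰ I c = transport Λ ℰ I d ∧ transport Λ ℰ I c ∈ Λ.cusp := by
  constructor
  · rintro ⟨q, ⟨⟨h1, h2⟩, h3⟩, h4⟩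
    have e1 := (h.mem_closure_branch_cell hI hIJ hc h4).mp h1
    have e2 := (h.mem_closure_branch_cell hI hIJ hd h4).mp h2
    refine ⟨e1.trans e2.symm, ?_⟩
    rw [e1]
    exact h.transport_mem_cusp hI (mem_cell_iff.mp h4).symm.subset h3
  · rintro ⟨he, hcusp⟩
    have hcen := h.isCenter_transport hI (q := c) (by rwa [mem_cell_iff.mp hc.1])
    have hs := h.transport_self hcen
    exact ⟨transport Λ ℰ I c, ⟨⟨(h.mem_closure_branch_cell hI hIJ hc hcen.1).mpr hs.symm,
      (h.mem_closure_branch_cell hI hIJ hd hcen.1).mpr (by rw [hs, he])⟩, hcusp⟩, hcen.1⟩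

/-- A Maslov potential is constant on the branch of a point that is not a cusp point. -/
theorem maslov_transport (μ : Λ.MaslovPotential) {J : Finset V} (hJ : J ∈ ℰ.faces) {q : L}
    (hq : J ⊆ ℰ.supp (Λ.base q)) (hc : transport Λ ℰ J q ∉ Λ.cusp) :
    μ.toFun q = μ.toFun (transport Λ ℰ J q) := by
  have hS := isDualRegion_star hJ
  have hcen := h.isCenter_transport hJ hq
  have hcc := h.connectedComponentIn_eq hS (q := q) hq
  have hpre := isPreconnected_connectedComponentIn (F := Λ.base ⁻¹' ℰ.star J) (x := q)
  rw [hcc] at hpre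
  refine hpre.induction₂ (fun a b => μ.toFun a = μ.toFun b) ?_
    (fun a b c _ _ _ hab hbc => hab.trans hbc) (fun a b _ _ hab => hab.symm) ⟨hq, rfl⟩
    ⟨(mem_cell_iff.mp hcen.1).symm.subset, h.transport_self hcen⟩
  intro a ha
  have : a ∉ Λ.cusp := h.notMem_cusp_of_transport hJ ha.1 (by rwa [ha.2])
  exact ((μ.locallyConstant a this).mono fun b hb => hb.symm).filter_mono nhdsWithin_le_nhds

/-- A Maslov potential is constant on the lower branch of a cusp component. -/
theorem exists_maslov_lower (μ : Λ.MaslovPotential) {J : Finset V} {c : L}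
    (hc : ℰ.IsCenter J (Λ.base c)) (hcc : c ∈ Λ.cusp) :
    ∃ m, ∀ p q, Λ.base p = Λ.base q → J ⊆ ℰ.supp (Λ.base p) → transport Λ ℰ J p = c →
      transport Λ ℰ J q = c → Λ.height p < Λ.height q → μ.toFun p = m := by
  have hJ := mem_faces_of_mem_cell hc.1
  have hev := h.eventually_transport_eq (q₀ := c) hJ (mem_cell_iff.mp hc.1).symm.subset
  rw [h.transport_self hc] at hev
  obtain ⟨A, B, Z, hf, hsub⟩ := exists_isFold h.mild hcc hev
  have hconst : ∀ a ∈ B, ∀ b ∈ B, μ.toFun a = μ.toFun b := fun a ha b hb =>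
    hf.preconnected_right.induction₂ (fun a b => μ.toFun a = μ.toFun b) (fun a ha =>
      ((μ.locallyConstant a (hf.right_notMem a ha)).mono fun b hb => hb.symm).filter_mono
        nhdsWithin_le_nhds)
      (fun a b c _ _ _ hab hbc => hab.trans hbc) (fun a b _ _ hab => hab.symm) ha hb
  obtain ⟨a₀, ha₀⟩ := hf.nonempty_left
  obtain ⟨b₀, hb₀, -⟩ := (hf.image_eq ▸ mem_image_of_mem Λ.base ha₀ : Λ.base a₀ ∈ Λ.base '' B)
  refine ⟨μ.toFun b₀, fun p q hpq hp hpc hqc hlt => ?_⟩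
  set x := Λ.base p
  obtain ⟨y, hy, hfy, -⟩ := h.exists_fib_eq hc (supp_mem_faces x) hp hf.mem_nhds
    (fun r hr => hsub hr) (P := fun _ => True) (Eventually.of_forall fun _ => trivial)
  have hsp := h.isSection_sec p
  have hsq := h.isSection_sec q
  rw [← hpq] at hsq
  have hcl := cell_subset_closedCell (ℰ := ℰ) (ℰ.supp x)
  have hJy : J ⊆ ℰ.supp y := by rwa [mem_cell_iff.mp hy]
  have hpy : sec Λ ℰ p y ∈ fib Λ ℰ J c y :=
    ⟨hsp.base_eq y (hcl hy), by rw [h.transport_sec hJ (hcl hy) hJy, hpc]⟩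
  have hqy : sec Λ ℰ q y ∈ fib Λ ℰ J c y :=
    ⟨hsq.base_eq y (hcl hy), by rw [h.transport_sec hJ (by rw [← hpq]; exact hcl hy) hJy, hqc]⟩
  have hlt' : Λ.height (sec Λ ℰ p y) < Λ.height (sec Λ ℰ q y) := by
    refine h.height_lt_of_isSection hsp hsq (hcl (mem_cell_supp x)) hy ?_
    rw [h.sec_base, hpq, h.sec_base]
    exact hlt
  rw [hfy] at hpy hqy
  have hpB : sec Λ ℰ p y ∈ B := by
    have hb : Λ.base (sec Λ ℰ p y) = Λ.base (sec Λ ℰ q y) := hpy.2.trans hqy.2.symm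
    rcases hpy.1 with (hA | hB) | hZ
    · rcases hqy.1 with (hA' | hB') | hZ'
      · exact absurd (congrArg Λ.height (hf.injOn_left (Or.inl hA) (Or.inl hA') hb)) hlt'.ne
      · exact absurd (hf.above _ hA _ hB' hb) hlt'.not_gt
      · exact absurd (congrArg Λ.height (hf.injOn_left (Or.inl hA) (Or.inr hZ') hb)) hlt'.ne
    · exact hB
    · exact absurd (congrArg Λ.height
        (hf.eq_of_base_eq (Or.inr hZ) (hf.edge_mem hZ) hqy.1 hb)) hlt'.ne
  have hpcusp : ∀ z ∈ ℰ.cell (ℰ.supp x), sec Λ ℰ p z ∉ Λ.cusp := fun z hz hm =>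
    hf.right_notMem _ hpB (h.mem_cusp_of_isSection hsp hz (hcl hy) hm)
  have : μ.toFun (sec Λ ℰ p x) = μ.toFun (sec Λ ℰ p y) := by
    refine (isPreconnected_cell (supp_mem_faces x)).induction₂
      (fun a b => μ.toFun (sec Λ ℰ p a) = μ.toFun (sec Λ ℰ p b)) (fun a ha => ?_)
      (fun a b c _ _ _ hab hbc => hab.trans hbc) (fun a b _ _ hab => hab.symm) (mem_cell_supp x) hy
    have := ((hsp.continuousOn a (hcl ha)).mono hcl).eventually
      (μ.locallyConstant _ (hpcusp a ha))
    exact this.mono fun b hb => hb.symm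
  rw [h.sec_base] at this
  rw [this]
  exact hconst _ hpB _ hb₀

end Admissible

end LegendrianSheaf

namespace LegendrianSheaf

open Set Filter

set_option linter.unusedSectionVars false

variable {L M : Type*} [TopologicalSpace L] [ChartedSpace Plane L]
  [TopologicalSpace M] [ChartedSpace Plane M] [IsManifold (𝓡 2) ∞ M]
  {V : Type*}

/-- The label `c` of a sheet or cusp component contributes a generator at the point `w` of
`M × ℝ`: some point of its branch is below `w` and, for a cusp component, some point is not. -/
def IsActive (Λ : LegendrianSurface L M) (ℰ : Triangulation V M) (J : Finset V) (c : L) (w : M × ℝ) :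
    Prop :=
  (∃ q ∈ fib Λ ℰ J c w.1, Λ.height q < w.2) ∧
    (c ∈ Λ.cusp → ∃ q ∈ fib Λ ℰ J c w.1, w.2 ≤ Λ.height q)

namespace Admissible

open Triangulation LegendrianSurface

variable [IsManifold (𝓡 2) ∞ L] [CompactSpace L] [T2Space L] [T2Space M]
  {Λ : LegendrianSurface L M} {ℰ : Triangulation V M}
variable (h : Admissible Λ ℰ)
include h

theorem eventually_forall_fiber {w₀ : M × ℝ} {ℓ : Filter (M × ℝ)} (hℓ : ℓ ≤ 𝓝 w₀)
    {P : L → M × ℝ → Prop}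
    (hP : ∀ p, Λ.base p = w₀.1 → ∃ U ∈ 𝓝 p, ∀ᶠ w in ℓ, ∀ q ∈ U, Λ.base q = w.1 → P q w) :
    ∀ᶠ w in ℓ, ∀ q, Λ.base q = w.1 → P q w := by
  classical
  have hfin := finite_fiber h.mild (Λ := Λ) w₀.1
  choose! U hU hUP using hP
  have h1 : ∀ᶠ y in 𝓝 w₀.1, ∀ q, Λ.base q = y → ∃ p ∈ {p | Λ.base p = w₀.1}, q ∈ U p :=
    eventually_fiber fun p hp => by
      filter_upwards [hU p hp] with q hq using ⟨p, hp, hq⟩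
  have h2 : ∀ᶠ w in ℓ, ∀ q, Λ.base q = w.1 → ∃ p ∈ {p | Λ.base p = w₀.1}, q ∈ U p :=
    (continuous_fst.tendsto w₀ |>.eventually h1).filter_mono hℓ
  filter_upwards [h2, (hfin.eventually_all).mpr hUP] with w hw hw' q hq
  obtain ⟨p, hp, hqp⟩ := hw q hq
  exact hw' p hp q hqp hq

theorem eventually_forall_fib {J : Finset V} (hJ : J ∈ ℰ.faces) {w₀ : M × ℝ}
    (hx : J ⊆ ℰ.supp w₀.1) {c : L} {ℓ : Filter (M × ℝ)} (hℓ : ℓ ≤ 𝓝 w₀) {P : L → M × ℝ → Prop}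
    (hP : ∀ p ∈ fib Λ ℰ J c w₀.1, ∃ U ∈ 𝓝 p, ∀ᶠ w in ℓ, ∀ q ∈ U, Λ.base q = w.1 → P q w) :
    ∀ᶠ w in ℓ, ∀ q ∈ fib Λ ℰ J c w.1, P q w := by
  have := h.eventually_forall_fiber hℓ (P := fun q w => transport Λ ℰ J q = c → P q w) (by
    intro p hp
    by_cases hpc : transport Λ ℰ J p = c
    · obtain ⟨U, hU, hUP⟩ := hP p ⟨hp, hpc⟩
      exact ⟨U, hU, hUP.mono fun w hw q hq hqw _ => hw q hq hqw⟩
    · refine ⟨_, h.eventually_transport_eq (q₀ := p) hJ (by rwa [hp]), Eventually.of_forall ?_⟩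
      intro w q hq _ hqc
      exact absurd (hq.symm.trans hqc) hpc)
  filter_upwards [this] with w hw q hq
  exact hw q hq.1 hq.2

theorem exists_nhds_height_lt {w₀ : M × ℝ} {p : L} (hp : Λ.height p < w₀.2) :
    ∃ U ∈ 𝓝 p, ∀ᶠ w in 𝓝 w₀, ∀ q ∈ U, Λ.height q < w.2 := by
  obtain ⟨m, h1, h2⟩ := exists_between hp
  refine ⟨_, Λ.continuous_height.continuousAt.eventually_lt_const h1, ?_⟩
  filter_upwards [continuous_snd.continuousAt.eventually_const_lt h2] with w hw q hq
  exact lt_trans hq hw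

theorem exists_nhds_lt_height {w₀ : M × ℝ} {p : L} (hp : w₀.2 < Λ.height p) :
    ∃ U ∈ 𝓝 p, ∀ᶠ w in 𝓝 w₀, ∀ q ∈ U, w.2 < Λ.height q := by
  obtain ⟨m, h1, h2⟩ := exists_between hp
  refine ⟨_, Λ.continuous_height.continuousAt.eventually_const_lt h2, ?_⟩
  filter_upwards [continuous_snd.continuousAt.eventually_lt_const h1] with w hw q hq
  exact lt_trans hw hq

theorem eventually_forall_height_lt {J : Finset V} (hJ : J ∈ ℰ.faces) {w₀ : M × ℝ}
    (hx : J ⊆ ℰ.supp w₀.1) {c : L} (hlt : ∀ p ∈ fib Λ ℰ J c w₀.1, Λ.height p < w₀.2) :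
    ∀ᶠ w in 𝓝 w₀, ∀ q ∈ fib Λ ℰ J c w.1, Λ.height q < w.2 :=
  h.eventually_forall_fib hJ hx le_rfl fun p hp => by
    obtain ⟨U, hU, hw⟩ := h.exists_nhds_height_lt (hlt p hp)
    exact ⟨U, hU, hw.mono fun w hw q hq _ => hw q hq⟩

theorem eventually_exists_fib {J : Finset V} (hJ : J ∈ ℰ.faces) {w₀ : M × ℝ}
    (hx : J ⊆ ℰ.supp w₀.1) {c p : L} (hp : p ∈ fib Λ ℰ J c w₀.1) (hpc : p ∉ Λ.cusp) {U : Set L}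
    (hU : U ∈ 𝓝 p) : ∀ᶠ w in 𝓝 w₀, ∃ q ∈ fib Λ ℰ J c w.1, q ∈ U ∧ q ∉ Λ.cusp := by
  have h1 : ∀ᶠ y in 𝓝 w₀.1, ∃ q ∈ fib Λ ℰ J c y, q ∈ U ∧ q ∉ Λ.cusp := by
    rw [← hp.1, ← map_base_nhds hpc, eventually_map]
    filter_upwards [hU, h.eventually_transport_eq (q₀ := p) hJ (by rwa [hp.1]),
      (isClosed_cusp h.mild).isOpen_compl.mem_nhds hpc] with q hq hqt hqc
    exact ⟨q, ⟨rfl, hqt.trans hp.2⟩, hq, hqc⟩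
  exact continuous_fst.tendsto w₀ |>.eventually h1

theorem eventually_exists_height_lt {J : Finset V} (hJ : J ∈ ℰ.faces) {w₀ : M × ℝ}
    (hx : J ⊆ ℰ.supp w₀.1) {c p : L} (hp : p ∈ fib Λ ℰ J c w₀.1) (hpc : p ∉ Λ.cusp)
    (hlt : Λ.height p < w₀.2) : ∀ᶠ w in 𝓝 w₀, ∃ q ∈ fib Λ ℰ J c w.1, Λ.height q < w.2 := by
  obtain ⟨U, hU, hw⟩ := h.exists_nhds_height_lt hlt
  filter_upwards [hw, h.eventually_exists_fib hJ hx hp hpc hU] with w hw ⟨q, hq, hqU, _⟩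
  exact ⟨q, hq, hw q hqU⟩

/-- Distinct points with the same label have different heights. -/
theorem eq_of_mem_fib {J : Finset V} {c : L} (hc : ℰ.IsCenter J (Λ.base c)) {x : M}
    (hx : J ⊆ ℰ.supp x) {p q : L} (hp : p ∈ fib Λ ℰ J c x) (hq : q ∈ fib Λ ℰ J c x)
    (hpq : Λ.height p = Λ.height q) : p = q := by
  by_cases hcc : c ∈ Λ.cusp
  · rcases h.fib_cases hc hcc hx with he | ⟨r, -, he⟩ | ⟨u, l, -, -, hlt, he⟩
    · rw [he] at hp; exact hp.elim
    · rw [he] at hp hq; exact hp.trans hq.symm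
    · rw [he] at hp hq
      rcases hp with rfl | rfl <;> rcases hq with rfl | rfl
      · rfl
      · exact absurd hpq hlt.ne'
      · exact absurd hpq hlt.ne
      · rfl
  · obtain ⟨r, -, he⟩ := h.exists_fib_eq_singleton hc hcc hx
    rw [he] at hp hq; exact hp.trans hq.symm

theorem fib_eq_singleton_of_mem_cusp {J : Finset V} {c : L} (hc : ℰ.IsCenter J (Λ.base c)) {x : M}
    (hx : J ⊆ ℰ.supp x) {q : L} (hq : q ∈ fib Λ ℰ J c x) (hqc : q ∈ Λ.cusp) :
    fib Λ ℰ J c x = {q} := by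
  have hcc : c ∈ Λ.cusp := by
    rw [← hq.2]
    exact h.transport_mem_cusp (mem_faces_of_mem_cell hc.1) (by rwa [hq.1]) hqc
  rcases h.fib_cases hc hcc hx with he | ⟨r, -, he⟩ | ⟨u, l, hu, hl, hlt, he⟩
  · rw [he] at hq; exact hq.elim
  · rw [he] at hq ⊢; rw [show q = r from hq]
  · rw [he] at hq
    rcases hq with rfl | rfl
    · exact absurd hqc hu
    · exact absurd hqc hl

theorem exists_fib_eq_pair {J : Finset V} {c : L} (hc : ℰ.IsCenter J (Λ.base c)) (hcc : c ∈ Λ.cusp)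
    {x : M} (hx : J ⊆ ℰ.supp x) {q : L} (hq : q ∈ fib Λ ℰ J c x) (hqc : q ∉ Λ.cusp) :
    ∃ u l, u ∉ Λ.cusp ∧ l ∉ Λ.cusp ∧ Λ.height l < Λ.height u ∧ fib Λ ℰ J c x = {u, l} := by
  rcases h.fib_cases hc hcc hx with he | ⟨r, hr, he⟩ | hul
  · rw [he] at hq; exact hq.elim
  · rw [he] at hq; rw [show q = r from hq] at hqc; exact absurd hr hqc
  · exact hul

/-- Activity is locally constant along a filter in which the points of the front persist. -/
theorem eventually_isActive_iff {J : Finset V} {c : L} (hc : ℰ.IsCenter J (Λ.base c))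
    {w₀ : M × ℝ} (hx : J ⊆ ℰ.supp w₀.1) {ℓ : Filter (M × ℝ)} (hℓ : ℓ ≤ 𝓝 w₀)
    (H : ∀ p ∈ fib Λ ℰ J c w₀.1, Λ.height p = w₀.2 → ∀ U ∈ 𝓝 p,
      ∀ᶠ w in ℓ, ∃ q ∈ U, Λ.front q = w ∧ (p ∈ Λ.cusp → q ∈ Λ.cusp)) :
    ∀ᶠ w in ℓ, (IsActive Λ ℰ J c w ↔ IsActive Λ ℰ J c w₀) := by
  have hJ := mem_faces_of_mem_cell hc.1
  have hstar : ∀ᶠ w in ℓ, J ⊆ ℰ.supp w.1 :=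
    (continuous_fst.tendsto w₀ |>.eventually ((isOpen_star J).mem_nhds hx)).filter_mono hℓ
  have hpers : ∀ p ∈ fib Λ ℰ J c w₀.1, Λ.height p = w₀.2 → ∀ᶠ w in ℓ,
      ∃ q ∈ fib Λ ℰ J c w.1, Λ.height q = w.2 ∧ (p ∈ Λ.cusp → q ∈ Λ.cusp) := by
    intro p hp hpz
    filter_upwards [H p hp hpz _ (h.eventually_transport_eq (q₀ := p) hJ (by rwa [hp.1]))]
      with w ⟨q, hq, hqw, hqc⟩
    subst hqw
    exact ⟨q, ⟨rfl, hq.trans hp.2⟩, rfl, hqc⟩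
  by_cases hcusp : ∃ p ∈ fib Λ ℰ J c w₀.1, p ∈ Λ.cusp
  · obtain ⟨p, hp, hpc⟩ := hcusp
    have hcc : c ∈ Λ.cusp := by
      rw [← hp.2]
      exact h.transport_mem_cusp hJ (by rwa [hp.1]) hpc
    have hsing := h.fib_eq_singleton_of_mem_cusp hc hx hp hpc
    have key : ∀ {w : M × ℝ} {q : L}, fib Λ ℰ J c w.1 = {q} → ¬ IsActive Λ ℰ J c w := by
      rintro w q hs ⟨⟨a, ha, hlt⟩, hb⟩
      obtain ⟨b, hb, hle⟩ := hb hcc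
      rw [hs] at ha hb
      obtain rfl : a = q := ha
      obtain rfl : b = a := hb
      exact hlt.not_ge hle
    have h0 := key hsing
    have hev : ∀ᶠ w in ℓ, ¬ IsActive Λ ℰ J c w := by
      rcases lt_trichotomy (Λ.height p) w₀.2 with hl | he | hg
      · have := h.eventually_forall_height_lt hJ hx (c := c) (by
          rw [hsing]; rintro _ rfl; exact hl)
        filter_upwards [this.filter_mono hℓ] with w hw ha
        obtain ⟨b, hb, hle⟩ := ha.2 hcc
        exact (hw b hb).not_ge hle
      · filter_upwards [hpers p hp he, hstar] with w ⟨q, hq, _, hqc⟩ hst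
        exact key (h.fib_eq_singleton_of_mem_cusp hc hst hq (hqc hpc))
      · have := h.eventually_forall_fib hJ hx le_rfl (c := c) (P := fun q w => w.2 < Λ.height q) (by
          rw [hsing]
          rintro _ rfl
          obtain ⟨U, hU, hw⟩ := h.exists_nhds_lt_height hg
          exact ⟨U, hU, hw.mono fun w hw q hq _ => hw q hq⟩)
        filter_upwards [this.filter_mono hℓ] with w hw ha
        obtain ⟨b, hb, hlt⟩ := ha.1
        exact (hw b hb).not_gt hlt
    filter_upwards [hev] with w hw using iff_of_false hw h0
  · push Not at hcusp
    have hlow : ∀ᶠ w in ℓ, ((∃ q ∈ fib Λ ℰ J c w.1, Λ.height q < w.2) ↔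
        ∃ q ∈ fib Λ ℰ J c w₀.1, Λ.height q < w₀.2) := by
      by_cases h0 : ∃ q ∈ fib Λ ℰ J c w₀.1, Λ.height q < w₀.2
      · obtain ⟨p, hp, hlt⟩ := id h0
        filter_upwards [(h.eventually_exists_height_lt hJ hx hp (hcusp p hp) hlt).filter_mono hℓ]
          with w hw using iff_of_true hw h0
      · push Not at h0
        have := h.eventually_forall_fib hJ hx hℓ (c := c) (P := fun q w => w.2 ≤ Λ.height q) (by
          intro p hp
          rcases (h0 p hp).lt_or_eq with hlt | heq
          · obtain ⟨U, hU, hw⟩ := h.exists_nhds_lt_height hlt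
            exact ⟨U, hU, (hw.filter_mono hℓ).mono fun w hw q hq _ => (hw q hq).le⟩
          · obtain ⟨U, hU, hi⟩ := exists_injOn_base (hcusp p hp)
            refine ⟨U, hU, ?_⟩
            filter_upwards [H p hp heq.symm U hU] with w ⟨r, hr, hrw, _⟩ q hq hqw
            subst hrw
            rw [hi hq hr hqw]
            exact le_rfl)
        filter_upwards [this] with w hw
        refine iff_of_false ?_ (by push Not; exact h0)
        push Not
        exact hw
    have hhigh : ∀ᶠ w in ℓ, ((∃ q ∈ fib Λ ℰ J c w.1, w.2 ≤ Λ.height q) ↔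
        ∃ q ∈ fib Λ ℰ J c w₀.1, w₀.2 ≤ Λ.height q) := by
      by_cases h0 : ∃ q ∈ fib Λ ℰ J c w₀.1, w₀.2 ≤ Λ.height q
      · obtain ⟨p, hp, hle⟩ := id h0
        rcases hle.lt_or_eq with hlt | heq
        · obtain ⟨U, hU, hw⟩ := h.exists_nhds_lt_height hlt
          filter_upwards [hw.filter_mono hℓ,
            (h.eventually_exists_fib hJ hx hp (hcusp p hp) hU).filter_mono hℓ]
            with w hw ⟨q, hq, hqU, _⟩
          exact iff_of_true ⟨q, hq, (hw q hqU).le⟩ h0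
        · filter_upwards [hpers p hp heq.symm] with w ⟨q, hq, hqz, _⟩
          exact iff_of_true ⟨q, hq, hqz.ge⟩ h0
      · have h0' := h0
        push Not at h0'
        filter_upwards [(h.eventually_forall_height_lt hJ hx h0').filter_mono hℓ] with w hw
        refine iff_of_false ?_ h0
        push Not
        exact hw
    filter_upwards [hlow, hhigh] with w h1 h2
    rw [IsActive, IsActive, h1, h2]

theorem eventually_isActive_iff_below {J : Finset V} {c : L} {x₀ : M} (z₀ : ℝ) :
    ∀ᶠ z in 𝓝[<] z₀, (IsActive Λ ℰ J c (x₀, z) ↔ IsActive Λ ℰ J c (x₀, z₀)) := by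
  have hfin : (fib Λ ℰ J c x₀).Finite :=
    (finite_fiber h.mild (Λ := Λ) x₀).subset fun q hq => hq.1
  have hall : ∀ᶠ z in 𝓝[<] z₀, ∀ q ∈ fib Λ ℰ J c x₀, (Λ.height q < z ↔ Λ.height q < z₀) := by
    refine (hfin.eventually_all).mpr fun q _ => ?_
    by_cases hq : Λ.height q < z₀
    · filter_upwards [(lt_mem_nhds hq).filter_mono nhdsWithin_le_nhds] with z hz
      exact iff_of_true hz hq
    · filter_upwards [self_mem_nhdsWithin] with z hz
      exact iff_of_false (fun h => hq (h.trans hz)) hq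
  filter_upwards [hall] with z hz
  have e1 : (∃ q ∈ fib Λ ℰ J c x₀, Λ.height q < z) ↔ ∃ q ∈ fib Λ ℰ J c x₀, Λ.height q < z₀ :=
    exists_congr fun q => and_congr_right fun hq => hz q hq
  have e2 : (∃ q ∈ fib Λ ℰ J c x₀, z ≤ Λ.height q) ↔ ∃ q ∈ fib Λ ℰ J c x₀, z₀ ≤ Λ.height q :=
    exists_congr fun q => and_congr_right fun hq => by
      rw [← not_lt, ← not_lt, hz q hq]
  exact and_congr e1 (imp_congr Iff.rfl e2)

end Admissible

end LegendrianSheaf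

namespace LegendrianSheaf

open Set Filter

set_option linter.unusedSectionVars false

variable {L M : Type*} [TopologicalSpace L] [ChartedSpace Plane L]
  [TopologicalSpace M] [ChartedSpace Plane M] [IsManifold (𝓡 2) ∞ M]
  {V : Type*}

namespace Stratum

open Triangulation

variable {Λ : LegendrianSurface L M} {ℰ : Triangulation V M} (s s' : Stratum Λ ℰ)

theorem carrier_subset : s.carrier ⊆ Λ.frontStratum s.k ∩ ℰ.handleCell s.I s.J ×ˢ univ := by
  obtain ⟨p, -, hs⟩ := s.isComponent
  rw [hs]
  exact connectedComponentIn_subset _ _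

theorem nonempty : s.carrier.Nonempty := by
  obtain ⟨p, hp, hs⟩ := s.isComponent
  exact ⟨p, hs ▸ mem_connectedComponentIn hp⟩

theorem isPreconnected : _root_.IsPreconnected s.carrier := by
  obtain ⟨p, -, hs⟩ := s.isComponent
  rw [hs]
  exact isPreconnected_connectedComponentIn

variable {s s'}

theorem fst_mem {w : M × ℝ} (hw : w ∈ s.carrier) : w.1 ∈ ℰ.handleCell s.I s.J :=
  (s.carrier_subset hw).2.1

theorem frontDepth_eq {w : M × ℝ} (hw : w ∈ s.carrier) : (Λ.frontDepth w : ℤ) - 1 = s.k :=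
  (s.carrier_subset hw).1

theorem isDualRegion (s : Stratum Λ ℰ) : IsDualRegion ℰ s.J s.handle :=
  isDualRegion_handle s.I_mem s.J_mem s.I_subset

theorem subset_supp {w : M × ℝ} (hw : w ∈ s.carrier) : s.J ⊆ ℰ.supp w.1 :=
  s.isDualRegion.subset_star (fst_mem hw)

theorem exists_of_le (hs : s ≤ s') {w : M × ℝ} (hw : w ∈ s.carrier) {P : M × ℝ → Prop}
    (hP : ∀ᶠ w' in 𝓝 w, P w') : ∃ w' ∈ s'.carrier, P w' := by
  obtain ⟨w', h1, h2⟩ := mem_closure_iff_nhds.mp (hs hw) _ hP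
  exact ⟨w', h2, h1⟩

theorem faces_of_le (hs : s ≤ s') : s.I ⊆ s'.I ∧ s'.J ⊆ s.J := by
  obtain ⟨w, hw⟩ := s.nonempty
  refine subset_of_mem_closure_handle (fst_mem hw) (mem_closure_iff_nhds.mpr fun U hU => ?_)
  obtain ⟨w', hw', hU'⟩ := exists_of_le hs hw (continuous_fst.continuousAt.preimage_mem_nhds hU)
  exact ⟨w'.1, hU', fst_mem hw'⟩

variable (s) in
/-- The labels of the sheets and cusp components which contribute generators to `X(s)`. -/
def active : Set L := {c | ℰ.IsCenter s.J (Λ.base c) ∧ ∃ w ∈ s.carrier, IsActive Λ ℰ s.J c w}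

end Stratum

namespace Admissible

open Triangulation LegendrianSurface Stratum

variable [IsManifold (𝓡 2) ∞ L] [CompactSpace L] [T2Space L] [T2Space M]
  {Λ : LegendrianSurface L M} {ℰ : Triangulation V M}
variable (h : Admissible Λ ℰ) {s s' s'' : Stratum Λ ℰ}
include h

theorem eventually_isActive_iff_of_frontDepth_eq {J : Finset V} {c : L}
    (hc : ℰ.IsCenter J (Λ.base c)) {w₀ : M × ℝ} (hx : J ⊆ ℰ.supp w₀.1) {S : Set (M × ℝ)}
    (hS : ∀ w ∈ S, Λ.frontDepth w = Λ.frontDepth w₀) :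
    ∀ᶠ w in 𝓝[S] w₀, (IsActive Λ ℰ J c w ↔ IsActive Λ ℰ J c w₀) := by
  refine h.eventually_isActive_iff hc hx nhdsWithin_le_nhds fun p hp hpz U hU => ?_
  have hf : Λ.front p = w₀ := Prod.ext hp.1 hpz
  have := exists_front_eq_of_frontDepth_eq h.mild (q₀ := p) hU
  rw [hf] at this
  filter_upwards [this.filter_mono nhdsWithin_le_nhds, self_mem_nhdsWithin] with w hw hwS
  exact hw (hS w hwS)

theorem mem_active_iff {w : M × ℝ} (hw : w ∈ s.carrier) {c : L} :
    c ∈ s.active ↔ ℰ.IsCenter s.J (Λ.base c) ∧ IsActive Λ ℰ s.J c w := by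
  refine and_congr_right fun hc => ⟨?_, fun ha => ⟨w, hw, ha⟩⟩
  rintro ⟨w', hw', ha⟩
  refine s.isPreconnected.induction₂ (fun a b => IsActive Λ ℰ s.J c a ↔ IsActive Λ ℰ s.J c b) ?_
    (fun a b c _ _ _ hab hbc => hab.trans hbc) (fun a b _ _ hab => hab.symm) hw' hw |>.mp ha
  intro a ha
  refine (h.eventually_isActive_iff_of_frontDepth_eq hc (subset_supp ha) fun b hb => ?_).mono
    fun b hb => hb.symm
  have h1 := frontDepth_eq ha
  have h2 := frontDepth_eq hb
  lia

theorem mem_below_iff {T : Set L} : T ∈ s.below ↔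
    ∃ c ∈ s.active, c ∉ Λ.cusp ∧ T = branch Λ ℰ s.J s.handle c := by
  rw [Stratum.below, mem_ofPred_eq, h.mem_sheets_iff s.isDualRegion]
  constructor
  · rintro ⟨⟨c, hc, hcc, rfl⟩, hT⟩
    obtain ⟨w, hw⟩ := s.nonempty
    obtain ⟨q, -, hq⟩ := h.exists_fib_eq_singleton hc hcc (subset_supp hw)
    have hm : q ∈ fib Λ ℰ s.J c w.1 := by rw [hq]; rfl
    refine ⟨c, ⟨hc, w, hw, ⟨q, hm, hT q ⟨?_, hm.2⟩ _ ?_⟩, fun h => absurd h hcc⟩, hcc, rfl⟩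
    · rw [hm.1]; exact fst_mem hw
    · rw [hm.1]; exact hw
  · rintro ⟨c, hc, hcc, rfl⟩
    refine ⟨⟨c, hc.1, hcc, rfl⟩, fun p hp z hz => ?_⟩
    obtain ⟨q, hq, hlt⟩ := ((h.mem_active_iff hz).mp hc).2.1
    obtain ⟨r, -, hr⟩ := h.exists_fib_eq_singleton hc.1 hcc (subset_supp hz)
    have hp' : p ∈ fib Λ ℰ s.J c (Λ.base p) := ⟨rfl, hp.2⟩
    rw [hr] at hq hp'
    rw [show p = q from hp'.trans hq.symm]
    exact hlt

theorem mem_exceptional_iff {C : Set L} : C ∈ s.exceptional ↔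
    ∃ c ∈ s.active, c ∈ Λ.cusp ∧ C = branch Λ ℰ s.J s.handle c := by
  rw [Stratum.exceptional, mem_ofPred_eq, h.mem_cuspComponents_iff s.isDualRegion]
  constructor
  · rintro ⟨⟨c, hc, hcc, rfl⟩, hC⟩
    obtain ⟨w, hw⟩ := s.nonempty
    obtain ⟨p, hp, q, hq, hpw, hqw, h1, h2⟩ := hC w hw
    exact ⟨c, ⟨hc, w, hw, ⟨p, ⟨hpw, hp.1.2⟩, h1⟩, fun _ => ⟨q, ⟨hqw, hq.1.2⟩, h2⟩⟩, hcc, rfl⟩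
  · rintro ⟨c, hc, hcc, rfl⟩
    refine ⟨⟨c, hc.1, hcc, rfl⟩, fun w hw => ?_⟩
    obtain ⟨⟨p, hp, h1⟩, hq⟩ := ((h.mem_active_iff hw).mp hc).2
    obtain ⟨q, hq, h2⟩ := hq hcc
    have hpb : p ∈ branch Λ ℰ s.J s.handle c := ⟨hp.1 ▸ fst_mem hw, hp.2⟩
    have hqb : q ∈ branch Λ ℰ s.J s.handle c := ⟨hq.1 ▸ fst_mem hw, hq.2⟩
    have hpq := hp.1.trans hq.1.symm
    have hlt := h1.trans_le h2
    exact ⟨p, ⟨hpb, q, hqb, hpq.symm, hlt⟩, q, ⟨hqb, p, hpb, hpq, hlt⟩, hp.1, hq.1, h1, h2⟩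

theorem isCenter_transport_of_le (hs : s ≤ s') {c : L} (hc : ℰ.IsCenter s.J (Λ.base c)) :
    ℰ.IsCenter s'.J (Λ.base (transport Λ ℰ s'.J c)) :=
  h.isCenter_transport s'.J_mem
    ((faces_of_le hs).2.trans (mem_cell_iff.mp hc.1).symm.subset)

theorem mem_fib_of_le (hs : s ≤ s') {p : L} {x : M} (hx : s.J ⊆ ℰ.supp x) {c' : L} :
    p ∈ fib Λ ℰ s'.J c' x ↔ Λ.base p = x ∧ transport Λ ℰ s'.J (transport Λ ℰ s.J p) = c' := by
  refine and_congr_right fun hp => ?_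
  rw [h.transport_transport s'.J_mem (faces_of_le hs).2 s.J_mem (by rwa [hp])]

theorem mem_fib_center_of_le (hs : s ≤ s') {p : L} {x b : M} (hx : s.J ⊆ ℰ.supp x)
    (hb : ℰ.IsCenter s.J b) {c' : L} : p ∈ fib Λ ℰ s'.J c' x ↔
      Λ.base p = x ∧ transport Λ ℰ s.J p ∈ fib Λ ℰ s'.J c' b := by
  rw [h.mem_fib_of_le hs hx]
  refine and_congr_right fun hp => ⟨fun ht => ⟨?_, ht⟩, fun ht => ht.2⟩
  exact (h.isCenter_transport s.J_mem (by rwa [hp])).eq hb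

theorem subset_supp_center (hs : s ≤ s') {b : M} (hb : ℰ.IsCenter s.J b) : s'.J ⊆ ℰ.supp b :=
  (faces_of_le hs).2.trans (mem_cell_iff.mp hb.1).symm.subset

/-- The heights of the points with a given label are not all below a point in the closure of a
stratum for which a cusp component is exceptional. -/
theorem exists_le_height_of_mem_active (hs : s ≤ s') {c' : L} (hc : c' ∈ s'.active)
    (hcc : c' ∈ Λ.cusp) {w : M × ℝ} (hw : w ∈ s.carrier) :
    ∃ p ∈ fib Λ ℰ s'.J c' w.1, w.2 ≤ Λ.height p := by
  by_contra! hn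
  obtain ⟨w', hw', hlt⟩ := exists_of_le hs hw (h.eventually_forall_height_lt s'.J_mem
    ((faces_of_le hs).2.trans (subset_supp hw)) hn)
  obtain ⟨q, hq, hle⟩ := ((h.mem_active_iff hw').mp hc).2.2 hcc
  exact (hlt q hq).not_ge hle

/-- A sheet below `s` in the closure of a cusp component for which `s'` is exceptional is a lower
sheet. -/
theorem exists_upper_of_mem_active (hs : s ≤ s') {c : L} (hc : c ∈ s.active) (hcc : c ∉ Λ.cusp)
    (hc' : transport Λ ℰ s'.J c ∈ s'.active) (hcc' : transport Λ ℰ s'.J c ∈ Λ.cusp) :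
    ∃ u, ℰ.IsCenter s.J (Λ.base u) ∧ u ∉ Λ.cusp ∧
      transport Λ ℰ s'.J u = transport Λ ℰ s'.J c ∧ Λ.height c < Λ.height u := by
  have hcs := h.subset_supp_center hs hc.1
  obtain ⟨u, l, hu, hl, hlt, hul⟩ := h.exists_fib_eq_pair hc'.1 hcc' hcs (q := c) ⟨rfl, rfl⟩ hcc
  have hum : u ∈ fib Λ ℰ s'.J (transport Λ ℰ s'.J c) (Λ.base c) := by rw [hul]; exact Or.inl rfl
  have hcm : c ∈ ({u, l} : Set L) := by rw [← hul]; exact ⟨rfl, rfl⟩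
  have hucen : ℰ.IsCenter s.J (Λ.base u) := by rw [hum.1]; exact hc.1
  rcases hcm with rfl | rfl
  · exfalso
    obtain ⟨w, hw⟩ := s.nonempty
    obtain ⟨p, hp, hle⟩ := h.exists_le_height_of_mem_active hs hc' hcc' hw
    obtain ⟨hpw, hpt⟩ := (h.mem_fib_center_of_le hs (subset_supp hw) hc.1).mp hp
    obtain ⟨q, hq, hqlt⟩ := ((h.mem_active_iff hw).mp hc).2.1
    rw [hul] at hpt
    rcases hpt with hpt | hpt
    · obtain ⟨r, -, hr⟩ := h.exists_fib_eq_singleton hc.1 hcc (subset_supp hw)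
      have hp' : p ∈ fib Λ ℰ s.J c w.1 := ⟨hpw, hpt⟩
      rw [hr] at hp' hq
      rw [show p = q from hp'.trans hq.symm] at hle
      exact hqlt.not_ge hle
    · have hpt : transport Λ ℰ s.J p = l := hpt
      have := h.height_lt_of_transport s.J_mem (p := p) (q := q) (hpw.trans hq.1.symm)
        (by rw [hpw]; exact subset_supp hw) (by rw [hpt, hq.2]; exact hlt)
      exact (this.trans hqlt).not_ge hle
  · exact ⟨u, hucen, hu, hum.2, hlt⟩

theorem transport_mem_active (hs : s ≤ s') {c : L} (hc : c ∈ s.active)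
    (hcc : transport Λ ℰ s'.J c ∉ Λ.cusp) : transport Λ ℰ s'.J c ∈ s'.active := by
  have hcen := h.isCenter_transport_of_le hs hc.1
  have hcc' := h.notMem_cusp_of_transport s'.J_mem (h.subset_supp_center hs hc.1) hcc
  obtain ⟨w, hw⟩ := s.nonempty
  obtain ⟨q, hq, hlt⟩ := ((h.mem_active_iff hw).mp hc).2.1
  have hqc := h.notMem_cusp_of_transport s.J_mem (q := q) (by rw [hq.1]; exact subset_supp hw)
    (by rwa [hq.2])
  have hq' : q ∈ fib Λ ℰ s'.J (transport Λ ℰ s'.J c) w.1 :=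
    (h.mem_fib_of_le hs (subset_supp hw)).mpr ⟨hq.1, by rw [hq.2]⟩
  obtain ⟨w', hw', hlow⟩ := exists_of_le hs hw (h.eventually_exists_height_lt s'.J_mem
    ((faces_of_le hs).2.trans (subset_supp hw)) hq' hqc hlt)
  exact ⟨hcen, w', hw', hlow, fun h => absurd h hcc⟩

theorem transport_mem_active_of_le_of_le (hs : s ≤ s') (hs' : s' ≤ s'') {c : L}
    (hc : c ∈ s.active) (hc'' : transport Λ ℰ s''.J c ∈ s''.active) :
    transport Λ ℰ s'.J c ∈ s'.active := by
  by_cases hcc : transport Λ ℰ s'.J c ∈ Λ.cusp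
  swap
  · exact h.transport_mem_active hs hc hcc
  have hcen := h.isCenter_transport_of_le hs hc.1
  have hcs := h.subset_supp_center hs hc.1
  have htt : transport Λ ℰ s''.J (transport Λ ℰ s'.J c) = transport Λ ℰ s''.J c :=
    h.transport_transport s''.J_mem (faces_of_le hs').2 s'.J_mem hcs
  have hcc'' : transport Λ ℰ s''.J c ∈ Λ.cusp := by
    rw [← htt]
    exact h.transport_mem_cusp s''.J_mem (h.subset_supp_center hs' hcen) hcc
  obtain ⟨w, hw⟩ := s.nonempty
  have hsupp := subset_supp hw
  have hsupp' : s'.J ⊆ ℰ.supp w.1 := (faces_of_le hs).2.trans hsupp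
  set c' := transport Λ ℰ s'.J c
  have two : ∃ p ∈ fib Λ ℰ s'.J c' w.1, ∃ q ∈ fib Λ ℰ s'.J c' w.1, p ≠ q ∧ p ∉ Λ.cusp ∧
      q ∉ Λ.cusp ∧ Λ.height p < w.2 := by
    obtain ⟨⟨p, hp, hlt⟩, hq⟩ := ((h.mem_active_iff hw).mp hc).2
    by_cases hccusp : c ∈ Λ.cusp
    · obtain ⟨q, hq, hle⟩ := hq hccusp
      have hne : p ≠ q := by
        rintro rfl
        exact hlt.not_ge hle
      refine ⟨p, (h.mem_fib_of_le hs hsupp).mpr ⟨hp.1, by rw [hp.2]⟩, q,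
        (h.mem_fib_of_le hs hsupp).mpr ⟨hq.1, by rw [hq.2]⟩, hne, fun hpc => ?_, fun hqc => ?_, hlt⟩
      · have := h.fib_eq_singleton_of_mem_cusp hc.1 hsupp hp hpc
        rw [this] at hq
        exact hne hq.symm
      · have := h.fib_eq_singleton_of_mem_cusp hc.1 hsupp hq hqc
        rw [this] at hp
        exact hne hp
    · have hcf : c ∈ fib Λ ℰ s'.J c' (Λ.base c) := ⟨rfl, rfl⟩
      obtain ⟨u, l, hu, hl, hul, hfib⟩ := h.exists_fib_eq_pair hcen hcc hcs hcf hccusp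
      have hother : ∃ o ∈ fib Λ ℰ s'.J c' (Λ.base c), o ≠ c ∧ o ∉ Λ.cusp := by
        rw [hfib] at hcf ⊢
        have hne : u ≠ l := fun h => hul.ne' (congrArg Λ.height h)
        rcases hcf with rfl | rfl
        · exact ⟨l, Or.inr rfl, hne.symm, hl⟩
        · exact ⟨u, Or.inl rfl, hne, hu⟩
      obtain ⟨o, ho, hoc, hocusp⟩ := hother
      obtain ⟨q, hqc, hqf⟩ := h.exists_fib_eq_singleton (c := o) (J := s.J)
        (by rw [ho.1]; exact hc.1) hocusp hsupp
      have hq : q ∈ fib Λ ℰ s.J o w.1 := by rw [hqf]; rfl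
      refine ⟨p, (h.mem_fib_of_le hs hsupp).mpr ⟨hp.1, by rw [hp.2]⟩, q,
        (h.mem_fib_of_le hs hsupp).mpr ⟨hq.1, by rw [hq.2, ho.2]⟩, ?_, ?_, hqc, hlt⟩
      · rintro rfl
        exact hoc (hq.2.symm.trans hp.2)
      · exact h.notMem_cusp_of_transport s.J_mem (by rwa [hp.1]) (by rwa [hp.2])
  obtain ⟨p, hp, q, hq, hne, hpc, hqc, hlt⟩ := two
  obtain ⟨D, D', hD, hD', hpD, hqD, hdisj⟩ := t2_separation hne
  obtain ⟨w', hw', ⟨⟨a, ha, haD, hac⟩, ⟨b, hb, hbD, -⟩⟩, hlow⟩ := exists_of_le hs hw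
    (((h.eventually_exists_fib s'.J_mem hsupp' hp hpc (hD.mem_nhds hpD)).and
      (h.eventually_exists_fib s'.J_mem hsupp' hq hqc (hD'.mem_nhds hqD))).and
      (h.eventually_exists_height_lt s'.J_mem hsupp' hp hpc hlt))
  have hsw := subset_supp hw'
  have hab : a ≠ b := by
    rintro rfl
    exact disjoint_left.mp hdisj haD hbD
  refine ⟨hcen, w', hw', hlow, fun _ => ?_⟩
  obtain ⟨r, hr, hle⟩ := h.exists_le_height_of_mem_active hs' hc'' hcc'' hw'
  have hmem : ∀ t ∈ fib Λ ℰ s'.J c' w'.1, t ∈ fib Λ ℰ s''.J (transport Λ ℰ s''.J c) w'.1 :=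
    fun t ht => (h.mem_fib_of_le hs' hsw).mpr ⟨ht.1, by rw [ht.2, htt]⟩
  obtain ⟨u, l, -, -, -, hul⟩ := h.exists_fib_eq_pair hc''.1 hcc''
    ((faces_of_le hs').2.trans hsw) (hmem a ha) hac
  have ha' := hmem a ha
  have hb' := hmem b hb
  rw [hul] at hr ha' hb'
  have : r = a ∨ r = b := by
    rcases hr with rfl | rfl <;> rcases ha' with rfl | rfl <;> rcases hb' with rfl | rfl <;> simp_all
  rcases this with rfl | rfl
  · exact ⟨r, ha, hle⟩
  · exact ⟨r, hb, hle⟩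

theorem mem_active_of_height_lt {c d : L} (hc : c ∈ s.active)
    (hd : ℰ.IsCenter s.J (Λ.base d)) (hdc : d ∉ Λ.cusp) (hlt : Λ.height d < Λ.height c) :
    d ∈ s.active := by
  obtain ⟨w, hw⟩ := s.nonempty
  obtain ⟨q, hq, hqlt⟩ := ((h.mem_active_iff hw).mp hc).2.1
  obtain ⟨p, -, hpf⟩ := h.exists_fib_eq_singleton hd hdc (subset_supp hw)
  have hp : p ∈ fib Λ ℰ s.J d w.1 := by rw [hpf]; rfl
  have := h.height_lt_of_transport s.J_mem (p := p) (q := q) (hp.1.trans hq.1.symm)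
    (by rw [hp.1]; exact subset_supp hw) (by rwa [hp.2, hq.2])
  exact ⟨hd, w, hw, ⟨p, hp, this.trans hqlt⟩, fun h => absurd h hdc⟩

theorem mem_active_iff_of_k_eq (hs : s ≤ s') (hk : s.k = s'.k) {w : M × ℝ} (hw : w ∈ s.carrier)
    {c : L} (hc : ℰ.IsCenter s'.J (Λ.base c)) : c ∈ s'.active ↔ IsActive Λ ℰ s'.J c w := by
  have hsupp : s'.J ⊆ ℰ.supp w.1 := (faces_of_le hs).2.trans (subset_supp hw)
  have := h.eventually_isActive_iff_of_frontDepth_eq hc hsupp (S := s'.carrier) fun a ha => by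
    have h1 := frontDepth_eq ha
    have h2 := frontDepth_eq hw
    lia
  rw [eventually_nhdsWithin_iff] at this
  obtain ⟨w', hw', hiff⟩ := exists_of_le hs hw this
  rw [h.mem_active_iff hw', ← hiff hw']
  exact and_iff_right hc

theorem mem_active_iff_of_isDownward (hd : IsDownward s s') :
    ∃ w ∈ s.carrier, ∀ c, ℰ.IsCenter s'.J (Λ.base c) →
      (c ∈ s'.active ↔ IsActive Λ ℰ s'.J c w) := by
  obtain ⟨-, x, z, hz, δ, hδ, hs'⟩ := hd
  have hw : (x, z) ∈ s.carrier := by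
    have : z ∈ {z | (x, z) ∈ s.carrier} := by rw [hz]; rfl
    exact this
  refine ⟨_, hw, fun c hc => ?_⟩
  have := h.eventually_isActive_iff_below (J := s'.J) (c := c) (x₀ := x) z
  obtain ⟨z', hiff, hz'⟩ := (this.and (Ioo_mem_nhdsLT (show z - δ < z by linarith))).exists
  rw [h.mem_active_iff (hs' z' hz'), ← hiff]
  exact and_iff_right hc

theorem exists_of_mem_active_iff (hs : s ≤ s') {w : M × ℝ} (hw : w ∈ s.carrier) {c' : L}
    (hc' : ℰ.IsCenter s'.J (Λ.base c')) (hiff : c' ∈ s'.active ↔ IsActive Λ ℰ s'.J c' w) :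
    (c' ∈ s'.active → ∃ c ∈ s.active, transport Λ ℰ s'.J c = c' ∧
      ∀ d ∈ s.active, transport Λ ℰ s'.J d = c' → d = c) ∧
    (c' ∉ s'.active → (∀ c ∈ s.active, transport Λ ℰ s'.J c ≠ c') ∨
      ∃ u ∈ s.active, ∃ l ∈ s.active, u ∉ Λ.cusp ∧ l ∉ Λ.cusp ∧ Λ.height l < Λ.height u ∧
        c' ∈ Λ.cusp ∧ ∀ d, ℰ.IsCenter s.J (Λ.base d) →
          (transport Λ ℰ s'.J d = c' ↔ d = u ∨ d = l)) := by
  obtain ⟨b, hb⟩ := exists_isCenter s.J_mem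
  have hsupp := subset_supp hw
  have hsupp' : s'.J ⊆ ℰ.supp w.1 := (faces_of_le hs).2.trans hsupp
  have hbs := h.subset_supp_center hs hb
  have hfib : ∀ d, ℰ.IsCenter s.J (Λ.base d) →
      (transport Λ ℰ s'.J d = c' ↔ d ∈ fib Λ ℰ s'.J c' b) := fun d hd =>
    ⟨fun h => ⟨hd.eq hb, h⟩, fun h => h.2⟩
  have single : ∀ c, fib Λ ℰ s'.J c' b = {c} → (c ∈ Λ.cusp ↔ c' ∈ Λ.cusp) →
      (c' ∈ s'.active ↔ c ∈ s.active) ∧ transport Λ ℰ s'.J c = c' ∧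
      ∀ d ∈ s.active, transport Λ ℰ s'.J d = c' → d = c := by
    intro c hc hcc
    have hcm : c ∈ fib Λ ℰ s'.J c' b := by rw [hc]; rfl
    have heq : fib Λ ℰ s'.J c' w.1 = fib Λ ℰ s.J c w.1 := by
      ext p
      rw [h.mem_fib_center_of_le hs hsupp hb, hc]
      rfl
    refine ⟨?_, hcm.2, fun d hd hdc => ?_⟩
    · rw [hiff, h.mem_active_iff hw, IsActive, IsActive, heq, hcc]
      exact (and_iff_right (by rw [hcm.1]; exact hb)).symm
    · have := (hfib d hd.1).mp hdc
      rw [hc] at this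
      exact this
  have fromSingle : ∀ c, fib Λ ℰ s'.J c' b = {c} → (c ∈ Λ.cusp ↔ c' ∈ Λ.cusp) →
    (c' ∈ s'.active → ∃ c ∈ s.active, transport Λ ℰ s'.J c = c' ∧
      ∀ d ∈ s.active, transport Λ ℰ s'.J d = c' → d = c) ∧
    (c' ∉ s'.active → ∀ c ∈ s.active, transport Λ ℰ s'.J c ≠ c') := by
    intro c hc hcc
    obtain ⟨h1, h2, h3⟩ := single c hc hcc
    refine ⟨fun ha => ⟨c, h1.mp ha, h2, h3⟩, fun ha d hd hdc => ha (h1.mpr ?_)⟩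
    rwa [← h3 d hd hdc]
  by_cases hcc : c' ∈ Λ.cusp
  · rcases h.fib_cases hc' hcc hbs with he | ⟨c, hc, he⟩ | ⟨u, l, hu, hl, hlt, he⟩
    · have hnone : ∀ c ∈ s.active, transport Λ ℰ s'.J c ≠ c' := by
        intro c hc hcc'
        have := (hfib c hc.1).mp hcc'
        rw [he] at this
        exact this
      refine ⟨fun ha => ?_, fun _ => Or.inl hnone⟩
      obtain ⟨p, hp, -⟩ := (hiff.mp ha).1
      have := ((h.mem_fib_center_of_le hs hsupp hb).mp hp).2
      rw [he] at this
      exact this.elim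
    · obtain ⟨h1, h2⟩ := fromSingle c he (iff_of_true hc hcc)
      exact ⟨h1, fun ha => Or.inl (h2 ha)⟩
    · have hum : u ∈ fib Λ ℰ s'.J c' b := by rw [he]; exact Or.inl rfl
      have hlm : l ∈ fib Λ ℰ s'.J c' b := by rw [he]; exact Or.inr rfl
      have huc : ℰ.IsCenter s.J (Λ.base u) := by rw [hum.1]; exact hb
      have hlc : ℰ.IsCenter s.J (Λ.base l) := by rw [hlm.1]; exact hb
      obtain ⟨p, -, hpf⟩ := h.exists_fib_eq_singleton huc hu hsupp
      obtain ⟨q, -, hqf⟩ := h.exists_fib_eq_singleton hlc hl hsupp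
      have hp : p ∈ fib Λ ℰ s.J u w.1 := by rw [hpf]; rfl
      have hq : q ∈ fib Λ ℰ s.J l w.1 := by rw [hqf]; rfl
      have hqp := h.height_lt_of_transport s.J_mem (p := q) (q := p) (hq.1.trans hp.1.symm)
        (by rwa [hq.1]) (by rwa [hq.2, hp.2])
      have hfw : ∀ t, t ∈ fib Λ ℰ s'.J c' w.1 ↔ t = p ∨ t = q := by
        intro t
        rw [h.mem_fib_center_of_le hs hsupp hb, he]
        constructor
        · rintro ⟨ht, htu | htl⟩
          · have : t ∈ fib Λ ℰ s.J u w.1 := ⟨ht, htu⟩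
            rw [hpf] at this
            exact Or.inl this
          · have : t ∈ fib Λ ℰ s.J l w.1 := ⟨ht, htl⟩
            rw [hqf] at this
            exact Or.inr this
        · rintro (rfl | rfl)
          · exact ⟨hp.1, Or.inl hp.2⟩
          · exact ⟨hq.1, Or.inr hq.2⟩
      have hactu : u ∈ s.active ↔ Λ.height p < w.2 := by
        rw [h.mem_active_iff hw, IsActive, hpf]
        simp [huc, hu]
      have hactl : l ∈ s.active ↔ Λ.height q < w.2 := by
        rw [h.mem_active_iff hw, IsActive, hqf]
        simp [hlc, hl]
      have hact' : c' ∈ s'.active ↔ Λ.height q < w.2 ∧ w.2 ≤ Λ.height p := by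
        rw [hiff, IsActive]
        simp only [hfw, exists_eq_or_imp, exists_eq_left, hcc, forall_true_left]
        constructor
        · rintro ⟨h1 | h1, h2 | h2⟩
          · exact absurd h1 h2.not_gt
          · exact absurd (h1.trans_le h2) hqp.not_gt
          · exact ⟨h1, h2⟩
          · exact absurd h1 h2.not_gt
        · rintro ⟨h1, h2⟩
          exact ⟨Or.inr h1, Or.inl h2⟩
      have hdul : ∀ d, ℰ.IsCenter s.J (Λ.base d) →
          (transport Λ ℰ s'.J d = c' ↔ d = u ∨ d = l) := by
        intro d hd
        rw [hfib d hd, he]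
        rfl
      constructor
      · intro ha
        obtain ⟨h1, h2⟩ := hact'.mp ha
        refine ⟨l, hactl.mpr h1, hlm.2, fun d hd hdc => ?_⟩
        rcases (hdul d hd.1).mp hdc with rfl | rfl
        · exact absurd (hactu.mp hd) h2.not_gt
        · rfl
      · intro ha
        by_cases h1 : Λ.height q < w.2
        · have h2 : Λ.height p < w.2 := not_le.mp fun h2 => ha (hact'.mpr ⟨h1, h2⟩)
          exact Or.inr ⟨u, hactu.mpr h2, l, hactl.mpr h1, hu, hl, hlt, hcc, hdul⟩
        · refine Or.inl fun d hd hdc => ?_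
          rcases (hdul d hd.1).mp hdc with rfl | rfl
          · exact h1 (hqp.trans (hactu.mp hd))
          · exact h1 (hactl.mp hd)
  · obtain ⟨c, hc, he⟩ := h.exists_fib_eq_singleton hc' hcc hbs
    obtain ⟨h1, h2⟩ := fromSingle c he (iff_of_false hc hcc)
    exact ⟨h1, fun ha => Or.inl (h2 ha)⟩

end Admissible

end LegendrianSheaf

namespace LegendrianSheaf

open Set Filter

set_option linter.unusedSectionVars false

variable {L M : Type*} [TopologicalSpace L] [ChartedSpace Plane L]
  [TopologicalSpace M] [ChartedSpace Plane M] [IsManifold (𝓡 2) ∞ M]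
  {V : Type*}

namespace LegendrianSurface

variable [IsManifold (𝓡 2) ∞ L] {Λ : LegendrianSurface L M}

theorem exists_height_lt_of_crossing {p q : L} (hp : p ∉ Λ.cusp) (hq : q ∉ Λ.cusp) (hne : p ≠ q)
    (hf : Λ.front p = Λ.front q) {P : L × L → Prop} (hP : ∀ᶠ ab in 𝓝 p ×ˢ 𝓝 q, P ab) :
    ∃ a b, Λ.base a = Λ.base b ∧ Λ.height b < Λ.height a ∧ P (a, b) := by
  obtain ⟨Φ, Ψ, hΦ, hΦb, hΨ, hΨb, -, hlt, -⟩ := Λ.exists_crossing_arc hp hq hne hf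
  have hb : Λ.base p = Λ.base q := (front_eq_iff.mp hf).1
  have tΦ : Tendsto Φ.symm (𝓝 (Λ.base p)) (𝓝 p) := by
    have := Φ.continuousAt_symm (Φ.map_source hΦ)
    rwa [ContinuousAt, Φ.left_inv hΦ, hΦb hΦ] at this
  have tΨ : Tendsto Ψ.symm (𝓝 (Λ.base p)) (𝓝 q) := by
    have := Ψ.continuousAt_symm (Ψ.map_source hΨ)
    rwa [ContinuousAt, Ψ.left_inv hΨ, hΨb hΨ, ← hb] at this
  have sΦ : ∀ᶠ x in 𝓝 (Λ.base p), x ∈ Φ.target := by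
    rw [← hΦb hΦ]
    exact Φ.open_target.mem_nhds (Φ.map_source hΦ)
  have sΨ : ∀ᶠ x in 𝓝 (Λ.base p), x ∈ Ψ.target := by
    rw [hb, ← hΨb hΨ]
    exact Ψ.open_target.mem_nhds (Ψ.map_source hΨ)
  obtain ⟨x, hlt, hPx, h1, h2⟩ :=
    (hlt.and_eventually (((tΦ.prodMk tΨ).eventually hP).and (sΦ.and sΨ))).exists
  refine ⟨Φ.symm x, Ψ.symm x, ?_, hlt, hPx⟩
  rw [← hΦb (Φ.map_target h1), ← hΨb (Ψ.map_target h2), Φ.right_inv h1, Ψ.right_inv h2]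

end LegendrianSurface

namespace Admissible

open Triangulation LegendrianSurface Stratum

variable [IsManifold (𝓡 2) ∞ L] [CompactSpace L] [T2Space L] [T2Space M]
  {Λ : LegendrianSurface L M} {ℰ : Triangulation V M}
variable (h : Admissible Λ ℰ)
include h

/-- Activity is locally constant along a smooth sheet. -/
theorem eventually_isActive_front_iff {J : Finset V} {p : L} (hp : p ∉ Λ.cusp)
    (hx : J ⊆ ℰ.supp (Λ.base p)) {c : L} (hc : ℰ.IsCenter J (Λ.base c))
    (hpc : p ∈ fib Λ ℰ J c (Λ.base p)) :
    ∀ᶠ a in 𝓝 p, (IsActive Λ ℰ J c (Λ.front a) ↔ IsActive Λ ℰ J c (Λ.front p)) := by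
  have hℓ : map Λ.front (𝓝 p) ≤ 𝓝 (Λ.front p) := Λ.continuous_front.continuousAt
  have hx' : J ⊆ ℰ.supp (Λ.front p).1 := hx
  refine eventually_map.mp (h.eventually_isActive_iff (w₀ := Λ.front p) hc hx' hℓ
    fun r hr hrz U hU => ?_)
  obtain rfl : r = p := h.eq_of_mem_fib hc hx hr hpc hrz
  rw [eventually_map]
  filter_upwards [hU] with a ha using ⟨a, ha, rfl, fun hrc => absurd hrc hp⟩

/-- Activity is locally constant above a smooth sheet. -/
theorem exists_nhds_isActive_iff_above {J : Finset V} {p : L} (hp : p ∉ Λ.cusp)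
    (hx : J ⊆ ℰ.supp (Λ.base p)) {c : L} (hc : ℰ.IsCenter J (Λ.base c))
    (hpc : p ∈ fib Λ ℰ J c (Λ.base p)) :
    ∃ U ∈ 𝓝 p, ∃ b : Prop, ∀ᶠ w in 𝓝 (Λ.front p), ∀ a ∈ U, Λ.base a = w.1 →
      Λ.height a < w.2 → (IsActive Λ ℰ J c w ↔ b) := by
  have hJ := mem_faces_of_mem_cell hc.1
  have hx' : J ⊆ ℰ.supp (Λ.front p).1 := hx
  obtain ⟨U, hU, hi⟩ := exists_injOn_base hp
  refine ⟨U ∩ {a | transport Λ ℰ J a = transport Λ ℰ J p},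
    inter_mem hU (h.eventually_transport_eq hJ hx),
    c ∈ Λ.cusp → ∃ r ∈ fib Λ ℰ J c (Λ.base p), Λ.height p < Λ.height r, ?_⟩
  have first : ∀ {w : M × ℝ} {a : L}, transport Λ ℰ J a = transport Λ ℰ J p → Λ.base a = w.1 →
      Λ.height a < w.2 → ∃ q ∈ fib Λ ℰ J c w.1, Λ.height q < w.2 :=
    fun hat haw hlt => ⟨_, ⟨haw, hat.trans hpc.2⟩, hlt⟩
  by_cases hcc : c ∈ Λ.cusp
  swap
  · filter_upwards with w a ha haw hlt
    exact iff_of_true ⟨first ha.2 haw hlt, fun hc => absurd hc hcc⟩ fun hc => absurd hc hcc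
  by_cases hr : ∃ r ∈ fib Λ ℰ J c (Λ.base p), Λ.height p < Λ.height r
  · have hr' := hr
    obtain ⟨r, hr, hpr⟩ := hr
    have hrc : r ∉ Λ.cusp := fun hrc => by
      rw [h.fib_eq_singleton_of_mem_cusp hc hx hr hrc] at hpc
      exact hpr.ne (congrArg Λ.height hpc)
    obtain ⟨D, hD, hw⟩ := h.exists_nhds_lt_height (w₀ := Λ.front p) hpr
    filter_upwards [hw, h.eventually_exists_fib hJ hx' hr hrc hD]
      with w hw ⟨q, hq, hqD, _⟩ a ha haw hlt
    exact iff_of_true ⟨first ha.2 haw hlt, fun _ => ⟨q, hq, (hw q hqD).le⟩⟩ fun _ => hr'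
  · have hr' := hr
    push Not at hr'
    have := h.eventually_forall_fib hJ hx' le_rfl (c := c) (P := fun q w => ∀ a ∈ U, Λ.base a = w.1 →
        Λ.height a < w.2 → Λ.height q < w.2) (by
      intro q hq
      rcases (hr' q hq).lt_or_eq with hlt | heq
      · obtain ⟨D, hD, hw⟩ := h.exists_nhds_height_lt (w₀ := Λ.front p) hlt
        exact ⟨D, hD, hw.mono fun w hw q hq _ a _ _ _ => hw q hq⟩
      · obtain rfl : q = p := h.eq_of_mem_fib hc hx hq hpc heq
        refine ⟨U, hU, Eventually.of_forall fun w r hr hrw a ha haw hlt => ?_⟩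
        rwa [hi hr ha (hrw.trans haw.symm)])
    filter_upwards [this] with w hw a ha haw hlt
    refine iff_of_false (fun hact => ?_) fun hb => hr (hb hcc)
    obtain ⟨q, hq, hle⟩ := hact.2 hcc
    exact (hw q hq a ha.1 haw hlt).not_ge hle

/-- Along a crossing, every generator persists from the crossing to one of the two upper half
sheets, and from the other one to the region above. -/
theorem mem_active_of_isCrossingSquare {s s₁ s₂ s₃ : Stratum Λ ℰ}
    (hsq : IsCrossingSquare s s₁ s₂ s₃) :
    s₁.J = s.J ∧ s₂.J = s.J ∧ s₃.J = s.J ∧ ∀ c, ℰ.IsCenter s.J (Λ.base c) →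
      ((c ∈ s.active ↔ c ∈ s₁.active) ∧ (c ∈ s₂.active ↔ c ∈ s₃.active)) ∨
      ((c ∈ s.active ↔ c ∈ s₂.active) ∧ (c ∈ s₁.active ↔ c ∈ s₃.active)) := by
  have hJ : ∀ t : Stratum Λ ℰ, s ≤ t → t.J = s.J := fun t ht =>
    (faces_of_le ht).2.antisymm (hsq.O_dim ▸ (faces_of_le ht).1.trans t.I_subset)
  have hJ₁ := hJ s₁ hsq.O_le_NW
  have hJ₂ := hJ s₂ hsq.O_le_NE
  have hs₃ := hsq.O_le_NW.trans hsq.NW_le_N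
  have hJ₃ := hJ s₃ hs₃
  refine ⟨hJ₁, hJ₂, hJ₃, fun c hc => ?_⟩
  obtain ⟨p, q, hp, hq, hne, hf, hw₀, hfar, habove⟩ := hsq.local_form
  have hx' : s.J ⊆ ℰ.supp (Λ.front p).1 := subset_supp hw₀
  have hx : s.J ⊆ ℰ.supp (Λ.base p) := hx'
  obtain ⟨hbpq, hhpq⟩ := front_eq_iff.mp hf
  have act : ∀ t : Stratum Λ ℰ, t.J = s.J → ∀ {w}, w ∈ t.carrier →
      (c ∈ t.active ↔ IsActive Λ ℰ s.J c w) := by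
    intro t ht w hw
    rw [h.mem_active_iff hw, ht]
    exact and_iff_right hc
  have hdepth : Λ.frontDepth (Λ.front p) = 2 := by
    have := frontDepth_eq hw₀
    rw [hsq.O_k] at this
    lia
  have honly : ∀ r, Λ.front r = Λ.front p → r = p ∨ r = q := by
    classical
    intro r hr
    by_contra! hn
    have := sum_weight_le_frontDepth h.mild (w := Λ.front p) (P := {r, p, q}) (by
      simp only [Finset.mem_insert, Finset.mem_singleton]
      rintro _ (rfl | rfl | rfl)
      exacts [hr, rfl, hf.symm])
    rw [hdepth, Finset.sum_insert (by simpa using hn), Finset.sum_pair hne, weight_of_notMem hp,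
      weight_of_notMem hq] at this
    have := Λ.weight_pos r
    lia
  have left : ∀ {P : L × L → Prop}, (∀ᶠ ab in 𝓝 p ×ˢ 𝓝 q, P ab) → ∃ a b, Λ.base a = Λ.base b ∧
      Λ.height b < Λ.height a ∧ Λ.front a ∈ s₁.carrier ∧ P (a, b) := by
    intro P hP
    obtain ⟨a, b, hab, hlt, hPab, hm⟩ := exists_height_lt_of_crossing hp hq hne hf (hP.and hfar)
    exact ⟨a, b, hab, hlt, (hm hab).1 hlt, hPab⟩
  have right : ∀ {P : L × L → Prop}, (∀ᶠ ab in 𝓝 p ×ˢ 𝓝 q, P ab) → ∃ a b, Λ.base a = Λ.base b ∧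
      Λ.height a < Λ.height b ∧ Λ.front b ∈ s₂.carrier ∧ P (a, b) := by
    intro P hP
    obtain ⟨b, a, hab, hlt, hPab, hm⟩ := exists_height_lt_of_crossing hq hp hne.symm hf.symm
      (P := fun ba => P ba.swap ∧ (Λ.base ba.2 = Λ.base ba.1 →
        (Λ.height ba.1 < Λ.height ba.2 → Λ.front ba.2 ∈ s₁.carrier) ∧
        (Λ.height ba.2 < Λ.height ba.1 → Λ.front ba.1 ∈ s₂.carrier)))
      (by
        rw [prod_comm, eventually_map]
        exact hP.and hfar)
    exact ⟨a, b, hab.symm, hlt, (hm hab.symm).2 hlt, hPab⟩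
  have top : ∀ {P : M × ℝ → Prop}, (∀ᶠ w in 𝓝 (Λ.front p), P w) → ∃ z, Λ.height p < z ∧
      (Λ.base p, z) ∈ s₃.carrier ∧ P (Λ.base p, z) := by
    intro P hP
    have t1 : Tendsto (fun z : ℝ => ((p, q), z)) (𝓝[>] (Λ.height p))
        ((𝓝 p ×ˢ 𝓝 q) ×ˢ 𝓝 (Λ.height p)) := by
      have t : Tendsto (fun _ : ℝ => (p, q)) (𝓝[>] (Λ.height p)) (𝓝 p ×ˢ 𝓝 q) :=
        (tendsto_const_nhds (x := p)).prodMk (tendsto_const_nhds (x := q))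
      exact t.prodMk (tendsto_id.mono_left nhdsWithin_le_nhds)
    have t2 : Tendsto (fun z : ℝ => (Λ.base p, z)) (𝓝[>] (Λ.height p)) (𝓝 (Λ.front p)) :=
      (Continuous.prodMk_right (Λ.base p)).continuousAt.mono_left nhdsWithin_le_nhds
    obtain ⟨z, h1, h2, h3⟩ := ((t1.eventually habove).and
      ((t2.eventually hP).and self_mem_nhdsWithin)).exists
    exact ⟨z, h3, h1 hbpq (max_lt h3 (hhpq ▸ h3)), h2⟩
  have ev₁ : ∀ {P : L → Prop}, (∀ᶠ a in 𝓝 p, P a) → ∀ᶠ ab in 𝓝 p ×ˢ 𝓝 q, P ab.1 :=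
    fun hP => tendsto_fst.eventually hP
  have ev₂ : ∀ {P : L → Prop}, (∀ᶠ a in 𝓝 q, P a) → ∀ᶠ ab in 𝓝 p ×ˢ 𝓝 q, P ab.2 :=
    fun hP => tendsto_snd.eventually hP
  have hcp : ContinuousAt Λ.front p := Λ.continuous_front.continuousAt
  have hcq : ContinuousAt Λ.front q := Λ.continuous_front.continuousAt
  by_cases hpc : transport Λ ℰ s.J p = c
  · have hpm : p ∈ fib Λ ℰ s.J c (Λ.base p) := ⟨rfl, hpc⟩
    left
    constructor
    · obtain ⟨a, b, -, -, hmem, hiff⟩ := left (ev₁ (h.eventually_isActive_front_iff hp hx hc hpm))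
      rw [act s rfl hw₀, act s₁ hJ₁ hmem, hiff]
    · obtain ⟨U, hU, B, hB⟩ := h.exists_nhds_isActive_iff_above hp hx hc hpm
      rw [hf] at hB
      obtain ⟨a, b, hab, hlt, hmem, hiff, haU⟩ := right ((ev₂ (hcq.eventually hB)).and (ev₁ hU))
      rw [← hf] at hB
      obtain ⟨z, hz, hmem', hiff'⟩ := top hB
      rw [act s₂ hJ₂ hmem, act s₃ hJ₃ hmem', hiff a haU hab hlt,
        hiff' p (mem_of_mem_nhds hU) rfl hz]
  by_cases hqc : transport Λ ℰ s.J q = c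
  · have hqm : q ∈ fib Λ ℰ s.J c (Λ.base q) := ⟨rfl, hqc⟩
    have hxq : s.J ⊆ ℰ.supp (Λ.base q) := by rwa [← hbpq]
    right
    constructor
    · obtain ⟨a, b, -, -, hmem, hiff⟩ := right (ev₂ (h.eventually_isActive_front_iff hq hxq hc hqm))
      rw [act s rfl hw₀, act s₂ hJ₂ hmem, hiff, hf]
    · obtain ⟨U, hU, B, hB⟩ := h.exists_nhds_isActive_iff_above hq hxq hc hqm
      rw [← hf] at hB
      obtain ⟨a, b, hab, hlt, hmem, hiff, hbU⟩ := left ((ev₁ (hcp.eventually hB)).and (ev₂ hU))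
      obtain ⟨z, hz, hmem', hiff'⟩ := top hB
      rw [act s₁ hJ₁ hmem, act s₃ hJ₃ hmem', hiff b hbU hab.symm hlt,
        hiff' q (mem_of_mem_nhds hU) hbpq.symm (hhpq ▸ hz)]
  · have hev := h.eventually_isActive_iff hc (w₀ := Λ.front p) hx' le_rfl fun r hr hrz => by
      rcases honly r (Prod.ext hr.1 hrz) with rfl | rfl
      exacts [absurd hr.2 hpc, absurd hr.2 hqc]
    have all : ∀ t : Stratum Λ ℰ, s ≤ t → (c ∈ t.active ↔ IsActive Λ ℰ s.J c (Λ.front p)) := by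
      intro t ht
      obtain ⟨w, hw, hiff⟩ := exists_of_le ht hw₀ hev
      rw [act t (hJ t ht) hw, hiff]
    left
    rw [all s le_rfl, all s₁ hsq.O_le_NW, all s₂ hsq.O_le_NE, all s₃ hs₃]
    exact ⟨Iff.rfl, Iff.rfl⟩

end Admissible

end LegendrianSheaf

namespace LegendrianSheaf

open Set Filter

set_option linter.unusedSectionVars false

section SetGen

variable (K : Type*) [Field K] {α β : Type*}

open Classical in
/-- The generator `a` of the free module on `S`, and `0` if `a` is not in `S`. -/
noncomputable def setGen (S : Set α) (a : α) : S →₀ K :=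
  if h : a ∈ S then Finsupp.single ⟨a, h⟩ 1 else 0

variable {K}

theorem setGen_of_mem {S : Set α} {a : α} (h : a ∈ S) : setGen K S a = Finsupp.single ⟨a, h⟩ 1 :=
  dif_pos h

theorem setGen_of_notMem {S : Set α} {a : α} (h : a ∉ S) : setGen K S a = 0 :=
  dif_neg h

theorem setGen_coe {S : Set α} (a : S) : setGen K S a = Finsupp.single a 1 :=
  setGen_of_mem a.2

theorem relMap_single {R : α → β → Prop} {a : α} {b : β} (h : ∀ b', R a b' ↔ b' = b) :
    relMap K R (Finsupp.single a 1) = Finsupp.single b 1 := by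
  have hex : ∃ b', R a b' := ⟨b, (h b).mpr rfl⟩
  rw [relMap, Finsupp.linearCombination_single, one_smul, dif_pos hex, (h _).mp hex.choose_spec]

theorem relMap_single_eq_zero {R : α → β → Prop} {a : α} (h : ∀ b, ¬ R a b) :
    relMap K R (Finsupp.single a 1) = 0 := by
  rw [relMap, Finsupp.linearCombination_single, one_smul, dif_neg (by push Not; exact h)]

theorem relMap_setGen_eq_zero {S : Set α} {T : Set β} {R : S → T → Prop} {a : α}
    (h : ∀ (ha : a ∈ S) b, ¬ R ⟨a, ha⟩ b) : relMap K R (setGen K S a) = 0 := by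
  by_cases ha : a ∈ S
  · rw [setGen_of_mem ha, relMap_single_eq_zero (h ha)]
  · rw [setGen_of_notMem ha, map_zero]

theorem relMap_setGen {S : Set α} {T : Set β} {R : S → T → Prop} {a : α} {b : β} (ha : a ∈ S)
    (h : ∀ b' : T, R ⟨a, ha⟩ b' ↔ b'.1 = b) : relMap K R (setGen K S a) = setGen K T b := by
  by_cases hb : b ∈ T
  · rw [setGen_of_mem ha, setGen_of_mem hb]
    refine relMap_single fun b' => ?_
    rw [h, Subtype.ext_iff]
  · rw [setGen_of_notMem hb]
    refine relMap_setGen_eq_zero fun _ b' hR => hb ?_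
    rw [← (h b').mp hR]
    exact b'.2

theorem linearMap_ext_setGen {S : Set α} {W : Type*} [AddCommGroup W] [Module K W]
    {f g : (S →₀ K) →ₗ[K] W} (h : ∀ a ∈ S, f (setGen K S a) = g (setGen K S a)) : f = g := by
  refine Finsupp.lhom_ext' fun a => LinearMap.ext_ring ?_
  have := h a a.2
  rw [setGen_coe] at this
  exact this

end SetGen

variable {L M : Type*} [TopologicalSpace L] [ChartedSpace Plane L]
  [TopologicalSpace M] [ChartedSpace Plane M] [IsManifold (𝓡 2) ∞ M]
  {V : Type*} (K : Type*) [Field K]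

/-- The generator of `V(e_J)` with a given label; zero for the labels of cusp components. -/
noncomputable def cellGen (Λ : LegendrianSurface L M) (ℰ : Triangulation V M) (J : Finset V) (c : L) :
    SheetModule K Λ (ℰ.cell J) :=
  setGen K (Λ.sheets (ℰ.cell J)) (branch Λ ℰ J (ℰ.cell J) c)

variable {K}

namespace Admissible

open Triangulation LegendrianSurface Stratum

variable [IsManifold (𝓡 2) ∞ L] [CompactSpace L] [T2Space L] [T2Space M]
  {Λ : LegendrianSurface L M} {ℰ : Triangulation V M}
variable (h : Admissible Λ ℰ) {I J : Finset V}
include h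

theorem branch_mem_sheets_iff {A : Set M} (hA : IsDualRegion ℰ J A) {c : L}
    (hc : ℰ.IsCenter J (Λ.base c)) : branch Λ ℰ J A c ∈ Λ.sheets A ↔ c ∉ Λ.cusp := by
  rw [h.mem_sheets_iff hA]
  constructor
  · rintro ⟨c', hc', hcc', he⟩
    rwa [h.branch_injective hA hc he]
  · exact fun hcc => ⟨c, hc, hcc, rfl⟩

theorem branch_eq_branch_iff {A : Set M} (hA : IsDualRegion ℰ J A) {c c' : L}
    (hc : ℰ.IsCenter J (Λ.base c)) : branch Λ ℰ J A c = branch Λ ℰ J A c' ↔ c = c' :=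
  ⟨fun he => h.branch_injective hA hc he, fun he => he ▸ rfl⟩

theorem cellGen_of_mem_cusp {c : L} (hc : ℰ.IsCenter J (Λ.base c)) (hcc : c ∈ Λ.cusp) :
    cellGen K Λ ℰ J c = 0 :=
  setGen_of_notMem fun hm => (h.branch_mem_sheets_iff
    (isDualRegion_cell (mem_faces_of_mem_cell hc.1)) hc).mp hm hcc

theorem branch_cell_mem {c : L} (hc : ℰ.IsCenter J (Λ.base c)) (hcc : c ∉ Λ.cusp) :
    branch Λ ℰ J (ℰ.cell J) c ∈ Λ.sheets (ℰ.cell J) :=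
  (h.branch_mem_sheets_iff (isDualRegion_cell (mem_faces_of_mem_cell hc.1)) hc).mpr hcc

theorem exists_of_mem_sheets_cell (hJ : J ∈ ℰ.faces) (S : Λ.sheets (ℰ.cell J)) :
    ∃ c, ℰ.IsCenter J (Λ.base c) ∧ c ∉ Λ.cusp ∧ S.1 = branch Λ ℰ J (ℰ.cell J) c :=
  (h.mem_sheets_iff (isDualRegion_cell hJ)).mp S.2

theorem branch_cell_eq_iff {c c' : L} (hc : ℰ.IsCenter J (Λ.base c)) :
    branch Λ ℰ J (ℰ.cell J) c = branch Λ ℰ J (ℰ.cell J) c' ↔ c = c' :=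
  h.branch_eq_branch_iff (isDualRegion_cell (mem_faces_of_mem_cell hc.1)) hc

section BoundaryExtension

variable (hIJ : I ⊆ J)
include hIJ

theorem subset_supp_of_subset {c : L} (hc : ℰ.IsCenter J (Λ.base c)) : I ⊆ ℰ.supp (Λ.base c) :=
  hIJ.trans (mem_cell_iff.mp hc.1).symm.subset

theorem incl_cellGen {c d : L} (hI : I ∈ ℰ.faces) (hc : ℰ.IsCenter J (Λ.base c))
    (hd : transport Λ ℰ I c = d) (hdc : d ∉ Λ.cusp) :
    incl K Λ ℰ I J (cellGen K Λ ℰ I d) = cellGen K Λ ℰ J c := by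
  have hsub := h.subset_supp_of_subset hIJ hc
  have hdcen : ℰ.IsCenter I (Λ.base d) := hd ▸ h.isCenter_transport hI hsub
  refine relMap_setGen (h.branch_cell_mem hdcen hdc) fun T => ?_
  obtain ⟨c', hc', hcc', hT⟩ := h.exists_of_mem_sheets_cell (mem_faces_of_mem_cell hc.1) T
  rw [hT, h.branch_subset_closure_cell_iff hIJ hc' hdcen, h.branch_cell_eq_iff hc']
  constructor
  · intro he
    obtain ⟨q, -, hq⟩ := h.exists_fib_eq_singleton hdcen hdc hsub
    have h1 : c ∈ fib Λ ℰ I d (Λ.base c) := ⟨rfl, hd⟩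
    have h2 : c' ∈ fib Λ ℰ I d (Λ.base c) := ⟨hc'.eq hc, he⟩
    rw [hq] at h1 h2
    exact h2.trans h1.symm
  · rintro rfl
    exact hd

theorem proj_cellGen {c : L} (hI : I ∈ ℰ.faces) (hc : ℰ.IsCenter J (Λ.base c)) :
    proj K Λ ℰ J I (cellGen K Λ ℰ J c) = cellGen K Λ ℰ I (transport Λ ℰ I c) := by
  have hsub := h.subset_supp_of_subset hIJ hc
  have htc := h.isCenter_transport hI hsub
  by_cases hcc : c ∈ Λ.cusp
  · rw [h.cellGen_of_mem_cusp hc hcc, h.cellGen_of_mem_cusp htc (h.transport_mem_cusp hI hsub hcc),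
      map_zero]
  refine relMap_setGen (h.branch_cell_mem hc hcc) fun S => ?_
  obtain ⟨d, hd, -, hS⟩ := h.exists_of_mem_sheets_cell hI S
  rw [hS, h.branch_subset_closure_cell_iff hIJ hc hd, h.branch_cell_eq_iff hd, eq_comm]

theorem exists_sheet_subset_closure_iff {c : L} (hI : I ∈ ℰ.faces)
    (hc : ℰ.IsCenter J (Λ.base c)) :
    (∃ S ∈ Λ.sheets (ℰ.cell I), S ⊆ closure (branch Λ ℰ J (ℰ.cell J) c)) ↔
      transport Λ ℰ I c ∉ Λ.cusp := by
  constructor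
  · rintro ⟨S, hS, hsub⟩
    obtain ⟨d, hd, hdc, rfl⟩ := (h.mem_sheets_iff (isDualRegion_cell hI)).mp hS
    rwa [(h.branch_subset_closure_cell_iff hIJ hc hd).mp hsub]
  · intro hn
    have htc := h.isCenter_transport hI (h.subset_supp_of_subset hIJ hc)
    exact ⟨_, h.branch_cell_mem htc hn, (h.branch_subset_closure_cell_iff hIJ hc htc).mpr rfl⟩

theorem cuspProj_cellGen_of_mem {c : L} (hI : I ∈ ℰ.faces) (hc : ℰ.IsCenter J (Λ.base c))
    (ht : transport Λ ℰ I c ∈ Λ.cusp) :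
    cuspProj K Λ ℰ I J (cellGen K Λ ℰ J c) = cellGen K Λ ℰ J c := by
  by_cases hcc : c ∈ Λ.cusp
  · rw [h.cellGen_of_mem_cusp hc hcc, map_zero]
  refine relMap_setGen (h.branch_cell_mem hc hcc) fun T => ?_
  rw [h.exists_sheet_subset_closure_iff hIJ hI hc, Subtype.ext_iff]
  simp only [ht, not_true, not_false_iff, and_true]
  exact eq_comm

theorem cuspProj_cellGen_of_notMem {c : L} (hI : I ∈ ℰ.faces) (hc : ℰ.IsCenter J (Λ.base c))
    (ht : transport Λ ℰ I c ∉ Λ.cusp) :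
    cuspProj K Λ ℰ I J (cellGen K Λ ℰ J c) = 0 := by
  refine relMap_setGen_eq_zero fun ha T hT => hT.2 ?_
  exact (h.exists_sheet_subset_closure_iff hIJ hI hc).mpr ht

/-- The relation which defines `cuspDiff`. -/
theorem cuspDiff_rel_iff {c d : L} (hI : I ∈ ℰ.faces) (hc : ℰ.IsCenter J (Λ.base c))
    (hd : ℰ.IsCenter J (Λ.base d)) (ht : transport Λ ℰ I c ∈ Λ.cusp) :
    (branch Λ ℰ J (ℰ.cell J) c ≠ branch Λ ℰ J (ℰ.cell J) d ∧
      Λ.Above (branch Λ ℰ J (ℰ.cell J) c) (branch Λ ℰ J (ℰ.cell J) d) ∧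
      (closure (branch Λ ℰ J (ℰ.cell J) c) ∩ closure (branch Λ ℰ J (ℰ.cell J) d) ∩ Λ.cusp ∩
        Λ.base ⁻¹' ℰ.cell I).Nonempty) ↔
      transport Λ ℰ I d = transport Λ ℰ I c ∧ Λ.height d < Λ.height c := by
  rw [h.above_branch_iff hc hd, h.closure_inter_cusp_nonempty_iff hI hIJ hc hd, Ne,
    h.branch_cell_eq_iff hc]
  constructor
  · rintro ⟨-, h1, h2, -⟩
    exact ⟨h2.symm, h1⟩
  · rintro ⟨h1, h2⟩
    refine ⟨?_, h2, h1.symm, ht⟩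
    rintro rfl
    exact h2.false

theorem cuspDiff_cellGen {u l : L} (hI : I ∈ ℰ.faces) (hu : ℰ.IsCenter J (Λ.base u))
    (hl : ℰ.IsCenter J (Λ.base l)) (huc : u ∉ Λ.cusp) (ht : transport Λ ℰ I u ∈ Λ.cusp)
    (hlu : transport Λ ℰ I l = transport Λ ℰ I u) (hlt : Λ.height l < Λ.height u) :
    cuspDiff K Λ ℰ I J (cellGen K Λ ℰ J u) = cellGen K Λ ℰ J l := by
  have hsub := h.subset_supp_of_subset hIJ hu
  refine relMap_setGen (h.branch_cell_mem hu huc) fun T => ?_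
  obtain ⟨d, hd, hdc, hT⟩ := h.exists_of_mem_sheets_cell (mem_faces_of_mem_cell hu.1) T
  have hne := h.cuspDiff_rel_iff hIJ hI hu hd ht
  rw [← hT] at hne
  rw [Ne, Subtype.ext_iff, ← Ne, hne, hT, h.branch_cell_eq_iff hd]
  constructor
  · rintro ⟨h1, h2⟩
    obtain ⟨a, b, -, -, hab, hfib⟩ := h.exists_fib_eq_pair (h.isCenter_transport hI hsub) ht hsub
      (q := u) ⟨rfl, rfl⟩ huc
    have m1 : u ∈ fib Λ ℰ I (transport Λ ℰ I u) (Λ.base u) := ⟨rfl, rfl⟩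
    have m2 : l ∈ fib Λ ℰ I (transport Λ ℰ I u) (Λ.base u) := ⟨hl.eq hu, hlu⟩
    have m3 : d ∈ fib Λ ℰ I (transport Λ ℰ I u) (Λ.base u) := ⟨hd.eq hu, h1⟩
    rw [hfib] at m1 m2 m3
    rcases m1 with rfl | rfl
    · rcases m2 with rfl | rfl
      · exact absurd rfl hlt.ne
      · rcases m3 with rfl | rfl
        · exact absurd rfl h2.ne
        · rfl
    · rcases m2 with rfl | rfl
      · exact absurd hlt hab.not_gt
      · exact absurd rfl hlt.ne
  · rintro rfl
    exact ⟨hlu, hlt⟩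

theorem cuspDiff_cellGen_eq_zero {c : L} (hI : I ∈ ℰ.faces) (hc : ℰ.IsCenter J (Λ.base c))
    (ht : transport Λ ℰ I c ∈ Λ.cusp) (hn : ∀ d, ℰ.IsCenter J (Λ.base d) →
      transport Λ ℰ I d = transport Λ ℰ I c → Λ.height c ≤ Λ.height d) :
    cuspDiff K Λ ℰ I J (cellGen K Λ ℰ J c) = 0 := by
  refine relMap_setGen_eq_zero fun ha T hT => ?_
  obtain ⟨d, hd, hdc, hTd⟩ := h.exists_of_mem_sheets_cell (mem_faces_of_mem_cell hc.1) T
  rw [Ne, Subtype.ext_iff, ← Ne] at hT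
  have hT' := hT
  rw [hTd] at hT'
  obtain ⟨h1, h2⟩ := (h.cuspDiff_rel_iff hIJ hI hc hd ht).mp hT'
  exact (hn d hd h1).not_gt h2

theorem boundaryExtension_cellGen_of_notMem {c : L} (hI : I ∈ ℰ.faces)
    (hc : ℰ.IsCenter J (Λ.base c)) (ht : transport Λ ℰ I c ∉ Λ.cusp)
    (f : SheetModule K Λ (ℰ.cell I) →ₗ[K] SheetModule K Λ (ℰ.cell I)) :
    boundaryExtension K Λ ℰ I J f (cellGen K Λ ℰ J c) =
      incl K Λ ℰ I J (f (cellGen K Λ ℰ I (transport Λ ℰ I c))) := by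
  rw [boundaryExtension, LinearMap.add_apply, LinearMap.comp_apply, LinearMap.comp_apply,
    h.proj_cellGen hIJ hI hc]
  split_ifs <;> simp [h.cuspProj_cellGen_of_notMem hIJ hI hc ht]

theorem boundaryExtension_cellGen_of_mem {c : L} (hI : I ∈ ℰ.faces)
    (hc : ℰ.IsCenter J (Λ.base c)) (ht : transport Λ ℰ I c ∈ Λ.cusp)
    (f : SheetModule K Λ (ℰ.cell I) →ₗ[K] SheetModule K Λ (ℰ.cell I)) :
    boundaryExtension K Λ ℰ I J f (cellGen K Λ ℰ J c) =
      if I.card = 1 then cuspDiff K Λ ℰ I J (cellGen K Λ ℰ J c)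
      else if I.card = 2 then cellGen K Λ ℰ J c else 0 := by
  rw [boundaryExtension, LinearMap.add_apply, LinearMap.comp_apply, LinearMap.comp_apply,
    h.proj_cellGen hIJ hI hc,
    h.cellGen_of_mem_cusp (h.isCenter_transport hI (h.subset_supp_of_subset hIJ hc)) ht]
  split_ifs <;> simp [h.cuspProj_cellGen_of_mem hIJ hI hc ht]

end BoundaryExtension

end Admissible

end LegendrianSheaf

namespace LegendrianSheaf

open Set Filter

set_option linter.unusedSectionVars false

variable {L M : Type*} [TopologicalSpace L] [ChartedSpace Plane L]
  [TopologicalSpace M] [ChartedSpace Plane M] [IsManifold (𝓡 2) ∞ M]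
  {V : Type*} (K : Type*) [Field K]

namespace Stratum

variable {Λ : LegendrianSurface L M} {ℰ : Triangulation V M} (s s' : Stratum Λ ℰ)

/-- The generator of `X(s)` with a given label; zero if the label is not active. -/
noncomputable def gen (c : L) : s.X K :=
  (setGen K s.below (branch Λ ℰ s.J s.handle c), setGen K s.exceptional (branch Λ ℰ s.J s.handle c))

/-- The linear map to `X(s)` which sends a label to the generator with this label. -/
noncomputable def ofLabels : (L →₀ K) →ₗ[K] s.X K := Finsupp.linearCombination K (s.gen K)

/-- The embedding of `X(s)` into the free module on the labels. -/
noncomputable def labels : s.X K →ₗ[K] (L →₀ K) :=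
  relMap K (fun (T : s.below) c => c ∈ s.active ∧ T.1 = branch Λ ℰ s.J s.handle c) ∘ₗ
      LinearMap.fst K _ _ +
    relMap K (fun (T : s.exceptional) c => c ∈ s.active ∧ T.1 = branch Λ ℰ s.J s.handle c) ∘ₗ
      LinearMap.snd K _ _

theorem ofLabels_single (c : L) (a : K) : s.ofLabels K (Finsupp.single c a) = a • s.gen K c := by
  simp [ofLabels]

theorem mapX_apply (x : s.X K) :
    s.mapX K s' x = (s.mapP K s' x.1, s.mapK K s' x.1 + s.mapL K s' x.2) :=
  rfl

end Stratum

variable {K}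

namespace Admissible

open Triangulation LegendrianSurface Stratum

variable [IsManifold (𝓡 2) ∞ L] [CompactSpace L] [T2Space L] [T2Space M]
  {Λ : LegendrianSurface L M} {ℰ : Triangulation V M}
variable (h : Admissible Λ ℰ) {s s' s'' : Stratum Λ ℰ}
include h

theorem branch_mem_below_iff {c : L} (hc : ℰ.IsCenter s.J (Λ.base c)) :
    branch Λ ℰ s.J s.handle c ∈ s.below ↔ c ∈ s.active ∧ c ∉ Λ.cusp := by
  rw [h.mem_below_iff]
  constructor
  · rintro ⟨c', hc', hcc', he⟩
    rw [h.branch_injective s.isDualRegion hc he]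
    exact ⟨hc', hcc'⟩
  · rintro ⟨h1, h2⟩
    exact ⟨c, h1, h2, rfl⟩

theorem branch_mem_exceptional_iff {c : L} (hc : ℰ.IsCenter s.J (Λ.base c)) :
    branch Λ ℰ s.J s.handle c ∈ s.exceptional ↔ c ∈ s.active ∧ c ∈ Λ.cusp := by
  rw [h.mem_exceptional_iff]
  constructor
  · rintro ⟨c', hc', hcc', he⟩
    rw [h.branch_injective s.isDualRegion hc he]
    exact ⟨hc', hcc'⟩
  · rintro ⟨h1, h2⟩
    exact ⟨c, h1, h2, rfl⟩

theorem gen_of_mem_cusp {c : L} (hc : ℰ.IsCenter s.J (Λ.base c)) (hcc : c ∈ Λ.cusp) :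
    s.gen K c = (0, setGen K s.exceptional (branch Λ ℰ s.J s.handle c)) := by
  rw [gen, setGen_of_notMem fun hm => ((h.branch_mem_below_iff hc).mp hm).2 hcc]

theorem gen_of_notMem_cusp {c : L} (hc : ℰ.IsCenter s.J (Λ.base c)) (hcc : c ∉ Λ.cusp) :
    s.gen K c = (setGen K s.below (branch Λ ℰ s.J s.handle c), 0) := by
  rw [gen, setGen_of_notMem fun hm => hcc ((h.branch_mem_exceptional_iff hc).mp hm).2]

theorem gen_of_notMem_active {c : L} (hc : ℰ.IsCenter s.J (Λ.base c)) (hn : c ∉ s.active) :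
    s.gen K c = 0 := by
  rw [gen, setGen_of_notMem fun hm => hn ((h.branch_mem_below_iff hc).mp hm).1,
    setGen_of_notMem fun hm => hn ((h.branch_mem_exceptional_iff hc).mp hm).1]
  rfl

theorem linearMap_ext_gen {W : Type*} [AddCommGroup W] [Module K W] {f g : s.X K →ₗ[K] W}
    (hfg : ∀ c ∈ s.active, f (s.gen K c) = g (s.gen K c)) : f = g := by
  refine LinearMap.prod_ext (linearMap_ext_setGen fun T hT => ?_)
    (linearMap_ext_setGen fun T hT => ?_)
  · obtain ⟨c, hc, hcc, rfl⟩ := h.mem_below_iff.mp hT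
    have := hfg c hc
    rwa [h.gen_of_notMem_cusp hc.1 hcc] at this
  · obtain ⟨c, hc, hcc, rfl⟩ := h.mem_exceptional_iff.mp hT
    have := hfg c hc
    rwa [h.gen_of_mem_cusp hc.1 hcc] at this

theorem labels_gen {c : L} (hc : c ∈ s.active) : s.labels K (s.gen K c) = Finsupp.single c 1 := by
  by_cases hcc : c ∈ Λ.cusp
  · rw [h.gen_of_mem_cusp hc.1 hcc, labels, LinearMap.add_apply, LinearMap.comp_apply,
      LinearMap.comp_apply, LinearMap.fst_apply, map_zero, zero_add, LinearMap.snd_apply,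
      setGen_of_mem ((h.branch_mem_exceptional_iff hc.1).mpr ⟨hc, hcc⟩), relMap_single]
    intro b'
    exact ⟨fun hb => h.branch_injective s.isDualRegion hb.1.1 hb.2.symm, fun hb => by rw [hb]; exact ⟨hc, rfl⟩⟩
  · rw [h.gen_of_notMem_cusp hc.1 hcc, labels, LinearMap.add_apply, LinearMap.comp_apply,
      LinearMap.comp_apply, LinearMap.snd_apply, map_zero, add_zero, LinearMap.fst_apply,
      setGen_of_mem ((h.branch_mem_below_iff hc.1).mpr ⟨hc, hcc⟩), relMap_single]
    intro b'
    exact ⟨fun hb => h.branch_injective s.isDualRegion hb.1.1 hb.2.symm, fun hb => by rw [hb]; exact ⟨hc, rfl⟩⟩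

theorem ofLabels_labels (x : s.X K) : s.ofLabels K (s.labels K x) = x := by
  have : s.ofLabels K ∘ₗ s.labels K = LinearMap.id := h.linearMap_ext_gen fun c hc => by
    rw [LinearMap.comp_apply, h.labels_gen hc, ofLabels_single, one_smul, LinearMap.id_apply]
  exact LinearMap.congr_fun this x

theorem labels_injective : Function.Injective (s.labels K) :=
  Function.LeftInverse.injective h.ofLabels_labels

theorem labels_mem_supported (x : s.X K) : s.labels K x ∈ Finsupp.supported K K s.active := by
  have : (Finsupp.supported K K s.active).mkQ ∘ₗ s.labels K = 0 :=
    h.linearMap_ext_gen fun c hc => by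
      rw [LinearMap.comp_apply, h.labels_gen hc, LinearMap.zero_apply, Submodule.mkQ_apply,
        Submodule.Quotient.mk_eq_zero]
      exact Finsupp.single_mem_supported K _ hc
  have := LinearMap.congr_fun this x
  rwa [LinearMap.comp_apply, LinearMap.zero_apply, Submodule.mkQ_apply,
    Submodule.Quotient.mk_eq_zero] at this

theorem finite_active : s.active.Finite := by
  obtain ⟨b, hb⟩ := exists_isCenter s.J_mem
  exact (finite_fiber h.mild (Λ := Λ) b).subset fun c hc => hc.1.eq hb

theorem finiteDimensional_X : FiniteDimensional K (s.X K) := by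
  have := (h.finite_active (s := s)).to_subtype
  refine Module.Finite.of_injective ((Finsupp.supportedEquivFinsupp s.active).toLinearMap ∘ₗ
    (s.labels K).codRestrict _ h.labels_mem_supported) fun x y hxy => ?_
  exact h.labels_injective (congrArg Subtype.val
    ((Finsupp.supportedEquivFinsupp (M := K) (R := K) s.active).injective hxy))

section Generization

variable (hs : s ≤ s')
include hs

theorem branch_subset_closure_iff {c c' : L} (hc : ℰ.IsCenter s.J (Λ.base c)) :
    branch Λ ℰ s.J s.handle c ⊆ closure (branch Λ ℰ s'.J s'.handle c') ↔
      transport Λ ℰ s'.J c = c' :=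
  h.branch_subset_closure_handle_iff (faces_of_le hs).1 s'.I_subset (faces_of_le hs).2 s.I_mem
    s.J_mem hc

theorem branch_subset_closure_lower_iff {c c' : L} (hc : c ∈ s.active) (hcc : c ∉ Λ.cusp)
    (hc' : c' ∈ s'.active) (hcc' : c' ∈ Λ.cusp) :
    branch Λ ℰ s.J s.handle c ⊆ closure (Λ.lower (branch Λ ℰ s'.J s'.handle c')) ↔
      transport Λ ℰ s'.J c = c' := by
  constructor
  · intro hsub
    exact (h.branch_subset_closure_iff hs hc.1).mp (hsub.trans (closure_mono fun _ hp => hp.1))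
  · rintro rfl p hp
    obtain ⟨u, hu, huc, hut, hlt⟩ := h.exists_upper_of_mem_active hs hc hcc hc' hcc'
    have hsupp : s.J ⊆ ℰ.supp (Λ.base p) := s.isDualRegion.subset_star hp.1
    have hsupp' := (faces_of_le hs).2.trans hsupp
    obtain ⟨q, hqc, hqf⟩ := h.exists_fib_eq_singleton hu huc hsupp
    have hq : q ∈ fib Λ ℰ s.J u (Λ.base p) := by rw [hqf]; rfl
    have hpq := h.height_lt_of_transport s.J_mem (p := p) (q := q) hq.1.symm hsupp
      (by rw [hp.2, hq.2]; exact hlt)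
    have hqt : transport Λ ℰ s'.J q = transport Λ ℰ s'.J c := by
      rw [← h.transport_transport s'.J_mem (faces_of_le hs).2 s.J_mem (by rwa [hq.1]), hq.2, hut]
    have hcl := h.mem_closure_branch_handle (faces_of_le hs).1 s'.I_subset (faces_of_le hs).2
      s.I_mem s.J_mem hp.1
    rw [← h.transport_transport s'.J_mem (faces_of_le hs).2 s.J_mem hsupp, hp.2] at hcl
    obtain ⟨m, h1, h2⟩ := exists_between hpq
    have ev1 : ∀ᶠ y in 𝓝 (Λ.base p), ∃ r, Λ.base r = y ∧ m < Λ.height r ∧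
        transport Λ ℰ s'.J r = transport Λ ℰ s'.J c := by
      rw [← hq.1, ← map_base_nhds hqc, eventually_map]
      filter_upwards [Λ.continuous_height.continuousAt.eventually_const_lt h2,
        h.eventually_transport_eq (q₀ := q) s'.J_mem (by rwa [hq.1])] with r hr hrt
      exact ⟨r, rfl, hr, hrt.trans hqt⟩
    have ev := (Λ.continuous_base.continuousAt.eventually ev1).and
      (Λ.continuous_height.continuousAt.eventually_lt_const h1)
    rw [mem_closure_iff_nhds] at hcl ⊢
    intro U hU
    obtain ⟨a, ⟨haU, ⟨r, hr1, hr2, hr3⟩, ham⟩, hab⟩ := hcl _ (inter_mem hU ev)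
    exact ⟨a, haU, hab, r, ⟨hr1 ▸ hab.1, hr3⟩, hr1, lt_trans ham hr2⟩

theorem mapX_gen {c : L} (hc : c ∈ s.active) :
    s.mapX K s' (s.gen K c) = s'.gen K (transport Λ ℰ s'.J c) := by
  have hcen := h.isCenter_transport_of_le hs hc.1
  have inj : ∀ {c'}, c' ∈ s'.active → (branch Λ ℰ s'.J s'.handle c' =
      branch Λ ℰ s'.J s'.handle (transport Λ ℰ s'.J c) ↔ transport Λ ℰ s'.J c = c') := fun hc' => by
    rw [h.branch_eq_branch_iff s'.isDualRegion hc'.1, eq_comm]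
  by_cases hcc : c ∈ Λ.cusp
  · rw [h.gen_of_mem_cusp hc.1 hcc, h.gen_of_mem_cusp hcen
      (h.transport_mem_cusp s'.J_mem (h.subset_supp_center hs hc.1) hcc)]
    rw [mapX_apply, map_zero, map_zero, zero_add]
    refine Prod.ext rfl ?_
    refine relMap_setGen ((h.branch_mem_exceptional_iff hc.1).mpr ⟨hc, hcc⟩) fun T => ?_
    obtain ⟨c', hc', -, hT⟩ := h.mem_exceptional_iff.mp T.2
    rw [hT, h.branch_subset_closure_iff hs hc.1, inj hc']
  · rw [h.gen_of_notMem_cusp hc.1 hcc, gen]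
    have hm := (h.branch_mem_below_iff hc.1).mpr ⟨hc, hcc⟩
    rw [mapX_apply, map_zero, add_zero]
    refine Prod.ext ?_ ?_
    · refine relMap_setGen hm fun T => ?_
      obtain ⟨c', hc', -, hT⟩ := h.mem_below_iff.mp T.2
      rw [hT, h.branch_subset_closure_iff hs hc.1, inj hc']
    · refine relMap_setGen hm fun T => ?_
      obtain ⟨c', hc', hcc', hT⟩ := h.mem_exceptional_iff.mp T.2
      rw [hT, h.branch_subset_closure_lower_iff hs hc hcc hc' hcc', inj hc']

end Generization

theorem mapX_self : s.mapX K s = LinearMap.id :=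
  h.linearMap_ext_gen fun c hc => by
    rw [h.mapX_gen le_rfl hc, h.transport_self hc.1, LinearMap.id_apply]

theorem mapX_comp (hs : s ≤ s') (hs' : s' ≤ s'') :
    s.mapX K s'' = s'.mapX K s'' ∘ₗ s.mapX K s' := by
  refine h.linearMap_ext_gen fun c hc => ?_
  have hcen := h.isCenter_transport_of_le hs hc.1
  have htt : transport Λ ℰ s''.J (transport Λ ℰ s'.J c) = transport Λ ℰ s''.J c :=
    h.transport_transport s''.J_mem (faces_of_le hs').2 s'.J_mem (h.subset_supp_center hs hc.1)
  rw [LinearMap.comp_apply, h.mapX_gen (hs.trans hs') hc, h.mapX_gen hs hc]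
  by_cases ha : transport Λ ℰ s'.J c ∈ s'.active
  · rw [h.mapX_gen hs' ha, htt]
  · rw [h.gen_of_notMem_active hcen ha, map_zero,
      h.gen_of_notMem_active (h.isCenter_transport_of_le (hs.trans hs') hc.1) fun hn =>
        ha (h.transport_mem_active_of_le_of_le hs hs' hc hn)]

end Admissible

end LegendrianSheaf

namespace LegendrianSheaf

open Set Filter

set_option linter.unusedSectionVars false

theorem freeGrading_le_comap {K ι W : Type*} [Field K] [AddCommGroup W] [Module K W] {deg : ι → ℤ}
    {n : ℤ} {f : (ι →₀ K) →ₗ[K] W} {p : Submodule K W}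
    (hp : ∀ i, deg i = n → f (Finsupp.single i 1) ∈ p) : freeGrading K deg n ≤ p.comap f := by
  rw [freeGrading, Finsupp.supported_eq_span_single, Submodule.span_le]
  rintro _ ⟨i, hi, rfl⟩
  exact hp i hi

variable {L M : Type*} [TopologicalSpace L] [ChartedSpace Plane L]
  [TopologicalSpace M] [ChartedSpace Plane M] [IsManifold (𝓡 2) ∞ M]
  {V : Type*} {K : Type*} [Field K]

namespace Admissible

open Triangulation LegendrianSurface Stratum

variable [IsManifold (𝓡 2) ∞ L] [CompactSpace L] [T2Space L] [T2Space M]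
  {Λ : LegendrianSurface L M} {ℰ : Triangulation V M}
variable (h : Admissible Λ ℰ) {s s' : Stratum Λ ℰ}
include h

theorem inclY_gen {c : L} (hc : c ∈ s.active) (hcc : c ∉ Λ.cusp) :
    s.inclY K (setGen K s.below (branch Λ ℰ s.J s.handle c)) = cellGen K Λ ℰ s.J c := by
  refine relMap_setGen ((h.branch_mem_below_iff hc.1).mpr ⟨hc, hcc⟩) fun S => ?_
  obtain ⟨d, hd, -, hS⟩ := h.exists_of_mem_sheets_cell s.J_mem S
  rw [hS, h.branch_inter_nonempty_iff s.isDualRegion hc.1, h.branch_cell_eq_iff hd, eq_comm]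

theorem projY_cellGen {c : L} (hc : ℰ.IsCenter s.J (Λ.base c)) :
    s.projY K (cellGen K Λ ℰ s.J c) = setGen K s.below (branch Λ ℰ s.J s.handle c) := by
  by_cases hcc : c ∈ Λ.cusp
  · rw [h.cellGen_of_mem_cusp hc hcc, map_zero,
      setGen_of_notMem fun hm => ((h.branch_mem_below_iff hc).mp hm).2 hcc]
  refine relMap_setGen (h.branch_cell_mem hc hcc) fun T => ?_
  obtain ⟨c', hc', -, hT⟩ := h.mem_below_iff.mp T.2
  rw [hT, h.branch_inter_nonempty_iff s.isDualRegion hc'.1,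
    h.branch_eq_branch_iff s.isDualRegion hc'.1]

theorem projY_inclY (y : s.Y K) : s.projY K (s.inclY K y) = y := by
  have : s.projY K ∘ₗ s.inclY K = LinearMap.id := linearMap_ext_setGen fun T hT => by
    obtain ⟨c, hc, hcc, rfl⟩ := h.mem_below_iff.mp hT
    rw [LinearMap.comp_apply, h.inclY_gen hc hcc, h.projY_cellGen hc.1, LinearMap.id_apply]
  exact LinearMap.congr_fun this y

theorem valueOn_branch (μ : Λ.MaslovPotential) {J : Finset V} {A : Set M} (hA : IsDualRegion ℰ J A)
    {c : L} (hc : ℰ.IsCenter J (Λ.base c)) (hcc : c ∉ Λ.cusp) :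
    valueOn μ.toFun (branch Λ ℰ J A c) = μ.toFun c := by
  have hne := h.branch_nonempty hA hc
  have hm := hne.some_mem
  rw [valueOn, dif_pos hne, h.maslov_transport μ hA.mem_faces (hA.subset_star hm.1)
    (by rwa [hm.2]), hm.2]

theorem inclY_mem (μ : Λ.MaslovPotential) {n : ℤ} {y : s.Y K} (hy : y ∈ s.gradingY K μ n) :
    s.inclY K y ∈ sheetGrading K Λ μ (ℰ.cell s.J) n := by
  refine freeGrading_le_comap (p := sheetGrading K Λ μ (ℰ.cell s.J) n) (fun T hT => ?_) hy
  obtain ⟨c, hc, hcc, hTc⟩ := h.mem_below_iff.mp T.2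
  rw [← setGen_coe, hTc, h.inclY_gen hc hcc, cellGen, setGen_of_mem (h.branch_cell_mem hc.1 hcc)]
  refine Finsupp.single_mem_supported K _ ?_
  rw [hTc, h.valueOn_branch μ s.isDualRegion hc.1 hcc] at hT
  change -valueOn μ.toFun (branch Λ ℰ s.J (ℰ.cell s.J) c) = n
  rwa [h.valueOn_branch μ (isDualRegion_cell s.J_mem) hc.1 hcc]

theorem projY_mem (μ : Λ.MaslovPotential) {n : ℤ} {v : SheetModule K Λ (ℰ.cell s.J)}
    (hv : v ∈ sheetGrading K Λ μ (ℰ.cell s.J) n) : s.projY K v ∈ s.gradingY K μ n := by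
  refine freeGrading_le_comap (p := s.gradingY K μ n) (fun S hS => ?_) hv
  obtain ⟨c, hc, hcc, hSc⟩ := h.exists_of_mem_sheets_cell s.J_mem S
  rw [← setGen_coe, hSc, ← cellGen, h.projY_cellGen hc]
  by_cases hb : branch Λ ℰ s.J s.handle c ∈ s.below
  · rw [setGen_of_mem hb]
    refine Finsupp.single_mem_supported K _ ?_
    rw [hSc, h.valueOn_branch μ (isDualRegion_cell s.J_mem) hc hcc] at hS
    change -valueOn μ.toFun (branch Λ ℰ s.J s.handle c) = n
    rwa [h.valueOn_branch μ s.isDualRegion hc hcc]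
  · rw [setGen_of_notMem hb]
    exact Submodule.zero_mem _

theorem valueOn_lower (μ : Λ.MaslovPotential) {c : L} (hc : c ∈ s.active) (hcc : c ∈ Λ.cusp) :
    (∃ p q, Λ.base p = Λ.base q ∧ s.J ⊆ ℰ.supp (Λ.base p) ∧ transport Λ ℰ s.J p = c ∧
      transport Λ ℰ s.J q = c ∧ Λ.height p < Λ.height q) ∧
    ∀ p q, Λ.base p = Λ.base q → s.J ⊆ ℰ.supp (Λ.base p) → transport Λ ℰ s.J p = c →
      transport Λ ℰ s.J q = c → Λ.height p < Λ.height q →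
      μ.toFun p = valueOn μ.toFun (Λ.lower (branch Λ ℰ s.J s.handle c)) := by
  obtain ⟨m, hm⟩ := h.exists_maslov_lower μ hc.1 hcc
  obtain ⟨w, hw⟩ := s.nonempty
  obtain ⟨p, hp, q, hq, hpw, hqw, h1, h2⟩ :=
    (h.mem_exceptional_iff.mpr ⟨c, hc, hcc, rfl⟩).2 w hw
  have hne : (Λ.lower (branch Λ ℰ s.J s.handle c)).Nonempty := ⟨p, hp⟩
  obtain ⟨hr, r, hr', hrr, hlt⟩ := hne.some_mem
  have hv : valueOn μ.toFun (Λ.lower (branch Λ ℰ s.J s.handle c)) = m := by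
    rw [valueOn, dif_pos hne]
    exact hm _ r hrr.symm (s.isDualRegion.subset_star hr.1) hr.2 hr'.2 hlt
  refine ⟨⟨p, q, hpw.trans hqw.symm, s.isDualRegion.subset_star hp.1.1, hp.1.2, hq.1.2,
    h1.trans_le h2⟩, fun p q hpq hp hpc hqc hlt => ?_⟩
  rw [hv]
  exact hm p q hpq hp hpc hqc hlt

theorem gen_mem_gradingX (μ : Λ.MaslovPotential) {n : ℤ} {c : L} (hc : ℰ.IsCenter s.J (Λ.base c))
    (hcc : c ∉ Λ.cusp) (hn : -μ.toFun c = n) : s.gen K c ∈ s.gradingX K μ n := by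
  rw [h.gen_of_notMem_cusp hc hcc]
  refine ⟨?_, Submodule.zero_mem _⟩
  by_cases hb : branch Λ ℰ s.J s.handle c ∈ s.below
  · rw [setGen_of_mem hb]
    refine Finsupp.single_mem_supported K _ ?_
    change -valueOn μ.toFun (branch Λ ℰ s.J s.handle c) = n
    rwa [h.valueOn_branch μ s.isDualRegion hc hcc]
  · rw [setGen_of_notMem hb]
    exact Submodule.zero_mem _

theorem gen_mem_gradingX_of_mem_cusp (μ : Λ.MaslovPotential) {n : ℤ} {c : L}
    (hc : ℰ.IsCenter s.J (Λ.base c)) (hcc : c ∈ Λ.cusp) (hn : c ∈ s.active →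
      -valueOn μ.toFun (Λ.lower (branch Λ ℰ s.J s.handle c)) = n) :
    s.gen K c ∈ s.gradingX K μ n := by
  rw [h.gen_of_mem_cusp hc hcc]
  refine ⟨Submodule.zero_mem _, ?_⟩
  by_cases hb : branch Λ ℰ s.J s.handle c ∈ s.exceptional
  · rw [setGen_of_mem hb]
    exact Finsupp.single_mem_supported K _ (hn ((h.branch_mem_exceptional_iff hc).mp hb).1)
  · rw [setGen_of_notMem hb]
    exact Submodule.zero_mem _

theorem degree_mapX (μ : Λ.MaslovPotential) (hs : s ≤ s') {n : ℤ} {x : s.X K}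
    (hx : x ∈ s.gradingX K μ n) : s.mapX K s' x ∈ s'.gradingX K μ n := by
  have hY : s.gradingY K μ n ≤
      (s'.gradingX K μ n).comap (s.mapX K s' ∘ₗ LinearMap.inl K (s.Y K) (s.Z K)) := by
    refine freeGrading_le_comap fun T hT => ?_
    obtain ⟨c, hc, hcc, hTc⟩ := h.mem_below_iff.mp T.2
    rw [hTc, h.valueOn_branch μ s.isDualRegion hc.1 hcc] at hT
    rw [← setGen_coe, hTc, LinearMap.comp_apply, LinearMap.inl_apply,
      ← h.gen_of_notMem_cusp hc.1 hcc, h.mapX_gen hs hc]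
    have hsub := h.subset_supp_center hs hc.1
    have hcen := h.isCenter_transport_of_le hs hc.1
    by_cases htc : transport Λ ℰ s'.J c ∈ Λ.cusp
    · refine h.gen_mem_gradingX_of_mem_cusp μ hcen htc fun ha => ?_
      obtain ⟨u, hu, -, hut, hlt⟩ := h.exists_upper_of_mem_active hs hc hcc ha htc
      rw [← (h.valueOn_lower μ ha htc).2 c u (hc.1.eq hu) hsub rfl hut hlt, hT]
    · refine h.gen_mem_gradingX μ hcen htc ?_
      rw [← h.maslov_transport μ s'.J_mem hsub htc, hT]
  have hZ : s.gradingZ K μ n ≤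
      (s'.gradingX K μ n).comap (s.mapX K s' ∘ₗ LinearMap.inr K (s.Y K) (s.Z K)) := by
    refine freeGrading_le_comap fun T hT => ?_
    obtain ⟨c, hc, hcc, hTc⟩ := h.mem_exceptional_iff.mp T.2
    rw [hTc] at hT
    rw [← setGen_coe, hTc, LinearMap.comp_apply, LinearMap.inr_apply,
      ← h.gen_of_mem_cusp hc.1 hcc, h.mapX_gen hs hc]
    have hsub := h.subset_supp_center hs hc.1
    refine h.gen_mem_gradingX_of_mem_cusp μ (h.isCenter_transport_of_le hs hc.1) (h.transport_mem_cusp s'.J_mem hsub hcc)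
      fun ha => ?_
    obtain ⟨⟨p, q, hpq, hpJ, hpc, hqc, hlt⟩, hval⟩ := h.valueOn_lower μ hc hcc
    have tt : ∀ r, s.J ⊆ ℰ.supp (Λ.base r) → transport Λ ℰ s.J r = c →
        transport Λ ℰ s'.J r = transport Λ ℰ s'.J c := fun r hr hrc => by
      rw [← hrc, h.transport_transport s'.J_mem (faces_of_le hs).2 s.J_mem hr]
    rw [← (h.valueOn_lower μ ha (h.transport_mem_cusp s'.J_mem hsub hcc)).2 p q hpq
      ((faces_of_le hs).2.trans hpJ) (tt p hpJ hpc) (tt q (hpq ▸ hpJ) hqc) hlt,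
      hval p q hpq hpJ hpc hqc hlt, hT]
  have : x = LinearMap.inl K (s.Y K) (s.Z K) x.1 + LinearMap.inr K (s.Y K) (s.Z K) x.2 := by simp
  rw [this, map_add]
  exact add_mem (hY hx.1) (hZ hx.2)

section FaceMaps

variable [LinearOrder V] {μ : Λ.MaslovPotential} (𝒞 : ChainHomotopyDiagram K Λ μ ℰ)

/-- The maps of a chain homotopy diagram do not move sheets upwards. -/
theorem chain_mem_span {F : Finset V} (hF : F ∈ ℰ.faces) {d : L} (hd : ℰ.IsCenter F (Λ.base d))
    (hdc : d ∉ Λ.cusp) : 𝒞.c F (cellGen K Λ ℰ F d) ∈ Submodule.span K (cellGen K Λ ℰ F ''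
      {d' | ℰ.IsCenter F (Λ.base d') ∧ d' ∉ Λ.cusp ∧ (d' = d ∨ Λ.height d' < Λ.height d)}) := by
  have hm := h.branch_cell_mem hd hdc
  have hle : Finsupp.supported K K {T : Λ.sheets (ℰ.cell F) |
      Λ.Above (branch Λ ℰ F (ℰ.cell F) d) T.1} ≤ Submodule.span K (cellGen K Λ ℰ F ''
      {d' | ℰ.IsCenter F (Λ.base d') ∧ d' ∉ Λ.cusp ∧ (d' = d ∨ Λ.height d' < Λ.height d)}) := by
    rw [Finsupp.supported_eq_span_single, Submodule.span_le]
    rintro _ ⟨T, hT, rfl⟩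
    obtain ⟨e, he, hec, hTe⟩ := h.exists_of_mem_sheets_cell hF T
    rw [mem_ofPred_eq, hTe, h.above_branch_iff hd he] at hT
    refine Submodule.subset_span ⟨e, ⟨he, hec, Or.inr hT⟩, ?_⟩
    rw [cellGen, ← hTe, setGen_coe]
  by_cases hcard : F.card = 2
  · have := hle (𝒞.lower_edge F hF hcard ⟨_, hm⟩)
    rw [LinearMap.sub_apply, ← setGen_of_mem hm, ← cellGen] at this
    have := add_mem this (Submodule.subset_span ⟨d, ⟨hd, hdc, Or.inl rfl⟩, rfl⟩)
    rwa [LinearMap.id_apply, sub_add_cancel] at this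
  · have := hle (𝒞.lower F hF hcard ⟨_, hm⟩)
    rwa [← setGen_of_mem hm, ← cellGen] at this

theorem exists_lift {F : Finset V} (hFJ : F ⊆ s.J) {c : L} (hc : c ∈ s.active)
    (hcc : c ∉ Λ.cusp) {d : L} (hd : ℰ.IsCenter F (Λ.base d)) (hdc : d ∉ Λ.cusp)
    (hle : d = transport Λ ℰ F c ∨ Λ.height d < Λ.height (transport Λ ℰ F c)) :
    ∃ e ∈ s.active, e ∉ Λ.cusp ∧ transport Λ ℰ F e = d ∧ (e = c ∨ Λ.height e < Λ.height c) := by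
  have hF := mem_faces_of_mem_cell hd.1
  have hsub := h.subset_supp_of_subset hFJ hc.1
  obtain ⟨e, hec, hef⟩ := h.exists_fib_eq_singleton hd hdc hsub
  have he : e ∈ fib Λ ℰ F d (Λ.base c) := by rw [hef]; rfl
  have heq : transport Λ ℰ F c = d → e = c := fun ht => by
    have : c ∈ fib Λ ℰ F d (Λ.base c) := ⟨rfl, ht⟩
    rw [hef] at this
    exact this.symm
  rcases hle with hle | hle
  · obtain rfl := heq hle.symm
    exact ⟨e, hc, hec, he.2, Or.inl rfl⟩
  · have hlt := h.height_lt_of_transport hF (p := e) (q := c) he.1 (by rwa [he.1])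
      (by rwa [he.2])
    exact ⟨e, h.mem_active_of_height_lt hc (by rw [he.1]; exact hc.1) hec hlt, hec, he.2,
      Or.inr hlt⟩

theorem boundaryExtension_mem_range {F : Finset V} (hF : F ∈ ℰ.faces) (hFJ : F ⊆ s.J) {c : L}
    (hc : c ∈ s.active) (hcc : c ∉ Λ.cusp) :
    boundaryExtension K Λ ℰ F s.J (𝒞.c F) (cellGen K Λ ℰ s.J c) ∈ LinearMap.range (s.inclY K) := by
  have hgen : ∀ e ∈ s.active, e ∉ Λ.cusp → cellGen K Λ ℰ s.J e ∈ LinearMap.range (s.inclY K) :=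
    fun e he hec => ⟨_, h.inclY_gen he hec⟩
  have hsub := h.subset_supp_of_subset hFJ hc.1
  by_cases ht : transport Λ ℰ F c ∈ Λ.cusp
  · rw [h.boundaryExtension_cellGen_of_mem hFJ hF hc.1 ht]
    split_ifs
    · by_cases hl : ∃ l, ℰ.IsCenter s.J (Λ.base l) ∧ transport Λ ℰ F l = transport Λ ℰ F c ∧
          Λ.height l < Λ.height c
      · obtain ⟨l, hl, hlt, hlc⟩ := hl
        rw [h.cuspDiff_cellGen hFJ hF hc.1 hl hcc ht hlt hlc]
        by_cases hlcusp : l ∈ Λ.cusp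
        · rw [h.cellGen_of_mem_cusp hl hlcusp]
          exact Submodule.zero_mem _
        · exact hgen l (h.mem_active_of_height_lt hc hl hlcusp hlc) hlcusp
      · push Not at hl
        rw [h.cuspDiff_cellGen_eq_zero hFJ hF hc.1 ht hl]
        exact Submodule.zero_mem _
    · exact hgen c hc hcc
    · exact Submodule.zero_mem _
  · rw [h.boundaryExtension_cellGen_of_notMem hFJ hF hc.1 ht]
    refine (Submodule.span_le (p := (LinearMap.range (s.inclY K)).comap (incl K Λ ℰ F s.J))).mpr ?_
      (h.chain_mem_span 𝒞 hF (h.isCenter_transport hF hsub) ht)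
    rintro _ ⟨d, ⟨hd, hdc, hle⟩, rfl⟩
    obtain ⟨e, he, hec, hed, -⟩ := h.exists_lift hFJ hc hcc hd hdc hle
    rw [SetLike.mem_coe, Submodule.mem_comap, h.incl_cellGen hFJ hF he.1 hed hdc]
    exact hgen e he hec

theorem map_range_inclY_le {F : Finset V} (hF : F ∈ ℰ.faces) (hFJ : F ⊆ s.J) :
    (LinearMap.range (s.inclY K)).map (boundaryExtension K Λ ℰ F s.J (𝒞.c F))
      ≤ LinearMap.range (s.inclY K) := by
  rw [Submodule.map_le_iff_le_comap]
  rintro _ ⟨y, rfl⟩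
  rw [Submodule.mem_comap, ← LinearMap.comp_apply]
  have : (LinearMap.range (s.inclY K)).mkQ ∘ₗ
      (boundaryExtension K Λ ℰ F s.J (𝒞.c F) ∘ₗ s.inclY K) = 0 := by
    refine linearMap_ext_setGen fun T hT => ?_
    obtain ⟨c, hc, hcc, rfl⟩ := h.mem_below_iff.mp hT
    rw [LinearMap.comp_apply, LinearMap.comp_apply, h.inclY_gen hc hcc, LinearMap.zero_apply,
      Submodule.mkQ_apply, Submodule.Quotient.mk_eq_zero]
    exact h.boundaryExtension_mem_range 𝒞 hF hFJ hc hcc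
  have := LinearMap.congr_fun this y
  rwa [LinearMap.comp_apply, LinearMap.zero_apply, Submodule.mkQ_apply,
    Submodule.Quotient.mk_eq_zero] at this

theorem inclY_faceY {F : Finset V} (hF : F ∈ ℰ.faces) (hFJ : F ⊆ s.J) (y : s.Y K) :
    s.inclY K (s.faceY 𝒞 F y) = boundaryExtension K Λ ℰ F s.J (𝒞.c F) (s.inclY K y) := by
  obtain ⟨y', hy'⟩ := h.map_range_inclY_le 𝒞 hF hFJ ⟨_, ⟨y, rfl⟩, rfl⟩
  rw [faceY, LinearMap.comp_apply, LinearMap.comp_apply, ← hy', h.projY_inclY]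

theorem faceX_gen_of_mem_cusp {F : Finset V} {c : L} (hc : ℰ.IsCenter s.J (Λ.base c))
    (hcc : c ∈ Λ.cusp) : s.faceX 𝒞 F (s.gen K c) = if F.card = 2 then s.gen K c else 0 := by
  rw [h.gen_of_mem_cusp hc hcc, faceX]
  split_ifs <;> simp

theorem faceX_gen_of_notMem_cusp {F : Finset V} {c : L} (hc : c ∈ s.active) (hcc : c ∉ Λ.cusp) :
    s.faceX 𝒞 F (s.gen K c) =
      (s.projY K (boundaryExtension K Λ ℰ F s.J (𝒞.c F) (cellGen K Λ ℰ s.J c)), 0) := by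
  rw [h.gen_of_notMem_cusp hc.1 hcc, faceX, LinearMap.prodMap_apply, map_zero, faceY,
    LinearMap.comp_apply, LinearMap.comp_apply, h.inclY_gen hc hcc]

theorem projY_cellGen_eq {c : L} (hc : ℰ.IsCenter s.J (Λ.base c)) (hcc : c ∉ Λ.cusp) :
    LinearMap.inl K (s.Y K) (s.Z K) (s.projY K (cellGen K Λ ℰ s.J c)) = s.gen K c := by
  rw [h.projY_cellGen hc, h.gen_of_notMem_cusp hc hcc, LinearMap.inl_apply]

theorem faceX_gen {F : Finset V} {c : L} (hc : c ∈ s.active)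
    (hcc : c ∉ Λ.cusp) : s.faceX 𝒞 F (s.gen K c) =
      LinearMap.inl K (s.Y K) (s.Z K)
        (s.projY K (boundaryExtension K Λ ℰ F s.J (𝒞.c F) (cellGen K Λ ℰ s.J c))) :=
  h.faceX_gen_of_notMem_cusp 𝒞 hc hcc

theorem faceX_gen_of_card_eq_two {F : Finset V} (hF : F ∈ ℰ.faces) (hFJ : F ⊆ s.J) {c : L}
    (hc : ℰ.IsCenter s.J (Λ.base c)) (ht : transport Λ ℰ F c ∈ Λ.cusp) (hcard : F.card = 2) :
    s.faceX 𝒞 F (s.gen K c) = s.gen K c := by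
  by_cases ha : c ∈ s.active
  swap
  · simp [h.gen_of_notMem_active hc ha]
  by_cases hcc : c ∈ Λ.cusp
  · rw [h.faceX_gen_of_mem_cusp 𝒞 hc hcc, if_pos hcard]
  · rw [h.faceX_gen 𝒞 ha hcc, h.boundaryExtension_cellGen_of_mem hFJ hF hc ht,
      if_neg (by lia), if_pos hcard, h.projY_cellGen_eq hc hcc]

theorem faceX_gen_of_three_le_card {F : Finset V} (hF : F ∈ ℰ.faces) (hFJ : F ⊆ s.J) {c : L}
    (hc : ℰ.IsCenter s.J (Λ.base c)) (ht : transport Λ ℰ F c ∈ Λ.cusp) (hcard : 3 ≤ F.card) :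
    s.faceX 𝒞 F (s.gen K c) = 0 := by
  by_cases ha : c ∈ s.active
  swap
  · simp [h.gen_of_notMem_active hc ha]
  by_cases hcc : c ∈ Λ.cusp
  · rw [h.faceX_gen_of_mem_cusp 𝒞 hc hcc, if_neg (by lia)]
  · rw [h.faceX_gen 𝒞 ha hcc, h.boundaryExtension_cellGen_of_mem hFJ hF hc ht,
      if_neg (by lia), if_neg (by lia), map_zero, map_zero]

/-- At a vertex below a cusp, the upper one of two sheets is sent to the lower one. -/
theorem faceX_gen_upper {F : Finset V} (hF : F ∈ ℰ.faces) (hFJ : F ⊆ s.J) {u l : L}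
    (hu : u ∈ s.active) (huc : u ∉ Λ.cusp) (hl : ℰ.IsCenter s.J (Λ.base l)) (hlc : l ∉ Λ.cusp)
    (ht : transport Λ ℰ F u ∈ Λ.cusp) (hcard : F.card = 1)
    (hlu : transport Λ ℰ F l = transport Λ ℰ F u) (hlt : Λ.height l < Λ.height u) :
    s.faceX 𝒞 F (s.gen K u) = s.gen K l := by
  rw [h.faceX_gen 𝒞 hu huc, h.boundaryExtension_cellGen_of_mem hFJ hF hu.1 ht,
    if_pos hcard, h.cuspDiff_cellGen hFJ hF hu.1 hl huc ht hlu hlt, h.projY_cellGen_eq hl hlc]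

theorem faceX_gen_lower {F : Finset V} (hF : F ∈ ℰ.faces) (hFJ : F ⊆ s.J) {c : L}
    (hc : ℰ.IsCenter s.J (Λ.base c)) (ht : transport Λ ℰ F c ∈ Λ.cusp) (hcard : F.card = 1)
    (hn : ∀ d, ℰ.IsCenter s.J (Λ.base d) → transport Λ ℰ F d = transport Λ ℰ F c →
      Λ.height c ≤ Λ.height d) :
    s.faceX 𝒞 F (s.gen K c) = 0 := by
  by_cases ha : c ∈ s.active
  swap
  · simp [h.gen_of_notMem_active hc ha]
  by_cases hcc : c ∈ Λ.cusp
  · rw [h.faceX_gen_of_mem_cusp 𝒞 hc hcc, if_neg (by lia)]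
  · rw [h.faceX_gen 𝒞 ha hcc, h.boundaryExtension_cellGen_of_mem hFJ hF hc ht,
      if_pos hcard, h.cuspDiff_cellGen_eq_zero hFJ hF hc ht hn, map_zero, map_zero]

theorem notMem_cusp_of_ne {F J : Finset V} (hF : F ∈ ℰ.faces) (hFJ : F ⊆ J) {c d : L}
    (hc : ℰ.IsCenter J (Λ.base c)) (hd : ℰ.IsCenter J (Λ.base d))
    (hcd : transport Λ ℰ F c = transport Λ ℰ F d) (hne : c ≠ d) : c ∉ Λ.cusp ∧ d ∉ Λ.cusp := by
  have hsub := h.subset_supp_of_subset hFJ hc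
  have hcen := h.isCenter_transport hF hsub
  have m1 : c ∈ fib Λ ℰ F (transport Λ ℰ F c) (Λ.base c) := ⟨rfl, rfl⟩
  have m2 : d ∈ fib Λ ℰ F (transport Λ ℰ F c) (Λ.base c) := ⟨hd.eq hc, hcd.symm⟩
  constructor <;> intro hcc
  · have := h.fib_eq_singleton_of_mem_cusp hcen hsub m1 hcc
    rw [this] at m2
    exact hne m2.symm
  · have := h.fib_eq_singleton_of_mem_cusp hcen hsub m2 hcc
    rw [this] at m1
    exact hne m1

theorem comm_gen (hs : s ≤ s') {F : Finset V} (hF : F.Nonempty) (hFI : F ⊆ s.I) {c : L}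
    (hc : c ∈ s.active) : s.mapX K s' (s.faceX 𝒞 F (s.gen K c)) =
      s'.faceX 𝒞 F (s'.gen K (transport Λ ℰ s'.J c)) := by
  have hFJ := hFI.trans s.I_subset
  have hFJ' : F ⊆ s'.J := (hFI.trans (faces_of_le hs).1).trans s'.I_subset
  have hFf := mem_faces_of_subset s.J_mem hF hFJ
  have hcen := h.isCenter_transport_of_le hs hc.1
  have hsub := h.subset_supp_center hs hc.1
  have htt : ∀ d, ℰ.IsCenter s.J (Λ.base d) →
      transport Λ ℰ F (transport Λ ℰ s'.J d) = transport Λ ℰ F d := fun d hd =>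
    h.transport_transport hFf hFJ' s'.J_mem (h.subset_supp_center hs hd)
  by_cases ht : transport Λ ℰ F c ∈ Λ.cusp
  · have ht' : transport Λ ℰ F (transport Λ ℰ s'.J c) ∈ Λ.cusp := by rwa [htt c hc.1]
    have hpos := hF.card_pos
    rcases (by lia : F.card = 1 ∨ F.card = 2 ∨ 3 ≤ F.card) with hcard | hcard | hcard
    · have hzero : transport Λ ℰ s'.J c ∈ Λ.cusp →
          s'.faceX 𝒞 F (s'.gen K (transport Λ ℰ s'.J c)) = 0 := fun htc => by
        rw [h.faceX_gen_of_mem_cusp 𝒞 hcen htc, if_neg (by lia)]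
      by_cases hl : ∃ l, ℰ.IsCenter s.J (Λ.base l) ∧ transport Λ ℰ F l = transport Λ ℰ F c ∧
          Λ.height l < Λ.height c
      · obtain ⟨l, hl, hlt, hlc⟩ := hl
        have hne : c ≠ l := fun he => hlc.ne' (congrArg Λ.height he)
        obtain ⟨hcc, hlcusp⟩ := h.notMem_cusp_of_ne hFf hFJ hc.1 hl hlt.symm hne
        have hla := h.mem_active_of_height_lt hc hl hlcusp hlc
        have hlcen := h.isCenter_transport_of_le hs hl
        have htl : transport Λ ℰ F (transport Λ ℰ s'.J c) =
            transport Λ ℰ F (transport Λ ℰ s'.J l) := by rw [htt c hc.1, htt l hl, hlt]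
        rw [h.faceX_gen_upper 𝒞 hFf hFJ hc hcc hl hlcusp ht hcard hlt hlc, h.mapX_gen hs hla]
        by_cases htc : transport Λ ℰ s'.J c ∈ Λ.cusp
        · have heq : transport Λ ℰ s'.J c = transport Λ ℰ s'.J l := by
            by_contra hne'
            exact (h.notMem_cusp_of_ne hFf hFJ' hcen hlcen htl hne').1 htc
          rw [hzero htc, ← heq]
          refine h.gen_of_notMem_active hcen fun ha => ?_
          obtain ⟨u, hu, -, hut, hcu⟩ := h.exists_upper_of_mem_active hs hc hcc ha htc
          obtain ⟨x, y, -, -, -, hfib⟩ := h.exists_fib_eq_pair (h.isCenter_transport hFf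
            (h.subset_supp_of_subset hFJ hc.1)) ht (h.subset_supp_of_subset hFJ hc.1)
            (q := c) ⟨rfl, rfl⟩ hcc
          have m1 : c ∈ fib Λ ℰ F (transport Λ ℰ F c) (Λ.base c) := ⟨rfl, rfl⟩
          have m2 : l ∈ fib Λ ℰ F (transport Λ ℰ F c) (Λ.base c) := ⟨hl.eq hc.1, hlt⟩
          have m3 : u ∈ fib Λ ℰ F (transport Λ ℰ F c) (Λ.base c) :=
            ⟨hu.eq hc.1, by rw [← htt u hu, hut, htt c hc.1]⟩
          rw [hfib] at m1 m2 m3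
          have hul : u ≠ l := fun he => (hlc.trans hcu).ne' (congrArg Λ.height he)
          have huc : u ≠ c := fun he => hcu.ne' (congrArg Λ.height he)
          rcases m1 with rfl | rfl <;> rcases m2 with rfl | rfl <;> rcases m3 with rfl | rfl <;>
            first | exact absurd rfl hne | exact absurd rfl hul | exact absurd rfl huc
        · have ha := h.transport_mem_active hs hc htc
          have hne' : transport Λ ℰ s'.J c ≠ transport Λ ℰ s'.J l := fun he => by
            obtain ⟨q, -, hq⟩ := h.exists_fib_eq_singleton hcen htc hsub
            have m1 : c ∈ fib Λ ℰ s'.J (transport Λ ℰ s'.J c) (Λ.base c) := ⟨rfl, rfl⟩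
            have m2 : l ∈ fib Λ ℰ s'.J (transport Λ ℰ s'.J c) (Λ.base c) := ⟨hl.eq hc.1, he.symm⟩
            rw [hq] at m1 m2
            exact hne (m1.trans m2.symm)
          have hlt' : Λ.height (transport Λ ℰ s'.J l) < Λ.height (transport Λ ℰ s'.J c) := by
            rcases lt_trichotomy (Λ.height (transport Λ ℰ s'.J l))
              (Λ.height (transport Λ ℰ s'.J c)) with h1 | h1 | h1
            · exact h1
            · refine absurd ?_ hne'.symm
              exact h.eq_of_mem_fib (h.isCenter_transport hFf (h.subset_supp_of_subset hFJ' hcen))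
                (h.subset_supp_of_subset hFJ' hcen) ⟨hlcen.eq hcen, htl.symm⟩ ⟨rfl, rfl⟩ h1
            · exact absurd (h.height_lt_of_transport s'.J_mem (hc.1.eq hl) hsub h1) hlc.not_gt
          rw [h.faceX_gen_upper 𝒞 hFf hFJ' ha htc hlcen
            (h.notMem_cusp_of_ne hFf hFJ' hcen hlcen htl hne').2 ht' hcard htl.symm hlt']
      · push Not at hl
        rw [h.faceX_gen_lower 𝒞 hFf hFJ hc.1 ht hcard hl, map_zero]
        by_cases htc : transport Λ ℰ s'.J c ∈ Λ.cusp
        · exact (hzero htc).symm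
        · refine (h.faceX_gen_lower 𝒞 hFf hFJ' hcen ht' hcard fun d hd hdc => ?_).symm
          by_contra! hlt
          have hne : d ≠ transport Λ ℰ s'.J c := fun he => hlt.ne (congrArg Λ.height he)
          have hdcusp := (h.notMem_cusp_of_ne hFf hFJ' hd hcen hdc hne).1
          obtain ⟨e, -, hef⟩ := h.exists_fib_eq_singleton hd hdcusp hsub
          have he : e ∈ fib Λ ℰ s'.J d (Λ.base c) := by rw [hef]; rfl
          have hecen : ℰ.IsCenter s.J (Λ.base e) := he.1 ▸ hc.1
          refine (hl e hecen ?_).not_gt (h.height_lt_of_transport s'.J_mem he.1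
            (by rw [he.1]; exact hsub) (by rw [he.2]; exact hlt))
          rw [← htt e hecen, he.2, hdc, htt c hc.1]
    · rw [h.faceX_gen_of_card_eq_two 𝒞 hFf hFJ hc.1 ht hcard,
        h.faceX_gen_of_card_eq_two 𝒞 hFf hFJ' hcen ht' hcard, h.mapX_gen hs hc]
    · rw [h.faceX_gen_of_three_le_card 𝒞 hFf hFJ hc.1 ht hcard,
        h.faceX_gen_of_three_le_card 𝒞 hFf hFJ' hcen ht' hcard, map_zero]
  · have ht' : transport Λ ℰ F (transport Λ ℰ s'.J c) ∉ Λ.cusp := by rwa [htt c hc.1]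
    have hsubF := h.subset_supp_of_subset hFJ hc.1
    have hcc := h.notMem_cusp_of_transport hFf hsubF ht
    have htc := h.notMem_cusp_of_transport hFf (h.subset_supp_of_subset hFJ' hcen) ht'
    have ha := h.transport_mem_active hs hc htc
    rw [h.faceX_gen 𝒞 hc hcc, h.faceX_gen 𝒞 ha htc,
      h.boundaryExtension_cellGen_of_notMem hFJ hFf hc.1 ht,
      h.boundaryExtension_cellGen_of_notMem hFJ' hFf hcen ht', htt c hc.1]
    refine LinearMap.eqOn_span
      (f := s.mapX K s' ∘ₗ LinearMap.inl K (s.Y K) (s.Z K) ∘ₗ s.projY K ∘ₗ incl K Λ ℰ F s.J)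
      (g := LinearMap.inl K (s'.Y K) (s'.Z K) ∘ₗ s'.projY K ∘ₗ incl K Λ ℰ F s'.J) ?_
      (h.chain_mem_span 𝒞 hFf (h.isCenter_transport hFf hsubF) ht)
    rintro _ ⟨d, ⟨hd, hdc, hle⟩, rfl⟩
    obtain ⟨e, he, hec, hed, -⟩ := h.exists_lift hFJ hc hcc hd hdc hle
    have hecen := h.isCenter_transport_of_le hs he.1
    have hed' : transport Λ ℰ F (transport Λ ℰ s'.J e) = d := by rw [htt e he.1, hed]
    have hec' := h.notMem_cusp_of_transport hFf (h.subset_supp_of_subset hFJ' hecen)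
      (by rwa [hed'])
    simp only [LinearMap.comp_apply]
    rw [h.incl_cellGen hFJ hFf he.1 hed hdc, h.incl_cellGen hFJ' hFf hecen hed' hdc,
      h.projY_cellGen_eq he.1 hec, h.projY_cellGen_eq hecen hec', h.mapX_gen hs he]

theorem comm_faceX (hs : s ≤ s') {F : Finset V} (hF : F.Nonempty) (hFI : F ⊆ s.I) :
    s.mapX K s' ∘ₗ s.faceX 𝒞 F = s'.faceX 𝒞 F ∘ₗ s.mapX K s' :=
  h.linearMap_ext_gen fun c hc => by
    rw [LinearMap.comp_apply, LinearMap.comp_apply, h.comm_gen 𝒞 hs hF hFI hc, h.mapX_gen hs hc]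

end FaceMaps

end Admissible

end LegendrianSheaf

namespace LegendrianSheaf

open Set Filter

set_option linter.unusedSectionVars false

section Edge

variable {V : Type*} [LinearOrder V] {K W : Type*} [Field K] [AddCommGroup W] [Module K W]

/-- The maps which are the identity for edges and zero otherwise satisfy the identity of simplex
diagrams. -/
theorem edge_identity (F : Finset V) :
    ∑ v ∈ inner F, (-1 : K) ^ (pos F v + 1) •
        (if (F.erase v).card = 2 then (LinearMap.id : W →ₗ[K] W) else 0)
      + ∑ v ∈ F, (-1 : K) ^ pos F v •
        ((if (backFace F v).card = 2 then (LinearMap.id : W →ₗ[K] W) else 0) ∘ₗ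
          (if (frontFace F v).card = 2 then LinearMap.id else 0)) = 0 := by
  have hinner : ∀ v ∈ inner F, v ∈ F := fun v hv => (mem_inner.mp hv).1
  by_cases hF : F.card = 3
  · have e : inner F = F.filter fun v => pos F v = 1 := by
      ext v
      rw [mem_inner, Finset.mem_filter]
      refine and_congr_right fun hv => ?_
      have h1 := card_frontFace hv
      have h2 := card_backFace (E := F) (v := v)
      have e1 : (∃ u ∈ F, u < v) ↔ 0 < pos F v := by
        rw [pos, Finset.card_pos, Finset.filter_nonempty_iff]
      have e2 : (∃ u ∈ F, v < u) ↔ 1 < (backFace F v).card := by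
        rw [Finset.one_lt_card_iff_nontrivial]
        constructor
        · rintro ⟨u, hu, hvu⟩
          exact ⟨v, by simp [backFace, hv], u, by simp [backFace, hu, hvu.le], hvu.ne⟩
        · intro hn
          obtain ⟨u, hu, huv⟩ := hn.exists_ne v
          rw [backFace, Finset.mem_filter] at hu
          exact ⟨u, hu.1, lt_of_le_of_ne hu.2 huv.symm⟩
      rw [e1, e2]
      lia
    rw [e, Finset.sum_filter, ← Finset.sum_add_distrib]
    refine Finset.sum_eq_zero fun v hv => ?_
    have h1 := card_frontFace hv
    have h2 := card_backFace (E := F) (v := v)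
    have h3 := Finset.card_erase_add_one hv
    by_cases hp : pos F v = 1
    · rw [if_pos hp, if_pos (by lia), if_pos (by lia), if_pos (by lia), hp]
      simp
    · rw [if_neg hp, if_neg (c := (frontFace F v).card = 2) (by lia), LinearMap.comp_zero,
        smul_zero, add_zero]
  · rw [Finset.sum_eq_zero, Finset.sum_eq_zero, add_zero]
    · intro v hv
      have h1 := card_frontFace hv
      have h2 := card_backFace (E := F) (v := v)
      by_cases hp : (frontFace F v).card = 2
      · rw [if_neg (by lia), LinearMap.zero_comp, smul_zero]
      · rw [if_neg hp, LinearMap.comp_zero, smul_zero]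
    · intro v hv
      have h3 := Finset.card_erase_add_one (hinner v hv)
      rw [if_neg (by lia), smul_zero]

end Edge

variable {L M : Type*} [TopologicalSpace L] [ChartedSpace Plane L]
  [TopologicalSpace M] [ChartedSpace Plane M] [IsManifold (𝓡 2) ∞ M]
  {V : Type*} {K : Type*} [Field K]

namespace Admissible

open Triangulation LegendrianSurface Stratum

variable [IsManifold (𝓡 2) ∞ L] [CompactSpace L] [T2Space L] [T2Space M]
  {Λ : LegendrianSurface L M} {ℰ : Triangulation V M}
variable (h : Admissible Λ ℰ) {s s' : Stratum Λ ℰ} [LinearOrder V] {μ : Λ.MaslovPotential}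
  (𝒞 : ChainHomotopyDiagram K Λ μ ℰ)
include h

theorem identity_faceY {F : Finset V} (hF : F.Nonempty) (hFJ : F ⊆ s.J) :
    ∑ v ∈ inner F, (-1 : K) ^ (pos F v + 1) • s.faceY 𝒞 (F.erase v)
      + ∑ v ∈ F, (-1 : K) ^ pos F v • (s.faceY 𝒞 (backFace F v) ∘ₗ s.faceY 𝒞 (frontFace F v))
        = 0 := by
  refine LinearMap.ext fun y => ?_
  have hinj : Function.Injective (s.inclY K) := Function.LeftInverse.injective h.projY_inclY
  refine hinj ?_
  have key : ∀ G : Finset V, G.Nonempty → G ⊆ F → ∀ y, s.inclY K (s.faceY 𝒞 G y) =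
      boundaryExtension K Λ ℰ G s.J (𝒞.c G) (s.inclY K y) := fun G hG hGF y =>
    h.inclY_faceY 𝒞 (mem_faces_of_subset s.J_mem hG (hGF.trans hFJ)) (hGF.trans hFJ) y
  have hid := LinearMap.congr_fun ((𝒞.diagram s.J s.J_mem).identity F hF hFJ) (s.inclY K y)
  simp only [LinearMap.add_apply, LinearMap.sum_apply, LinearMap.smul_apply, LinearMap.comp_apply,
    LinearMap.zero_apply, map_add, map_sum, map_smul, map_zero] at hid ⊢
  rw [← hid]
  congr 1
  · refine Finset.sum_congr rfl fun v hv => ?_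
    obtain ⟨-, ⟨u, hu, huv⟩, -⟩ := mem_inner.mp hv
    rw [key _ ⟨u, Finset.mem_erase.mpr ⟨huv.ne, hu⟩⟩ (Finset.erase_subset _ _)]
  · refine Finset.sum_congr rfl fun v hv => ?_
    rw [key (backFace F v) ⟨v, by simp [backFace, hv]⟩ (Finset.filter_subset _ _),
      key (frontFace F v) ⟨v, by simp [frontFace, hv]⟩ (Finset.filter_subset _ _)]

theorem isSimplexDiagram (s : Stratum Λ ℰ) :
    IsSimplexDiagram s.I (s.gradingX K μ) (s.faceX 𝒞) where
  degree F hF hFI n w hw := by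
    have hFJ := hFI.trans s.I_subset
    refine ⟨h.projY_mem μ ((𝒞.diagram s.J s.J_mem).degree F hF hFJ n _ (h.inclY_mem μ hw.1)), ?_⟩
    rw [faceX, LinearMap.prodMap_apply]
    split_ifs with hcard
    · rw [show n + 1 - sdim F = n by simp [sdim, hcard]]
      exact hw.2
    · exact Submodule.zero_mem _
  identity F hF hFI := by
    have h1 := h.identity_faceY 𝒞 hF (hFI.trans s.I_subset)
    have h2 := edge_identity (K := K) (W := s.Z K) F
    refine LinearMap.ext fun x => Prod.ext ?_ ?_
    · have := LinearMap.congr_fun h1 x.1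
      simp only [faceX, LinearMap.add_apply, LinearMap.sum_apply, LinearMap.smul_apply,
        LinearMap.comp_apply, LinearMap.prodMap_apply, Prod.fst_add, Prod.fst_sum, Prod.smul_fst,
        LinearMap.zero_apply, Prod.fst_zero] at this ⊢
      exact this
    · have := LinearMap.congr_fun h2 x.2
      simp only [faceX, LinearMap.add_apply, LinearMap.sum_apply, LinearMap.smul_apply,
        LinearMap.comp_apply, LinearMap.prodMap_apply, Prod.snd_add, Prod.snd_sum, Prod.smul_snd,
        LinearMap.zero_apply, Prod.snd_zero] at this ⊢
      exact this

theorem isWellDefined : IsWellDefined 𝒞 where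
  sheet_bijection s := by
    constructor
    · intro T hT
      obtain ⟨c, hc, hcc, rfl⟩ := (h.mem_sheets_iff s.isDualRegion).mp hT
      refine ⟨_, ⟨h.branch_cell_mem hc hcc,
        (h.branch_inter_nonempty_iff s.isDualRegion hc).mpr rfl⟩, ?_⟩
      rintro S ⟨hS, hTS⟩
      obtain ⟨d, hd, -, rfl⟩ := (h.mem_sheets_iff (isDualRegion_cell s.J_mem)).mp hS
      rw [(h.branch_inter_nonempty_iff s.isDualRegion hc).mp hTS]
    · intro S hS
      obtain ⟨d, hd, hdc, rfl⟩ := (h.mem_sheets_iff (isDualRegion_cell s.J_mem)).mp hS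
      refine ⟨_, ⟨(h.branch_mem_sheets_iff s.isDualRegion hd).mpr hdc,
        (h.branch_inter_nonempty_iff s.isDualRegion hd).mpr rfl⟩, ?_⟩
      rintro T ⟨hT, hTS⟩
      obtain ⟨c, hc, -, rfl⟩ := (h.mem_sheets_iff s.isDualRegion).mp hT
      rw [(h.branch_inter_nonempty_iff s.isDualRegion hc).mp hTS]
  invariant s F hF hFI := h.map_range_inclY_le 𝒞
    (mem_faces_of_subset s.J_mem hF (hFI.trans s.I_subset)) (hFI.trans s.I_subset)
  below_of_le s s' hs T hT T' hT' hTT' := by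
    obtain ⟨c, hc, -, rfl⟩ := h.mem_below_iff.mp hT
    obtain ⟨c', hc', hcc', rfl⟩ := (h.mem_sheets_iff s'.isDualRegion).mp hT'
    obtain rfl := (h.branch_subset_closure_iff hs hc.1).mp hTT'
    exact h.mem_below_iff.mpr ⟨_, h.transport_mem_active hs hc hcc', hcc', rfl⟩
  diagram s := h.isSimplexDiagram 𝒞 s
  face _ _ hs := (faces_of_le hs).1
  degree _ _ hs _ _ hw := h.degree_mapX μ hs hw
  comm _ _ hs _ hF hFI := h.comm_faceX 𝒞 hs hF hFI
  map_id _ := h.mapX_self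
  map_comp _ _ _ hs hs' := h.mapX_comp hs hs'

end Admissible

end LegendrianSheaf

namespace LegendrianSheaf

open Set Filter

set_option linter.unusedSectionVars false

universe w v

section Homological

open CochainComplex CochainComplex.HomComplex HomologicalComplex

variable {K : Type v} [Ring K]

theorem hom_comp_apply {A B C : ModuleCat.{w} K} {f : A ⟶ B} {g : B ⟶ C} {k : A ⟶ C}
    (e : f ≫ g = k) (x : A) : g.hom (f.hom x) = k.hom x := by
  rw [← e]
  rfl

/-- A map of cochain complexes of modules is a quasi-isomorphism if it is bijective on cohomology,
in terms of elements. -/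
theorem quasiIso_of_forall {C D : CochainComplex (ModuleCat.{w} K) ℤ} (f : C ⟶ D)
    (hinj : ∀ n (x : C.X n) (y : D.X (n - 1)), (C.d n (n + 1)).hom x = 0 →
      (f.f n).hom x = (D.d (n - 1) n).hom y → ∃ z : C.X (n - 1), (C.d (n - 1) n).hom z = x)
    (hsurj : ∀ n (y : D.X n), (D.d n (n + 1)).hom y = 0 → ∃ x : C.X n,
      (C.d n (n + 1)).hom x = 0 ∧ ∃ z : D.X (n - 1), y = (f.f n).hom x + (D.d (n - 1) n).hom z) :
    QuasiIso f := by
  rw [quasiIso_iff]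
  intro n
  rw [quasiIsoAt_iff_isIso_homologyMap]
  have hm : Mono (homologyMap f n) := by
    rw [mono_homologyMap_iff_up_to_refinements f (n - 1) n (n + 1) (by simp) (by simp)]
    intro A x₂ hx₂ y₁ hy₁
    let N : Submodule K (A × C.X (n - 1)) :=
      LinearMap.ker (x₂.hom ∘ₗ LinearMap.fst K _ _ - (C.d (n - 1) n).hom ∘ₗ LinearMap.snd K _ _)
    refine ⟨ModuleCat.of K N, ModuleCat.ofHom (LinearMap.fst K _ _ ∘ₗ N.subtype), ?_,
      ModuleCat.ofHom (LinearMap.snd K _ _ ∘ₗ N.subtype), ?_⟩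
    · rw [ModuleCat.epi_iff_surjective]
      intro a
      obtain ⟨z, hz⟩ := hinj n (x₂.hom a) (y₁.hom a) (hom_comp_apply hx₂ a)
        ((hom_comp_apply hy₁ a).trans rfl)
      exact ⟨⟨(a, z), by simp [N, hz]⟩, rfl⟩
    · ext ⟨⟨a, z⟩, haz⟩
      simpa [N, sub_eq_zero] using haz
  have he : Epi (homologyMap f n) := by
    rw [epi_homologyMap_iff_up_to_refinements f (n - 1) n (n + 1) (by simp) (by simp)]
    intro A y₂ hy₂
    let N : Submodule K (A × C.X n × D.X (n - 1)) :=
      LinearMap.ker (y₂.hom ∘ₗ LinearMap.fst K _ _ -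
        (f.f n).hom ∘ₗ LinearMap.fst K _ _ ∘ₗ LinearMap.snd K _ _ -
        (D.d (n - 1) n).hom ∘ₗ LinearMap.snd K _ _ ∘ₗ LinearMap.snd K _ _) ⊓
      LinearMap.ker ((C.d n (n + 1)).hom ∘ₗ LinearMap.fst K _ _ ∘ₗ LinearMap.snd K _ _)
    refine ⟨ModuleCat.of K N, ModuleCat.ofHom (LinearMap.fst K _ _ ∘ₗ N.subtype), ?_,
      ModuleCat.ofHom (LinearMap.fst K _ _ ∘ₗ LinearMap.snd K _ _ ∘ₗ N.subtype), ?_,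
      ModuleCat.ofHom (LinearMap.snd K _ _ ∘ₗ LinearMap.snd K _ _ ∘ₗ N.subtype), ?_⟩
    · rw [ModuleCat.epi_iff_surjective]
      intro a
      obtain ⟨x, hx, z, hz⟩ := hsurj n (y₂.hom a) (hom_comp_apply hy₂ a)
      exact ⟨⟨(a, x, z), by simp [N, hz, hx]⟩, rfl⟩
    · ext ⟨⟨a, x, z⟩, haz⟩
      exact haz.2
    · ext ⟨⟨a, x, z⟩, haz⟩
      have h0 : y₂.hom a - (f.f n).hom x - (D.d (n - 1) n).hom z = 0 := haz.1
      rw [sub_sub, sub_eq_zero] at h0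
      exact h0
  exact isIso_of_mono_of_epi _

section Cone

variable {F G : CochainComplex (ModuleCat.{w} K) ℤ} (φ : F ⟶ G)

theorem exists_mappingCone_eq {i j : ℤ} (hij : i + 1 = j) (z : (mappingCone φ).X i) :
    ∃ (a : F.X j) (b : G.X i), z = ((mappingCone.inl φ).v j i (by lia)).hom a +
      ((mappingCone.inr φ).f i).hom b := by
  refine ⟨((mappingCone.fst φ).1.v i j hij).hom z, ((mappingCone.snd φ).v i i (add_zero i)).hom z, ?_⟩
  have := congrArg (fun f => f.hom z) (mappingCone.id_X φ i j hij)
  exact this.symm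

theorem mappingCone_eq_zero {i j : ℤ} (hij : i + 1 = j) {a : F.X j} {b : G.X i}
    (h : ((mappingCone.inl φ).v j i (by lia)).hom a + ((mappingCone.inr φ).f i).hom b = 0) :
    a = 0 ∧ b = 0 := by
  have h1 := congrArg ((mappingCone.fst φ).1.v i j hij).hom h
  have h2 := congrArg ((mappingCone.snd φ).v i i (add_zero i)).hom h
  rw [map_add, map_zero, hom_comp_apply (mappingCone.inl_v_fst_v φ j i hij),
    hom_comp_apply (mappingCone.inr_f_fst_v φ i j hij)] at h1
  rw [map_add, map_zero, hom_comp_apply (mappingCone.inl_v_snd_v φ j i (by lia)),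
    hom_comp_apply (mappingCone.inr_f_snd_v φ i)] at h2
  constructor
  · simpa using h1
  · simpa using h2

theorem d_inl_apply {i j k : ℤ} (hij : i + (-1) = j) (hik : k + (-1) = i) (a : F.X i) :
    ((mappingCone φ).d j i).hom (((mappingCone.inl φ).v i j hij).hom a) =
      ((mappingCone.inr φ).f i).hom ((φ.f i).hom a) -
        ((mappingCone.inl φ).v k i hik).hom ((F.d i k).hom a) := by
  rw [hom_comp_apply (mappingCone.inl_v_d φ i j k hij hik)]
  rfl

theorem d_inr_apply {i j : ℤ} (b : G.X i) :
    ((mappingCone φ).d i j).hom (((mappingCone.inr φ).f i).hom b) =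
      ((mappingCone.inr φ).f j).hom ((G.d i j).hom b) := by
  rw [hom_comp_apply (mappingCone.inr_f_d φ i j)]
  rfl

end Cone

section Square

variable {A B C D : CochainComplex (ModuleCat.{w} K) ℤ} (f : A ⟶ B) (g : C ⟶ D) (u : A ⟶ C)
  (v : B ⟶ D) (comm : f ≫ v = u ≫ g)

theorem map_inl_apply {i j : ℤ} (hij : i + (-1) = j) (a : A.X i) :
    ((mappingCone.map f g u v comm).f j).hom (((mappingCone.inl f).v i j hij).hom a) =
      ((mappingCone.inl g).v i j hij).hom ((u.f i).hom a) := by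
  have : (mappingCone.inl f).v i j hij ≫ (mappingCone.map f g u v comm).f j =
      u.f i ≫ (mappingCone.inl g).v i j hij := by
    simp [mappingCone.map]
  rw [hom_comp_apply this]
  rfl

theorem map_inr_apply {i : ℤ} (b : B.X i) :
    ((mappingCone.map f g u v comm).f i).hom (((mappingCone.inr f).f i).hom b) =
      ((mappingCone.inr g).f i).hom ((v.f i).hom b) := by
  have : (mappingCone.inr f).f i ≫ (mappingCone.map f g u v comm).f i =
      v.f i ≫ (mappingCone.inr g).f i := by
    simp [mappingCone.map]
  rw [hom_comp_apply this]
  rfl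

/-- The total complex of a square of complexes which is cartesian and cocartesian in every degree
is acyclic. -/
theorem acyclic_of_bicartesian
    (hinj : ∀ n (a : A.X n), (f.f n).hom a = 0 → (u.f n).hom a = 0 → a = 0)
    (hex : ∀ n (b : B.X n) (c : C.X n), (v.f n).hom b = (g.f n).hom c →
      ∃ a : A.X n, (f.f n).hom a = b ∧ (u.f n).hom a = c)
    (hsurj : ∀ n (d : D.X n), ∃ (b : B.X n) (c : C.X n), d = (v.f n).hom b + (g.f n).hom c) :
    (mappingCone (mappingCone.map f g u v comm)).Acyclic := by
  intro n
  obtain ⟨p, hp⟩ : ∃ p, p + 1 = n := ⟨n - 1, by lia⟩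
  obtain ⟨q, hq⟩ : ∃ q, n + 1 = q := ⟨_, rfl⟩
  obtain ⟨r, hr⟩ : ∃ r, q + 1 = r := ⟨_, rfl⟩
  obtain ⟨t, ht⟩ : ∃ t, r + 1 = t := ⟨_, rfl⟩
  have hp' : n + (-1) = p := by lia
  have hq' : q + (-1) = n := by lia
  have hr' : r + (-1) = q := by lia
  have ht' : t + (-1) = r := by lia
  rw [exactAt_iff' _ p n q (by simp [← hp]) (by simp [hq]), ShortComplex.moduleCat_exact_iff]
  set m := mappingCone.map f g u v comm
  suffices H : ∀ z : (mappingCone m).X n, ((mappingCone m).d n q).hom z = 0 →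
      ∃ y, ((mappingCone m).d p n).hom y = z from fun z hz => H z hz
  let iD : ∀ k, D.X k →ₗ[K] (mappingCone m).X k := fun k =>
    ((mappingCone.inr m).f k).hom ∘ₗ ((mappingCone.inr g).f k).hom
  let iC : ∀ k l, k + (-1) = l → C.X k →ₗ[K] (mappingCone m).X l := fun k l hkl =>
    ((mappingCone.inr m).f l).hom ∘ₗ ((mappingCone.inl g).v k l hkl).hom
  let iB : ∀ k l, k + (-1) = l → B.X k →ₗ[K] (mappingCone m).X l := fun k l hkl =>
    ((mappingCone.inl m).v k l hkl).hom ∘ₗ ((mappingCone.inr f).f k).hom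
  let iA : ∀ k l j, k + (-1) = l → l + (-1) = j → A.X k →ₗ[K] (mappingCone m).X j :=
    fun k l j hkl hlj => ((mappingCone.inl m).v l j hlj).hom ∘ₗ ((mappingCone.inl f).v k l hkl).hom
  have dD : ∀ k l d, ((mappingCone m).d k l).hom (iD k d) = iD l ((D.d k l).hom d) := by
    intro k l d
    simp only [iD, LinearMap.comp_apply, d_inr_apply]
  have dC : ∀ k l p (hkl : k + (-1) = l) (hpk : p + (-1) = k) c,
      ((mappingCone m).d l k).hom (iC k l hkl c) =
        iD k ((g.f k).hom c) - iC p k hpk ((C.d k p).hom c) := by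
    intro k l p hkl hpk c
    simp only [iD, iC, LinearMap.comp_apply, d_inr_apply, d_inl_apply g hkl hpk, map_sub]
  have dB : ∀ k l p (hkl : k + (-1) = l) (hpk : p + (-1) = k) b,
      ((mappingCone m).d l k).hom (iB k l hkl b) =
        iD k ((v.f k).hom b) - iB p k hpk ((B.d k p).hom b) := by
    intro k l p hkl hpk b
    simp only [iD, iB, LinearMap.comp_apply, d_inr_apply, d_inl_apply m hkl hpk]
    rw [map_inr_apply]
  have dA : ∀ k l j p (hkl : k + (-1) = l) (hlj : l + (-1) = j) (hpk : p + (-1) = k) a,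
      ((mappingCone m).d j l).hom (iA k l j hkl hlj a) = iC k l hkl ((u.f k).hom a) -
        iB k l hkl ((f.f k).hom a) + iA p k l hpk hkl ((A.d k p).hom a) := by
    intro k l j p hkl hlj hpk a
    simp only [iC, iB, iA, LinearMap.comp_apply, d_inl_apply m hlj hkl, d_inl_apply f hkl hpk,
      map_sub]
    rw [map_inl_apply]
    abel
  have decomp : ∀ z : (mappingCone m).X n, ∃ a b c d,
      z = iA r q n hr' hq' a + iB q n hq' b + iC q n hq' c + iD n d := by
    intro z
    obtain ⟨x, y, rfl⟩ := exists_mappingCone_eq m hq z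
    obtain ⟨a, b, rfl⟩ := exists_mappingCone_eq f hr x
    obtain ⟨c, d, rfl⟩ := exists_mappingCone_eq g hq y
    refine ⟨a, b, c, d, ?_⟩
    simp only [iA, iB, iC, iD, LinearMap.comp_apply, map_add]
    abel
  have indep : ∀ a b c d, iA t r q ht' hr' a + iB r q hr' b + iC r q hr' c + iD q d = 0 →
      a = 0 ∧ b = 0 ∧ c = 0 ∧ d = 0 := by
    intro a b c d h0
    simp only [iA, iB, iC, iD, LinearMap.comp_apply] at h0
    rw [add_assoc, ← map_add, ← map_add] at h0
    obtain ⟨h1, h2⟩ := mappingCone_eq_zero m hr h0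
    obtain ⟨h3, h4⟩ := mappingCone_eq_zero f ht h1
    obtain ⟨h5, h6⟩ := mappingCone_eq_zero g hr h2
    exact ⟨h3, h4, h5, h6⟩
  clear_value iA iB iC iD
  have dd : ∀ y, ((mappingCone m).d n q).hom (((mappingCone m).d p n).hom y) = 0 :=
    fun y => LinearMap.congr_fun (congrArg ModuleCat.Hom.hom ((mappingCone m).d_comp_d p n q)) y
  have fin : ∀ a, ((mappingCone m).d n q).hom (iA r q n hr' hq' a) = 0 → a = 0 := by
    intro a h0
    rw [dA r q n t hr' hq' ht'] at h0
    obtain ⟨-, h1, h2, -⟩ := indep ((A.d r t).hom a) (-(f.f r).hom a) ((u.f r).hom a) 0 (by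
      rw [← h0, map_neg, map_zero]
      abel)
    exact hinj r a (neg_eq_zero.mp h1) h2
  have mid : ∀ a b c, ((mappingCone m).d n q).hom (iA r q n hr' hq' a + iB q n hq' b +
      iC q n hq' c) = 0 → ∃ y, ((mappingCone m).d p n).hom y = iA r q n hr' hq' a +
        iB q n hq' b + iC q n hq' c := by
    intro a b c h0
    have h0' := h0
    rw [map_add, map_add, dA r q n t hr' hq' ht', dB q n r hq' hr', dC q n r hq' hr'] at h0
    obtain ⟨-, -, -, h1⟩ := indep ((A.d r t).hom a) (-(f.f r).hom a - (B.d q r).hom b)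
      ((u.f r).hom a - (C.d q r).hom c) ((v.f q).hom b + (g.f q).hom c) (by
      rw [← h0, map_sub, map_sub, map_neg, map_add]
      abel)
    obtain ⟨o, h2, h3⟩ := hex q (-b) c (by rw [map_neg, neg_eq_iff_add_eq_zero]; exact h1)
    have h4 := dA q n p r hq' hp' hr' o
    rw [h2, h3, map_neg] at h4
    have h5 : iA r q n hr' hq' (a - (A.d q r).hom o) =
        iA r q n hr' hq' a + iB q n hq' b + iC q n hq' c -
          ((mappingCone m).d p n).hom (iA q n p hq' hp' o) := by
      rw [h4, map_sub]
      abel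
    have h6 := fin (a - (A.d q r).hom o) (by rw [h5, map_sub, h0', dd, sub_zero])
    rw [h6, map_zero] at h5
    exact ⟨_, (sub_eq_zero.mp h5.symm).symm⟩
  intro z hz
  obtain ⟨a, b, c, d, rfl⟩ := decomp z
  obtain ⟨b', c', hd⟩ := hsurj n d
  have h1 : iA r q n hr' hq' a + iB q n hq' (b + (B.d n q).hom b') +
      iC q n hq' (c + (C.d n q).hom c') = iA r q n hr' hq' a + iB q n hq' b + iC q n hq' c +
        iD n d - ((mappingCone m).d p n).hom (iB n p hp' b' + iC n p hp' c') := by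
    rw [map_add ((mappingCone m).d p n).hom, dB n p q hp' hq', dC n p q hp' hq', hd]
    simp only [map_add]
    abel
  obtain ⟨y, hy⟩ := mid _ _ _ (by rw [h1, map_sub, hz, dd, sub_zero])
  refine ⟨y + (iB n p hp' b' + iC n p hp' c'), ?_⟩
  rw [map_add, hy, h1]
  abel

end Square

end Homological

end LegendrianSheaf

namespace LegendrianSheaf

open Set Filter

set_option linter.unusedSectionVars false

section CylinderHomotopy

variable {K : Type*} [Field K] {V : Type*} [LinearOrder V]
  {W : Type*} [AddCommGroup W] [Module K W]

/-- The contraction of the mapping cylinder onto the summand of the vertex `n`. -/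
noncomputable def cylHomotopy (n : V) : (Finset V →₀ W) →ₗ[K] (Finset V →₀ W) :=
  Finsupp.lsum K fun F => if n ∈ F then 0 else Finsupp.lsingle (insert n F)

/-- The projection of the mapping cylinder onto the summand of the vertex `n`. -/
noncomputable def cylRetract (a : Finset V → W →ₗ[K] W) (n : V) : (Finset V →₀ W) →ₗ[K] W :=
  Finsupp.lsum K fun F => if F = {n} then LinearMap.id else if n ∈ F then 0 else
    (-1 : K) ^ (F.card + 1) • a (insert n F)

theorem cylHomotopy_single_of_mem {n : V} {F : Finset V} (h : n ∈ F) (w : W) :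
    cylHomotopy (K := K) n (Finsupp.single F w) = 0 := by
  simp [cylHomotopy, h]

theorem cylHomotopy_single_of_notMem {n : V} {F : Finset V} (h : n ∉ F) (w : W) :
    cylHomotopy (K := K) n (Finsupp.single F w) = Finsupp.single (insert n F) w := by
  simp [cylHomotopy, h]

theorem cylRetract_single_self (a : Finset V → W →ₗ[K] W) (n : V) (w : W) :
    cylRetract a n (Finsupp.single {n} w) = w := by
  simp [cylRetract]

theorem cylRetract_single_of_mem (a : Finset V → W →ₗ[K] W) {n : V} {F : Finset V} (h : n ∈ F)
    (hF : F ≠ {n}) (w : W) : cylRetract a n (Finsupp.single F w) = 0 := by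
  simp [cylRetract, h, hF]

theorem cylRetract_single_of_notMem (a : Finset V → W →ₗ[K] W) {n : V} {F : Finset V}
    (h : n ∉ F) (w : W) : cylRetract a n (Finsupp.single F w) =
      (-1 : K) ^ (F.card + 1) • a (insert n F) w := by
  have : F ≠ {n} := by rintro rfl; simp at h
  simp [cylRetract, h, this]

theorem cylDiff_single_vertex (a : Finset V → W →ₗ[K] W) (n : V) (w : W) :
    cylDiff a (Finsupp.single {n} w) = - Finsupp.single {n} (a {n} w) := by
  have e : nonFirst ({n} : Finset V) = ∅ := by
    ext v
    simp only [mem_nonFirst, Finset.mem_singleton, Finset.notMem_empty, iff_false]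
    rintro ⟨rfl, u, rfl, h⟩
    exact h.false
  rw [cylDiff_single, e]
  simp [backFace, frontFace, Finset.filter_singleton]

theorem homotopy_single (a : Finset V → W →ₗ[K] W) {n : V} {F : Finset V} (hF : F.Nonempty)
    (hn : ∀ v ∈ F, v ≤ n) (w : W) :
    cylDiff a (cylHomotopy (K := K) n (Finsupp.single F w)) +
      cylHomotopy (K := K) n (cylDiff a (Finsupp.single F w)) =
      Finsupp.single {n} (cylRetract a n (Finsupp.single F w)) - Finsupp.single F w := by
  have hodd : ∀ m : ℕ, (-1 : K) ^ (m + 1 + m) = -1 := fun m => by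
    rw [show m + 1 + m = 2 * m + 1 by lia, pow_add, pow_mul]; simp
  by_cases h : n ∈ F
  · rw [cylHomotopy_single_of_mem h, map_zero, zero_add]
    rcases eq_or_ne F {n} with rfl | hne
    · rw [cylDiff_single_vertex, map_neg, cylHomotopy_single_of_mem (by simp),
        cylRetract_single_self]
      simp
    · rw [cylRetract_single_of_mem a h hne, cylDiff_single, map_add, map_sum, map_sum]
      have hnf : n ∈ nonFirst F := by
        obtain ⟨u, hu, hun⟩ : ∃ u ∈ F, u ≠ n := by
          by_contra! hc
          exact hne (Finset.eq_singleton_iff_unique_mem.mpr ⟨h, hc⟩)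
        exact mem_nonFirst.mpr ⟨h, u, hu, lt_of_le_of_ne (hn u hu) hun⟩
      rw [Finset.sum_eq_zero, Finset.sum_eq_single_of_mem n hnf]
      · rw [map_smul, cylHomotopy_single_of_notMem (by simp), Finset.insert_erase h]
        have hp : F.card = pos F n + 1 := by
          have := card_frontFace h
          rwa [frontFace, Finset.filter_true_of_mem hn] at this
        rw [hp, show pos F n + 1 + pos F n = pos F n + 1 + pos F n from rfl, hodd]
        simp
      · intro v hv hvn
        rw [map_smul, cylHomotopy_single_of_mem (by simp [h, hvn.symm]), smul_zero]
      · intro v hv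
        rw [map_smul, cylHomotopy_single_of_mem (by simp [backFace, h, hn v hv]), smul_zero]
  · have hlt : ∀ v ∈ F, v < n := fun v hv => lt_of_le_of_ne (hn v hv) fun e => h (e ▸ hv)
    have hcard : (insert n F).card = F.card + 1 := Finset.card_insert_of_notMem h
    have hnf : nonFirst (insert n F) = insert n (nonFirst F) := by
      ext v
      simp only [mem_nonFirst, Finset.mem_insert]
      constructor
      · rintro ⟨rfl | hv, u, rfl | hu, huv⟩
        · exact Or.inl rfl
        · exact Or.inl rfl
        · exact absurd huv (hlt v hv).not_gt
        · exact Or.inr ⟨hv, u, hu, huv⟩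
      · rintro (rfl | ⟨hv, u, hu, huv⟩)
        · obtain ⟨u, hu⟩ := hF
          exact ⟨Or.inl rfl, u, Or.inr hu, hlt u hu⟩
        · exact ⟨Or.inr hv, u, Or.inr hu, huv⟩
    have hpos : ∀ v ∈ F, pos (insert n F) v = pos F v := by
      intro v hv
      rw [pos, pos, Finset.filter_insert, if_neg (hlt v hv).not_gt]
    have hposn : pos (insert n F) n = F.card := by
      rw [pos, Finset.filter_insert, if_neg (lt_irrefl n), Finset.filter_true_of_mem hlt]
    have hfr : ∀ v ∈ F, frontFace (insert n F) v = frontFace F v := by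
      intro v hv
      rw [frontFace, frontFace, Finset.filter_insert, if_neg (hlt v hv).not_ge]
    have hfrn : frontFace (insert n F) n = insert n F :=
      Finset.filter_true_of_mem (by simpa using hn)
    have hbk : ∀ v ∈ F, backFace (insert n F) v = insert n (backFace F v) := by
      intro v hv
      rw [backFace, backFace, Finset.filter_insert, if_pos (hn v hv)]
    have hbkn : backFace (insert n F) n = {n} := by
      rw [backFace, Finset.filter_insert, if_pos le_rfl,
        Finset.filter_false_of_mem fun v hv => (hlt v hv).not_ge, insert_empty_eq]
    rw [cylHomotopy_single_of_notMem h, cylRetract_single_of_notMem a h, cylDiff_single,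
      Finset.sum_insert h, hnf, Finset.sum_insert fun hc => h (mem_nonFirst.mp hc).1, hbkn, hfrn,
      hposn, hcard, hodd, Finset.erase_insert h, cylDiff_single, map_add, map_sum, map_sum]
    have e1 : ∑ v ∈ F, (-1 : K) ^ (F.card + 1) • Finsupp.single (backFace (insert n F) v)
        (a (frontFace (insert n F) v) w) = - ∑ v ∈ F, cylHomotopy (K := K) n
          ((-1 : K) ^ F.card • Finsupp.single (backFace F v) (a (frontFace F v) w)) := by
      rw [← Finset.sum_neg_distrib]
      refine Finset.sum_congr rfl fun v hv => ?_
      rw [hbk v hv, hfr v hv, map_smul,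
        cylHomotopy_single_of_notMem (F := backFace F v) fun hc => h (Finset.mem_filter.mp hc).1,
        pow_succ,
        mul_neg_one, neg_smul]
    have e2 : ∑ v ∈ nonFirst F, (-1 : K) ^ (F.card + 1 + pos (insert n F) v) •
        Finsupp.single ((insert n F).erase v) w = - ∑ v ∈ nonFirst F, cylHomotopy (K := K) n
          ((-1 : K) ^ (F.card + pos F v) • Finsupp.single (F.erase v) w) := by
      rw [← Finset.sum_neg_distrib]
      refine Finset.sum_congr rfl fun v hv => ?_
      have hvF := (mem_nonFirst.mp hv).1
      rw [hpos v hvF, map_smul, cylHomotopy_single_of_notMem fun hc => h (Finset.mem_erase.mp hc).2,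
        add_right_comm, pow_succ, mul_neg_one, neg_smul,
        Finset.erase_insert_of_ne (hlt v hvF).ne']
    rw [e1, e2, ← Finsupp.smul_single, neg_one_smul]
    abel

variable {Δ : Finset V} {gr : ℤ → Submodule K W} {a : Finset V → W →ₗ[K] W}

theorem homotopy_of_mem {n : V} (hn : ∀ v ∈ Δ, v ≤ n) {k : ℤ} {f : Finset V →₀ W}
    (hf : f ∈ cylPart Δ gr k) :
    cylDiff a (cylHomotopy (K := K) n f) + cylHomotopy (K := K) n (cylDiff a f) =
      Finsupp.single {n} (cylRetract a n f) - f := by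
  rw [← sub_eq_zero]
  refine mem_cylPart_induction (p := LinearMap.ker (cylDiff a ∘ₗ cylHomotopy n +
    cylHomotopy n ∘ₗ cylDiff a - (Finsupp.lsingle {n} ∘ₗ cylRetract a n - LinearMap.id))) ?_ hf
  intro F hF hΔ w _
  have := homotopy_single a hF (fun v hv => hn v (hΔ hv)) w
  simpa [sub_eq_zero] using this

theorem cylHomotopy_mem {n : V} (hn : n ∈ Δ) {k : ℤ} {f : Finset V →₀ W}
    (hf : f ∈ cylPart Δ gr k) : cylHomotopy (K := K) n f ∈ cylPart Δ gr (k - 1) := by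
  refine mem_cylPart_induction (p := (cylPart Δ gr (k - 1)).comap (cylHomotopy n)) ?_ hf
  intro F hF hΔ w hw
  rw [Submodule.mem_comap]
  by_cases h : n ∈ F
  · rw [cylHomotopy_single_of_mem h]
    exact zero_mem _
  · rw [cylHomotopy_single_of_notMem h]
    refine single_mem_cylPart (by simp) (Finset.insert_subset hn hΔ) ?_
    rwa [sdim, Finset.card_insert_of_notMem h, Nat.cast_add, Nat.cast_one,
      show k - 1 + ((F.card : ℤ) + 1 - 1) = k + sdim F by rw [sdim]; ring]

theorem IsSimplexDiagram.cylRetract_mem (h : IsSimplexDiagram Δ gr a) {n : V} (hn : n ∈ Δ) {k : ℤ}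
    {f : Finset V →₀ W} (hf : f ∈ cylPart Δ gr k) : cylRetract a n f ∈ gr k := by
  refine mem_cylPart_induction (p := (gr k).comap (cylRetract a n)) ?_ hf
  intro F hF hΔ w hw
  rw [Submodule.mem_comap]
  by_cases hnF : n ∈ F
  · rcases eq_or_ne F {n} with rfl | hne
    · rw [cylRetract_single_self]
      simpa [sdim] using hw
    · rw [cylRetract_single_of_mem a hnF hne]
      exact zero_mem _
  · rw [cylRetract_single_of_notMem a hnF]
    refine Submodule.smul_mem _ _ ?_
    have := h.degree (insert n F) (by simp) (Finset.insert_subset hn hΔ) _ w hw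
    rwa [sdim, sdim, Finset.card_insert_of_notMem hnF, Nat.cast_add, Nat.cast_one,
      show k + ((F.card : ℤ) - 1) + 1 - (F.card + 1 - 1) = k by ring] at this

theorem IsSimplexDiagram.comp_vertex (h : IsSimplexDiagram Δ gr a) {i : V} (hi : i ∈ Δ) (w : W) :
    a {i} (a {i} w) = 0 := by
  have := LinearMap.congr_fun (h.identity {i} (by simp) (by simpa using hi)) w
  have e : inner ({i} : Finset V) = ∅ := by
    ext v
    simp only [mem_inner, Finset.mem_singleton, Finset.notMem_empty, iff_false]
    rintro ⟨rfl, ⟨u, rfl, h⟩, -⟩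
    exact h.false
  simpa [e, pos, backFace, frontFace, Finset.filter_singleton] using this

theorem IsSimplexDiagram.comm_edge (h : IsSimplexDiagram Δ gr a) {i n : V} (hi : i ∈ Δ)
    (hn : n ∈ Δ) (hin : i < n) (w : W) : a {i, n} (a {i} w) = a {n} (a {i, n} w) := by
  have := LinearMap.congr_fun (h.identity {i, n} (by simp) (by
    simp [Finset.insert_subset_iff, hi, hn])) w
  have e : inner ({i, n} : Finset V) = ∅ := by
    ext v
    simp only [mem_inner, Finset.mem_insert, Finset.mem_singleton, Finset.notMem_empty, iff_false]
    rintro ⟨rfl | rfl, ⟨u, rfl | rfl, h⟩, u', rfl | rfl, h'⟩ <;> order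
  rw [e, Finset.sum_empty, zero_add, Finset.sum_pair hin.ne] at this
  simpa [pos, backFace, frontFace, Finset.filter_insert, Finset.filter_singleton, hin, hin.le,
    hin.not_ge, hin.not_gt, ← sub_eq_add_neg, sub_eq_zero] using this

theorem cylDiff_single_edge (a : Finset V → W →ₗ[K] W) {i n : V} (hin : i < n) (w : W) :
    cylDiff a (Finsupp.single {i, n} w) = Finsupp.single {i, n} (a {i} w) +
      Finsupp.single {n} (a {i, n} w) - Finsupp.single {i} w := by
  have e : nonFirst ({i, n} : Finset V) = {n} := by
    ext v
    simp only [mem_nonFirst, Finset.mem_insert, Finset.mem_singleton]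
    constructor
    · rintro ⟨rfl | rfl, u, rfl | rfl, h⟩
      · exact absurd h (lt_irrefl _)
      · exact absurd h hin.not_gt
      · rfl
      · rfl
    · rintro rfl
      exact ⟨Or.inr rfl, i, Or.inl rfl, hin⟩
  have e2 : ({i, n} : Finset V).erase n = {i} := by
    ext v
    simp only [Finset.mem_erase, Finset.mem_insert, Finset.mem_singleton]
    constructor
    · rintro ⟨h1, rfl | h2⟩
      · rfl
      · exact absurd h2 h1
    · rintro rfl
      exact ⟨hin.ne, Or.inl rfl⟩
  rw [cylDiff_single, e, Finset.sum_pair hin.ne, Finset.sum_singleton, e2, Finset.card_pair hin.ne]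
  simp [pos, backFace, frontFace, Finset.filter_insert, Finset.filter_singleton, hin, hin.le,
    hin.not_ge, sub_eq_add_neg, pow_succ]

/-- The edge maps starting at the vertex `i` are bijective in every degree. -/
def EdgesBijective (Δ : Finset V) (gr : ℤ → Submodule K W) (a : Finset V → W →ₗ[K] W) (i : V) :
    Prop :=
  ∀ n ∈ Δ, i < n → Function.Injective (a {i, n}) ∧ ∀ k, ∀ w ∈ gr k, ∃ w' ∈ gr k, a {i, n} w' = w

/-- Every cocycle of the mapping cylinder is cohomologous to one supported at the vertex `i`. -/
theorem IsSimplexDiagram.exists_cocycle (h : IsSimplexDiagram Δ gr a) {i : V} (hi : i ∈ Δ)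
    (he : EdgesBijective Δ gr a i) {k : ℤ} {f : Finset V →₀ W} (hf : f ∈ cylPart Δ gr k)
    (hd : cylDiff a f = 0) : ∃ w ∈ gr k, a {i} w = 0 ∧ ∃ g ∈ cylPart Δ gr (k - 1),
      f = Finsupp.single {i} w + cylDiff a g := by
  obtain ⟨n, hn, hmax⟩ : ∃ n ∈ Δ, ∀ v ∈ Δ, v ≤ n :=
    ⟨Δ.max' ⟨i, hi⟩, Δ.max'_mem _, fun v hv => Δ.le_max' v hv⟩
  have h1 := homotopy_of_mem (a := a) hmax hf
  rw [hd, map_zero, add_zero] at h1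
  have hr := h.cylRetract_mem hn hf
  have hg := cylHomotopy_mem (K := K) hn hf
  have hw : a {n} (cylRetract a n f) = 0 := by
    have h2 := congrArg (cylDiff a) h1
    rw [cylDiff_comp h hg, map_sub, hd, sub_zero, cylDiff_single_vertex, eq_comm, neg_eq_zero,
      Finsupp.single_eq_zero] at h2
    exact h2
  have hfe : f = Finsupp.single {n} (cylRetract a n f) + cylDiff a (-cylHomotopy (K := K) n f) := by
    rw [map_neg, h1]
    abel
  rcases (hmax i hi).eq_or_lt with rfl | hin
  · exact ⟨_, hr, hw, _, neg_mem hg, hfe⟩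
  · obtain ⟨w', hw', hww⟩ := (he n hn hin).2 k _ hr
    have ha : a {i} w' = 0 := (he n hn hin).1 (by
      rw [h.comm_edge hi hn hin, hww, hw, map_zero])
    refine ⟨w', hw', ha, Finsupp.single {i, n} w' - cylHomotopy (K := K) n f,
      sub_mem (single_mem_cylPart (by simp) (by simp [Finset.insert_subset_iff, hi, hn]) ?_) hg, ?_⟩
    · rwa [sdim, Finset.card_pair hin.ne, show k - 1 + (((2 : ℕ) : ℤ) - 1) = k by push_cast; ring]
    · rw [map_sub, cylDiff_single_edge a hin, ha, hww, Finsupp.single_zero, h1]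
      abel

theorem IsSimplexDiagram.exists_of_single_eq (h : IsSimplexDiagram Δ gr a) {i : V} (hi : i ∈ Δ)
    (he : EdgesBijective Δ gr a i) {k : ℤ} {w : W} (hw : w ∈ gr k) (ha : a {i} w = 0)
    {g : Finset V →₀ W} (hg : g ∈ cylPart Δ gr (k - 1)) (hd : Finsupp.single {i} w = cylDiff a g) :
    ∃ v ∈ gr (k - 1), a {i} v = w := by
  obtain ⟨n, hn, hmax⟩ : ∃ n ∈ Δ, ∀ v ∈ Δ, v ≤ n :=
    ⟨Δ.max' ⟨i, hi⟩, Δ.max'_mem _, fun v hv => Δ.le_max' v hv⟩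
  have key : ∀ w (g : Finset V →₀ W), g ∈ cylPart Δ gr (k - 1) →
      Finsupp.single {n} w = cylDiff a g → a {n} (-cylRetract a n g) = w := by
    intro w g hg hd
    have h1 := congrArg (cylDiff a) (homotopy_of_mem (a := a) hmax hg)
    rw [← hd, cylHomotopy_single_of_mem (by simp), add_zero, map_sub, ← hd, cylDiff_single_vertex,
      cylDiff_comp h (cylHomotopy_mem (K := K) hn hg), eq_comm, sub_eq_zero, ← Finsupp.single_neg] at h1
    rw [map_neg]
    exact Finsupp.single_injective _ h1
  rcases (hmax i hi).eq_or_lt with rfl | hin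
  · exact ⟨_, neg_mem (h.cylRetract_mem hn hg), key w g hg hd⟩
  · have hE : Finsupp.single {i, n} w ∈ cylPart Δ gr (k - 1) := by
      refine single_mem_cylPart (by simp) (by simp [Finset.insert_subset_iff, hi, hn]) ?_
      rwa [sdim, Finset.card_pair hin.ne, show k - 1 + (((2 : ℕ) : ℤ) - 1) = k by push_cast; ring]
    have h1 := key (a {i, n} w) (g + Finsupp.single {i, n} w) (add_mem hg hE) (by
      rw [map_add, cylDiff_single_edge a hin, ha, Finsupp.single_zero, ← hd]
      abel)
    obtain ⟨v, hv, hvw⟩ := (he n hn hin).2 (k - 1) _ (neg_mem (h.cylRetract_mem hn (add_mem hg hE)))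
    exact ⟨v, hv, (he n hn hin).1 (by rw [h.comm_edge hi hn hin, hvw, h1])⟩

end CylinderHomotopy

namespace SimplexDiagram

universe u₁ u₂ u₃

variable {K : Type u₁} [Field K] {V : Type u₂} [LinearOrder V]

theorem coe_cylinder_d (A : SimplexDiagram.{u₂, u₁, u₃} K V) {i j : ℤ} (hij : i + 1 = j)
    (x : A.cylinder.X i) : ((A.cylinder.d i j).hom x).1 = cylDiff A.map x.1 := by
  subst hij
  have : A.cylinder.d i (i + 1) = ModuleCat.ofHom ((cylDiff A.map).restrict fun _ hf =>
      cylDiff_mem A.isDiagram hf) := dif_pos rfl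
  rw [this]
  rfl

/-- A morphism of simplex diagrams induces a quasi-isomorphism of mapping cylinders if it is
surjective with acyclic kernel at a vertex from which all edge maps are bijective. -/
theorem quasiIso_map {A B : SimplexDiagram.{u₂, u₁, u₃} K V} (φ : A ⟶ B) {i : V}
    (hi : i ∈ A.simplex) (hA : EdgesBijective A.simplex A.gr A.map i)
    (hB : EdgesBijective B.simplex B.gr B.map i)
    (hsurj : ∀ k, ∀ y ∈ B.gr k, ∃ x ∈ A.gr k, φ.lin x = y)
    (hker : ∀ k, ∀ x ∈ A.gr k, φ.lin x = 0 → A.map {i} x = 0 →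
      ∃ z ∈ A.gr (k - 1), φ.lin z = 0 ∧ A.map {i} z = x) :
    QuasiIso (Map.map φ) := by
  have hiB := φ.face hi
  have comm : ∀ x, φ.lin (A.map {i} x) = B.map {i} (φ.lin x) :=
    fun x => LinearMap.congr_fun (φ.comm {i} (by simp) (by simpa using hi)) x
  have degA : ∀ k, ∀ x ∈ A.gr k, A.map {i} x ∈ A.gr (k + 1) := fun k x hx => by
    simpa [sdim] using A.isDiagram.degree {i} (by simp) (by simpa using hi) k x hx
  have hsingle : ∀ (C : SimplexDiagram.{u₂, u₁, u₃} K V) (_ : i ∈ C.simplex) k (x : C.carrier),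
      x ∈ C.gr k → Finsupp.single {i} x ∈ cylPart C.simplex C.gr k := fun C hC k x hx =>
    single_mem_cylPart (by simp) (by simpa using hC) (by simpa [sdim] using hx)
  refine quasiIso_of_forall _ ?_ ?_
  · intro n (x : cylPart A.simplex A.gr n) (y : cylPart B.simplex B.gr (n - 1)) hx hxy
    have hx' : cylDiff A.map x.1 = 0 :=
      (coe_cylinder_d A rfl x).symm.trans (congrArg Subtype.val hx)
    have hxy' : Finsupp.mapRange.linearMap φ.lin x.1 = cylDiff B.map y.1 :=
      (congrArg Subtype.val hxy).trans (coe_cylinder_d B (sub_add_cancel n 1) y)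
    obtain ⟨w, hw, haw, g, hg, hxg⟩ := A.isDiagram.exists_cocycle hi hA x.2 hx'
    have h1 : Finsupp.single {i} (φ.lin w) =
        cylDiff B.map (y.1 - Finsupp.mapRange.linearMap φ.lin g) := by
      rw [map_sub, Hom.map_comm φ hg, ← hxy', hxg, map_add, Finsupp.mapRange.linearMap_apply,
        Finsupp.mapRange_single]
      abel
    obtain ⟨v, hv, hvw⟩ := B.isDiagram.exists_of_single_eq hiB hB (φ.degree n w hw)
      (by rw [← comm, haw, map_zero]) (sub_mem y.2 (Hom.map_mem φ hg)) h1
    obtain ⟨v', hv', rfl⟩ := hsurj (n - 1) v hv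
    have h2 := degA _ _ hv'
    rw [sub_add_cancel] at h2
    obtain ⟨z, hz, -, hzw⟩ := hker n (w - A.map {i} v') (sub_mem hw h2)
      (by rw [map_sub, comm, hvw, sub_self])
      (by rw [map_sub, haw, A.isDiagram.comp_vertex hi, sub_zero])
    refine ⟨⟨g - Finsupp.single {i} (z + v'), sub_mem hg (hsingle A hi _ _ (add_mem hz hv'))⟩, ?_⟩
    refine Subtype.ext ((coe_cylinder_d A (sub_add_cancel n 1) _).trans ?_)
    rw [map_sub, cylDiff_single_vertex, map_add, hzw,
      sub_add_cancel, hxg]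
    abel
  · intro n (y : cylPart B.simplex B.gr n) hy
    have hy' : cylDiff B.map y.1 = 0 :=
      (coe_cylinder_d B rfl y).symm.trans (congrArg Subtype.val hy)
    obtain ⟨w, hw, haw, g, hg, hyg⟩ := B.isDiagram.exists_cocycle hiB hB y.2 hy'
    obtain ⟨w', hw', rfl⟩ := hsurj n w hw
    obtain ⟨z, hz, hz0, hzw⟩ := hker (n + 1) (A.map {i} w') (degA _ _ hw')
      (by rw [comm, haw]) (A.isDiagram.comp_vertex hi w')
    rw [add_sub_cancel_right] at hz
    refine ⟨⟨Finsupp.single {i} (w' - z), hsingle A hi n _ (sub_mem hw' hz)⟩, 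
      Subtype.ext ((coe_cylinder_d A rfl _).trans ?_), ⟨g, hg⟩, Subtype.ext (hyg.trans ?_)⟩
    · rw [cylDiff_single_vertex, map_sub, hzw, sub_self, Finsupp.single_zero, neg_zero]
      rfl
    · refine congrArg₂ (· + ·) ?_ (coe_cylinder_d B (sub_add_cancel n 1) ⟨g, hg⟩).symm
      refine Eq.trans ?_ (Finsupp.mapRange_single (hf := map_zero φ.lin)).symm
      rw [map_sub, hz0, sub_zero]

end SimplexDiagram

end LegendrianSheaf

namespace LegendrianSheaf

open Set Filter

set_option linter.unusedSectionVars false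

section Graded

variable {K W W' : Type*} [Field K] [AddCommGroup W] [Module K W] [AddCommGroup W'] [Module K W']
  {gr : ℤ → Submodule K W} {gr' : ℤ → Submodule K W'}

theorem exists_gradedProj (hgr : DirectSum.IsInternal gr) : ∃ p : ℤ → W →ₗ[K] W,
    (∀ k, ∀ x ∈ gr k, p k x = x) ∧ (∀ k n, n ≠ k → ∀ x ∈ gr n, p k x = 0) ∧
      ∀ k x, p k x ∈ gr k := by
  let e := LinearEquiv.ofBijective (DirectSum.coeLinearMap gr) hgr
  have he : ∀ n (x : gr n), e.symm x.1 = DirectSum.lof K ℤ (fun n => gr n) n x := fun n x => by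
    rw [LinearEquiv.symm_apply_eq]
    exact (DirectSum.coeLinearMap_lof gr n x).symm
  refine ⟨fun k => (gr k).subtype ∘ₗ DirectSum.component K ℤ (fun n => gr n) k ∘ₗ
    e.symm.toLinearMap, fun k x hx => ?_, fun k n hn x hx => ?_, fun k x => ?_⟩
  · have := he k ⟨x, hx⟩
    simp only [LinearMap.comp_apply, LinearEquiv.coe_coe]
    rw [this, DirectSum.component.lof_self]
    rfl
  · have := he n ⟨x, hx⟩
    simp only [LinearMap.comp_apply, LinearEquiv.coe_coe]
    rw [this, DirectSum.component.of, dif_neg hn, map_zero]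
  · exact Subtype.property _

theorem gradedProj_comm {p : ℤ → W →ₗ[K] W} {p' : ℤ → W' →ₗ[K] W'}
    (hgr : DirectSum.IsInternal gr) (hp : ∀ k, ∀ x ∈ gr k, p k x = x)
    (hp0 : ∀ k n, n ≠ k → ∀ x ∈ gr n, p k x = 0) (hp' : ∀ k, ∀ x ∈ gr' k, p' k x = x)
    (hp0' : ∀ k n, n ≠ k → ∀ x ∈ gr' n, p' k x = 0) {f : W →ₗ[K] W'} {d : ℤ}
    (hf : ∀ n, ∀ x ∈ gr n, f x ∈ gr' (n + d)) (k : ℤ) (x : W) :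
    p' (k + d) (f x) = f (p k x) := by
  have hx : x ∈ ⨆ n, gr n := hgr.submodule_iSup_eq_top ▸ Submodule.mem_top
  induction hx using Submodule.iSup_induction' with
  | mem n x hx =>
    rcases eq_or_ne n k with rfl | hn
    · rw [hp n x hx, hp' _ _ (hf n x hx)]
    · rw [hp0 k n hn x hx, hp0' (k + d) (n + d) (by lia) _ (hf n x hx), map_zero]
  | zero => simp
  | add x y _ _ hx hy => rw [map_add, map_add, hx, hy, map_add, map_add]

/-- A preimage under a graded map can be replaced by a homogeneous one. -/
theorem exists_mem_of_graded {W'' : Type*} [AddCommGroup W''] [Module K W'']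
    {gr'' : ℤ → Submodule K W''} (hgr : DirectSum.IsInternal gr) (hgr' : DirectSum.IsInternal gr')
    (hgr'' : DirectSum.IsInternal gr'') {f : W →ₗ[K] W'} {g : W →ₗ[K] W''} {d e : ℤ}
    (hf : ∀ n, ∀ x ∈ gr n, f x ∈ gr' (n + d)) (hg : ∀ n, ∀ x ∈ gr n, g x ∈ gr'' (n + e))
    {k : ℤ} {x : W} (hfx : f x ∈ gr' (k + d)) (hgx : g x ∈ gr'' (k + e)) :
    ∃ x' ∈ gr k, f x' = f x ∧ g x' = g x := by
  obtain ⟨p, hp, hp0, hpm⟩ := exists_gradedProj hgr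
  obtain ⟨p', hp', hp0', -⟩ := exists_gradedProj hgr'
  obtain ⟨p'', hp'', hp0'', -⟩ := exists_gradedProj hgr''
  exact ⟨p k x, hpm k x, by rw [← gradedProj_comm hgr hp hp0 hp' hp0' hf, hp' _ _ hfx],
    by rw [← gradedProj_comm hgr hp hp0 hp'' hp0'' hg, hp'' _ _ hgx]⟩

end Graded

variable {L M : Type*} [TopologicalSpace L] [ChartedSpace Plane L]
  [TopologicalSpace M] [ChartedSpace Plane M] [IsManifold (𝓡 2) ∞ M]
  {V : Type*} {K : Type*} [Field K] [LinearOrder V]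

theorem Stratum.gradingX_isInternal {Λ : LegendrianSurface L M} {ℰ : Triangulation V M}
    (s : Stratum Λ ℰ) (μ : Λ.MaslovPotential) : DirectSum.IsInternal (s.gradingX K μ) :=
  prodGrading_isInternal (freeGrading_isInternal K _) (freeGrading_isInternal K _)

namespace Admissible

open Triangulation LegendrianSurface Stratum

variable [IsManifold (𝓡 2) ∞ L] [CompactSpace L] [T2Space L] [T2Space M]
  {Λ : LegendrianSurface L M} {ℰ : Triangulation V M}
variable (h : Admissible Λ ℰ) {s s' s'' : Stratum Λ ℰ} {μ : Λ.MaslovPotential}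
  (𝒞 : ChainHomotopyDiagram K Λ μ ℰ)
include h

theorem mem_of_forall_gen_mem {p : Submodule K (s.X K)} (hp : ∀ c ∈ s.active, s.gen K c ∈ p)
    (x : s.X K) : x ∈ p := by
  have : p.mkQ = 0 := h.linearMap_ext_gen fun c hc => by
    rw [LinearMap.zero_apply, Submodule.mkQ_apply, Submodule.Quotient.mk_eq_zero]
    exact hp c hc
  have := LinearMap.congr_fun this x
  rwa [LinearMap.zero_apply, Submodule.mkQ_apply, Submodule.Quotient.mk_eq_zero] at this

theorem edge_sub_mem_span {F : Finset V} (hF : F ∈ ℰ.faces) (hcard : F.card = 2) {d : L}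
    (hd : ℰ.IsCenter F (Λ.base d)) (hdc : d ∉ Λ.cusp) :
    𝒞.c F (cellGen K Λ ℰ F d) - cellGen K Λ ℰ F d ∈ Submodule.span K (cellGen K Λ ℰ F ''
      {d' | ℰ.IsCenter F (Λ.base d') ∧ d' ∉ Λ.cusp ∧ Λ.height d' < Λ.height d}) := by
  have hm := h.branch_cell_mem hd hdc
  have := 𝒞.lower_edge F hF hcard ⟨_, hm⟩
  rw [LinearMap.sub_apply, ← setGen_of_mem hm, ← cellGen, LinearMap.id_apply,
    Finsupp.supported_eq_span_single] at this
  refine Submodule.span_mono ?_ this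
  rintro _ ⟨T, hT, rfl⟩
  obtain ⟨e, he, hec, hTe⟩ := h.exists_of_mem_sheets_cell hF T
  rw [mem_ofPred_eq, hTe, h.above_branch_iff hd he] at hT
  refine ⟨e, ⟨he, hec, hT⟩, ?_⟩
  rw [cellGen, ← hTe, setGen_coe]

/-- The maps of the edges are unipotent. -/
theorem faceX_edge_sub_mem_span {F : Finset V} (hF : F ∈ ℰ.faces) (hFJ : F ⊆ s.J)
    (hcard : F.card = 2) {c : L} (hc : c ∈ s.active) :
    s.faceX 𝒞 F (s.gen K c) - s.gen K c ∈
      Submodule.span K (s.gen K '' {e ∈ s.active | Λ.height e < Λ.height c}) := by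
  by_cases ht : transport Λ ℰ F c ∈ Λ.cusp
  · rw [h.faceX_gen_of_card_eq_two 𝒞 hF hFJ hc.1 ht hcard, sub_self]
    exact Submodule.zero_mem _
  have hsub := h.subset_supp_of_subset hFJ hc.1
  have hcc := h.notMem_cusp_of_transport hF hsub ht
  let f := LinearMap.inl K (s.Y K) (s.Z K) ∘ₗ s.projY K ∘ₗ incl K Λ ℰ F s.J
  have e1 : s.faceX 𝒞 F (s.gen K c) = f (𝒞.c F (cellGen K Λ ℰ F (transport Λ ℰ F c))) := by
    rw [h.faceX_gen 𝒞 hc hcc, h.boundaryExtension_cellGen_of_notMem hFJ hF hc.1 ht]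
    rfl
  have e2 : s.gen K c = f (cellGen K Λ ℰ F (transport Λ ℰ F c)) := by
    simp only [f, LinearMap.comp_apply]
    rw [h.incl_cellGen hFJ hF hc.1 rfl ht, h.projY_cellGen_eq hc.1 hcc]
  rw [e1, e2, ← map_sub, ← Submodule.mem_comap]
  refine (Submodule.span_le.mpr ?_)
    (h.edge_sub_mem_span 𝒞 hF hcard (h.isCenter_transport hF hsub) ht)
  rintro _ ⟨d, ⟨hd, hdc, hlt⟩, rfl⟩
  obtain ⟨e, he, hec, hed, hle⟩ := h.exists_lift hFJ hc hcc hd hdc (Or.inr hlt)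
  have hlt' : Λ.height e < Λ.height c := hle.resolve_left fun hec => by
    rw [hec] at hed
    rw [hed] at hlt
    exact hlt.false
  simp only [f, SetLike.mem_coe, Submodule.mem_comap, LinearMap.comp_apply]
  rw [h.incl_cellGen hFJ hF he.1 hed hdc, h.projY_cellGen_eq he.1 hec]
  exact Submodule.subset_span ⟨e, ⟨he, hlt'⟩, rfl⟩

theorem faceX_edge_surjective {F : Finset V} (hF : F ∈ ℰ.faces) (hFJ : F ⊆ s.J)
    (hcard : F.card = 2) : Function.Surjective (s.faceX 𝒞 F) := by
  rw [← LinearMap.range_eq_top, eq_top_iff]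
  rintro x -
  refine h.mem_of_forall_gen_mem ?_ x
  by_contra! hn
  obtain ⟨c, ⟨hc, hcn⟩, hmin⟩ := Set.exists_min_image
    {c ∈ s.active | s.gen K c ∉ LinearMap.range (s.faceX 𝒞 F)} Λ.height
    (h.finite_active.subset fun c hc => hc.1) hn
  have hle : Submodule.span K (s.gen K '' {e ∈ s.active | Λ.height e < Λ.height c}) ≤
      LinearMap.range (s.faceX 𝒞 F) := by
    rw [Submodule.span_le]
    rintro _ ⟨e, ⟨he, hlt⟩, rfl⟩
    by_contra hen
    exact (hmin e ⟨he, hen⟩).not_gt hlt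
  have := sub_mem (LinearMap.mem_range_self (s.faceX 𝒞 F) (s.gen K c))
    (hle (h.faceX_edge_sub_mem_span 𝒞 hF hFJ hcard hc))
  rw [sub_sub_cancel] at this
  exact hcn this

theorem edgesBijective {i : V} (hi : i ∈ s.I) :
    EdgesBijective s.I (s.gradingX K μ) (s.faceX 𝒞) i := by
  intro n hn hin
  have hsub : ({i, n} : Finset V) ⊆ s.I := by simp [Finset.insert_subset_iff, hi, hn]
  have hF := mem_faces_of_subset s.I_mem (by simp) hsub
  have hcard := Finset.card_pair hin.ne
  have hsurj := h.faceX_edge_surjective 𝒞 hF (hsub.trans s.I_subset) hcard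
  have := h.finiteDimensional_X (K := K) (s := s)
  refine ⟨LinearMap.injective_iff_surjective.mpr hsurj, fun k w hw => ?_⟩
  obtain ⟨w', rfl⟩ := hsurj w
  have hdeg : ∀ m, ∀ x ∈ s.gradingX K μ m, s.faceX 𝒞 {i, n} x ∈ s.gradingX K μ (m + 0) := by
    intro m x hx
    have := (h.isSimplexDiagram 𝒞 s).degree _ (by simp) hsub m x hx
    rwa [sdim, hcard, show m + 1 - (((2 : ℕ) : ℤ) - 1) = m + 0 by push_cast; ring] at this
  obtain ⟨x', hx', he, -⟩ := exists_mem_of_graded (f := s.faceX 𝒞 {i, n})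
    (g := s.faceX 𝒞 {i, n}) (d := 0) (e := 0) (k := k) (x := w') (s.gradingX_isInternal (K := K) μ)
    (s.gradingX_isInternal (K := K) μ) (s.gradingX_isInternal (K := K) μ) hdeg hdeg (by rwa [add_zero])
    (by rwa [add_zero])
  exact ⟨x', hx', he⟩

section QuasiIso

variable (hs : s ≤ s')
  (hact : ∀ c' ∈ s'.active, ∃ c ∈ s.active, transport Λ ℰ s'.J c = c' ∧
    ∀ d ∈ s.active, transport Λ ℰ s'.J d = c' → d = c)
include hs hact

theorem mapX_surjective : Function.Surjective (s.mapX K s') := by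
  rw [← LinearMap.range_eq_top, eq_top_iff]
  rintro x -
  refine h.mem_of_forall_gen_mem (fun c' hc' => ?_) x
  obtain ⟨c, hc, hcc', -⟩ := hact c' hc'
  exact ⟨s.gen K c, by rw [h.mapX_gen hs hc, hcc']⟩

/-- The generators in the kernel of a generization map cancel in pairs. -/
theorem exists_faceX_eq {i : V} (hi : i ∈ s.I)
    (hpair : ∀ c ∈ s.active, transport Λ ℰ s'.J c ∉ s'.active →
      ∃ u ∈ s.active, ∃ l ∈ s.active, u ∉ Λ.cusp ∧ l ∉ Λ.cusp ∧ Λ.height l < Λ.height u ∧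
        transport Λ ℰ s'.J c ∈ Λ.cusp ∧ ∀ d, ℰ.IsCenter s.J (Λ.base d) →
          (transport Λ ℰ s'.J d = transport Λ ℰ s'.J c ↔ d = u ∨ d = l))
    {x : s.X K} (hx : s.mapX K s' x = 0) (hax : s.faceX 𝒞 {i} x = 0) :
    ∃ z, s.mapX K s' z = 0 ∧ s.faceX 𝒞 {i} z = x := by
  classical
  let P : L → L → Prop := fun c u => u ∈ s.active ∧ transport Λ ℰ s'.J u = transport Λ ℰ s'.J c ∧
    transport Λ ℰ s'.J c ∉ s'.active ∧ Λ.height c < Λ.height u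
  let σ : s.X K →ₗ[K] s.X K := Finsupp.linearCombination K
    (fun c => if hc : ∃ u, P c u then s.gen K hc.choose else 0) ∘ₗ s.labels K
  have hσ : ∀ c ∈ s.active, σ (s.gen K c) =
      if hc : ∃ u, P c u then s.gen K hc.choose else 0 := fun c hc => by
    rw [LinearMap.comp_apply, h.labels_gen hc, Finsupp.linearCombination_single, one_smul]
  have hφσ : s.mapX K s' ∘ₗ σ = 0 := h.linearMap_ext_gen fun c hc => by
    rw [LinearMap.comp_apply, hσ c hc, LinearMap.zero_apply]
    split_ifs with hP
    · obtain ⟨h1, h2, h3, -⟩ := hP.choose_spec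
      rw [h.mapX_gen hs h1, h2,
        h.gen_of_notMem_active (h.isCenter_transport_of_le hs hc.1) h3]
    · rw [map_zero]
  choose! r hr hrt hru using hact
  let ρ : s'.X K →ₗ[K] s.X K :=
    Finsupp.linearCombination K (fun c' => s.gen K (r c')) ∘ₗ s'.labels K
  have hρ : ∀ c' ∈ s'.active, ρ (s'.gen K c') = s.gen K (r c') := fun c' hc' => by
    rw [LinearMap.comp_apply, h.labels_gen hc', Finsupp.linearCombination_single, one_smul]
  clear_value σ ρ
  have hiI : ({i} : Finset V) ⊆ s.I := by simpa using hi
  have hiJ := hiI.trans s.I_subset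
  have hiJ' := (hiI.trans (faces_of_le hs).1).trans s'.I_subset
  have hF := mem_faces_of_subset s.I_mem (by simp) hiI
  have key : (LinearMap.id - s.faceX 𝒞 {i} ∘ₗ σ - σ ∘ₗ s.faceX 𝒞 {i}) ∘ₗ
      (LinearMap.id - ρ ∘ₗ s.mapX K s') = 0 := by
    refine h.linearMap_ext_gen fun c hc => ?_
    rw [LinearMap.zero_apply, LinearMap.comp_apply, LinearMap.sub_apply (f := LinearMap.id),
      LinearMap.comp_apply, h.mapX_gen hs hc, LinearMap.id_apply]
    by_cases hc' : transport Λ ℰ s'.J c ∈ s'.active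
    · rw [hρ _ hc', ← hru _ hc' c hc rfl, sub_self, map_zero]
    rw [h.gen_of_notMem_active (h.isCenter_transport_of_le hs hc.1) hc', map_zero, sub_zero]
    obtain ⟨u, hu, l, hl, huc, hlc, hlt, hcusp, hul⟩ := hpair c hc hc'
    have hut := (hul u hu.1).mpr (Or.inl rfl)
    have hlt' := (hul l hl.1).mpr (Or.inr rfl)
    have hti : ∀ d, ℰ.IsCenter s.J (Λ.base d) → transport Λ ℰ {i} (transport Λ ℰ s'.J d) =
        transport Λ ℰ {i} d := fun d hd =>
      h.transport_transport hF hiJ' s'.J_mem (h.subset_supp_center hs hd)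
    have hau : s.faceX 𝒞 {i} (s.gen K u) = s.gen K l := by
      refine h.faceX_gen_upper 𝒞 hF hiJ hu huc hl.1 hlc ?_ (by simp) ?_ hlt
      · rw [← hti u hu.1, hut]
        exact h.transport_mem_cusp hF
          (h.subset_supp_of_subset hiJ' (h.isCenter_transport_of_le hs hc.1)) hcusp
      · rw [← hti l hl.1, ← hti u hu.1, hut, hlt']
    have hal : s.faceX 𝒞 {i} (s.gen K l) = 0 := by
      rw [← hau]
      exact (h.isSimplexDiagram 𝒞 s).comp_vertex hi _
    have hσu : σ (s.gen K u) = 0 := by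
      rw [hσ u hu, dif_neg]
      rintro ⟨d, hd, hdt, -, hlt₂⟩
      rcases (hul d hd.1).mp (hdt.trans hut) with rfl | rfl
      · exact hlt₂.false
      · exact hlt₂.not_gt hlt
    have hσl : σ (s.gen K l) = s.gen K u := by
      have hP : ∃ u, P l u := ⟨u, hu, hut.trans hlt'.symm, by rwa [hlt'], hlt⟩
      rw [hσ l hl, dif_pos hP]
      obtain ⟨h1, h2, -, h4⟩ := hP.choose_spec
      rcases (hul _ h1.1).mp (h2.trans hlt') with h5 | h5
      · rw [h5]
      · rw [h5] at h4
        exact absurd h4 (lt_irrefl _)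
    simp only [LinearMap.sub_apply, LinearMap.comp_apply, LinearMap.id_apply]
    rcases (hul c hc.1).mp rfl with rfl | rfl
    · rw [hσu, map_zero, hau, hσl, sub_zero, sub_self]
    · rw [hσl, hau, hal, map_zero, sub_zero, sub_self]
  refine ⟨σ x, LinearMap.congr_fun hφσ x, ?_⟩
  have := LinearMap.congr_fun key x
  rw [LinearMap.comp_apply, LinearMap.sub_apply (f := LinearMap.id), LinearMap.comp_apply, hx,
    map_zero, LinearMap.id_apply, sub_zero, LinearMap.sub_apply, LinearMap.sub_apply,
    LinearMap.comp_apply, LinearMap.comp_apply, hax, map_zero, sub_zero, LinearMap.id_apply,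
    LinearMap.zero_apply, sub_eq_zero] at this
  exact this.symm

end QuasiIso

theorem quasiIso_map (hs : s ≤ s') {w : M × ℝ} (hw : w ∈ s.carrier)
    (hiff : ∀ c, ℰ.IsCenter s'.J (Λ.base c) → (c ∈ s'.active ↔ IsActive Λ ℰ s'.J c w)) :
    QuasiIso ((functorF 𝒞 (h.isWellDefined 𝒞)).map (homOfLE hs)) := by
  obtain ⟨i, hi⟩ : s.I.Nonempty := ℰ.complex.isRelLowerSet_faces.prop_of_mem s.I_mem
  have hact : ∀ c' ∈ s'.active, ∃ c ∈ s.active, transport Λ ℰ s'.J c = c' ∧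
      ∀ d ∈ s.active, transport Λ ℰ s'.J d = c' → d = c := fun c' hc' =>
    (h.exists_of_mem_active_iff hs hw hc'.1 (hiff c' hc'.1)).1 hc'
  have hdeg : ∀ n, ∀ x ∈ s.gradingX K μ n, s.mapX K s' x ∈ s'.gradingX K μ (n + 0) :=
    fun n x hx => by
      rw [add_zero]
      exact h.degree_mapX μ hs hx
  have hadeg : ∀ n, ∀ x ∈ s.gradingX K μ n, s.faceX 𝒞 {i} x ∈ s.gradingX K μ (n + 1) :=
    fun n x hx => by
      simpa [sdim] using (h.isSimplexDiagram 𝒞 s).degree {i} (by simp) (by simpa using hi) n x hx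
  have hsurj : ∀ k, ∀ y ∈ s'.gradingX K μ k, ∃ x ∈ s.gradingX K μ k, s.mapX K s' x = y := by
    intro k y hy
    obtain ⟨x, rfl⟩ := h.mapX_surjective hs hact y
    obtain ⟨x', hx', he, -⟩ := exists_mem_of_graded (f := s.mapX K s')
      (g := s.mapX K s') (d := 0) (e := 0) (k := k) (x := x) (s.gradingX_isInternal (K := K) μ)
      (s'.gradingX_isInternal (K := K) μ) (s'.gradingX_isInternal (K := K) μ) hdeg hdeg
      (show s.mapX K s' x ∈ s'.gradingX K μ (k + 0) by rwa [add_zero])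
      (show s.mapX K s' x ∈ s'.gradingX K μ (k + 0) by rwa [add_zero])
    exact ⟨x', hx', he⟩
  have hker : ∀ k, ∀ x ∈ s.gradingX K μ k, s.mapX K s' x = 0 → s.faceX 𝒞 {i} x = 0 →
      ∃ z ∈ s.gradingX K μ (k - 1), s.mapX K s' z = 0 ∧ s.faceX 𝒞 {i} z = x := by
    intro k x hx hx0 hax
    obtain ⟨z, hz0, rfl⟩ := h.exists_faceX_eq 𝒞 hs hact hi (fun c hc hc' => by
      have hcen := h.isCenter_transport_of_le hs hc.1
      exact ((h.exists_of_mem_active_iff hs hw hcen (hiff _ hcen)).2 hc').resolve_left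
        fun hne => hne c hc rfl) hx0 hax
    obtain ⟨z', hz', he, he'⟩ := exists_mem_of_graded (f := s.mapX K s')
      (g := s.faceX 𝒞 {i}) (d := 0) (e := 1) (k := k - 1) (x := z) (s.gradingX_isInternal (K := K) μ)
      (s'.gradingX_isInternal (K := K) μ) (s.gradingX_isInternal (K := K) μ) hdeg hadeg
      (show s.mapX K s' z ∈ s'.gradingX K μ (k - 1 + 0) by rw [hz0]; exact zero_mem _)
      (show s.faceX 𝒞 {i} z ∈ s.gradingX K μ (k - 1 + 1) by rwa [sub_add_cancel])
    exact ⟨z', hz', he.trans hz0, he'⟩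
  exact SimplexDiagram.quasiIso_map ((functorG 𝒞 (h.isWellDefined 𝒞)).map (homOfLE hs)) hi
    (h.edgesBijective 𝒞 hi) (h.edgesBijective 𝒞 ((faces_of_le hs).1 hi)) hsurj hker

theorem quasiIso_of_k_eq (hs : s ≤ s') (hk : s.k = s'.k) :
    QuasiIso ((functorF 𝒞 (h.isWellDefined 𝒞)).map (homOfLE hs)) := by
  obtain ⟨w, hw⟩ := s.nonempty
  exact h.quasiIso_map 𝒞 hs hw fun c hc => h.mem_active_iff_of_k_eq hs hk hw hc

theorem quasiIso_of_isDownward (hs : s ≤ s') (hd : IsDownward s s') :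
    QuasiIso ((functorF 𝒞 (h.isWellDefined 𝒞)).map (homOfLE hs)) := by
  obtain ⟨w, hw, hiff⟩ := h.mem_active_iff_of_isDownward hd
  exact h.quasiIso_map 𝒞 hs hw hiff

end Admissible

end LegendrianSheaf

namespace LegendrianSheaf

open Set Filter

set_option linter.unusedSectionVars false

theorem mapRange_mem_cylPart {K V W W' : Type*} [Field K] [LinearOrder V] [AddCommGroup W]
    [Module K W] [AddCommGroup W'] [Module K W'] {Δ Δ' : Finset V} {gr : ℤ → Submodule K W}
    {gr' : ℤ → Submodule K W'} {g : W →ₗ[K] W'} (hΔ : Δ = Δ')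
    (hg : ∀ n, ∀ w ∈ gr n, g w ∈ gr' n) {n : ℤ} {f : Finset V →₀ W} (hf : f ∈ cylPart Δ gr n) :
    Finsupp.mapRange.linearMap g f ∈ cylPart Δ' gr' n := by
  subst hΔ
  intro F
  rw [Finsupp.mapRange.linearMap_apply, Finsupp.mapRange_apply]
  exact ⟨fun h => hg _ _ ((hf F).1 h), fun h => by rw [(hf F).2 h, map_zero]⟩

variable {L M : Type*} [TopologicalSpace L] [ChartedSpace Plane L]
  [TopologicalSpace M] [ChartedSpace Plane M] [IsManifold (𝓡 2) ∞ M]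
  {V : Type*}

/-- For strata above the same cell, the map which identifies generators with the same label. -/
noncomputable def Stratum.relabel (K : Type*) [Field K] {Λ : LegendrianSurface L M}
    {ℰ : Triangulation V M} (s s' : Stratum Λ ℰ) : s.X K →ₗ[K] s'.X K :=
  s'.ofLabels K ∘ₗ s.labels K

variable {K : Type*} [Field K]

namespace Admissible

open Triangulation LegendrianSurface Stratum

variable [IsManifold (𝓡 2) ∞ L] [CompactSpace L] [T2Space L] [T2Space M]
  {Λ : LegendrianSurface L M} {ℰ : Triangulation V M}
variable (h : Admissible Λ ℰ) {s s' s₁ s₂ s₃ : Stratum Λ ℰ}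
include h

theorem relabel_gen {c : L} (hc : c ∈ s.active) : s.relabel K s' (s.gen K c) = s'.gen K c := by
  rw [relabel, LinearMap.comp_apply, h.labels_gen hc, ofLabels_single, one_smul]

theorem mapX_eq_relabel (hs : s ≤ s') (hJ : s'.J = s.J) : s.mapX K s' = s.relabel K s' :=
  h.linearMap_ext_gen fun c hc => by
    rw [h.mapX_gen hs hc, h.relabel_gen hc, h.transport_self (hJ ▸ hc.1)]

open Classical in
theorem labels_relabel (hJ : s'.J = s.J) (x : s.X K) (c : L) :
    s'.labels K (s.relabel K s' x) c = if c ∈ s'.active then s.labels K x c else 0 := by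
  let p : (L →₀ K) →ₗ[K] K := if c ∈ s'.active then Finsupp.lapply c else 0
  have key : Finsupp.lapply c ∘ₗ s'.labels K ∘ₗ s.relabel K s' = p ∘ₗ s.labels K := by
    refine h.linearMap_ext_gen fun d hd => ?_
    simp only [LinearMap.comp_apply]
    rw [h.relabel_gen hd, h.labels_gen hd]
    by_cases hd' : d ∈ s'.active
    · rw [h.labels_gen hd', Finsupp.lapply_apply]
      by_cases hc : c ∈ s'.active
      · simp [p, hc]
      · have hdc : c ≠ d := fun e => hc (e ▸ hd')
        simp [p, hc, Finsupp.single_eq_of_ne hdc]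
    · rw [h.gen_of_notMem_active (hJ ▸ hd.1) hd', map_zero, map_zero]
      by_cases hc : c ∈ s'.active
      · have hdc : c ≠ d := fun e => hd' (e ▸ hc)
        simp [p, hc, Finsupp.single_eq_of_ne hdc]
      · simp [p, hc]
  have := LinearMap.congr_fun key x
  simp only [LinearMap.comp_apply, Finsupp.lapply_apply] at this
  rw [this]
  by_cases hc : c ∈ s'.active <;> simp [p, hc]

theorem labels_eq_zero (x : s.X K) {c : L} (hc : c ∉ s.active) : s.labels K x c = 0 := by
  by_contra hn
  exact hc (h.labels_mem_supported x (Finsupp.mem_support_iff.mpr hn))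

theorem relabel_mem (μ : Λ.MaslovPotential) (hI : s'.I = s.I) (hJ : s'.J = s.J) {n : ℤ} {x : s.X K}
    (hx : x ∈ s.gradingX K μ n) : s.relabel K s' x ∈ s'.gradingX K μ n := by
  have hb : ∀ c, branch Λ ℰ s'.J s'.handle c = branch Λ ℰ s.J s.handle c := fun c => by
    simp only [Stratum.handle, hI, hJ]
  have hY : s.gradingY K μ n ≤
      (s'.gradingX K μ n).comap (s.relabel K s' ∘ₗ LinearMap.inl K (s.Y K) (s.Z K)) := by
    refine freeGrading_le_comap fun T hT => ?_
    obtain ⟨c, hc, hcc, hTc⟩ := h.mem_below_iff.mp T.2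
    rw [hTc, h.valueOn_branch μ s.isDualRegion hc.1 hcc] at hT
    rw [← setGen_coe, hTc, LinearMap.comp_apply, LinearMap.inl_apply,
      ← h.gen_of_notMem_cusp hc.1 hcc, h.relabel_gen hc]
    exact h.gen_mem_gradingX μ (hJ ▸ hc.1) hcc hT
  have hZ : s.gradingZ K μ n ≤
      (s'.gradingX K μ n).comap (s.relabel K s' ∘ₗ LinearMap.inr K (s.Y K) (s.Z K)) := by
    refine freeGrading_le_comap fun T hT => ?_
    obtain ⟨c, hc, hcc, hTc⟩ := h.mem_exceptional_iff.mp T.2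
    rw [hTc] at hT
    rw [← setGen_coe, hTc, LinearMap.comp_apply, LinearMap.inr_apply,
      ← h.gen_of_mem_cusp hc.1 hcc, h.relabel_gen hc]
    exact h.gen_mem_gradingX_of_mem_cusp μ (hJ ▸ hc.1) hcc fun _ => by rw [hb, hT]
  have : x = LinearMap.inl K (s.Y K) (s.Z K) x.1 + LinearMap.inr K (s.Y K) (s.Z K) x.2 := by simp
  rw [this, map_add]
  exact add_mem (hY hx.1) (hZ hx.2)

section Square

variable (hJ₁ : s₁.J = s.J) (hJ₂ : s₂.J = s.J) (hJ₃ : s₃.J = s.J)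
  (hact : ∀ c, ℰ.IsCenter s.J (Λ.base c) →
    ((c ∈ s.active ↔ c ∈ s₁.active) ∧ (c ∈ s₂.active ↔ c ∈ s₃.active)) ∨
    ((c ∈ s.active ↔ c ∈ s₂.active) ∧ (c ∈ s₁.active ↔ c ∈ s₃.active)))
include hJ₁ hJ₂ hJ₃ hact

theorem eq_zero_of_relabel {x : s.X K} (h₁ : s.relabel K s₁ x = 0) (h₂ : s.relabel K s₂ x = 0) :
    x = 0 := by
  classical
  refine h.labels_injective (Finsupp.ext fun c => ?_)
  rw [map_zero, Finsupp.zero_apply]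
  by_cases hc : c ∈ s.active
  · have e₁ := h.labels_relabel hJ₁ x c
    have e₂ := h.labels_relabel hJ₂ x c
    rw [h₁, map_zero, Finsupp.zero_apply] at e₁
    rw [h₂, map_zero, Finsupp.zero_apply] at e₂
    rcases hact c hc.1 with ⟨h3, -⟩ | ⟨h3, -⟩
    · rwa [if_pos (h3.mp hc), eq_comm] at e₁
    · rwa [if_pos (h3.mp hc), eq_comm] at e₂
  · exact h.labels_eq_zero x hc

theorem relabel_glue {b : s₁.X K} {c : s₂.X K} (hbc : s₁.relabel K s₃ b = s₂.relabel K s₃ c) :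
    s.relabel K s₁ (s₁.relabel K s b + s₂.relabel K s c - s₃.relabel K s (s₁.relabel K s₃ b)) = b ∧
    s.relabel K s₂ (s₁.relabel K s b + s₂.relabel K s c - s₃.relabel K s (s₁.relabel K s₃ b)) =
      c := by
  classical
  have hbc' : ∀ d, (if d ∈ s₃.active then s₁.labels K b d else 0) =
      if d ∈ s₃.active then s₂.labels K c d else 0 := fun d => by
    rw [← h.labels_relabel (hJ₃.trans hJ₁.symm), ← h.labels_relabel (hJ₃.trans hJ₂.symm), hbc]
  constructor
  all_goals
    refine h.labels_injective (Finsupp.ext fun d => ?_)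
    have e₁ := fun hn => h.labels_eq_zero b (c := d) hn
    have e₂ := fun hn => h.labels_eq_zero c (c := d) hn
    have e₃ := hbc' d
    simp only [h.labels_relabel hJ₁, h.labels_relabel hJ₂, map_add, map_sub, Finsupp.add_apply,
      Finsupp.sub_apply, h.labels_relabel hJ₁.symm, h.labels_relabel hJ₂.symm,
      h.labels_relabel hJ₃.symm, h.labels_relabel (hJ₃.trans hJ₁.symm)]
    by_cases hc : ℰ.IsCenter s.J (Λ.base d)
    · rcases hact d hc with ⟨h1, h2⟩ | ⟨h1, h2⟩ <;> by_cases h3 : d ∈ s.active <;>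
        by_cases h4 : d ∈ s₁.active <;> by_cases h5 : d ∈ s₂.active <;>
        by_cases h6 : d ∈ s₃.active <;> simp_all
    · rw [e₁ fun hn => hc (hJ₁ ▸ hn.1), e₂ fun hn => hc (hJ₂ ▸ hn.1)]
      simp

theorem relabel_split (d : s₃.X K) :
    d = s₁.relabel K s₃ (s₃.relabel K s₁ d) +
      s₂.relabel K s₃ (s₃.relabel K s₂ (d - s₁.relabel K s₃ (s₃.relabel K s₁ d))) := by
  classical
  refine h.labels_injective (Finsupp.ext fun c => ?_)
  have e := fun hn => h.labels_eq_zero d (c := c) hn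
  simp only [map_add, Finsupp.add_apply, h.labels_relabel (hJ₃.trans hJ₁.symm),
    h.labels_relabel (hJ₃.trans hJ₂.symm), h.labels_relabel (hJ₁.trans hJ₃.symm),
    h.labels_relabel (hJ₂.trans hJ₃.symm), map_sub, Finsupp.sub_apply]
  by_cases hc : c ∈ s₃.active
  · rcases hact c (hJ₃ ▸ hc.1) with ⟨h1, h2⟩ | ⟨h1, h2⟩ <;> by_cases h4 : c ∈ s₁.active <;>
      simp_all
  · simp [hc, e hc]

end Square

variable [LinearOrder V] {μ : Λ.MaslovPotential} (𝒞 : ChainHomotopyDiagram K Λ μ ℰ)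

theorem acyclic_of_isCrossingSquare (hsq : IsCrossingSquare s s₁ s₂ s₃) :
    (totalComplex (functorF 𝒞 (h.isWellDefined 𝒞)) hsq.O_le_NW hsq.O_le_NE hsq.NW_le_N
      hsq.NE_le_N).Acyclic := by
  obtain ⟨hJ₁, hJ₂, hJ₃, hact⟩ := h.mem_active_of_isCrossingSquare hsq
  have hI : ∀ t : Stratum Λ ℰ, s ≤ t → t.J = s.J → t.I = s.I := fun t ht hJ =>
    (t.I_subset.trans (by rw [hJ, hsq.O_dim])).antisymm (faces_of_le ht).1
  have hI₁ := hI s₁ hsq.O_le_NW hJ₁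
  have hI₂ := hI s₂ hsq.O_le_NE hJ₂
  have hI₃ := hI s₃ (hsq.O_le_NW.trans hsq.NW_le_N) hJ₃
  have m₁ := h.mapX_eq_relabel (K := K) hsq.O_le_NW hJ₁
  have m₂ := h.mapX_eq_relabel (K := K) hsq.O_le_NE hJ₂
  have m₁₃ := h.mapX_eq_relabel (K := K) hsq.NW_le_N (hJ₃.trans hJ₁.symm)
  have m₂₃ := h.mapX_eq_relabel (K := K) hsq.NE_le_N (hJ₃.trans hJ₂.symm)
  have cyl : ∀ {t t' : Stratum Λ ℰ} (_ : t'.I = t.I) (_ : t'.J = t.J) {n : ℤ}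
      {f : Finset V →₀ t.X K}, f ∈ cylPart t.I (t.gradingX K μ) n →
      Finsupp.mapRange.linearMap (t.relabel K t') f ∈ cylPart t'.I (t'.gradingX K μ) n :=
    fun hI hJ => mapRange_mem_cylPart hI.symm fun n w hw => h.relabel_mem μ hI hJ hw
  have coe : ∀ {t t' : Stratum Λ ℰ} (ht : t ≤ t') {n : ℤ}
      (x : cylPart t.I (t.gradingX K μ) n) (y : cylPart t'.I (t'.gradingX K μ) n),
      (((functorF 𝒞 (h.isWellDefined 𝒞)).map (homOfLE ht)).f n).hom x = y ↔
        ∀ F, t.mapX K t' (x.1 F) = y.1 F := by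
    intro t t' ht n x y
    constructor
    · intro he F
      exact DFunLike.congr_fun (congrArg Subtype.val he) F
    · intro he
      exact Subtype.ext (Finsupp.ext he)
  refine acyclic_of_bicartesian _ _ _ _ _ ?_ ?_ ?_
  · intro n (a : cylPart s.I (s.gradingX K μ) n) h₁ h₂
    have e₁ := (coe hsq.O_le_NW a 0).mp h₁
    have e₂ := (coe hsq.O_le_NE a 0).mp h₂
    rw [m₁] at e₁
    rw [m₂] at e₂
    exact Subtype.ext (Finsupp.ext fun F => h.eq_zero_of_relabel hJ₁ hJ₂ hJ₃ hact (e₁ F) (e₂ F))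
  · intro n (b : cylPart s₁.I (s₁.gradingX K μ) n) (c : cylPart s₂.I (s₂.gradingX K μ) n) hbc
    have e : ∀ F, s₁.relabel K s₃ (b.1 F) = s₂.relabel K s₃ (c.1 F) := by
      rw [← m₁₃, ← m₂₃]
      exact fun F => DFunLike.congr_fun (congrArg Subtype.val hbc) F
    refine ⟨⟨Finsupp.mapRange.linearMap (s₁.relabel K s) b.1 +
      Finsupp.mapRange.linearMap (s₂.relabel K s) c.1 - Finsupp.mapRange.linearMap (s₃.relabel K s)
        (Finsupp.mapRange.linearMap (s₁.relabel K s₃) b.1), sub_mem (add_mem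
        (cyl hI₁.symm hJ₁.symm b.2) (cyl hI₂.symm hJ₂.symm c.2)) (cyl hI₃.symm hJ₃.symm
        (cyl (hI₃.trans hI₁.symm) (hJ₃.trans hJ₁.symm) b.2))⟩, ?_, ?_⟩
    · refine (coe hsq.O_le_NW _ b).mpr fun F => ?_
      rw [m₁]
      exact (h.relabel_glue hJ₁ hJ₂ hJ₃ hact (e F)).1
    · refine (coe hsq.O_le_NE _ c).mpr fun F => ?_
      rw [m₂]
      exact (h.relabel_glue hJ₁ hJ₂ hJ₃ hact (e F)).2
  · intro n (d : cylPart s₃.I (s₃.gradingX K μ) n)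
    let b : cylPart s₁.I (s₁.gradingX K μ) n :=
      ⟨_, cyl (hI₁.trans hI₃.symm) (hJ₁.trans hJ₃.symm) d.2⟩
    let d' : cylPart s₃.I (s₃.gradingX K μ) n :=
      ⟨_, cyl (hI₃.trans hI₁.symm) (hJ₃.trans hJ₁.symm) b.2⟩
    let c : cylPart s₂.I (s₂.gradingX K μ) n :=
      ⟨_, cyl (hI₂.trans hI₃.symm) (hJ₂.trans hJ₃.symm) (sub_mem d.2 d'.2)⟩
    let d'' : cylPart s₃.I (s₃.gradingX K μ) n :=
      ⟨_, cyl (hI₃.trans hI₂.symm) (hJ₃.trans hJ₂.symm) c.2⟩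
    have hb : ∀ F, b.1 F = s₃.relabel K s₁ (d.1 F) := fun _ => rfl
    have hd' : ∀ F, s₁.relabel K s₃ (b.1 F) = d'.1 F := fun _ => rfl
    have hc : ∀ F, c.1 F = s₃.relabel K s₂ (d.1 F - d'.1 F) := fun _ => rfl
    have hd'' : ∀ F, s₂.relabel K s₃ (c.1 F) = d''.1 F := fun _ => rfl
    clear_value b c d' d''
    have hd : d = d' + d'' := by
      refine Subtype.ext (Finsupp.ext fun F => ?_)
      rw [Submodule.coe_add, Finsupp.add_apply, ← hd'', hc, ← hd', hb]
      exact h.relabel_split hJ₁ hJ₂ hJ₃ hact (d.1 F)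
    have e₁ := (coe hsq.NW_le_N b d').mpr (m₁₃ ▸ hd')
    have e₂ := (coe hsq.NE_le_N c d'').mpr (m₂₃ ▸ hd'')
    refine ⟨b, c, ?_⟩
    subst e₁ e₂
    exact hd

end Admissible

end LegendrianSheaf

theorem mainTheorem7
    {L M V K : Type*} [TopologicalSpace L] [CompactSpace L] [T2Space L] [ChartedSpace Plane L]
    [IsManifold (𝓡 2) ∞ L]
    [TopologicalSpace M] [T2Space M] [ChartedSpace Plane M] [IsManifold (𝓡 2) ∞ M]
    [LinearOrder V] [Field K]
    (Λ : LegendrianSurface L M) (hmild : Λ.HasMildFront)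
    (hfront : Λ.FrontTransverse) (hbase : Λ.BaseTransverse)
    (μ : Λ.MaslovPotential)
    (ℰ : Triangulation V M) (hcompat : Compatible Λ ℰ)
    (𝒞 : ChainHomotopyDiagram K Λ μ ℰ) :
    ∃ h : IsWellDefined 𝒞, MemFun (functorF 𝒞 h) := by
  have h : Admissible Λ ℰ := ⟨hmild, hfront, hbase, hcompat⟩
  exact ⟨h.isWellDefined 𝒞, fun s s' hs hd => h.quasiIso_of_isDownward 𝒞 hs hd,
    fun s s' hs hk => h.quasiIso_of_k_eq 𝒞 hs hk,
    fun s s₁ s₂ s₃ hsq => h.acyclic_of_isCrossingSquare 𝒞 hsq⟩
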